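/- **Conventions.** A raviolo field on a graded complex vector space $\mathcal V$ (graded by cohomological degree in $\mathbf Z$ and possibly a super parity; $|a|$ is the total parity) is a series $A(z)=\sum_{m<0}z^{-m-1}A_m+\sum_{m\ge 0}\Omega^m_zA_m$, $A_m\in\mathrm{End}(\mathcal V)$, with $A_mv=0$ for $m\gg0$ for each $v$; here $\Omega^m$ has degree $1$, $\Omega^i\Omega^j=0$, $z^i\Omega^j=\Omega^{j-i}$ for $i\le j$ and $z^i\Omega^j=0$ for $i>j$, $\partial_z\Omega^m=-(m+1)\Omega^{m+1}$. A raviolo vertex algebra $(\mathcal V,|0\rangle,\partial,Y)$ is given by a degree-$0$ state-field map $Y(a,z)$ with modes $a_{(m)}$ satisfying the vacuum axiom, the translation axiom $[\partial,Y(a,z)]=\partial_zY(a,z)$, and mutual locality $[Y(a,z),Y(b,w)]=\sum_{n=0}^N\frac1{n!}\partial_w^n\Delta(z-w)C^n(w)$ for some fields $C^n$, with $\Delta(z-w)=\sum_{n\ge0}(w^n\Omega_z^n-z^n\Omega_w^n)$. Write $:\!ab\!:=a_{(-1)}b$ and $a(z)b(w)\sim\sum_{n\ge0}\Omega^n_{z-w}(a_{(n)}b)(w)$.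 A superpotential is an even $W\in\mathcal V^2$ with $W_{(0)}W\in\mathrm{im}\,\partial$; if $\mathcal V$ has a spin grading, $W$ is required to have spin $1$. A conformal structure on a spin-graded raviolo vertex algebra (over $\mathbf C[\xi]$, $\xi$ of degree $1$, acting by an operator called the central charge) is a non-zero even vector $\gamma$ of degree $1$ and spin $2$, with field $\Gamma(z)$ (the stress tensor), whose modes $G_m=\gamma_{(m)}$, $\Gamma_m=\gamma_{(-m-1)}$ ($m\ge0$) satisfy the raviolo Virasoro relations $[G_m,G_n]=(m-n)G_{m+n-1}$, $[\Gamma_m,\Gamma_n]=0$, and $[G_m,\Gamma_n]=(m+n+1)\Gamma_{n-m+1}$ for $m\le n+1$, $\frac{m(m-1)(m-2)}{12}\xi$ for $m=n+3$, and $0$ otherwise, with $\gamma_{(0)}=\partial$ and $\gamma_{(1)}=s$ on vectors of spin $s$; $a$ is a conformal primary of spin $s$ if it has spin $s$ and $\gamma_{(m)}a=0$ for all $m\ge2$. **Theorem.** Let $\mathfrak g$ be a finite-dimensional complex Lie algebra with basis $T_a$ and $[T_a,T_b]=f^c_{ab}T_c$ (repeated indices are summed). Let $\mathcal V$ be a raviolo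 vertex algebra with a Hamiltonian $\mathfrak g$-symmetry at level $0$, that is, a morphism to $\mathcal V$ from the raviolo current algebra $\mathcal V[\mathfrak g]$, which is freely generated by fields $\mu_a$ of degree $1$ (and spin $1$) with $\mu_a(z)\mu_b(w)\sim\Omega^0_{z-w}f^c_{ab}\mu_c(w)$; let $\mu_a\in\mathcal V^1$ also denote the images of the generators. Let $K_{ab}$ be a (possibly degenerate) symmetric $\mathfrak g$-invariant bilinear form on $\mathfrak g$, and let $W$ be a superpotential on $\mathcal V$ that is a $\mathfrak g$-invariant primary, i.e. $\mu_{a,(m)}W=0$ for all $a$ and all $m\ge0$. Let $\mathcal V^{\mathfrak g}_{bc}$ be the free field raviolo vertex algebra generated by bosons $b_a$ of degree $0$ and spin $1$ and fermions $c^a$ of degree $1$ and spin $0$, with $b_a(z)c^b(w)\sim\Omega^0_{z-w}\delta_a^b$, $c^b(z)b_a(w)\sim\Omega^0_{z-w}\delta_a^b$ and all other OPEs of generators regular. Then $\mathcal V\otimes\mathcal V^{\mathfrak g}_{bc}$ is a raviolo vertex algebra, and $$W_{tot}=\tfrac12f^a_{bc}:\!b_ac^bc^c\!:+\tfrac12K_{ab}:\!c^a\partial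 c^b\!:+:\!c^a\mu_a\!:+W$$ is a superpotential on it. If $\mathcal V$ has a spin grading for which the $\mu_a$ and $W$ have spin $1$, then $\mathcal V\otimes\mathcal V^{\mathfrak g}_{bc}$ with the total spin is spin-graded, and $W_{tot}$ has spin $1$. Moreover, if $\mathcal V$ is conformal with stress tensor $\Gamma$ and central charge $\xi^{\mathcal V}$, and $W$ and all $\mu_a$ are conformal primaries of spin $1$, then $\mathcal V\otimes\mathcal V^{\mathfrak g}_{bc}$ is conformal with stress tensor $$\Gamma_{tot}=\Gamma-:\!b_a\partial c^a\!:$$ and central charge $\xi^{\mathcal V}\otimes 1$, and $W_{tot}$ is a conformal primary of spin $1$. -/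

import Mathlib

open TensorProduct

noncomputable section

namespace Raviolo

/-! ### Locally finite sums of linear maps -/

/-- The sum of a family of linear maps that is finite on each vector (`0` for other families). -/
def locSum {α E F : Type*} [AddCommGroup E] [Module ℂ E] [AddCommGroup F] [Module ℂ F]
    (f : α → E →ₗ[ℂ] F) : E →ₗ[ℂ] F := by
  classical
  exact
    if h : ∀ x, (Function.support fun j => f j x).Finite then
      { toFun := fun x => ∑ᶠ j, f j x
        map_add' := fun x y => by
          simp only [map_add]
          exact finsum_add_distrib (h x) (h y)
        map_smul' := fun c x => by
          simp only [map_smul, RingHom.id_apply]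
          exact (smul_finsum c _).symm }
    else 0

/-- The sum of a family of bilinear maps that is finite on each pair of vectors
(`0` for other families). -/
def locSum₂ {α E F G : Type*} [AddCommGroup E] [Module ℂ E] [AddCommGroup F] [Module ℂ F]
    [AddCommGroup G] [Module ℂ G]
    (f : α → E →ₗ[ℂ] F →ₗ[ℂ] G) : E →ₗ[ℂ] F →ₗ[ℂ] G := by
  classical
  exact
    if h : ∀ x y, (Function.support fun j => f j x y).Finite then
      LinearMap.mk₂ ℂ (fun x y => ∑ᶠ j, f j x y)
        (fun x x' y => by
          simp only [map_add, LinearMap.add_apply]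
          exact finsum_add_distrib (h x y) (h x' y))
        (fun c x y => by
          simp only [map_smul, LinearMap.smul_apply]
          exact (smul_finsum c _).symm)
        (fun x y y' => by
          simp only [map_add]
          exact finsum_add_distrib (h x y) (h x y'))
        (fun c x y => by
          simp only [map_smul]
          exact (smul_finsum c _).symm)
    else 0

/-! ### Degrees and signs -/

/-- A degree is a pair (cohomological degree, super parity). -/
abbrev Deg := ℤ × ZMod 2

/-- The totalized parity of a degree, which governs all Koszul signs. -/
def par (d : Deg) : ZMod 2 := (d.1 : ZMod 2) + d.2

/-- `(-1) ^ p`. -/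
def sign (p : ZMod 2) : ℂ := if p = 0 then 1 else -1

/-- The parity of the `m`-th mode of a field of parity `p`: the coefficients of the
`Ω^m`, `m ≥ 0`, are shifted, because `Ω^m` has cohomological degree one. -/
def modePar (p : ZMod 2) (m : ℤ) : ZMod 2 := if m < 0 then p else p + 1

/-! ### Raviolo fields and mutual locality

A series `A(z) = ∑_{m<0} z^{-m-1} A_m + ∑_{m≥0} Ω^m_z A_m` with coefficients in `End V`
is stored as the family of its modes `A_m`, `m : ℤ`. -/

section Fields

variable {V : Type*} [AddCommGroup V] [Module ℂ V]

/-- The series with modes `A` is a raviolo field: each vector is killed by `A_m` for `m` large. -/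
def IsField (A : ℤ → Module.End ℂ V) : Prop :=
  ∀ v, ∃ N : ℤ, ∀ m, N ≤ m → A m v = 0

/-- The graded commutator of operators of parities `p` and `q`. -/
def gradedComm (p q : ZMod 2) (A B : Module.End ℂ V) : Module.End ℂ V :=
  A * B - sign (p * q) • (B * A)

/-- Mutual locality of two homogeneous fields of total parities `p` and `q`: there are fields
`C^0, …, C^N` with `[A(z), B(w)] = ∑_{n ≤ N} (1/n!) ∂_w^n Δ(z-w) C^n(w)`, where `Δ` is the raviolo
delta function; spelt out in modes, this is the formula below
(with generalized binomial coefficients `Ring.choose m n`). -/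
def MutuallyLocal (p q : ZMod 2) (A B : ℤ → Module.End ℂ V) : Prop :=
  ∃ (N : ℕ) (C : ℕ → ℤ → Module.End ℂ V), (∀ n, IsField (C n)) ∧
    ∀ m l : ℤ, gradedComm (modePar p m) (modePar q l) (A m) (B l) =
      if m < 0 ∧ l < 0 then 0
      else (if 0 ≤ l then sign (p + 1) else 1) •
        ∑ n ∈ Finset.range (N + 1),
          if (0 ≤ m ∧ 0 ≤ l) ∨ m + l + 1 ≤ (n : ℤ) then
            Ring.choose m n • C n (m + l - n)
          else 0

end Fields

/-! ### Raviolo vertex algebras -/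

/-- The data of a raviolo vertex algebra. -/
structure RavioloData (V : Type*) [AddCommGroup V] [Module ℂ V] where
  /-- the homogeneous subspaces, for cohomological degree and super parity -/
  gr : Deg → Submodule ℂ V
  /-- the parity operator `a ↦ (-1)^{|a|} a` -/
  sgn : V →ₗ[ℂ] V
  /-- the vacuum vector -/
  vac : V
  /-- the translation operator `∂` -/
  T : V →ₗ[ℂ] V
  /-- the state-field correspondence: `Y m a` is the mode `a_(m)` -/
  Y : ℤ → V →ₗ[ℂ] V →ₗ[ℂ] V

section Definitions

variable {V : Type*} [AddCommGroup V] [Module ℂ V]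

/-- The axioms of a (super-graded) raviolo vertex algebra. A raviolo vertex algebra without super
grading is one for which `gr (r, 1) = ⊥`. -/
structure IsRaviolo (𝒱 : RavioloData V) : Prop where
  grading : DirectSum.IsInternal 𝒱.gr
  sgn_eq : ∀ d, ∀ a ∈ 𝒱.gr d, 𝒱.sgn a = sign (par d) • a
  vac_mem : 𝒱.vac ∈ 𝒱.gr (0, 0)
  T_mem : ∀ d, ∀ a ∈ 𝒱.gr d, 𝒱.T a ∈ 𝒱.gr d
  Y_mem_neg : ∀ m : ℤ, m < 0 → ∀ d e, ∀ a ∈ 𝒱.gr d, ∀ b ∈ 𝒱.gr e, 𝒱.Y m a b ∈ 𝒱.gr (d + e)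
  Y_mem_nonneg : ∀ m : ℤ, 0 ≤ m → ∀ d e, ∀ a ∈ 𝒱.gr d, ∀ b ∈ 𝒱.gr e,
    𝒱.Y m a b ∈ 𝒱.gr (d + e - (1, 0))
  field : ∀ a, IsField fun m => 𝒱.Y m a
  translation : ∀ m a b, 𝒱.T (𝒱.Y m a b) - 𝒱.Y m a (𝒱.T b) = -m • 𝒱.Y (m - 1) a b
  T_vac : 𝒱.T 𝒱.vac = 0
  Y_vac : ∀ m a, 𝒱.Y m 𝒱.vac a = if m = -1 then a else 0
  Y_apply_vac : ∀ m a, 0 ≤ m → 𝒱.Y m a 𝒱.vac = 0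
  Y_neg_one_vac : ∀ a, 𝒱.Y (-1) a 𝒱.vac = a
  locality : ∀ d e, ∀ a ∈ 𝒱.gr d, ∀ b ∈ 𝒱.gr e,
    MutuallyLocal (par d) (par e) (fun m => 𝒱.Y m a) (fun m => 𝒱.Y m b)

/-- `spin s` is the space of vectors of spin `s`, for `s ∈ (1/L) ℤ`. -/
structure IsSpinGrading (𝒱 : RavioloData V) (spin : ℚ → Submodule ℂ V) : Prop where
  denom : ∃ L : ℕ, 0 < L ∧ ∀ s, spin s ≠ ⊥ → ∃ k : ℤ, s * L = k
  grading : DirectSum.IsInternal spin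
  /-- the spin grading and the cohomological and super gradings form one multi-grading -/
  bigrading : DirectSum.IsInternal fun i : Deg × ℚ => 𝒱.gr i.1 ⊓ spin i.2
  vac_mem : 𝒱.vac ∈ spin 0
  T_mem : ∀ s, ∀ a ∈ spin s, 𝒱.T a ∈ spin (s + 1)
  Y_mem : ∀ (m : ℤ) s t, ∀ a ∈ spin s, ∀ b ∈ spin t, 𝒱.Y m a b ∈ spin (t + (s - m - 1))

/-- A morphism of raviolo vertex algebras. -/
structure IsMorphism {V₁ V₂ : Type*} [AddCommGroup V₁] [Module ℂ V₁] [AddCommGroup V₂]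
    [Module ℂ V₂] (𝒱₁ : RavioloData V₁) (𝒱₂ : RavioloData V₂) (ρ : V₁ →ₗ[ℂ] V₂) : Prop where
  degree : ∀ d, ∀ a ∈ 𝒱₁.gr d, ρ a ∈ 𝒱₂.gr d
  vac : ρ 𝒱₁.vac = 𝒱₂.vac
  T : ∀ a, ρ (𝒱₁.T a) = 𝒱₂.T (ρ a)
  Y : ∀ m a b, ρ (𝒱₁.Y m a b) = 𝒱₂.Y m (ρ a) (ρ b)

/-- An even element `W` of cohomological degree `2` is a superpotential if
`W_(0) W_(-1) |0⟩` is in the image of `∂`. -/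
structure IsSuperpotential (𝒱 : RavioloData V) (W : V) : Prop where
  mem : W ∈ 𝒱.gr (2, 0)
  bracket : 𝒱.Y 0 W (𝒱.Y (-1) W 𝒱.vac) ∈ LinearMap.range 𝒱.T

/-- The endomorphism `ξ` makes the spin-graded raviolo vertex algebra `𝒱` one over the graded
commutative algebra `ℂ[ξ] = ℂ ⊕ ℂ ξ`, `ξ` of cohomological degree one, even and of spin `0`. -/
structure IsOver (𝒱 : RavioloData V) (spin : ℚ → Submodule ℂ V) (ξ : V →ₗ[ℂ] V) : Prop where
  degree : ∀ d, ∀ a ∈ 𝒱.gr d, ξ a ∈ 𝒱.gr (d + (1, 0))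
  spin : ∀ s, ∀ a ∈ spin s, ξ a ∈ spin s
  sq : ∀ a, ξ (ξ a) = 0
  T : ∀ a, 𝒱.T (ξ a) = ξ (𝒱.T a)
  /-- the modes are graded `ℂ[ξ]`-linear -/
  mode : ∀ m d, ∀ a ∈ 𝒱.gr d, ∀ b, 𝒱.Y m a (ξ b) = sign (modePar (par d) m) • ξ (𝒱.Y m a b)
  /-- the state-field correspondence is `ℂ[ξ]`-linear (`ξ` is moved past `Ω^m` if `m ≥ 0`) -/
  state : ∀ m a b, 𝒱.Y m (ξ a) b = sign (modePar 0 m) • ξ (𝒱.Y m a b)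

/-- `𝒱` is a conformal raviolo vertex algebra with conformal vector `γ` and central charge `ξ`:
the modes `G_m = γ_(m)`, `Γ_m = γ_(-m-1)`, `m ≥ 0`, satisfy the relations of the raviolo Virasoro
algebra, `G_0 = ∂`, and `G_1` is multiplication by `s` on the vectors of spin `s`. -/
structure IsConformal (𝒱 : RavioloData V) (spin : ℚ → Submodule ℂ V) (ξ : V →ₗ[ℂ] V) (γ : V) :
    Prop where
  raviolo : IsRaviolo 𝒱
  spinGrading : IsSpinGrading 𝒱 spin
  isOver : IsOver 𝒱 spin ξ
  ne_zero : γ ≠ 0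
  mem_gr : γ ∈ 𝒱.gr (1, 0)
  mem_spin : γ ∈ spin 2
  comm_GG : ∀ (m n : ℕ) a, 𝒱.Y m γ (𝒱.Y n γ a) - 𝒱.Y n γ (𝒱.Y m γ a) =
    ((m : ℂ) - n) • 𝒱.Y ((m : ℤ) + n - 1) γ a
  comm_ΓΓ : ∀ (m n : ℕ) a, 𝒱.Y (-m - 1) γ (𝒱.Y (-n - 1) γ a) +
    𝒱.Y (-n - 1) γ (𝒱.Y (-m - 1) γ a) = 0
  comm_GΓ : ∀ (m n : ℕ) a, 𝒱.Y m γ (𝒱.Y (-n - 1) γ a) - 𝒱.Y (-n - 1) γ (𝒱.Y m γ a) =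
    if m ≤ n + 1 then ((m : ℂ) + n + 1) • 𝒱.Y (-((n : ℤ) + 1 - m) - 1) γ a
    else if m = n + 3 then ((m : ℂ) * (m - 1) * (m - 2) / 12) • ξ a
    else 0
  G_zero : ∀ a, 𝒱.Y 0 γ a = 𝒱.T a
  G_one : ∀ s, ∀ a ∈ spin s, 𝒱.Y 1 γ a = (s : ℂ) • a

/-- `a` is a conformal primary of spin `s` for the conformal vector `γ`. -/
def IsConformalPrimary (𝒱 : RavioloData V) (spin : ℚ → Submodule ℂ V) (γ : V) (s : ℚ) (a : V) :
    Prop :=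
  a ∈ spin s ∧ ∀ m : ℤ, 2 ≤ m → 𝒱.Y m γ a = 0

end Definitions

/-! ### Tensor products -/

section Tensor

variable {V W : Type*} [AddCommGroup V] [Module ℂ V] [AddCommGroup W] [Module ℂ W]

/-- The Koszul tensor product of two bilinear operations,
`(a ⊗ x, b ⊗ y) ↦ (-1)^{|x||b|} α(a, b) ⊗ β(x, y)`. -/
def koszul (𝒱 : RavioloData V) (𝒲 : RavioloData W) (α : V →ₗ[ℂ] V →ₗ[ℂ] V)
    (β : W →ₗ[ℂ] W →ₗ[ℂ] W) : V ⊗[ℂ] W →ₗ[ℂ] V ⊗[ℂ] W →ₗ[ℂ] V ⊗[ℂ] W :=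
  TensorProduct.map₂ α (β ∘ₗ ((1 / 2 : ℂ) • (LinearMap.id + 𝒲.sgn))) +
  TensorProduct.map₂ (α.compl₂ 𝒱.sgn) (β ∘ₗ ((1 / 2 : ℂ) • (LinearMap.id - 𝒲.sgn)))

/-- The tensor product, with `Y(a ⊗ x, z) = Y(a, z) ⊗ Y(x, z)`. In this product,
`z^i Ω^j = Ω^{j-i}` (which is `0` if `i > j`) and `Ω^i Ω^j = 0`, and the signs come from moving
`Ω^j` past `a_(m)`, and the modes of `x` past `b`. -/
def tensor (𝒱 : RavioloData V) (𝒲 : RavioloData W) : RavioloData (V ⊗[ℂ] W) where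
  gr d := ⨆ e : Deg, Submodule.map₂ (TensorProduct.mk ℂ V W) (𝒱.gr e) (𝒲.gr (d - e))
  sgn := TensorProduct.map 𝒱.sgn 𝒲.sgn
  vac := 𝒱.vac ⊗ₜ[ℂ] 𝒲.vac
  T := TensorProduct.map 𝒱.T LinearMap.id + TensorProduct.map LinearMap.id 𝒲.T
  Y k :=
    if k < 0 then ∑ m ∈ Finset.Icc k (-1), koszul 𝒱 𝒲 (𝒱.Y m) (𝒲.Y (k - m - 1))
    else locSum₂ fun n : ℕ =>
      koszul 𝒱 𝒲 ((𝒱.Y (-n - 1) ∘ₗ 𝒱.sgn).compl₂ 𝒱.sgn) (𝒲.Y (k + n)) +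
      koszul 𝒱 𝒲 (𝒱.Y (k + n)) (𝒲.Y (-n - 1))

/-- The spin grading of a tensor product. -/
def tensorSpin (spin₁ : ℚ → Submodule ℂ V) (spin₂ : ℚ → Submodule ℂ W) (s : ℚ) :
    Submodule ℂ (V ⊗[ℂ] W) :=
  ⨆ t : ℚ, Submodule.map₂ (TensorProduct.mk ℂ V W) (spin₁ t) (spin₂ (s - t))

end Tensor

/-! ### Normally ordered polynomials in generating fields

In the two examples below the state space is a graded commutative algebra `F` generated by letters
`φ_n`, `n ≥ 0`, for finitely many generating fields `φ`; the letter `φ_n` is `(1/n!) ∂^n φ`. The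
mode `φ_(-n-1)` is multiplication by `φ_n`, and the modes `φ_(k)`, `k ≥ 0`, are derivations of `F`.
The field of a polynomial in the letters is the normally ordered polynomial in the fields
`(1/n!) ∂_z^n φ(z)`. As `Ω^i Ω^j = 0`, each of its terms contains at most one annihilator. -/

section Wick

variable {F : Type*} [Ring F] [Algebra ℂ F]

/-- The divided power `T^j / j!`. -/
def divPow (T : F →ₗ[ℂ] F) (j : ℕ) : F →ₗ[ℂ] F := ((j.factorial : ℂ)⁻¹) • T ^ j

/-- The modes of normally ordered polynomials. Here `D φ n a` is the left derivative of `a` with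
respect to the letter `φ_n`, times the sign `(-1)^{(|φ|+1)|∂a|}` of moving the annihilator of `φ`
to the right, and `ann φ k` is the mode `φ_(k)`, `k ≥ 0`. The coefficient of `Ω^{n+k}` in
`(1/n!) ∂_z^n φ(z)` is `(-1)^n binom(n+k, n) φ_(k)`. -/
def wick {J : Type*} (T : F →ₗ[ℂ] F) (D ann : J → ℕ → F →ₗ[ℂ] F) (m : ℤ) :
    F →ₗ[ℂ] F →ₗ[ℂ] F :=
  if m < 0 then LinearMap.mul ℂ F ∘ₗ divPow T (-m - 1).toNat
  else locSum₂ fun i : J × ℕ × ℕ =>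
    if m ≤ i.2.1 + i.2.2 then
      ((-1 : ℂ) ^ i.2.1 * (i.2.1 + i.2.2).choose i.2.1) •
        (LinearMap.mul ℂ F ∘ₗ divPow T (i.2.1 + i.2.2 - m).toNat ∘ₗ D i.1 i.2.1).compl₂
          (ann i.1 i.2.2)
    else 0

end Wick

/-! ### Free fields -/

section FreeFields

variable (ι : Type*)

/-- The exterior algebra on letters `c^a_n`, `a ∈ ι`, `n ≥ 0`. -/
abbrev ExtAlg := ExteriorAlgebra ℂ (ι × ℕ →₀ ℂ)

/-- The state space of the `bc` system: polynomials in commuting letters `b_{a,n}`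
and anticommuting letters `c^a_n`. -/
abbrev Fock := MvPolynomial (ι × ℕ) ℂ ⊗[ℂ] ExtAlg ι

variable {ι}

/-- A letter in the exterior algebra. -/
def oddLetter (i : ι × ℕ) : ExtAlg ι := ExteriorAlgebra.ι ℂ (Finsupp.single i 1)

/-- The left derivative with respect to a letter of the exterior algebra. -/
def oddDeriv (i : ι × ℕ) : ExtAlg ι →ₗ[ℂ] ExtAlg ι :=
  CliffordAlgebra.contractLeft (Q := (0 : QuadraticForm ℂ (ι × ℕ →₀ ℂ))) (Finsupp.lapply i)

/-- The parity operator of the exterior algebra. -/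
def extSgn : ExtAlg ι →ₗ[ℂ] ExtAlg ι :=
  (CliffordAlgebra.involute (Q := (0 : QuadraticForm ℂ (ι × ℕ →₀ ℂ)))).toLinearMap

/-- The letter `b_{a,n}`. -/
def bLetter (a : ι) (n : ℕ) : Fock ι := MvPolynomial.X (a, n) ⊗ₜ[ℂ] 1

/-- The letter `c^a_n`. -/
def cLetter (a : ι) (n : ℕ) : Fock ι := 1 ⊗ₜ[ℂ] oddLetter (a, n)

/-- The partial derivative with respect to `b_{a,n}`. -/
def bDeriv (a : ι) (n : ℕ) : Fock ι →ₗ[ℂ] Fock ι :=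
  LinearMap.rTensor (ExtAlg ι) (MvPolynomial.pderiv (R := ℂ) (a, n)).toLinearMap

/-- The left partial derivative with respect to `c^a_n`. -/
def cDeriv (a : ι) (n : ℕ) : Fock ι →ₗ[ℂ] Fock ι :=
  LinearMap.lTensor (MvPolynomial (ι × ℕ) ℂ) (oddDeriv (a, n))

/-- The parity operator of the Fock space. -/
def fockSgn : Fock ι →ₗ[ℂ] Fock ι :=
  LinearMap.lTensor (MvPolynomial (ι × ℕ) ℂ) extSgn

/-- The derivation `∂` with `∂ b_{a,n} = (n+1) b_{a,n+1}` and `∂ c^a_n = (n+1) c^a_{n+1}`. -/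
def fockT : Fock ι →ₗ[ℂ] Fock ι :=
  locSum fun i : ι × ℕ => ((i.2 : ℂ) + 1) •
    (LinearMap.mulLeft ℂ (bLetter i.1 (i.2 + 1)) ∘ₗ bDeriv i.1 i.2 +
      LinearMap.mulLeft ℂ (cLetter i.1 (i.2 + 1)) ∘ₗ cDeriv i.1 i.2)

/-- The monomial with exponents `p` in the letters `b` and with the letters `c` in the list `l`. -/
def fockMonomial (p : ι × ℕ →₀ ℕ) (l : List (ι × ℕ)) : Fock ι :=
  MvPolynomial.monomial p 1 ⊗ₜ[ℂ] (l.map oddLetter).prod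

variable (ι)

/-- The free field raviolo vertex algebra generated by bosons `b_a` of cohomological degree `0` and
fermions `c^a` of cohomological degree `1`, `a ∈ ι`, with
`b_a(z) c^b(w) ∼ Ω⁰ δ_a^b ∼ c^b(z) b_a(w)`. The mode `(b_a)_(k)`, `k ≥ 0`, is the derivative with
respect to `c^a_k`, and `(c^a)_(k)` is the one with respect to `b_{a,k}`. -/
def bcSystem : RavioloData (Fock ι) where
  gr d := Submodule.span ℂ {x | ∃ p l, (l.length : ℤ) = d.1 ∧ d.2 = 0 ∧ x = fockMonomial p l}
  sgn := fockSgn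
  vac := 1
  T := fockT
  Y := wick (J := ι ⊕ ι) fockT
    (Sum.elim (fun a n => bDeriv a n ∘ₗ fockSgn) cDeriv)
    (Sum.elim cDeriv bDeriv)

/-- The spin grading of the `bc` system for which `b_a` has spin `1` and `c^a` has spin `0`. -/
def bcSpin (s : ℚ) : Submodule ℂ (Fock ι) :=
  Submodule.span ℂ {x | ∃ p l, ((p.sum fun i k => k * (i.2 + 1) : ℕ) : ℚ) +
    ((l.map Prod.snd).sum : ℕ) = s ∧ x = fockMonomial p l}

end FreeFields

/-! ### The current algebra at level zero and Hamiltonian symmetries -/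

section Currents

variable {ι 𝔤 : Type*} [Fintype ι] [LieRing 𝔤] [LieAlgebra ℂ 𝔤]

/-- The structure constants: `[T_a, T_b] = ∑_c f^c_{ab} T_c`, and `structConst T a b c = f^c_{ab}`. -/
def structConst (T : Module.Basis ι ℂ 𝔤) (a b c : ι) : ℂ := T.repr ⁅T a, T b⁆ c

/-- The derivation `∂` with `∂ μ_{a,n} = (n+1) μ_{a,n+1}`. -/
def currentT : ExtAlg ι →ₗ[ℂ] ExtAlg ι :=
  locSum fun i : ι × ℕ => ((i.2 : ℂ) + 1) •
    (LinearMap.mulLeft ℂ (oddLetter (i.1, i.2 + 1)) ∘ₗ oddDeriv i)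

/-- The operator `J_{a,m} = (μ_a)_(m)`, `m ≥ 0`: the derivation that maps `μ_{b,n}` to
`∑_c f^c_{ab} μ_{c,n-m}` if `n ≥ m` and to `0` otherwise. -/
def currentJ (T : Module.Basis ι ℂ 𝔤) (a : ι) (m : ℕ) : ExtAlg ι →ₗ[ℂ] ExtAlg ι :=
  locSum fun i : ι × ℕ =>
    if m ≤ i.2 then
      ∑ c, structConst T a i.1 c • (LinearMap.mulLeft ℂ (oddLetter (c, i.2 - m)) ∘ₗ oddDeriv i)
    else 0

/-- The raviolo current algebra `𝒱[𝔤]` at level zero. Its state space, the vacuum module of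
`𝔤 ⊗ 𝒦`, is the exterior algebra on the letters `μ_{a,n} = T_a ⊗ Ω^n`. -/
def currentAlgebra (T : Module.Basis ι ℂ 𝔤) : RavioloData (ExtAlg ι) where
  gr d := Submodule.span ℂ {x | ∃ l : List (ι × ℕ), (l.length : ℤ) = d.1 ∧ d.2 = 0 ∧
    x = (l.map oddLetter).prod}
  sgn := extSgn
  vac := 1
  T := currentT
  Y := wick currentT (fun a n => oddDeriv (a, n)) (currentJ T)

variable {V : Type*} [AddCommGroup V] [Module ℂ V]

/-- A Hamiltonian `𝔤`-symmetry at level zero: a morphism from the current algebra `𝒱[𝔤]`. -/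
def IsHamiltonianSymmetry (T : Module.Basis ι ℂ 𝔤) (𝒱 : RavioloData V) (ρ : ExtAlg ι →ₗ[ℂ] V) :
    Prop :=
  IsMorphism (currentAlgebra T) 𝒱 ρ

/-- The moment map `μ_a`, the image of the state `μ_{a,0} |0⟩`. -/
def moment (ρ : ExtAlg ι →ₗ[ℂ] V) (a : ι) : V := ρ (oddLetter (a, 0))

/-- `W` is a `𝔤`-invariant primary: the OPE of `W` with each `μ_a` is regular. -/
def IsInvariantPrimary (𝒱 : RavioloData V) (ρ : ExtAlg ι →ₗ[ℂ] V) (W : V) : Prop :=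
  ∀ (a : ι) (m : ℤ), 0 ≤ m → 𝒱.Y m (moment ρ a) W = 0

end Currents

/-! ### The gauged superpotential -/

section Gauging

variable {ι 𝔤 V : Type*} [Fintype ι] [LieRing 𝔤] [LieAlgebra ℂ 𝔤] [AddCommGroup V] [Module ℂ V]

/-- The tensor product of `𝒱` and the `bc` system. -/
def gauged (ι : Type*) (𝒱 : RavioloData V) : RavioloData (V ⊗[ℂ] Fock ι) :=
  tensor 𝒱 (bcSystem ι)

/-- The normally ordered product of states, `:A B: = A_(-1) B`. -/
def nop (𝒱 : RavioloData V) (A B : V) : V := 𝒱.Y (-1) A B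

/-- The state `b_a` of the tensor product. -/
def bState (𝒱 : RavioloData V) (a : ι) : V ⊗[ℂ] Fock ι := 𝒱.vac ⊗ₜ[ℂ] bLetter a 0

/-- The state `c^a` of the tensor product. -/
def cState (𝒱 : RavioloData V) (a : ι) : V ⊗[ℂ] Fock ι := 𝒱.vac ⊗ₜ[ℂ] cLetter a 0

/-- A state of `𝒱`, in the tensor product. -/
def matter (ι : Type*) (v : V) : V ⊗[ℂ] Fock ι := v ⊗ₜ[ℂ] 1

/-- `W_tot = ½ f^a_{bc} :b_a c^b c^c: + ½ K_{ab} :c^a ∂c^b: + :c^a μ_a: + W`. -/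
def totalSuperpotential (T : Module.Basis ι ℂ 𝔤) (K : LinearMap.BilinForm ℂ 𝔤)
    (𝒱 : RavioloData V) (ρ : ExtAlg ι →ₗ[ℂ] V) (W : V) : V ⊗[ℂ] Fock ι :=
  (1 / 2 : ℂ) • ∑ a, ∑ b, ∑ c, structConst T b c a •
      nop (gauged ι 𝒱) (bState 𝒱 a) (nop (gauged ι 𝒱) (cState 𝒱 b) (cState 𝒱 c)) +
    (1 / 2 : ℂ) • ∑ a, ∑ b, K (T a) (T b) •
      nop (gauged ι 𝒱) (cState 𝒱 a) ((gauged ι 𝒱).T (cState 𝒱 b)) +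
    ∑ a, nop (gauged ι 𝒱) (cState 𝒱 a) (matter ι (moment ρ a)) +
    matter ι W

/-- `Γ_tot = Γ - :b_a ∂c^a:`. -/
def totalStress (ι : Type*) [Fintype ι] (𝒱 : RavioloData V) (γ : V) : V ⊗[ℂ] Fock ι :=
  matter ι γ - ∑ a : ι, nop (gauged ι 𝒱) (bState 𝒱 a) ((gauged ι 𝒱).T (cState 𝒱 a))

end Gauging

end Raviolo

end

open Raviolo

open TensorProduct
set_option linter.unusedSectionVars false

noncomputable section

namespace Raviolo

open Finset.HasAntidiagonal (antidiagonal)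

/-! ### Signs -/

/-! The proof replaces locality by algebra. Since a product of two Ω's vanishes, the negative modes
of a raviolo vertex algebra supercommute. So `a_(-1) b` is an associative graded commutative product
with derivation `∂`, and `a_(-n-1)` is multiplication by `∂^n a / n!`. Locality then says that the
non-negative modes are superderivations of this product, covariant under translation and
skew-symmetric, and that their commutators are killed by a power of `z - w`. These properties are
extracted in `IsRaviolo.isPoisson` and `IsRaviolo.isLocalPair`. They also suffice to recover
locality (`IsPoisson.mutuallyLocal`): the negative modes of the coefficient `C^n` are those of
`a_(n) b`, and its non-negative modes are the Newton coefficients of the commutator.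

In this form everything can be tested on generators, because each property passes from `a` and `x`
to their product as soon as the modes of `a x` obey the Wick formula. That formula has no double
contractions, again because `Ω^i Ω^j = 0`. For a tensor product the generators are `a ⊗ |0⟩` and
`|0⟩ ⊗ x` (`tensor_isRaviolo`), for the ghosts they are the letters of the Fock space
(`bc_isRaviolo`).

For the superpotential, let `Q` be the zero mode of `W_tot`. It is an odd derivation commuting with
`∂`, so it is determined by its values on generators: `Q c` is the Chevalley-Eilenberg differential,
`Q b` is the coadjoint term plus `K ∂c` plus `μ`, `Q μ` is the adjoint action by `c`, and `Q W =
W_(0) W` by invariance of `W`. In `Q W_tot` the terms `bccc` cancel by the Jacobi identity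
(`gaugePotential_cubic`), the terms `ccμ` cancel because the moment maps close on the bracket at
level zero (`gaugePotential_linear`), and the terms `cc∂c` form the derivative of the cubic
Chern-Simons form because `K` is invariant (`gaugePotential_quadratic`). What remains is `W_(0) W`,
which lies in the image of `∂` by assumption. As there are no double contractions, no anomaly
condition on `𝔤` or `K` arises.

In the conformal case the conformal vector is odd, so its non-negative modes are even derivations,
and the Witt relations only need to be checked on letters, where they hold because `b` and `c` are
primaries of weights `1` and `0`. The ghost stress tensor is itself primary of weight `2`
(`bcStress_isPrimary`), hence contributes no central term, and the total central charge is
multiplication by `ξ|0⟩ ⊗ 1`. -/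

theorem sign_zero : sign 0 = 1 := by simp [sign]

theorem sign_one : sign 1 = -1 := by simp [sign]

theorem sign_two : sign 2 = 1 := sign_zero

theorem sign_three : sign 3 = -1 := sign_one

theorem zmod_two_cases (p : ZMod 2) : p = 0 ∨ p = 1 := by
  revert p; decide

theorem sign_add (p q : ZMod 2) : sign (p + q) = sign p * sign q := by
  rcases zmod_two_cases p with rfl | rfl <;> rcases zmod_two_cases q with rfl | rfl <;>
    simp [sign_zero, sign_one, show (1 + 1 : ZMod 2) = 0 from rfl]

theorem sign_mul_self (p : ZMod 2) : sign p * sign p = 1 := by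
  rcases zmod_two_cases p with rfl | rfl <;> simp [sign_zero, sign_one]

theorem sign_add_one (p : ZMod 2) : sign (p + 1) = -sign p := by
  rw [sign_add, sign_one, mul_neg_one]

theorem sign_smul_smul {E : Type*} [AddCommGroup E] [Module ℂ E] (p : ZMod 2) (x : E) :
    sign p • sign p • x = x := by
  rw [smul_smul, sign_mul_self, one_smul]

/-! ### Sums of eventually vanishing sequences -/

section Sums

variable {E F : Type*} [AddCommGroup E] [Module ℂ E] [AddCommGroup F] [Module ℂ F]

theorem finsum_eq_sum_range {f : ℕ → E} (N : ℕ) (h : ∀ n, N ≤ n → f n = 0) :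
    ∑ᶠ n, f n = ∑ n ∈ Finset.range N, f n := by
  apply finsum_eq_sum_of_support_subset
  intro n hn
  by_contra hN
  simp only [Finset.coe_range, Set.mem_Iio, not_lt] at hN
  exact hn (h n hN)

theorem finite_support_of_eventually {f : ℕ → E} (N : ℕ) (h : ∀ n, N ≤ n → f n = 0) :
    (Function.support f).Finite := by
  refine (Finset.range N).finite_toSet.subset fun n hn => ?_
  by_contra hN
  simp only [Finset.coe_range, Set.mem_Iio, not_lt] at hN
  exact hn (h n hN)

/-- The square of side `N` and the triangle `i + j < N` differ only where the summand vanishes. This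
lets locally finite double sums be regrouped by total order. -/
theorem sum_range_range_eq_sum_antidiagonal (N : ℕ) (g : ℕ → ℕ → E)
    (h : ∀ i j, N ≤ i + j → g i j = 0) :
    ∑ i ∈ Finset.range N, ∑ j ∈ Finset.range N, g i j =
      ∑ n ∈ Finset.range N, ∑ x ∈ antidiagonal n, g x.1 x.2 := by
  rw [← Finset.sum_product', Finset.sum_sigma']
  symm
  refine Finset.sum_of_injOn (fun x => x.2) ?_ ?_ ?_ ?_
  · rintro ⟨n, i, j⟩ hx ⟨n', i', j'⟩ hx' he
    simp only [Finset.coe_sigma, Set.mem_sigma_iff, Finset.mem_coe, Finset.mem_range,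
      Finset.HasAntidiagonal.mem_antidiagonal] at hx hx'
    simp only [Prod.mk.injEq] at he
    obtain ⟨rfl, rfl⟩ := he
    obtain ⟨h1, rfl⟩ := hx
    obtain ⟨h2, rfl⟩ := hx'
    rfl
  · rintro ⟨n, i, j⟩ hx
    simp only [Finset.coe_sigma, Set.mem_sigma_iff, Finset.mem_coe, Finset.mem_range,
      Finset.HasAntidiagonal.mem_antidiagonal] at hx
    simp only [Finset.mem_coe, Finset.mem_product, Finset.mem_range]
    omega
  · rintro ⟨i, j⟩ - hx
    apply h
    by_contra hlt
    refine hx ⟨⟨i + j, i, j⟩, ?_, rfl⟩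
    simpa using hlt
  · intros; rfl

theorem sum_antidiagonal_assoc (n : ℕ) (g : ℕ → ℕ → ℕ → E) :
    ∑ x ∈ antidiagonal n, ∑ y ∈ antidiagonal x.1, g y.1 y.2 x.2 =
      ∑ x ∈ antidiagonal n, ∑ y ∈ antidiagonal x.2, g y.1 x.1 y.2 := by
  rw [Finset.sum_sigma', Finset.sum_sigma']
  refine Finset.sum_nbij' (fun x => ⟨(x.2.2, x.2.1 + x.1.2), (x.2.1, x.1.2)⟩)
    (fun x => ⟨(x.2.1 + x.1.1, x.2.2), (x.2.1, x.1.1)⟩) ?_ ?_ ?_ ?_ ?_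
  · rintro ⟨⟨a, b⟩, ⟨c, d⟩⟩ h
    simp only [Finset.mem_sigma, Finset.HasAntidiagonal.mem_antidiagonal] at h ⊢
    exact ⟨by have := h.1; have := h.2; omega, trivial⟩
  · rintro ⟨⟨a, b⟩, ⟨c, d⟩⟩ h
    simp only [Finset.mem_sigma, Finset.HasAntidiagonal.mem_antidiagonal] at h ⊢
    exact ⟨by have := h.1; have := h.2; omega, trivial⟩
  · rintro ⟨⟨a, b⟩, ⟨c, d⟩⟩ h
    simp only [Finset.mem_sigma, Finset.HasAntidiagonal.mem_antidiagonal] at h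
    obtain ⟨rfl, rfl⟩ := h
    rfl
  · rintro ⟨⟨a, b⟩, ⟨c, d⟩⟩ h
    simp only [Finset.mem_sigma, Finset.HasAntidiagonal.mem_antidiagonal] at h
    obtain ⟨rfl, rfl⟩ := h
    rfl
  · intros; rfl

/-- This cancellation drives both identities for the skew-symmetry transform below. -/
theorem sum_antidiagonal_neg_one_pow_choose (n : ℕ) :
    ∑ x ∈ antidiagonal n, (-1 : ℂ) ^ x.1 * (n.choose x.1 : ℂ) = if n = 0 then 1 else 0 := by
  rw [Finset.Nat.sum_antidiagonal_eq_sum_range_succ (fun i _ => (-1 : ℂ) ^ i * (n.choose i : ℂ))]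
  have := congrArg (fun z : ℤ => (z : ℂ)) (Int.alternating_sum_range_choose (n := n))
  push_cast at this
  exact this

/-- The functions `m ↦ binom(m, n)` are linearly independent even on large `m`: by Pascal's rule the
difference of consecutive relations is a relation of lower order for the shifted coefficients. It
isolates the individual fields `C^n` of a locality relation, which are visible only in sums weighted
by these binomials. -/
theorem eq_zero_of_sum_choose_smul_eq_zero (N : ℕ) :
    ∀ (x : ℕ → E) (M : ℕ),
      (∀ m, M ≤ m → ∑ n ∈ Finset.range (N + 1), (m.choose n : ℂ) • x n = 0) →
      ∀ n, n ≤ N → x n = 0 := by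
  induction N with
  | zero =>
    intro x M h n hn
    obtain rfl : n = 0 := by omega
    simpa using h M le_rfl
  | succ N ih =>
    intro x M h
    have h1 : ∀ n, n ≤ N → x (n + 1) = 0 := by
      apply ih (fun n => x (n + 1)) M
      intro m hm
      have h2 := h (m + 1) (by omega)
      have h3 := h m hm
      rw [Finset.sum_range_succ'] at h2 h3
      simp only [Nat.choose_zero_right, Nat.choose_succ_succ, Nat.cast_add, add_smul,
        Finset.sum_add_distrib] at h2 h3
      rw [add_assoc, h3, add_zero] at h2
      exact h2
    have h0 : x 0 = 0 := by
      have h2 := h M le_rfl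
      rw [Finset.sum_range_succ'] at h2
      rw [Finset.sum_eq_zero, zero_add] at h2
      · simpa using h2
      · intro n hn
        rw [h1 n (by simpa [Nat.lt_succ_iff] using hn), smul_zero]
    intro n hn
    cases n with
    | zero => exact h0
    | succ n => exact h1 n (by omega)

/-! ### Divided powers of an operator -/

/-- The divided power `T^j / j!`. -/
def dpow (T : E →ₗ[ℂ] E) (j : ℕ) : E →ₗ[ℂ] E := ((j.factorial : ℂ)⁻¹) • T ^ j

theorem dpow_zero (T : E →ₗ[ℂ] E) (x : E) : dpow T 0 x = x := by simp [dpow]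

theorem dpow_one (T : E →ₗ[ℂ] E) (x : E) : dpow T 1 x = T x := by simp [dpow]

theorem T_dpow (T : E →ₗ[ℂ] E) (j : ℕ) (x : E) :
    T (dpow T j x) = ((j : ℂ) + 1) • dpow T (j + 1) x := by
  have hj : (j.factorial : ℂ) ≠ 0 := by exact_mod_cast j.factorial_ne_zero
  have hj' : (j : ℂ) + 1 ≠ 0 := by exact_mod_cast j.succ_ne_zero
  simp only [dpow, LinearMap.smul_apply, map_smul, pow_succ', Module.End.mul_apply, smul_smul,
    Nat.factorial_succ, Nat.cast_mul, Nat.cast_add, Nat.cast_one, mul_inv]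
  congr 1
  field_simp

theorem dpow_succ (T : E →ₗ[ℂ] E) (j : ℕ) (x : E) :
    dpow T (j + 1) x = ((j : ℂ) + 1)⁻¹ • T (dpow T j x) := by
  have hj' : (j : ℂ) + 1 ≠ 0 := by exact_mod_cast j.succ_ne_zero
  rw [T_dpow, smul_smul, inv_mul_cancel₀ hj', one_smul]

theorem dpow_T (T : E →ₗ[ℂ] E) (j : ℕ) (x : E) : dpow T j (T x) = T (dpow T j x) := by
  simp only [dpow, LinearMap.smul_apply, map_smul]
  rw [← Module.End.mul_apply, ← Module.End.mul_apply, ← pow_succ, ← pow_succ']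

theorem dpow_dpow (T : E →ₗ[ℂ] E) (i j : ℕ) (x : E) :
    dpow T i (dpow T j x) = ((i + j).choose i : ℂ) • dpow T (i + j) x := by
  have hi : (i.factorial : ℂ) ≠ 0 := by exact_mod_cast i.factorial_ne_zero
  have hj : (j.factorial : ℂ) ≠ 0 := by exact_mod_cast j.factorial_ne_zero
  have hij : ((i + j).factorial : ℂ) ≠ 0 := by exact_mod_cast (i + j).factorial_ne_zero
  simp only [dpow, LinearMap.smul_apply, map_smul, smul_smul]
  rw [← Module.End.mul_apply, ← pow_add, Nat.cast_add_choose]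
  congr 1
  field_simp

theorem dpow_map {T : E →ₗ[ℂ] E} {S : F →ₗ[ℂ] F} (f : E →ₗ[ℂ] F) (h : ∀ x, f (T x) = S (f x))
    (j : ℕ) (x : E) : f (dpow T j x) = dpow S j (f x) := by
  induction j with
  | zero => simp [dpow_zero]
  | succ j ih => rw [dpow_succ, dpow_succ, map_smul, h, ih]

theorem dpow_of_T_eq_zero {T : E →ₗ[ℂ] E} {x : E} (h : T x = 0) (j : ℕ) :
    dpow T j x = if j = 0 then x else 0 := by
  cases j with
  | zero => simp [dpow_zero]
  | succ j => rw [dpow_succ, ← dpow_T, h]; simp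

/-- The Leibniz rule for divided powers. -/
theorem dpow_bilin {G : Type*} [AddCommGroup G] [Module ℂ G] {T : E →ₗ[ℂ] E} {S : F →ₗ[ℂ] F}
    {R : G →ₗ[ℂ] G} (μ : E →ₗ[ℂ] F →ₗ[ℂ] G)
    (h : ∀ x y, R (μ x y) = μ (T x) y + μ x (S y)) (n : ℕ) (x : E) (y : F) :
    dpow R n (μ x y) = ∑ i ∈ antidiagonal n, μ (dpow T i.1 x) (dpow S i.2 y) := by
  induction n with
  | zero => simp [dpow_zero]
  | succ n ih =>
    have hn : (n : ℂ) + 1 ≠ 0 := by exact_mod_cast n.succ_ne_zero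
    rw [dpow_succ, ih, map_sum, inv_smul_eq_iff₀ hn]
    simp only [h, T_dpow, map_smul, LinearMap.smul_apply, Finset.sum_add_distrib]
    -- After the shift the added boundary term has coefficient zero, so both sums live on the same
    -- antidiagonal, where the coefficients `i.1` and `i.2` add up to `n + 1`.
    have h1 : ∑ i ∈ antidiagonal n, ((i.1 : ℂ) + 1) •
        μ (dpow T (i.1 + 1) x) (dpow S i.2 y) =
        ∑ i ∈ antidiagonal (n + 1), (i.1 : ℂ) • μ (dpow T i.1 x) (dpow S i.2 y) := by
      rw [Finset.Nat.sum_antidiagonal_succ]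
      simp
    have h2 : ∑ i ∈ antidiagonal n, ((i.2 : ℂ) + 1) •
        μ (dpow T i.1 x) (dpow S (i.2 + 1) y) =
        ∑ i ∈ antidiagonal (n + 1), (i.2 : ℂ) • μ (dpow T i.1 x) (dpow S i.2 y) := by
      rw [Finset.Nat.sum_antidiagonal_succ']
      simp
    rw [h1, h2, ← Finset.sum_add_distrib, Finset.smul_sum]
    refine Finset.sum_congr rfl fun i hi => ?_
    rw [← add_smul]
    congr 1
    rw [Finset.HasAntidiagonal.mem_antidiagonal] at hi
    exact_mod_cast hi

/-! ### The skew-symmetry transform and the Wick product of sequences -/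

/-- The transform `f ↦ ∑_j (-1)^{l+j} T^j/j! f_{l+j}` of skew-symmetry. -/
def skewTransform (T : E →ₗ[ℂ] E) (f : ℕ → E) (l : ℕ) : E :=
  ∑ᶠ j : ℕ, (-1 : ℂ) ^ (l + j) • dpow T j (f (l + j))

/-- The sequence `∑_i (T^i/i! a) f_{m+i}`. -/
def wickSum (T : E →ₗ[ℂ] E) (μ : E →ₗ[ℂ] E →ₗ[ℂ] E) (a : E) (f : ℕ → E) (m : ℕ) : E :=
  ∑ᶠ i : ℕ, μ (dpow T i a) (f (m + i))

variable {T : E →ₗ[ℂ] E} {μ : E →ₗ[ℂ] E →ₗ[ℂ] E} {f g : ℕ → E} {N : ℕ}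

theorem skewTransform_eq (hf : ∀ n, N ≤ n → f n = 0) (l : ℕ) :
    skewTransform T f l = ∑ j ∈ Finset.range N, (-1 : ℂ) ^ (l + j) • dpow T j (f (l + j)) :=
  finsum_eq_sum_range N fun j hj => by rw [hf _ (by omega), map_zero, smul_zero]

theorem wickSum_eq (hf : ∀ n, N ≤ n → f n = 0) (a : E) (m : ℕ) :
    wickSum T μ a f m = ∑ i ∈ Finset.range N, μ (dpow T i a) (f (m + i)) :=
  finsum_eq_sum_range N fun j hj => by rw [hf _ (by omega), map_zero]

theorem skewTransform_eventually (hf : ∀ n, N ≤ n → f n = 0) (l : ℕ) (hl : N ≤ l) :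
    skewTransform T f l = 0 := by
  rw [skewTransform_eq hf]
  exact Finset.sum_eq_zero fun j _ => by rw [hf _ (by omega), map_zero, smul_zero]

theorem wickSum_eventually (hf : ∀ n, N ≤ n → f n = 0) (a : E) (l : ℕ) (hl : N ≤ l) :
    wickSum T μ a f l = 0 := by
  rw [wickSum_eq hf]
  exact Finset.sum_eq_zero fun j _ => by rw [hf _ (by omega), map_zero]

/-- Collecting the terms of total order `n`, the coefficient of `T^n/n! f_{l+n}` is, up to sign, the
alternating sum of `binom(n, i)`, so only `n = 0` survives. Involutivity makes skew-symmetry a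
symmetric relation. -/
theorem skewTransform_skewTransform (hf : ∀ n, N ≤ n → f n = 0) (l : ℕ) :
    skewTransform T (skewTransform T f) l = f l := by
  rw [skewTransform_eq (skewTransform_eventually hf)]
  simp only [skewTransform_eq hf, map_sum, map_smul, Finset.smul_sum]
  rw [sum_range_range_eq_sum_antidiagonal N (fun j i => (-1 : ℂ) ^ (l + j) •
    (-1 : ℂ) ^ (l + j + i) • dpow T j (dpow T i (f (l + j + i))))
    (fun i j hij => by rw [hf _ (by omega)]; simp)]
  have : ∀ n, ∑ x ∈ antidiagonal n, (-1 : ℂ) ^ (l + x.1) •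
      (-1 : ℂ) ^ (l + x.1 + x.2) • dpow T x.1 (dpow T x.2 (f (l + x.1 + x.2))) =
      if n = 0 then f l else 0 := by
    intro n
    have h1 : ∀ x ∈ antidiagonal n, (-1 : ℂ) ^ (l + x.1) •
      (-1 : ℂ) ^ (l + x.1 + x.2) • dpow T x.1 (dpow T x.2 (f (l + x.1 + x.2))) =
      ((-1 : ℂ) ^ x.1 * (n.choose x.1 : ℂ)) • (-1 : ℂ) ^ n • dpow T n (f (l + n)) := by
      rintro ⟨i, j⟩ hx
      rw [Finset.HasAntidiagonal.mem_antidiagonal] at hx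
      obtain rfl := hx
      simp only [dpow_dpow, smul_smul, add_assoc]
      congr 1
      have h1 : ((-1 : ℂ) ^ l) * (-1) ^ l = 1 := by rw [← mul_pow]; simp
      simp only [pow_add]
      linear_combination ((-1) ^ i * (-1) ^ i * (-1) ^ j * ((i + j).choose i : ℂ)) * h1
    rw [Finset.sum_congr rfl h1, ← Finset.sum_smul, sum_antidiagonal_neg_one_pow_choose]
    split_ifs with h
    · subst h; simp [dpow_zero]
    · simp
  simp only [this]
  rw [Finset.sum_ite_eq' (Finset.range N) 0 (fun _ => f l)]
  split_ifs with h
  · rfl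
  · rw [hf l]; simp at h; omega

/-- The Leibniz rule spreads the powers of `T` over both factors, and an alternating sum of
binomials cancels everything in which `a` is differentiated. The transform thus turns a Wick sum
into a plain product, which is how the Wick formula for `a x` on `b` corresponds to the derivation
property of `b` on `a x`. -/
theorem skewTransform_wickSum (hμ : ∀ x y, T (μ x y) = μ (T x) y + μ x (T y))
    (hf : ∀ n, N ≤ n → f n = 0) (a : E) (l : ℕ) :
    skewTransform T (wickSum T μ a f) l = μ a (skewTransform T f l) := by
  rw [skewTransform_eq (wickSum_eventually hf a)]
  simp only [wickSum_eq hf, skewTransform_eq hf, map_sum, map_smul, Finset.smul_sum]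
  rw [sum_range_range_eq_sum_antidiagonal N (fun j i => (-1 : ℂ) ^ (l + j) •
    dpow T j (μ (dpow T i a) (f (l + j + i))))
    (fun i j hij => by rw [hf _ (by omega)]; simp)]
  refine Finset.sum_congr rfl fun n _ => ?_
  have h1 : ∀ x ∈ antidiagonal n, (-1 : ℂ) ^ (l + x.1) •
      dpow T x.1 (μ (dpow T x.2 a) (f (l + x.1 + x.2))) =
      ∑ y ∈ antidiagonal x.1, (-1 : ℂ) ^ (l + y.1 + y.2) • ((y.1 + x.2).choose y.1 : ℂ) •
        μ (dpow T (y.1 + x.2) a) (dpow T y.2 (f (l + n))) := by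
    rintro ⟨j, i⟩ hx
    simp only [Finset.HasAntidiagonal.mem_antidiagonal] at hx
    rw [dpow_bilin μ hμ, Finset.smul_sum]
    refine Finset.sum_congr rfl fun y hy => ?_
    simp only [Finset.HasAntidiagonal.mem_antidiagonal] at hy
    rw [dpow_dpow, map_smul, LinearMap.smul_apply, add_assoc l j i, hx, add_assoc l y.1, hy]
  -- Regroup so that, for a fixed order of the derivative of `f`, all contributions to one
  -- derivative of `a` are summed first.
  rw [Finset.sum_congr rfl h1, sum_antidiagonal_assoc n (fun p q i => (-1 : ℂ) ^ (l + p + q) •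
    ((p + i).choose p : ℂ) • μ (dpow T (p + i) a) (dpow T q (f (l + n))))]
  have h2 : ∀ x ∈ antidiagonal n, ∑ y ∈ antidiagonal x.2,
      (-1 : ℂ) ^ (l + y.1 + x.1) • ((y.1 + y.2).choose y.1 : ℂ) •
      μ (dpow T (y.1 + y.2) a) (dpow T x.1 (f (l + n))) =
      if x.2 = 0 then (-1 : ℂ) ^ (l + n) • μ a (dpow T n (f (l + n))) else 0 := by
    rintro ⟨q, r⟩ hx
    simp only [Finset.HasAntidiagonal.mem_antidiagonal] at hx
    have h3 : ∀ y ∈ antidiagonal r, (-1 : ℂ) ^ (l + y.1 + q) •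
      ((y.1 + y.2).choose y.1 : ℂ) • μ (dpow T (y.1 + y.2) a) (dpow T q (f (l + n))) =
      ((-1 : ℂ) ^ y.1 * (r.choose y.1 : ℂ)) • (-1 : ℂ) ^ (l + q) •
        μ (dpow T r a) (dpow T q (f (l + n))) := by
      intro y hy
      simp only [Finset.HasAntidiagonal.mem_antidiagonal] at hy
      rw [hy, smul_smul, smul_smul]
      congr 1
      simp only [pow_add]; ring
    rw [Finset.sum_congr rfl h3, ← Finset.sum_smul, sum_antidiagonal_neg_one_pow_choose]
    dsimp only
    split_ifs with h
    · subst h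
      obtain rfl : q = n := by omega
      simp [dpow_zero]
    · simp
  rw [Finset.sum_congr rfl h2, Finset.sum_eq_single (n, 0)]
  · simp
  · rintro ⟨q, r⟩ hx hne
    simp only [Finset.HasAntidiagonal.mem_antidiagonal] at hx
    rw [if_neg]
    rintro rfl
    exact hne (by simp at hx; simp [hx])
  · intro h; simp at h

theorem skewTransform_add (hf : ∀ n, N ≤ n → f n = 0) (hg : ∀ n, N ≤ n → g n = 0) (s t : ℂ)
    (l : ℕ) : skewTransform T (fun n => s • f n + t • g n) l =
      s • skewTransform T f l + t • skewTransform T g l := by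
  rw [skewTransform_eq hf, skewTransform_eq hg,
    skewTransform_eq (N := N) (fun n hn => by rw [hf n hn, hg n hn]; simp)]
  simp only [Finset.smul_sum, ← Finset.sum_add_distrib, map_add, map_smul, smul_add]
  refine Finset.sum_congr rfl fun j _ => ?_
  rw [smul_comm s, smul_comm t]

end Sums


/-! ### Diagonal differences -/

section DiagDiff

variable {E F : Type*} [AddCommGroup E] [Module ℂ E] [AddCommGroup F] [Module ℂ F]

/-- The action of `z - w` on functionals on polynomials in `z` and `w`. -/
def diagDiff (Φ : ℕ → ℕ → E) (m l : ℕ) : E := Φ (m + 1) l - Φ m (l + 1)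

theorem diagDiff_zero : diagDiff (fun _ _ => 0 : ℕ → ℕ → E) = fun _ _ => 0 := by
  funext m l; simp [diagDiff]

theorem diagDiff_iterate_zero (M : ℕ) : diagDiff^[M] (fun _ _ => 0 : ℕ → ℕ → E) = fun _ _ => 0 := by
  induction M with
  | zero => rfl
  | succ M ih => rw [Function.iterate_succ_apply, diagDiff_zero, ih]

theorem diagDiff_iterate_map (f : E →ₗ[ℂ] F) (M : ℕ) (Φ : ℕ → ℕ → E) :
    diagDiff^[M] (fun m l => f (Φ m l)) = fun m l => f ((diagDiff^[M] Φ) m l) := by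
  induction M generalizing Φ with
  | zero => rfl
  | succ M ih =>
    rw [Function.iterate_succ_apply, Function.iterate_succ_apply, ← ih]
    congr 1
    funext m l
    simp [diagDiff]

theorem diagDiff_iterate_add (M : ℕ) (Φ Ψ : ℕ → ℕ → E) :
    diagDiff^[M] (fun m l => Φ m l + Ψ m l) =
      fun m l => (diagDiff^[M] Φ) m l + (diagDiff^[M] Ψ) m l := by
  induction M generalizing Φ Ψ with
  | zero => rfl
  | succ M ih =>
    simp only [Function.iterate_succ_apply]
    rw [← ih]
    congr 1
    funext m l
    simp only [diagDiff]; abel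

theorem diagDiff_iterate_shift (M k : ℕ) (Φ : ℕ → ℕ → E) :
    diagDiff^[M] (fun m l => Φ (m + k) l) = fun m l => (diagDiff^[M] Φ) (m + k) l := by
  induction M generalizing Φ with
  | zero => rfl
  | succ M ih =>
    simp only [Function.iterate_succ_apply]
    rw [← ih]
    congr 1
    funext m l
    simp only [diagDiff, add_right_comm]

theorem diagDiff_iterate_swap (M : ℕ) (Φ : ℕ → ℕ → E) :
    diagDiff^[M] (fun m l => Φ l m) = fun m l => (-1 : ℂ) ^ M • (diagDiff^[M] Φ) l m := by
  induction M generalizing Φ with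
  | zero => simp
  | succ M ih =>
    simp only [Function.iterate_succ_apply]
    have : diagDiff (fun m l => Φ l m) =
        fun m l => LinearMap.lsmul ℂ E (-1) ((fun m l => diagDiff Φ l m) m l) := by
      funext m l; simp [diagDiff]
    rw [this, diagDiff_iterate_map (LinearMap.lsmul ℂ E (-1)), ih]
    funext m l
    simp only [LinearMap.lsmul_apply, smul_smul, pow_succ']

theorem diagDiff_iterate_eq_zero_of_le {M M' : ℕ} (h : M ≤ M') {Φ : ℕ → ℕ → E}
    (hΦ : diagDiff^[M] Φ = fun _ _ => 0) : diagDiff^[M'] Φ = fun _ _ => 0 := by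
  obtain ⟨k, rfl⟩ := Nat.exists_eq_add_of_le h
  rw [add_comm, Function.iterate_add_apply, hΦ, diagDiff_iterate_zero]

theorem diagDiff_iterate_finsum (M : ℕ) (g : ℕ → ℕ → ℕ → E)
    (hg : ∀ m l, (Function.support fun i => g i m l).Finite) :
    diagDiff^[M] (fun m l => ∑ᶠ i, g i m l) = fun m l => ∑ᶠ i, (diagDiff^[M] (g i)) m l := by
  induction M generalizing g with
  | zero => rfl
  | succ M ih =>
    simp only [Function.iterate_succ_apply]
    rw [← ih]
    · congr 1
      funext m l
      simp only [diagDiff]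
      rw [finsum_sub_distrib (hg _ _) (hg _ _)]
    · intro m l
      refine ((hg (m + 1) l).union (hg m (l + 1))).subset fun i hi => ?_
      by_contra hc
      simp only [Set.mem_union, Function.mem_support, not_or, not_not] at hc
      exact hi (by simp [diagDiff, hc.1, hc.2])

/-- The Newton expansion. -/
theorem newton_diagDiff (Φ : ℕ → ℕ → E) (m l : ℕ) :
    Φ m l = ∑ n ∈ Finset.range (m + 1), (m.choose n : ℂ) • (diagDiff^[n] Φ) 0 (m + l - n) := by
  induction m generalizing Φ l with
  | zero => simp
  | succ m ih =>
    have h1 : Φ (m + 1) l = diagDiff Φ m l + Φ m (l + 1) := by simp [diagDiff]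
    rw [h1, ih (diagDiff Φ), ih Φ (l + 1), Finset.sum_range_succ' _ (m + 1)]
    simp only [← Function.iterate_succ_apply]
    have h2 : ∑ n ∈ Finset.range (m + 1), (m.choose n : ℂ) • (diagDiff^[n] Φ) 0 (m + (l + 1) - n) =
        ∑ n ∈ Finset.range (m + 1), (m.choose (n + 1) : ℂ) • (diagDiff^[n + 1] Φ) 0 (m + l - n) +
        Φ 0 (m + l + 1) := by
      rw [Finset.sum_range_succ', Finset.sum_range_succ _ m]
      simp only [Nat.choose_succ_self, Nat.cast_zero, zero_smul, add_zero, Nat.choose_zero_right,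
        Nat.cast_one, one_smul, Function.iterate_zero, id]
      congr 1
      refine Finset.sum_congr rfl fun n _ => ?_
      rw [show m + (l + 1) - (n + 1) = m + l - n by omega]
    rw [h2, ← add_assoc, ← Finset.sum_add_distrib]
    congr 1
    · refine Finset.sum_congr rfl fun n _ => ?_
      rw [Nat.choose_succ_succ, Nat.cast_add, add_smul,
        show m + 1 + l - (n + 1) = m + l - n by omega]
    · simp [add_right_comm]

end DiagDiff

/-! ### Modes on divided powers -/

section Modes

variable {E : Type*} [AddCommGroup E] [Module ℂ E]

/-- This is the coefficient of `t^i` in `A_m e^{tT} = e^{tT} ∑_k binom(m, k) t^k A_{m-k}`, the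
integrated form of covariance. The truncated subtraction is harmless, since `binom(m, k)` vanishes
for `k > m`. -/
theorem mode_dpow {T : E →ₗ[ℂ] E} {A : ℕ → E →ₗ[ℂ] E}
    (h : ∀ m b, A m (T b) = T (A m b) + (m : ℂ) • A (m - 1) b) (m i : ℕ) (b : E) :
    A m (dpow T i b) =
      ∑ x ∈ antidiagonal i, (m.choose x.1 : ℂ) • dpow T x.2 (A (m - x.1) b) := by
  induction i generalizing m with
  | zero => simp [dpow_zero]
  | succ i ih =>
    have hi : (i : ℂ) + 1 ≠ 0 := by exact_mod_cast i.succ_ne_zero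
    rw [dpow_succ, map_smul, h, ih, ih, inv_smul_eq_iff₀ hi, map_sum, Finset.smul_sum]
    simp only [map_smul, T_dpow]
    have h1 : ∑ x ∈ antidiagonal i, (m.choose x.1 : ℂ) • ((x.2 : ℂ) + 1) •
        dpow T (x.2 + 1) (A (m - x.1) b) =
        ∑ x ∈ antidiagonal (i + 1), (m.choose x.1 : ℂ) • (x.2 : ℂ) •
          dpow T x.2 (A (m - x.1) b) := by
      rw [Finset.Nat.sum_antidiagonal_succ']
      simp
    have h2 : ∑ x ∈ antidiagonal i, (m : ℂ) • ((m - 1).choose x.1 : ℂ) •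
        dpow T x.2 (A (m - 1 - x.1) b) =
        ∑ x ∈ antidiagonal (i + 1), (m.choose x.1 : ℂ) • (x.1 : ℂ) •
          dpow T x.2 (A (m - x.1) b) := by
      rw [Finset.Nat.sum_antidiagonal_succ]
      simp only [Nat.cast_zero, zero_smul, smul_zero, zero_add, smul_smul]
      refine Finset.sum_congr rfl fun x _ => ?_
      rw [Nat.sub_sub, add_comm 1 x.1]
      congr 1
      cases m with
      | zero => simp
      | succ m =>
        have := Nat.add_one_mul_choose_eq m x.1
        simp only [Nat.add_sub_cancel]
        exact_mod_cast this
    rw [h1, h2, ← Finset.sum_add_distrib, Finset.smul_sum]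
    refine Finset.sum_congr rfl fun x hx => ?_
    rw [Finset.HasAntidiagonal.mem_antidiagonal] at hx
    rw [← smul_add, ← add_smul, smul_comm, show (x.2 : ℂ) + (x.1 : ℂ) = (i : ℂ) + 1 by
      rw [add_comm]; exact_mod_cast hx]

/-- In the term with index `m + i` the part `i` of the covariance coefficient is produced by `T`
acting on `T^i/i! a`, and the part `m` is the covariance coefficient of the Wick sum. This passes
covariance on to products. -/
theorem T_wickSum {T : E →ₗ[ℂ] E} {μ : E →ₗ[ℂ] E →ₗ[ℂ] E}
    (hμ : ∀ x y, T (μ x y) = μ (T x) y + μ x (T y)) {f : ℕ → E} {N : ℕ}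
    (hf : ∀ n, N ≤ n → f n = 0) (a : E) (m : ℕ) :
    wickSum T μ a (fun k => T (f k) + (k : ℂ) • f (k - 1)) m =
      T (wickSum T μ a f m) + (m : ℂ) • wickSum T μ a f (m - 1) := by
  have hf' : ∀ n, N + 1 ≤ n → f n = 0 := fun n hn => hf n (by omega)
  rw [wickSum_eq (N := N + 1) (fun n hn => by rw [hf n (by omega), hf (n - 1) (by omega)]; simp),
    wickSum_eq hf, wickSum_eq hf']
  simp only [map_add, map_sum, hμ, map_smul, T_dpow, LinearMap.smul_apply, Finset.sum_add_distrib]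
  have h1 : ∑ i ∈ Finset.range (N + 1), μ (dpow T i a) (T (f (m + i))) =
      ∑ i ∈ Finset.range N, μ (dpow T i a) (T (f (m + i))) := by
    rw [Finset.sum_range_succ, hf (m + N) (by omega)]; simp
  have h2 : ∑ i ∈ Finset.range N, ((i : ℂ) + 1) • μ (dpow T (i + 1) a) (f (m + i)) =
      ∑ i ∈ Finset.range (N + 1), (i : ℂ) • μ (dpow T i a) (f (m + i - 1)) := by
    rw [Finset.sum_range_succ']
    simp only [Nat.cast_zero, zero_smul, add_zero, Nat.cast_add, Nat.cast_one]
    exact Finset.sum_congr rfl fun i _ => by rw [← add_assoc, Nat.add_sub_cancel]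
  have h3 : (m : ℂ) • ∑ i ∈ Finset.range (N + 1), μ (dpow T i a) (f (m - 1 + i)) =
      ∑ i ∈ Finset.range (N + 1), (m : ℂ) • μ (dpow T i a) (f (m + i - 1)) := by
    rw [Finset.smul_sum]
    refine Finset.sum_congr rfl fun i _ => ?_
    cases m with
    | zero => simp
    | succ m => congr 3; omega
  rw [h1, h2, h3]
  simp only [Nat.cast_add, add_smul, Finset.sum_add_distrib]
  abel

/-- The functional `∑_i α_{i,l} f_{m+i}`. -/
theorem diagDiff_finsum_mul {T : E →ₗ[ℂ] E} (μ : E →ₗ[ℂ] E →ₗ[ℂ] E) {f : ℕ → E} {N : ℕ}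
    (hf : ∀ n, N ≤ n → f n = 0) (β : ℕ → E) (M n : ℕ) (hβ : ∀ k, M + n ≤ k → β k = 0) :
    diagDiff^[M] (fun m l => ∑ᶠ i : ℕ, μ (∑ x ∈ antidiagonal i,
      (l.choose x.1 : ℂ) • dpow T x.2 (β (l - x.1 + n))) (f (m + i))) = fun _ _ => 0 := by
  induction M generalizing n with
  | zero =>
    funext m l
    simp only [Function.iterate_zero, id]
    rw [finsum_eq_zero_of_forall_eq_zero]
    intro i
    rw [Finset.sum_eq_zero, map_zero, LinearMap.zero_apply]
    intro x _
    rw [hβ _ (by omega), map_zero, smul_zero]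
  | succ M ih =>
    rw [Function.iterate_succ_apply]
    -- For `n = 0` and `β k = b_(k) a` this is `b_(l)` applied to the `i`-th divided derivative of
    -- `a`. Pascal's rule makes one application of `z - w` the same as raising `n` by one and
    -- changing the sign, and after `M` applications only vanishing values of `β` are left.
    set α : ℕ → ℕ → ℕ → E := fun n i l => ∑ x ∈ antidiagonal i,
      (l.choose x.1 : ℂ) • dpow T x.2 (β (l - x.1 + n)) with hα
    have key0 : ∀ l, α n 0 (l + 1) = α (n + 1) 0 l := by
      intro l; simp [hα, dpow_zero]; congr 1; omega
    have key : ∀ i l, α n (i + 1) (l + 1) = α n i l + α (n + 1) (i + 1) l := by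
      intro i l
      simp only [hα, Finset.Nat.sum_antidiagonal_succ, Nat.choose_succ_succ, Nat.cast_add,
        add_smul, Finset.sum_add_distrib, Nat.choose_zero_right, Nat.add_sub_add_right, tsub_zero]
      have h1 : ∑ x ∈ antidiagonal i, (l.choose (x.1 + 1) : ℂ) •
          dpow T x.2 (β (l - (x.1 + 1) + (n + 1))) =
          ∑ x ∈ antidiagonal i, (l.choose (x.1 + 1) : ℂ) • dpow T x.2 (β (l - x.1 + n)) := by
        refine Finset.sum_congr rfl fun x _ => ?_
        rcases Nat.lt_or_ge l (x.1 + 1) with h | h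
        · rw [Nat.choose_eq_zero_of_lt h]; simp
        · congr 3; omega
      rw [h1, show l + 1 + n = l + (n + 1) by omega]
      abel
    have hstep : diagDiff (fun m l => ∑ᶠ i : ℕ, μ (α n i l) (f (m + i))) =
        fun m l => (LinearMap.lsmul ℂ E (-1))
          ((fun m l => ∑ᶠ i : ℕ, μ (α (n + 1) i l) (f (m + i))) m l) := by
      funext m l
      simp only [diagDiff]
      rw [finsum_eq_sum_range N (fun i hi => by rw [hf _ (by omega), map_zero]),
        finsum_eq_sum_range (N + 1) (fun i hi => by rw [hf _ (by omega), map_zero]),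
        finsum_eq_sum_range (N + 1) (fun i hi => by rw [hf _ (by omega), map_zero]),
        Finset.sum_range_succ', Finset.sum_range_succ' _ N]
      simp only [key0, key, map_add, LinearMap.add_apply, Finset.sum_add_distrib]
      have : ∀ i, f (m + 1 + i) = f (m + (i + 1)) := fun i => by congr 1; omega
      simp only [this, LinearMap.lsmul_apply, neg_smul, one_smul]
      abel
    change diagDiff^[M] (diagDiff (fun m l => ∑ᶠ i : ℕ, μ (α n i l) (f (m + i)))) = _
    rw [hstep, diagDiff_iterate_map]
    have := ih (n + 1) (fun k hk => hβ k (by omega))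
    change diagDiff^[M] (fun m l => ∑ᶠ i : ℕ, μ (α (n + 1) i l) (f (m + i))) = _ at this
    rw [this]
    simp

end Modes


section Poisson

variable {U : Type*} [AddCommGroup U] [Module ℂ U]

/-! ### The commutative product and the properties of the non-negative modes -/

/-- `a` is homogeneous of total parity `p`. -/
def HasParity (𝒰 : RavioloData U) (p : ZMod 2) (a : U) : Prop := 𝒰.sgn a = sign p • a

/-- The negative modes are those of a graded commutative differential algebra. -/
structure IsCommutative (𝒰 : RavioloData U) : Prop where
  sgn_sgn : ∀ a, 𝒰.sgn (𝒰.sgn a) = a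
  sgn_vac : 𝒰.sgn 𝒰.vac = 𝒰.vac
  sgn_T : ∀ a, 𝒰.sgn (𝒰.T a) = 𝒰.T (𝒰.sgn a)
  sgn_mul : ∀ a b, 𝒰.sgn (𝒰.Y (-1) a b) = 𝒰.Y (-1) (𝒰.sgn a) (𝒰.sgn b)
  sgn_mode : ∀ (m : ℕ) a b, 𝒰.sgn (𝒰.Y m a b) = -𝒰.Y m (𝒰.sgn a) (𝒰.sgn b)
  field : ∀ a, IsField fun m => 𝒰.Y m a
  T_vac : 𝒰.T 𝒰.vac = 0
  T_mul : ∀ a b, 𝒰.T (𝒰.Y (-1) a b) = 𝒰.Y (-1) (𝒰.T a) b + 𝒰.Y (-1) a (𝒰.T b)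
  neg : ∀ (n : ℕ) a, 𝒰.Y (-(n : ℤ) - 1) a = 𝒰.Y (-1) (dpow 𝒰.T n a)
  vac_mul : ∀ a, 𝒰.Y (-1) 𝒰.vac a = a
  vac_mode : ∀ (m : ℕ) a, 𝒰.Y m 𝒰.vac a = 0
  mode_vac : ∀ (m : ℕ) a, 𝒰.Y m a 𝒰.vac = 0
  comm : ∀ p q a b, HasParity 𝒰 p a → HasParity 𝒰 q b →
    𝒰.Y (-1) a b = sign (p * q) • 𝒰.Y (-1) b a
  assoc : ∀ a b c, 𝒰.Y (-1) (𝒰.Y (-1) a b) c = 𝒰.Y (-1) a (𝒰.Y (-1) b c)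

/-- The non-negative modes of `a` are superderivations. -/
def IsDerivation (𝒰 : RavioloData U) (p : ZMod 2) (a : U) : Prop :=
  ∀ q b, HasParity 𝒰 q b → ∀ (m : ℕ) c, 𝒰.Y m a (𝒰.Y (-1) b c) =
    𝒰.Y (-1) (𝒰.Y m a b) c + sign ((p + 1) * q) • 𝒰.Y (-1) b (𝒰.Y m a c)

/-- The non-negative modes of `a` are translation covariant. -/
def IsCovariant (𝒰 : RavioloData U) (a : U) : Prop :=
  ∀ (m : ℕ) b, 𝒰.Y m a (𝒰.T b) = 𝒰.T (𝒰.Y m a b) + (m : ℂ) • 𝒰.Y ((m - 1 : ℕ) : ℤ) a b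

/-- Skew-symmetry of the non-negative modes. -/
def IsSkew (𝒰 : RavioloData U) (p q : ZMod 2) (a b : U) : Prop :=
  ∀ l : ℕ, 𝒰.Y l b a = sign (p * q) • skewTransform 𝒰.T (fun m : ℕ => 𝒰.Y m a b) l

/-- The Wick formula for the non-negative modes of the product of `a` and `x`. -/
def IsWick (𝒰 : RavioloData U) (p r : ZMod 2) (a x : U) : Prop :=
  ∀ (m : ℕ) v, 𝒰.Y m (𝒰.Y (-1) a x) v =
    sign p • wickSum 𝒰.T (𝒰.Y (-1)) a (fun k : ℕ => 𝒰.Y k x v) m +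
    sign (p * r + r) • wickSum 𝒰.T (𝒰.Y (-1)) x (fun k : ℕ => 𝒰.Y k a v) m

/-- The commutator of two non-negative modes. -/
def modeComm (𝒰 : RavioloData U) (p q : ZMod 2) (a b : U) (m l : ℕ) : Module.End ℂ U :=
  𝒰.Y m a * 𝒰.Y l b - sign ((p + 1) * (q + 1)) • (𝒰.Y l b * 𝒰.Y m a)

/-- The commutators of the non-negative modes have finite order on the diagonal. -/
def IsLocalPair (𝒰 : RavioloData U) (p q : ZMod 2) (a b : U) : Prop :=
  ∃ M : ℕ, diagDiff^[M] (modeComm 𝒰 p q a b) = fun _ _ => 0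

variable {𝒰 : RavioloData U} {p q r : ZMod 2} {a b x y : U}

theorem HasParity.add (ha : HasParity 𝒰 p a) (hb : HasParity 𝒰 p b) : HasParity 𝒰 p (a + b) := by
  unfold HasParity at *; rw [map_add, ha, hb, smul_add]

theorem HasParity.smul (ha : HasParity 𝒰 p a) (t : ℂ) : HasParity 𝒰 p (t • a) := by
  unfold HasParity at *; rw [map_smul, ha, smul_comm]

theorem HasParity.zero : HasParity 𝒰 p (0 : U) := by
  unfold HasParity; simp

theorem HasParity.neg (ha : HasParity 𝒰 p a) : HasParity 𝒰 p (-a) := by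
  simpa using ha.smul (-1)

theorem HasParity.sum {α : Type*} {s : Finset α} {f : α → U}
    (h : ∀ i ∈ s, HasParity 𝒰 p (f i)) : HasParity 𝒰 p (∑ i ∈ s, f i) := by
  unfold HasParity at *; rw [map_sum, Finset.smul_sum]; exact Finset.sum_congr rfl h

namespace IsCommutative

variable (h : IsCommutative 𝒰)
include h

theorem parity_vac : HasParity 𝒰 0 𝒰.vac := by
  unfold HasParity; rw [h.sgn_vac, sign_zero, one_smul]

theorem parity_T (ha : HasParity 𝒰 p a) : HasParity 𝒰 p (𝒰.T a) := by
  unfold HasParity at *; rw [h.sgn_T, ha, map_smul]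

theorem parity_dpow (ha : HasParity 𝒰 p a) (n : ℕ) : HasParity 𝒰 p (dpow 𝒰.T n a) := by
  induction n with
  | zero => rwa [dpow_zero]
  | succ n ih => rw [dpow_succ]; exact (h.parity_T ih).smul _

theorem parity_mul (ha : HasParity 𝒰 p a) (hb : HasParity 𝒰 q b) :
    HasParity 𝒰 (p + q) (𝒰.Y (-1) a b) := by
  unfold HasParity at *
  rw [h.sgn_mul, ha, hb]; simp only [map_smul, LinearMap.smul_apply, smul_smul, sign_add]
  rw [mul_comm]

theorem parity_mode (ha : HasParity 𝒰 p a) (hb : HasParity 𝒰 q b) (m : ℕ) :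
    HasParity 𝒰 (p + q + 1) (𝒰.Y m a b) := by
  unfold HasParity at *
  rw [h.sgn_mode, ha, hb]
  simp only [map_smul, LinearMap.smul_apply, smul_smul, sign_add, sign_one]
  rw [mul_neg_one, neg_smul, mul_comm]

/-- Every vector is the sum of its even and its odd part. -/
theorem exists_parity_decomp (a : U) :
    ∃ a₀ a₁, a = a₀ + a₁ ∧ HasParity 𝒰 0 a₀ ∧ HasParity 𝒰 1 a₁ := by
  refine ⟨(1 / 2 : ℂ) • (a + 𝒰.sgn a), (1 / 2 : ℂ) • (a - 𝒰.sgn a), ?_, ?_, ?_⟩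
  · module
  · unfold HasParity; simp only [map_smul, map_add, h.sgn_sgn, sign_zero]; module
  · unfold HasParity; simp only [map_smul, map_sub, h.sgn_sgn, sign_one]; module

theorem parity_induction {P : U → Prop} (hadd : ∀ a b, P a → P b → P (a + b))
    (hP : ∀ p a, HasParity 𝒰 p a → P a) (a : U) : P a := by
  obtain ⟨a₀, a₁, rfl, h₀, h₁⟩ := h.exists_parity_decomp a
  exact hadd _ _ (hP _ _ h₀) (hP _ _ h₁)

theorem exists_bound (a v : U) : ∃ N : ℕ, ∀ n : ℕ, N ≤ n → 𝒰.Y n a v = 0 := by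
  obtain ⟨N, hN⟩ := h.field a v
  exact ⟨N.toNat, fun n hn => hN n (by omega)⟩

theorem mul_vac (a : U) : 𝒰.Y (-1) a 𝒰.vac = a := by
  refine h.parity_induction (P := fun a => 𝒰.Y (-1) a 𝒰.vac = a) ?_ ?_ a
  · intro a b ha hb; rw [map_add, LinearMap.add_apply, ha, hb]
  · intro p a ha
    rw [h.comm p 0 a _ ha h.parity_vac, mul_zero, sign_zero, one_smul, h.vac_mul]

theorem left_comm (ha : HasParity 𝒰 p a) (hb : HasParity 𝒰 q b) (c : U) :
    𝒰.Y (-1) a (𝒰.Y (-1) b c) = sign (p * q) • 𝒰.Y (-1) b (𝒰.Y (-1) a c) := by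
  rw [← h.assoc, h.comm p q a b ha hb, map_smul, LinearMap.smul_apply, h.assoc]

/-! ### Closure under products -/

/-- By the Wick formula a mode of `a x` is a sum of multiplications composed with derivations, and
in a graded commutative algebra such compositions are derivations. -/
theorem isDerivation_mul (ha : HasParity 𝒰 p a) (hx : HasParity 𝒰 r x) (hw : IsWick 𝒰 p r a x)
    (hda : IsDerivation 𝒰 p a) (hdx : IsDerivation 𝒰 r x) :
    IsDerivation 𝒰 (p + r) (𝒰.Y (-1) a x) := by
  intro q b hb m c
  rw [hw, hw, hw]
  have key : ∀ {p r : ZMod 2} {a x : U}, HasParity 𝒰 p a → IsDerivation 𝒰 r x →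
      wickSum 𝒰.T (𝒰.Y (-1)) a (fun k : ℕ => 𝒰.Y k x (𝒰.Y (-1) b c)) m =
      𝒰.Y (-1) (wickSum 𝒰.T (𝒰.Y (-1)) a (fun k : ℕ => 𝒰.Y k x b) m) c +
      sign ((p + r + 1) * q) •
        𝒰.Y (-1) b (wickSum 𝒰.T (𝒰.Y (-1)) a (fun k : ℕ => 𝒰.Y k x c) m) := by
    intro p r a x ha hdx
    obtain ⟨N₁, h₁⟩ := h.exists_bound x b
    obtain ⟨N₂, h₂⟩ := h.exists_bound x c
    obtain ⟨N₃, h₃⟩ := h.exists_bound x (𝒰.Y (-1) b c)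
    set N := max N₁ (max N₂ N₃)
    rw [wickSum_eq (N := N) (fun n hn => h₁ n (by omega)),
      wickSum_eq (N := N) (fun n hn => h₂ n (by omega)),
      wickSum_eq (N := N) (fun n hn => h₃ n (by omega))]
    simp only [map_sum, LinearMap.sum_apply, Finset.smul_sum]
    rw [← Finset.sum_add_distrib]
    refine Finset.sum_congr rfl fun i _ => ?_
    rw [hdx q b hb, map_add, map_smul, ← h.assoc,
      h.left_comm (h.parity_dpow ha i) hb, smul_smul, ← sign_add]
    congr 3; ring
  rw [key ha hdx, key hx hda]
  simp only [smul_add, map_add, LinearMap.add_apply, map_smul, LinearMap.smul_apply]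
  rw [smul_comm (sign p), smul_comm (sign (p * r + r)) (sign ((r + p + 1) * q)), add_comm r p]
  abel

theorem isCovariant_mul (hw : IsWick 𝒰 p r a x)
    (hca : IsCovariant 𝒰 a) (hcx : IsCovariant 𝒰 x) : IsCovariant 𝒰 (𝒰.Y (-1) a x) := by
  intro m b
  rw [hw, hw, hw]
  obtain ⟨N₁, h₁⟩ := h.exists_bound x b
  obtain ⟨N₂, h₂⟩ := h.exists_bound a b
  simp only [hca _ b, hcx _ b]
  rw [T_wickSum h.T_mul h₁, T_wickSum h.T_mul h₂]
  simp only [map_add, map_smul, smul_add]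
  rw [smul_comm (sign p), smul_comm (sign (p * r + r)) (m : ℂ)]
  abel

/-- Applying the transform to the Wick formula for `(a x)_(m) b` gives one product for each factor,
and these are the two terms by which the derivation `b_(l)` acts on `a x`. -/
theorem isSkew_mul (ha : HasParity 𝒰 p a) (hx : HasParity 𝒰 r x) (hb : HasParity 𝒰 q b)
    (hw : IsWick 𝒰 p r a x) (hdb : IsDerivation 𝒰 q b)
    (hsa : IsSkew 𝒰 p q a b) (hsx : IsSkew 𝒰 r q x b) :
    IsSkew 𝒰 (p + r) q (𝒰.Y (-1) a x) b := by
  intro l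
  obtain ⟨N₁, h₁⟩ := h.exists_bound x b
  obtain ⟨N₂, h₂⟩ := h.exists_bound a b
  set N := max N₁ N₂
  have h₁' : ∀ n, N ≤ n → 𝒰.Y n x b = 0 := fun n hn => h₁ n (by omega)
  have h₂' : ∀ n, N ≤ n → 𝒰.Y n a b = 0 := fun n hn => h₂ n (by omega)
  have hx' : skewTransform 𝒰.T (fun m : ℕ => 𝒰.Y m x b) l = sign (r * q) • 𝒰.Y l b x := by
    rw [hsx l, sign_smul_smul]
  have ha' : skewTransform 𝒰.T (fun m : ℕ => 𝒰.Y m a b) l = sign (p * q) • 𝒰.Y l b a := by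
    rw [hsa l, sign_smul_smul]
  simp only [hw _ b]
  rw [skewTransform_add (wickSum_eventually h₁' a) (wickSum_eventually h₂' x),
    skewTransform_wickSum h.T_mul h₁', skewTransform_wickSum h.T_mul h₂', hx', ha',
    hdb p a ha l x, h.comm _ _ _ _ (h.parity_mode hb ha l) hx]
  simp only [map_smul, smul_add, smul_smul]
  rw [add_comm]
  congr 2 <;> rcases zmod_two_cases p with rfl | rfl <;> rcases zmod_two_cases q with rfl | rfl <;>
    rcases zmod_two_cases r with rfl | rfl <;>
    norm_num [sign_zero, sign_one, sign_two, sign_three]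

theorem isSkew_symm (hs : IsSkew 𝒰 p q a b) : IsSkew 𝒰 q p b a := by
  intro l
  obtain ⟨N, hN⟩ := h.exists_bound a b
  have : (fun m : ℕ => 𝒰.Y m b a) =
      fun m => sign (p * q) • skewTransform 𝒰.T (fun m : ℕ => 𝒰.Y m a b) m +
        (0 : ℂ) • skewTransform 𝒰.T (fun m : ℕ => 𝒰.Y m a b) m := by
    funext m; rw [hs m, zero_smul, add_zero]
  rw [this, skewTransform_add (skewTransform_eventually hN) (skewTransform_eventually hN),
    skewTransform_skewTransform hN, zero_smul, add_zero, mul_comm q p, sign_smul_smul]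

/-- Skew-symmetry implies the Wick formula. -/
theorem isWick_of_isSkew (ha : HasParity 𝒰 p a) (hx : HasParity 𝒰 r x)
    (hd : ∀ q b, HasParity 𝒰 q b → IsDerivation 𝒰 q b)
    (hs : ∀ p q a b, HasParity 𝒰 p a → HasParity 𝒰 q b → IsSkew 𝒰 p q a b) :
    IsWick 𝒰 p r a x := by
  intro m v
  refine h.parity_induction (P := fun v => 𝒰.Y m (𝒰.Y (-1) a x) v =
    sign p • wickSum 𝒰.T (𝒰.Y (-1)) a (fun k : ℕ => 𝒰.Y k x v) m +
    sign (p * r + r) • wickSum 𝒰.T (𝒰.Y (-1)) x (fun k : ℕ => 𝒰.Y k a v) m) ?_ ?_ v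
  · intro v w hv hw
    have key : ∀ a x, wickSum 𝒰.T (𝒰.Y (-1)) a (fun k : ℕ => 𝒰.Y k x (v + w)) m =
        wickSum 𝒰.T (𝒰.Y (-1)) a (fun k : ℕ => 𝒰.Y k x v) m +
        wickSum 𝒰.T (𝒰.Y (-1)) a (fun k : ℕ => 𝒰.Y k x w) m := by
      intro a x
      obtain ⟨N₁, h₁⟩ := h.exists_bound x v
      obtain ⟨N₂, h₂⟩ := h.exists_bound x w
      set N := max N₁ N₂
      rw [wickSum_eq (N := N) (fun n hn => h₁ n (by omega)),
        wickSum_eq (N := N) (fun n hn => h₂ n (by omega)),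
        wickSum_eq (N := N) (fun n hn => by rw [map_add, h₁ n (by omega), h₂ n (by omega),
          add_zero]), ← Finset.sum_add_distrib]
      simp only [map_add]
    rw [map_add, hv, hw, key, key]
    simp only [smul_add]; abel
  · intro q b hb
    obtain ⟨N₁, h₁⟩ := h.exists_bound x b
    obtain ⟨N₂, h₂⟩ := h.exists_bound a b
    set N := max N₁ N₂
    have h₁' : ∀ n, N ≤ n → 𝒰.Y n x b = 0 := fun n hn => h₁ n (by omega)
    have h₂' : ∀ n, N ≤ n → 𝒰.Y n a b = 0 := fun n hn => h₂ n (by omega)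
    -- `F` is the claimed value. The computation of `isSkew_mul` read backwards shows that `b_(l) (a
    -- x)` is the transform of `F`, and skew-symmetry for `b` and `a x` together with involutivity
    -- transforms it back.
    set F : ℕ → U := fun m => sign p • wickSum 𝒰.T (𝒰.Y (-1)) a (fun k : ℕ => 𝒰.Y k x b) m +
      sign (p * r + r) • wickSum 𝒰.T (𝒰.Y (-1)) x (fun k : ℕ => 𝒰.Y k a b) m with hF
    have hFN : ∀ n, N ≤ n → F n = 0 := fun n hn => by
      simp only [hF]
      rw [wickSum_eventually h₁' a n hn, wickSum_eventually h₂' x n hn]; simp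
    have hFb : ∀ l : ℕ, 𝒰.Y (l : ℤ) b (𝒰.Y (-1) a x) =
        sign ((p + r) * q) • skewTransform 𝒰.T F l := by
      intro l
      have hx' := hs r q x b hx hb l
      have ha' := hs p q a b ha hb l
      rw [hF, skewTransform_add (wickSum_eventually h₁' a) (wickSum_eventually h₂' x),
        skewTransform_wickSum h.T_mul h₁', skewTransform_wickSum h.T_mul h₂',
        hd q b hb p a ha l x, h.comm _ _ _ _ (h.parity_mode hb ha l) hx, hx', ha']
      simp only [map_smul, smul_add, smul_smul]
      rw [add_comm]
      congr 2 <;> rcases zmod_two_cases p with rfl | rfl <;>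
        rcases zmod_two_cases q with rfl | rfl <;>
        rcases zmod_two_cases r with rfl | rfl <;>
        norm_num [sign_zero, sign_one, sign_two, sign_three]
    change _ = F m
    rw [hs q (p + r) b (𝒰.Y (-1) a x) hb (h.parity_mul ha hx) m]
    have : (fun m : ℕ => 𝒰.Y m b (𝒰.Y (-1) a x)) =
        fun m => sign ((p + r) * q) • skewTransform 𝒰.T F m +
          (0 : ℂ) • skewTransform 𝒰.T F m := by
      funext m; rw [hFb m, zero_smul, add_zero]
    rw [this, skewTransform_add (skewTransform_eventually hFN) (skewTransform_eventually hFN),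
      skewTransform_skewTransform hFN, zero_smul, add_zero, mul_comm q, sign_smul_smul]

theorem isLocalPair_symm (hl : IsLocalPair 𝒰 p q a b) : IsLocalPair 𝒰 q p b a := by
  obtain ⟨M, hM⟩ := hl
  refine ⟨M, ?_⟩
  have : modeComm 𝒰 q p b a = fun m l => LinearMap.lsmul ℂ (Module.End ℂ U)
      (-sign ((p + 1) * (q + 1))) ((fun m l => modeComm 𝒰 p q a b l m) m l) := by
    funext m l
    simp only [modeComm, LinearMap.lsmul_apply, neg_smul, smul_sub, sign_smul_smul]
    rw [mul_comm (q + 1)]; abel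
  rw [this, diagDiff_iterate_map, diagDiff_iterate_swap, hM]
  funext m l; simp

theorem modeComm_apply_eq_zero (a b v : U) (l : ℕ) :
    ∃ N : ℕ, ∀ m, N ≤ m → modeComm 𝒰 p q a b m l v = 0 := by
  obtain ⟨N₁, h₁⟩ := h.exists_bound a (𝒰.Y l b v)
  obtain ⟨N₂, h₂⟩ := h.exists_bound a v
  refine ⟨max N₁ N₂, fun m hm => ?_⟩
  simp only [modeComm, LinearMap.sub_apply, LinearMap.smul_apply, Module.End.mul_apply]
  rw [h₁ m (by omega), h₂ m (by omega)]; simp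

/-- Commuting the derivation `b_(l)` through `(T^i/i! a) x_(m+i)` either reaches the mode of `x`,
giving a commutator, or differentiates the coefficient, giving a term with only one mode acting on
`v`. The two kinds of terms have finite order on the diagonal for different reasons. -/
theorem modeComm_mul_apply (ha : HasParity 𝒰 p a) (hx : HasParity 𝒰 r x)
    (hw : IsWick 𝒰 p r a x) (hdb : IsDerivation 𝒰 q b) (m l : ℕ) (v : U) :
    modeComm 𝒰 (p + r) q (𝒰.Y (-1) a x) b m l v =
      sign p • (∑ᶠ i : ℕ, 𝒰.Y (-1) (dpow 𝒰.T i a) (modeComm 𝒰 r q x b (m + i) l v) -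
        sign ((p + r + 1) * (q + 1)) •
          ∑ᶠ i : ℕ, 𝒰.Y (-1) (𝒰.Y l b (dpow 𝒰.T i a)) (𝒰.Y ((m + i : ℕ) : ℤ) x v)) +
      sign (p * r + r) • (∑ᶠ i : ℕ, 𝒰.Y (-1) (dpow 𝒰.T i x) (modeComm 𝒰 p q a b (m + i) l v) -
        sign ((p + r + 1) * (q + 1)) •
          ∑ᶠ i : ℕ, 𝒰.Y (-1) (𝒰.Y l b (dpow 𝒰.T i x)) (𝒰.Y ((m + i : ℕ) : ℤ) a v)) := by
  have key : ∀ {p r : ZMod 2} {a x : U}, HasParity 𝒰 p a →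
      wickSum 𝒰.T (𝒰.Y (-1)) a (fun k : ℕ => 𝒰.Y k x (𝒰.Y l b v)) m -
        sign ((p + r + 1) * (q + 1)) •
          𝒰.Y l b (wickSum 𝒰.T (𝒰.Y (-1)) a (fun k : ℕ => 𝒰.Y k x v) m) =
      ∑ᶠ i : ℕ, 𝒰.Y (-1) (dpow 𝒰.T i a) (modeComm 𝒰 r q x b (m + i) l v) -
        sign ((p + r + 1) * (q + 1)) •
          ∑ᶠ i : ℕ, 𝒰.Y (-1) (𝒰.Y l b (dpow 𝒰.T i a)) (𝒰.Y ((m + i : ℕ) : ℤ) x v) := by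
    intro p r a x ha
    obtain ⟨N₁, h₁⟩ := h.exists_bound x v
    obtain ⟨N₂, h₂⟩ := h.exists_bound x (𝒰.Y l b v)
    obtain ⟨N₃, h₃⟩ := h.modeComm_apply_eq_zero (p := r) (q := q) x b v l
    set N := max N₁ (max N₂ N₃)
    rw [wickSum_eq (N := N) (fun n hn => h₁ n (by omega)),
      wickSum_eq (N := N) (fun n hn => h₂ n (by omega)),
      finsum_eq_sum_range N (fun n hn => by rw [h₃ _ (by omega), map_zero]),
      finsum_eq_sum_range N (fun n hn => by rw [h₁ _ (by omega), map_zero]),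
      map_sum, Finset.smul_sum, Finset.smul_sum, ← Finset.sum_sub_distrib,
      ← Finset.sum_sub_distrib]
    refine Finset.sum_congr rfl fun i _ => ?_
    rw [hdb p _ (h.parity_dpow ha i) l]
    simp only [modeComm, LinearMap.sub_apply, LinearMap.smul_apply, Module.End.mul_apply, map_sub,
      map_smul, smul_add, smul_smul]
    have : sign ((p + r + 1) * (q + 1)) * sign ((q + 1) * p) = sign ((r + 1) * (q + 1)) := by
      rw [← sign_add]
      congr 1
      have h2 : (2 : ZMod 2) = 0 := rfl
      linear_combination (p * (q + 1)) * h2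
    rw [this]; abel
  rw [modeComm, LinearMap.sub_apply, LinearMap.smul_apply, Module.End.mul_apply,
    Module.End.mul_apply, hw, hw, map_add, map_smul, map_smul, smul_add]
  rw [← key ha, add_comm p r, ← key hx, smul_sub, smul_sub,
    smul_comm (sign ((r + p + 1) * (q + 1))), smul_comm (sign ((r + p + 1) * (q + 1)))]
  abel

/-- The sums of commutators inherit their order from the factors, because the shift `m ↦ m + i` and
the multiplications commute with `z - w`. The remaining sums are killed by `diagDiff_finsum_mul`,
with the order read off from the vanishing of `b_(n) a` and `b_(n) x`. -/
theorem isLocalPair_mul (ha : HasParity 𝒰 p a) (hx : HasParity 𝒰 r x)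
    (hw : IsWick 𝒰 p r a x) (hdb : IsDerivation 𝒰 q b) (hcb : IsCovariant 𝒰 b)
    (hla : IsLocalPair 𝒰 p q a b) (hlx : IsLocalPair 𝒰 r q x b) :
    IsLocalPair 𝒰 (p + r) q (𝒰.Y (-1) a x) b := by
  obtain ⟨M₁, h₁⟩ := hla
  obtain ⟨M₂, h₂⟩ := hlx
  obtain ⟨M₃, h₃⟩ := h.exists_bound b a
  obtain ⟨M₄, h₄⟩ := h.exists_bound b x
  set M := max (max M₁ M₂) (max M₃ M₄)
  have key1 : ∀ {p r : ZMod 2} {a x : U} {M' : ℕ},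
      diagDiff^[M'] (modeComm 𝒰 r q x b) = (fun _ _ => 0) → M' ≤ M → ∀ v,
      diagDiff^[M] (fun m l => ∑ᶠ i : ℕ, 𝒰.Y (-1) (dpow 𝒰.T i a)
        (modeComm 𝒰 r q x b (m + i) l v)) = fun _ _ => 0 := by
    intro p r a x M' hM' hle v
    rw [diagDiff_iterate_finsum]
    · funext m l
      refine finsum_eq_zero_of_forall_eq_zero fun i => ?_
      refine (congrFun (congrFun (diagDiff_iterate_map
        (𝒰.Y (-1) (dpow 𝒰.T i a) ∘ₗ LinearMap.applyₗ v) M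
        (fun m l => modeComm 𝒰 r q x b (m + i) l)) m) l).trans ?_
      rw [diagDiff_iterate_shift, diagDiff_iterate_eq_zero_of_le hle hM']
      simp
    · intro m l
      obtain ⟨N, hN⟩ := h.modeComm_apply_eq_zero (p := r) (q := q) x b v l
      exact finite_support_of_eventually N fun n hn => by rw [hN _ (by omega), map_zero]
  have key2 : ∀ {a x : U} {M' : ℕ}, (∀ n : ℕ, M' ≤ n → 𝒰.Y n b a = 0) → M' ≤ M → ∀ v,
      diagDiff^[M] (fun m l => ∑ᶠ i : ℕ, 𝒰.Y (-1) (𝒰.Y l b (dpow 𝒰.T i a))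
        (𝒰.Y ((m + i : ℕ) : ℤ) x v)) = fun _ _ => 0 := by
    intro a x M' hM' hle v
    obtain ⟨N, hN⟩ := h.exists_bound x v
    have := diagDiff_finsum_mul (T := 𝒰.T) (𝒰.Y (-1)) (f := fun n : ℕ => 𝒰.Y n x v) hN
      (fun n : ℕ => 𝒰.Y n b a) M 0 (fun k hk => hM' k (by omega))
    rw [← this]
    congr 1
    funext m l
    refine finsum_congr fun i => ?_
    rw [mode_dpow (A := fun n : ℕ => 𝒰.Y n b) hcb]
    simp
  refine ⟨M, ?_⟩
  have happ : ∀ v, diagDiff^[M] (fun m l => modeComm 𝒰 (p + r) q (𝒰.Y (-1) a x) b m l v) =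
      fun _ _ => 0 := by
    intro v
    simp only [h.modeComm_mul_apply ha hx hw hdb]
    set s := sign p
    set t := sign (p * r + r)
    set ε := sign ((p + r + 1) * (q + 1))
    have hsplit : ∀ A B C D : ℕ → ℕ → U, diagDiff^[M] A = (fun _ _ => 0) →
        diagDiff^[M] B = (fun _ _ => 0) → diagDiff^[M] C = (fun _ _ => 0) →
        diagDiff^[M] D = (fun _ _ => 0) →
        diagDiff^[M] (fun m l => s • (A m l - ε • B m l) + t • (C m l - ε • D m l)) =
          fun _ _ => 0 := by
      intro A B C D hA hB hC hD
      have hsub : ∀ (u : ℂ) (A B : ℕ → ℕ → U), diagDiff^[M] A = (fun _ _ => 0) →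
          diagDiff^[M] B = (fun _ _ => 0) →
          diagDiff^[M] (fun m l => u • (A m l - ε • B m l)) = fun _ _ => 0 := by
        intro u A B hA hB
        refine (diagDiff_iterate_map (LinearMap.lsmul ℂ U u) M
          (fun m l => A m l - ε • B m l)).trans ?_
        have := diagDiff_iterate_add M A (fun m l => LinearMap.lsmul ℂ U (-ε) (B m l))
        rw [diagDiff_iterate_map, hA, hB] at this
        simp only [LinearMap.lsmul_apply, neg_smul, ← sub_eq_add_neg] at this
        rw [this]; simp
      rw [diagDiff_iterate_add M (fun m l => s • (A m l - ε • B m l)), hsub s A B hA hB,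
        hsub t C D hC hD]
      simp
    exact hsplit _ _ _ _ (key1 (p := p) h₂ (by omega) v) (key2 h₃ (by omega) v)
      (key1 (p := p) h₁ (by omega) v) (key2 h₄ (by omega) v)
  funext m l
  ext v
  have := (diagDiff_iterate_map (LinearMap.applyₗ v) M
    (modeComm 𝒰 (p + r) q (𝒰.Y (-1) a x) b)).symm.trans (happ v)
  exact congrFun (congrFun this m) l

end IsCommutative

end Poisson


/-! ### Auxiliary sums -/

section Sums

variable {E : Type*} [AddCommGroup E] [Module ℂ E]

/-- Reindexing `mode_dpow` by the mode `n` that survives puts it in the shape of the locality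
formula, with the same coefficients `binom(m, n)`. -/
theorem mode_dpow_eq_sum_range {T : E →ₗ[ℂ] E} {A : ℕ → E →ₗ[ℂ] E}
    (h : ∀ m b, A m (T b) = T (A m b) + (m : ℂ) • A (m - 1) b) (m k : ℕ) (b : E) (N : ℕ)
    (hN : ∀ n, N ≤ n → A n b = 0) :
    A m (dpow T k b) = ∑ n ∈ Finset.range N,
      if m ≤ n + k then (m.choose n : ℂ) • dpow T (n + k - m) (A n b) else 0 := by
  rw [mode_dpow h]
  refine Finset.sum_bij_ne_zero (fun x _ _ => m - x.1) ?_ ?_ ?_ ?_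
  · rintro ⟨i, j⟩ hx h0
    by_contra hc
    rw [Finset.mem_range, not_lt] at hc
    exact h0 (by simp [hN _ hc])
  · rintro ⟨i, j⟩ hx h0 ⟨i', j'⟩ hx' h0' he
    simp only [Finset.HasAntidiagonal.mem_antidiagonal] at hx hx' he
    have h1 : i ≤ m := by
      by_contra hc; exact h0 (by simp [Nat.choose_eq_zero_of_lt (not_le.1 hc)])
    have h2 : i' ≤ m := by
      by_contra hc; exact h0' (by simp [Nat.choose_eq_zero_of_lt (not_le.1 hc)])
    ext <;> dsimp only <;> omega
  · intro n hn h0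
    have h1 : m ≤ n + k := by by_contra hc; exact h0 (by simp [hc])
    have h2 : n ≤ m := by
      by_contra hc; exact h0 (by simp [Nat.choose_eq_zero_of_lt (not_le.1 hc)])
    rw [if_pos h1] at h0
    refine ⟨(m - n, n + k - m), ?_, ?_, ?_⟩
    · rw [Finset.HasAntidiagonal.mem_antidiagonal]; dsimp only; omega
    · rw [Nat.choose_symm h2, show m - (m - n) = n by omega]; exact h0
    · dsimp only; omega
  · rintro ⟨i, j⟩ hx h0
    simp only [Finset.HasAntidiagonal.mem_antidiagonal] at hx
    have h1 : i ≤ m := by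
      by_contra hc; exact h0 (by simp [Nat.choose_eq_zero_of_lt (not_le.1 hc)])
    dsimp only
    rw [if_pos (by omega), Nat.choose_symm h1, show m - i + k - m = j by omega]

/-- Through skew-symmetry this converts covariance in the second argument into the rule for the
modes of `T a`. -/
theorem skewTransform_T {T : E →ₗ[ℂ] E} {f : ℕ → E} {N : ℕ} (hf : ∀ n, N ≤ n → f n = 0) (l : ℕ) :
    skewTransform T (fun k => T (f k) + (k : ℂ) • f (k - 1)) l =
      -(l : ℂ) • skewTransform T f (l - 1) := by
  have hf' : ∀ n, N + 1 ≤ n → f n = 0 := fun n hn => hf n (by omega)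
  rw [skewTransform_eq (N := N + 1)
    (fun n hn => by rw [hf n (by omega), hf (n - 1) (by omega)]; simp), skewTransform_eq hf']
  simp only [map_add, map_smul, dpow_T, T_dpow, smul_add, Finset.sum_add_distrib]
  have h1 : ∑ j ∈ Finset.range (N + 1), (-1 : ℂ) ^ (l + j) • ((j : ℂ) + 1) •
      dpow T (j + 1) (f (l + j)) =
      ∑ j ∈ Finset.range (N + 1), -((-1 : ℂ) ^ (l + j) • (j : ℂ) • dpow T j (f (l + j - 1))) := by
    rw [Finset.sum_range_succ, hf (l + N) (by omega), Finset.sum_range_succ' _ N]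
    simp only [map_zero, smul_zero, add_zero, Nat.cast_zero, zero_smul, neg_zero, Nat.cast_add,
      Nat.cast_one]
    refine Finset.sum_congr rfl fun j _ => ?_
    rw [← add_assoc, Nat.add_sub_cancel, pow_succ, mul_neg_one, neg_smul, neg_neg]
  rw [h1, ← Finset.sum_add_distrib, Finset.smul_sum]
  refine Finset.sum_congr rfl fun j _ => ?_
  rw [Nat.cast_add, add_smul, smul_add]
  cases l with
  | zero => simp
  | succ l =>
    rw [show l + 1 + j - 1 = l + 1 - 1 + j by omega, show l + 1 + j = (l + 1 - 1 + j) + 1 by omega,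
      pow_succ]
    module

/-- The coefficient in the locality formula when the first mode has the negative index `-k - 1`. -/
theorem ring_choose_neg (k n : ℕ) :
    (Ring.choose (-(k : ℤ) - 1) n : ℤ) = (-1) ^ n * ((n + k).choose k : ℤ) := by
  have h1 : (-(k : ℤ) - 1) = -((k : ℤ) + 1) := by ring
  rw [h1, Ring.choose_neg, show (k : ℤ) + 1 + n - 1 = ((n + k : ℕ) : ℤ) by push_cast; ring,
    Ring.choose_natCast, Nat.choose_symm_add]
  simp [Int.negOnePow_def, Units.smul_def]

end Sums


/-! ### From raviolo vertex algebras to Poisson structures -/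

section RavioloToPoisson

variable {U : Type*} [AddCommGroup U] [Module ℂ U]

/-- The negative modes form a graded commutative differential algebra, on which the non-negative
modes act by skew-symmetric covariant derivations. -/
structure IsPoisson (𝒰 : RavioloData U) : Prop extends IsCommutative 𝒰 where
  derivation : ∀ p a, HasParity 𝒰 p a → IsDerivation 𝒰 p a
  covariant : ∀ a, IsCovariant 𝒰 a
  skew : ∀ p q a b, HasParity 𝒰 p a → HasParity 𝒰 q b → IsSkew 𝒰 p q a b

theorem IsPoisson.wick {𝒰 : RavioloData U} (h : IsPoisson 𝒰) {p r : ZMod 2} {a x : U}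
    (ha : HasParity 𝒰 p a) (hx : HasParity 𝒰 r x) : IsWick 𝒰 p r a x :=
  h.isWick_of_isSkew ha hx h.derivation h.skew

variable {𝒰 : RavioloData U}

theorem modePar_nat (p : ZMod 2) (m : ℕ) : modePar p m = p + 1 := by
  rw [modePar, if_neg (by omega)]

theorem modePar_neg (p : ZMod 2) {m : ℤ} (hm : m < 0) : modePar p m = p := by
  rw [modePar, if_pos hm]

theorem par_add (d e : Deg) : par (d + e) = par d + par e := by
  simp only [par, Prod.fst_add, Prod.snd_add, Int.cast_add]; ring

theorem par_sub_one (d : Deg) : par (d - (1, 0)) = par d + 1 := by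
  simp only [par, Prod.fst_sub, Prod.snd_sub, Int.cast_sub, Int.cast_one, sub_zero]
  rw [CharTwo.sub_eq_add]; ring

namespace IsRaviolo

variable (h : IsRaviolo 𝒰)
include h

theorem hasParity {d : Deg} {a : U} (ha : a ∈ 𝒰.gr d) : HasParity 𝒰 (par d) a := h.sgn_eq d a ha

theorem gr_induction {P : U → Prop} (h0 : P 0) (hadd : ∀ a b, P a → P b → P (a + b))
    (hP : ∀ d, ∀ a ∈ 𝒰.gr d, P a) (a : U) : P a := by
  have ha : a ∈ ⨆ d, 𝒰.gr d := by rw [h.grading.submodule_iSup_eq_top]; trivial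
  induction ha using Submodule.iSup_induction' with
  | mem d a ha => exact hP d a ha
  | zero => exact h0
  | add a b _ _ ha hb => exact hadd a b ha hb

/-- The projection onto parity `p` is the identity on graded pieces of that parity and kills all
others, so a vector of parity `p` is a sum of homogeneous vectors of parity `p`. -/
theorem parity_gr_induction {p : ZMod 2} {P : U → Prop} (h0 : P 0)
    (hadd : ∀ a b, P a → P b → P (a + b)) (hP : ∀ d, par d = p → ∀ a ∈ 𝒰.gr d, P a)
    (a : U) (ha : HasParity 𝒰 p a) : P a := by
  have key : ∀ a, P ((1 / 2 : ℂ) • (a + sign p • 𝒰.sgn a)) := by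
    refine h.gr_induction (by simpa using h0) ?_ ?_
    · intro a b ha hb
      convert hadd _ _ ha hb using 1
      simp only [map_add]; module
    · intro d a ha
      rw [h.sgn_eq d a ha]
      by_cases hd : par d = p
      · rw [hd, sign_smul_smul]
        convert hP d hd a ha using 1
        module
      · have : sign p * sign (par d) = -1 := by
          rcases zmod_two_cases p with rfl | rfl <;>
            rcases zmod_two_cases (par d) with h' | h' <;> simp_all [sign_zero, sign_one]
        rw [smul_smul, this]
        simpa using h0
  have := key a
  rw [ha, sign_smul_smul] at this
  convert this using 1
  module

/-- Every term of the delta function contains an Ω, so locality puts no term on the right when both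
indices are negative. -/
theorem neg_comm {d e : Deg} {a b : U} (ha : a ∈ 𝒰.gr d) (hb : b ∈ 𝒰.gr e) {m l : ℤ}
    (hm : m < 0) (hl : l < 0) (v : U) :
    𝒰.Y m a (𝒰.Y l b v) = sign (par d * par e) • 𝒰.Y l b (𝒰.Y m a v) := by
  obtain ⟨N, C, -, hC⟩ := h.locality d e a ha b hb
  have := LinearMap.congr_fun (hC m l) v
  rw [if_pos ⟨hm, hl⟩, modePar_neg _ hm, modePar_neg _ hl] at this
  simpa [gradedComm, sub_eq_zero] using this

/-- Every vector is `c_(-1)|0⟩`, so an operator that supercommutes with all multiplications is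
determined by its value on the vacuum. This plays the role of Goddard's uniqueness theorem. -/
theorem eq_zero_of_comm (X : Module.End ℂ U) (η : ZMod 2)
    (hX : ∀ e, ∀ c ∈ 𝒰.gr e, ∀ v, X (𝒰.Y (-1) c v) = sign (η * par e) • 𝒰.Y (-1) c (X v))
    (h0 : X 𝒰.vac = 0) : X = 0 := by
  ext v
  refine h.gr_induction (P := fun v => X v = 0) (map_zero _) ?_ ?_ v
  · intro a b ha hb; rw [map_add, ha, hb, add_zero]
  · intro e c hc
    rw [← h.Y_neg_one_vac c, hX e c hc, h0, map_zero, smul_zero]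

theorem mul_mem {d e : Deg} {a b : U} (ha : a ∈ 𝒰.gr d) (hb : b ∈ 𝒰.gr e) :
    𝒰.Y (-1) a b ∈ 𝒰.gr (d + e) := h.Y_mem_neg (-1) (by norm_num) d e a ha b hb

theorem mode_mem {d e : Deg} {a b : U} (ha : a ∈ 𝒰.gr d) (hb : b ∈ 𝒰.gr e) (m : ℕ) :
    𝒰.Y m a b ∈ 𝒰.gr (d + e - (1, 0)) := h.Y_mem_nonneg m (by omega) d e a ha b hb

theorem comm_gr {d e : Deg} {a b : U} (ha : a ∈ 𝒰.gr d) (hb : b ∈ 𝒰.gr e) :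
    𝒰.Y (-1) a b = sign (par d * par e) • 𝒰.Y (-1) b a := by
  have := h.neg_comm ha hb (m := -1) (l := -1) (by norm_num) (by norm_num) 𝒰.vac
  rwa [h.Y_neg_one_vac, h.Y_neg_one_vac] at this

/-- Both operators supercommute with all multiplications by `neg_comm`, and they agree on the
vacuum. -/
theorem assoc_gr {d e : Deg} {a b : U} (ha : a ∈ 𝒰.gr d) (hb : b ∈ 𝒰.gr e) (v : U) :
    𝒰.Y (-1) (𝒰.Y (-1) a b) v = 𝒰.Y (-1) a (𝒰.Y (-1) b v) := by
  have hm : (-1 : ℤ) < 0 := by norm_num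
  have := h.eq_zero_of_comm (𝒰.Y (-1) (𝒰.Y (-1) a b) - 𝒰.Y (-1) a * 𝒰.Y (-1) b) (par d + par e)
    (fun f c hc v => by
      simp only [LinearMap.sub_apply, Module.End.mul_apply, map_sub, smul_sub]
      rw [h.neg_comm (h.mul_mem ha hb) hc hm hm, h.neg_comm hb hc hm hm, map_smul,
        h.neg_comm ha hc hm hm, par_add, smul_smul, ← sign_add]
      congr 3; ring)
    (by simp only [LinearMap.sub_apply, Module.End.mul_apply, h.Y_neg_one_vac, sub_self])
  exact sub_eq_zero.1 (LinearMap.congr_fun this v)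

/-- Uniqueness identifies `a_(-2)` with `(T a)_(-1)`. The translation axiom at index `-1` is then
the Leibniz rule. -/
theorem T_mul_gr {d : Deg} {a : U} (ha : a ∈ 𝒰.gr d) (b : U) :
    𝒰.T (𝒰.Y (-1) a b) = 𝒰.Y (-1) (𝒰.T a) b + 𝒰.Y (-1) a (𝒰.T b) := by
  have hm : (-1 : ℤ) < 0 := by norm_num
  have htr : ∀ v, 𝒰.T (𝒰.Y (-1) a v) - 𝒰.Y (-1) a (𝒰.T v) = 𝒰.Y (-2) a v := fun v => by
    simpa using h.translation (-1) a v
  have := h.eq_zero_of_comm (𝒰.Y (-2) a - 𝒰.Y (-1) (𝒰.T a)) (par d)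
    (fun f c hc v => by
      simp only [LinearMap.sub_apply, map_sub, smul_sub]
      rw [h.neg_comm (h.T_mem d a ha) hc hm hm, h.neg_comm ha hc (by norm_num) hm])
    (by rw [LinearMap.sub_apply, ← htr, h.Y_neg_one_vac, h.Y_neg_one_vac, h.T_vac]; simp)
  have h2 := LinearMap.congr_fun this b
  rw [LinearMap.sub_apply, LinearMap.zero_apply, ← htr, sub_eq_zero] at h2
  rw [← h2]; abel

theorem isCommutative : IsCommutative 𝒰 where
  sgn_sgn := h.gr_induction (by simp) (fun a b ha hb => by rw [map_add, map_add, ha, hb])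
    (fun d a ha => by rw [h.sgn_eq d a ha, map_smul, h.sgn_eq d a ha, sign_smul_smul])
  sgn_vac := by
    have := h.sgn_eq _ _ h.vac_mem
    rwa [show par (0, 0) = 0 by simp [par], sign_zero, one_smul] at this
  sgn_T := h.gr_induction (by simp) (fun a b ha hb => by simp only [map_add, ha, hb])
    (fun d a ha => by rw [h.sgn_eq d a ha, map_smul, h.sgn_eq d _ (h.T_mem d a ha)])
  sgn_mul := h.gr_induction (by simp)
    (fun a b ha hb c => by simp only [map_add, LinearMap.add_apply, ha, hb])
    (fun d a ha => h.gr_induction (by simp)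
      (fun a b ha hb => by simp only [map_add, ha, hb])
      (fun e b hb => by
        rw [h.sgn_eq d a ha, h.sgn_eq e b hb, h.sgn_eq _ _ (h.mul_mem ha hb), par_add, sign_add,
          map_smul, map_smul, LinearMap.smul_apply, smul_smul, mul_comm]))
  sgn_mode m := h.gr_induction (by simp)
    (fun a b ha hb c => by simp only [map_add, LinearMap.add_apply, ha, hb]; abel)
    (fun d a ha => h.gr_induction (by simp)
      (fun a b ha hb => by simp only [map_add, ha, hb]; abel)
      (fun e b hb => by
        rw [h.sgn_eq d a ha, h.sgn_eq e b hb, h.sgn_eq _ _ (h.mode_mem ha hb m), par_sub_one,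
          par_add, sign_add_one, sign_add,
          map_smul, map_smul, LinearMap.smul_apply, smul_smul, mul_comm, neg_smul]))
  field := h.field
  T_vac := h.T_vac
  T_mul := h.gr_induction (by simp)
    (fun a b ha hb c => by simp only [map_add, LinearMap.add_apply, ha, hb]; abel)
    (fun d a ha => h.T_mul_gr ha)
  neg := by
    intro n a
    refine h.gr_induction (P := fun a => 𝒰.Y (-(n : ℤ) - 1) a = 𝒰.Y (-1) (dpow 𝒰.T n a))
      (by simp) (fun a b ha hb => by simp only [map_add, ha, hb]) ?_ a
    intro d a ha
    induction n with
    | zero => simp [dpow_zero]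
    | succ n ih =>
      have hn : (n : ℂ) + 1 ≠ 0 := by exact_mod_cast n.succ_ne_zero
      have hmem : dpow 𝒰.T n a ∈ 𝒰.gr d := by
        clear ih
        induction n with
        | zero => rwa [dpow_zero]
        | succ n ih =>
          rw [dpow_succ]
          exact Submodule.smul_mem _ _ (h.T_mem _ _ (ih (by exact_mod_cast n.succ_ne_zero)))
      ext v
      have h1 := h.translation (-(n : ℤ) - 1) a v
      rw [ih, h.T_mul_gr hmem, add_sub_cancel_right, T_dpow,
        show -(n : ℤ) - 1 - 1 = -((n + 1 : ℕ) : ℤ) - 1 by push_cast; ring,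
        show -(-(n : ℤ) - 1) = ((n + 1 : ℕ) : ℤ) by push_cast; ring, natCast_zsmul,
        ← Nat.cast_smul_eq_nsmul ℂ, map_smul, LinearMap.smul_apply] at h1
      push_cast at h1 ⊢
      exact (smul_right_injective U hn h1).symm
  vac_mul a := by rw [h.Y_vac, if_pos rfl]
  vac_mode m a := by rw [h.Y_vac, if_neg (by omega)]
  mode_vac m a := h.Y_apply_vac m a (by omega)
  comm p q a b ha hb := by
    refine h.parity_gr_induction (P := fun a => 𝒰.Y (-1) a b = sign (p * q) • 𝒰.Y (-1) b a)
      (by simp) (fun a b ha hb => by simp only [map_add, LinearMap.add_apply, ha, hb, smul_add])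
      (fun d hd a ha => ?_) a ha
    refine h.parity_gr_induction (P := fun b => 𝒰.Y (-1) a b = sign (p * q) • 𝒰.Y (-1) b a)
      (by simp) (fun a b ha hb => by simp only [map_add, LinearMap.add_apply, ha, hb, smul_add])
      (fun e he b hb => ?_) b hb
    rw [h.comm_gr ha hb, hd, he]
  assoc := h.gr_induction (by simp)
    (fun a b ha hb c d => by simp only [map_add, LinearMap.add_apply, ha, hb])
    (fun d a ha => h.gr_induction (by simp)
      (fun a b ha hb c => by simp only [map_add, LinearMap.add_apply, ha, hb])
      (fun e b hb => h.assoc_gr ha hb))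

theorem covariant (a : U) : IsCovariant 𝒰 a := by
  intro m b
  have h1 := h.translation m a b
  cases m with
  | zero => simp at h1 ⊢; rw [sub_eq_zero] at h1; exact h1.symm
  | succ m =>
    rw [show ((m + 1 : ℕ) : ℤ) - 1 = (m : ℤ) by push_cast; ring, ← Int.cast_smul_eq_zsmul ℂ] at h1
    rw [Nat.add_sub_cancel]
    rw [sub_eq_iff_eq_add] at h1
    rw [h1]
    push_cast
    module

/-- The claim is that the commutator of `a_(m₀)` and `b_(-1)` is multiplication by `a_(m₀) b`. The
two agree on the vacuum, so it is enough that the commutator supercommutes with every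
multiplication. This is not immediate, because `a_(m₀)` does not. By locality the commutator is a
combination of coefficients `C^n` of fixed total index, and for these one may compare with large
modes of `a`. -/
theorem derivation_gr {d e : Deg} {a b : U} (ha : a ∈ 𝒰.gr d) (hb : b ∈ 𝒰.gr e) (m₀ : ℕ) (v : U) :
    𝒰.Y m₀ a (𝒰.Y (-1) b v) = 𝒰.Y (-1) (𝒰.Y m₀ a b) v +
      sign ((par d + 1) * par e) • 𝒰.Y (-1) b (𝒰.Y m₀ a v) := by
  have hm : (-1 : ℤ) < 0 := by norm_num
  obtain ⟨N, C, -, hC⟩ := h.locality d e a ha b hb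
  -- the commutator with a mode of negative index commutes with all multiplications
  have hcomm : ∀ f, ∀ c ∈ 𝒰.gr f, ∀ n, n ≤ N → ∀ v, m₀ ≤ n →
      C n ((m₀ : ℤ) - 1 - n) (𝒰.Y (-1) c v) =
        sign ((par d + par e + 1) * par f) • 𝒰.Y (-1) c (C n ((m₀ : ℤ) - 1 - n) v) := by
    intro f c hc n hn v hn'
    obtain ⟨N', C', -, hC'⟩ := h.locality d f a ha c hc
    set η := sign ((par d + par e + 1) * par f) with hη
    -- Keep the index sum equal to `m₀ - 1` and let the mode `m` of `a` grow. Beyond `N'` the mode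
    -- `a_(m)` supercommutes with `c_(-1)` by locality with `c`, and the negative mode of `b` always
    -- does. So the whole sum over `n` supercommutes for every large `m`, and independence of the
    -- binomials separates the coefficients.
    have key := eq_zero_of_sum_choose_smul_eq_zero N
      (fun n => if m₀ ≤ n then C n ((m₀ : ℤ) - 1 - n) (𝒰.Y (-1) c v) -
        η • 𝒰.Y (-1) c (C n ((m₀ : ℤ) - 1 - n) v) else 0) (max (N' + 1) (m₀ + 1)) (by
      intro m hmm
      have hl : (m₀ : ℤ) - 1 - m < 0 := by omega
      have hac : ∀ v, 𝒰.Y m a (𝒰.Y (-1) c v) =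
          sign ((par d + 1) * par f) • 𝒰.Y (-1) c (𝒰.Y m a v) := by
        intro v
        have := LinearMap.congr_fun (hC' m (-1)) v
        rw [if_neg (by omega), modePar_nat, modePar_neg _ hm, Finset.sum_eq_zero, smul_zero] at this
        · simpa [gradedComm, sub_eq_zero] using this
        · intro n hn
          rw [Finset.mem_range] at hn
          rw [if_neg (by omega)]
      have hab := hC m ((m₀ : ℤ) - 1 - m)
      rw [if_neg (by omega), modePar_nat, modePar_neg _ hl, if_neg (by omega), one_smul] at hab
      have h1 : ∀ v, (gradedComm (par d + 1) (par e) (𝒰.Y m a) (𝒰.Y ((m₀ : ℤ) - 1 - m) b)) v =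
          ∑ n ∈ Finset.range (N + 1), (m.choose n : ℂ) •
            if m₀ ≤ n then C n ((m₀ : ℤ) - 1 - n) v else 0 := by
        intro v
        rw [hab, LinearMap.sum_apply]
        refine Finset.sum_congr rfl fun n _ => ?_
        by_cases hmn : m₀ ≤ n
        · rw [if_pos (by omega), if_pos hmn, Ring.choose_natCast, LinearMap.smul_apply,
            natCast_zsmul, Nat.cast_smul_eq_nsmul,
            show (m : ℤ) + ((m₀ : ℤ) - 1 - m) - n = (m₀ : ℤ) - 1 - n by ring]
        · rw [if_neg (by omega), if_neg hmn, smul_zero, LinearMap.zero_apply]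
      have h2 : (gradedComm (par d + 1) (par e) (𝒰.Y m a) (𝒰.Y ((m₀ : ℤ) - 1 - m) b))
          (𝒰.Y (-1) c v) = η • 𝒰.Y (-1) c
          ((gradedComm (par d + 1) (par e) (𝒰.Y m a) (𝒰.Y ((m₀ : ℤ) - 1 - m) b)) v) := by
        simp only [gradedComm, LinearMap.sub_apply, LinearMap.smul_apply, Module.End.mul_apply,
          map_sub, map_smul]
        rw [h.neg_comm hb hc hl hm, map_smul, hac, hac, map_smul, h.neg_comm hb hc hl hm, smul_sub,
          smul_smul, smul_smul, smul_smul, smul_smul, hη,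
          show (par d + par e + 1) * par f = par e * par f + (par d + 1) * par f by ring, sign_add]
        congr 2; ring
      rw [h1, h1, map_sum, Finset.smul_sum, ← sub_eq_zero, ← Finset.sum_sub_distrib] at h2
      refine Eq.trans ?_ h2
      refine Finset.sum_congr rfl fun n _ => ?_
      split_ifs
      · rw [map_smul, smul_comm η, smul_sub]
      · simp) n hn
    rw [if_pos hn', sub_eq_zero] at key
    exact key
  have hab := hC m₀ (-1)
  rw [if_neg (by omega), modePar_nat, modePar_neg _ hm, if_neg (by omega), one_smul] at hab
  have hX : ∀ f, ∀ c ∈ 𝒰.gr f, ∀ v,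
      gradedComm (par d + 1) (par e) (𝒰.Y m₀ a) (𝒰.Y (-1) b) (𝒰.Y (-1) c v) =
      sign ((par d + par e + 1) * par f) •
        𝒰.Y (-1) c (gradedComm (par d + 1) (par e) (𝒰.Y m₀ a) (𝒰.Y (-1) b) v) := by
    intro f c hc v
    rw [hab, LinearMap.sum_apply, LinearMap.sum_apply, map_sum, Finset.smul_sum]
    refine Finset.sum_congr rfl fun n hn => ?_
    rw [Finset.mem_range] at hn
    by_cases hmn : m₀ ≤ n
    · rw [if_pos (by omega), LinearMap.smul_apply, LinearMap.smul_apply,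
        show (m₀ : ℤ) + -1 - n = (m₀ : ℤ) - 1 - n by ring, hcomm f c hc n (by omega) v hmn,
        map_zsmul, smul_comm]
    · rw [if_neg (by omega)]; simp
  have := h.eq_zero_of_comm
    (gradedComm (par d + 1) (par e) (𝒰.Y m₀ a) (𝒰.Y (-1) b) - 𝒰.Y (-1) (𝒰.Y m₀ a b))
    (par d + par e + 1) (fun f c hc v => by
      rw [LinearMap.sub_apply, LinearMap.sub_apply, hX f c hc,
        h.neg_comm (h.mode_mem ha hb m₀) hc hm hm, par_sub_one, par_add, map_sub, smul_sub])
    (by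
      rw [LinearMap.sub_apply, h.Y_neg_one_vac]
      simp [gradedComm, h.Y_neg_one_vac, h.Y_apply_vac m₀ a (by omega)])
  have h3 := LinearMap.congr_fun this v
  simp only [gradedComm, LinearMap.sub_apply, LinearMap.smul_apply, Module.End.mul_apply,
    LinearMap.zero_apply] at h3
  rw [sub_sub, sub_eq_zero] at h3
  rw [h3, add_comm]

/-- Locality is evaluated on the vacuum twice. With a non-negative mode of `a` and a negative mode
of `b` it determines the vectors `C^n_(-j-1)|0⟩`. With `a_(-1)` and `b_(l)` it expresses `b_(l) a`
through them. -/
theorem skew_gr {d e : Deg} {a b : U} (ha : a ∈ 𝒰.gr d) (hb : b ∈ 𝒰.gr e) :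
    IsSkew 𝒰 (par d) (par e) a b := by
  have hm : (-1 : ℤ) < 0 := by norm_num
  obtain ⟨N, C, -, hC⟩ := h.locality d e a ha b hb
  obtain ⟨K, hK⟩ := h.isCommutative.exists_bound a b
  -- The range extends to `N + K` because `a_(n) b` is not yet known to vanish for `n > N`;
  -- comparison with the absent coefficients `C^n` shows that it does.
  have hCvac : ∀ n j : ℕ, n ≤ N + K → (if n ≤ N then C n (-(j : ℤ) - 1) 𝒰.vac else 0) =
      dpow 𝒰.T j (𝒰.Y n a b) := by
    intro n₀ j₀ hn₀
    have key := eq_zero_of_sum_choose_smul_eq_zero (N + K)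
      (fun n => if n₀ ≤ n + j₀ then (if n ≤ N then C n (-((n + j₀ - n₀ : ℕ) : ℤ) - 1) 𝒰.vac else 0) -
        dpow 𝒰.T (n + j₀ - n₀) (𝒰.Y n a b) else 0) n₀ (by
      intro m hmm
      -- the mode `m` of `a` on the divided derivative of order `k` of `b`
      set k := m - n₀ + j₀ with hk
      have h1 := LinearMap.congr_fun (hC m (-(k : ℤ) - 1)) 𝒰.vac
      beta_reduce at h1
      rw [if_neg (by omega), modePar_nat, modePar_neg _ (by omega), if_neg (by omega), one_smul,
        gradedComm, LinearMap.sub_apply, LinearMap.smul_apply, Module.End.mul_apply,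
        Module.End.mul_apply, h.Y_apply_vac m a (by omega), map_zero, smul_zero, sub_zero,
        h.isCommutative.neg, h.isCommutative.mul_vac,
        mode_dpow_eq_sum_range (A := fun n : ℕ => 𝒰.Y n a) (h.covariant a) m k b (N + K + 1)
          (fun n hn => hK n (by omega)), LinearMap.sum_apply] at h1
      have h2 : ∑ n ∈ Finset.range (N + 1), (if (0 ≤ (m : ℤ) ∧ 0 ≤ -(k : ℤ) - 1) ∨
          (m : ℤ) + (-(k : ℤ) - 1) + 1 ≤ n then
            Ring.choose (m : ℤ) n • C n ((m : ℤ) + (-(k : ℤ) - 1) - n) else 0) 𝒰.vac =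
          ∑ n ∈ Finset.range (N + K + 1), if m ≤ n + k then (m.choose n : ℂ) •
            (if n ≤ N then C n (-((n + k - m : ℕ) : ℤ) - 1) 𝒰.vac else 0) else 0 := by
        rw [show N + K + 1 = (N + 1) + K by ring, Finset.sum_range_add _ (N + 1) K]
        rw [Finset.sum_eq_zero (s := Finset.range K), add_zero]
        · refine Finset.sum_congr rfl fun n hn => ?_
          rw [Finset.mem_range] at hn
          by_cases hmn : m ≤ n + k
          · rw [if_pos (by omega), if_pos hmn, if_pos (by omega), Ring.choose_natCast,
              LinearMap.smul_apply, natCast_zsmul, Nat.cast_smul_eq_nsmul,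
              show (m : ℤ) + (-(k : ℤ) - 1) - n = -((n + k - m : ℕ) : ℤ) - 1 by omega]
          · rw [if_neg (by omega), if_neg hmn]; simp
        · intro n _
          rw [if_neg (show ¬ N + 1 + n ≤ N by omega)]; simp
      rw [h2, eq_comm, ← sub_eq_zero, ← Finset.sum_sub_distrib] at h1
      refine Eq.trans ?_ h1
      refine Finset.sum_congr rfl fun n _ => ?_
      by_cases hmn : m ≤ n + k
      · rw [if_pos hmn, if_pos hmn, if_pos (by omega), ← smul_sub,
          show n + j₀ - n₀ = n + k - m by omega]
      · rw [if_neg hmn, if_neg hmn, if_neg (by omega)]; simp) n₀ hn₀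
    rwa [if_pos (by omega), Nat.add_sub_cancel_left, sub_eq_zero] at key
  intro l
  -- Since `b_(l)` kills the vacuum, only the term `b_(l) a` of the commutator remains. The
  -- coefficients `binom(-1, n) = (-1)^n` are the signs of the skew-symmetry transform.
  have h1 := LinearMap.congr_fun (hC (-1) l) 𝒰.vac
  beta_reduce at h1
  rw [if_neg (by omega), modePar_nat, modePar_neg _ hm, if_pos (by omega), gradedComm,
    LinearMap.sub_apply, LinearMap.smul_apply, Module.End.mul_apply, Module.End.mul_apply,
    h.Y_apply_vac l b (by omega), map_zero, zero_sub, h.Y_neg_one_vac, LinearMap.smul_apply,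
    LinearMap.sum_apply] at h1
  have h2 : ∑ n ∈ Finset.range (N + 1), (if (0 ≤ (-1 : ℤ) ∧ 0 ≤ (l : ℤ)) ∨
      (-1 : ℤ) + l + 1 ≤ n then Ring.choose (-1 : ℤ) n • C n ((-1 : ℤ) + l - n) else 0) 𝒰.vac =
      skewTransform 𝒰.T (fun m : ℕ => 𝒰.Y m a b) l := by
    have hN : ∀ n, N < n → ∀ j, dpow 𝒰.T j (𝒰.Y n a b) = 0 := by
      intro n hn j
      by_cases hnK : n ≤ N + K
      · rw [← hCvac n j hnK, if_neg (by omega)]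
      · rw [hK n (by omega), map_zero]
    rw [skewTransform, finsum_eq_sum_range (N + 1) (fun j hj => by
      rw [hN _ (by omega), smul_zero])]
    symm
    refine Finset.sum_bij_ne_zero (fun j _ _ => l + j) ?_ ?_ ?_ ?_
    · intro j _ h0
      by_contra hc
      rw [Finset.mem_range, not_lt] at hc
      exact h0 (by rw [hN _ (by omega), smul_zero])
    · intro i _ _ j _ _ hij; omega
    · intro n hn h0
      rw [Finset.mem_range] at hn
      have hln : l ≤ n := by
        by_contra hc
        rw [if_neg (by omega)] at h0
        exact h0 rfl
      refine ⟨n - l, by rw [Finset.mem_range]; omega, ?_, by omega⟩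
      rw [if_pos (by omega), LinearMap.smul_apply,
        show (-1 : ℤ) + l - n = -((n - l : ℕ) : ℤ) - 1 by omega] at h0
      have := hCvac n (n - l) (by omega)
      rw [if_pos (by omega)] at this
      rw [this] at h0
      rw [show l + (n - l) = n by omega]
      intro h0'
      apply h0
      rw [smul_eq_zero] at h0'
      rcases h0' with h0' | h0'
      · simp at h0'
      · rw [h0', smul_zero]
    · intro j hj h0
      have hlj : l + j ≤ N := by
        by_contra hc
        exact h0 (by rw [hN _ (by omega), smul_zero])
      have := hCvac (l + j) j (by omega)
      rw [if_pos (by omega)] at this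
      have hch := ring_choose_neg 0 (l + j)
      simp only [Nat.cast_zero, neg_zero, zero_sub, Nat.choose_zero_right, Nat.cast_one,
        mul_one] at hch
      rw [if_pos (by omega), LinearMap.smul_apply,
        show (-1 : ℤ) + l - ((l + j : ℕ) : ℤ) = -(j : ℤ) - 1 by push_cast; ring, this, hch,
        ← Int.cast_smul_eq_zsmul ℂ]
      push_cast
      rfl
  rw [h2, ← neg_smul, neg_eq_neg_one_mul] at h1
  have h3 := congrArg (fun x => (-sign (par d * (par e + 1))) • x) h1
  simp only [smul_smul] at h3
  have e1 : -sign (par d * (par e + 1)) * (-1 * sign (par d * (par e + 1))) = 1 := by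
    linear_combination sign_mul_self (par d * (par e + 1))
  have e2 : -sign (par d * (par e + 1)) * sign (par d + 1) = sign (par d * par e) := by
    rw [mul_add, mul_one, sign_add, sign_add_one]
    linear_combination sign (par d * par e) * sign_mul_self (par d)
  rw [e1, e2, one_smul] at h3
  exact h3

theorem isPoisson : IsPoisson 𝒰 where
  toIsCommutative := h.isCommutative
  derivation p a ha q b hb m c := by
    refine h.parity_gr_induction (P := fun a => 𝒰.Y m a (𝒰.Y (-1) b c) =
      𝒰.Y (-1) (𝒰.Y m a b) c + sign ((p + 1) * q) • 𝒰.Y (-1) b (𝒰.Y m a c))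
      (by simp) (fun a b ha hb => by
        simp only [map_add, LinearMap.add_apply, ha, hb, smul_add]; abel) (fun d hd a ha => ?_) a ha
    refine h.parity_gr_induction (P := fun b => 𝒰.Y m a (𝒰.Y (-1) b c) =
      𝒰.Y (-1) (𝒰.Y m a b) c + sign ((p + 1) * q) • 𝒰.Y (-1) b (𝒰.Y m a c))
      (by simp) (fun a b ha hb => by
        simp only [map_add, LinearMap.add_apply, ha, hb, smul_add]; abel) (fun e he b hb => ?_) b hb
    rw [h.derivation_gr ha hb, hd, he]
  covariant := h.covariant
  skew p q a b ha hb l := by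
    have hadd : ∀ a a' b, skewTransform 𝒰.T (fun m : ℕ => 𝒰.Y m (a + a') b) l =
        skewTransform 𝒰.T (fun m : ℕ => 𝒰.Y m a b) l +
        skewTransform 𝒰.T (fun m : ℕ => 𝒰.Y m a' b) l := by
      intro a a' b
      obtain ⟨N₁, h₁⟩ := h.isCommutative.exists_bound a b
      obtain ⟨N₂, h₂⟩ := h.isCommutative.exists_bound a' b
      have := skewTransform_add (T := 𝒰.T) (N := max N₁ N₂)
        (fun n hn => h₁ n (by omega)) (fun n hn => h₂ n (by omega)) 1 1 l
      simpa using this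
    have hadd' : ∀ a b b', skewTransform 𝒰.T (fun m : ℕ => 𝒰.Y m a (b + b')) l =
        skewTransform 𝒰.T (fun m : ℕ => 𝒰.Y m a b) l +
        skewTransform 𝒰.T (fun m : ℕ => 𝒰.Y m a b') l := by
      intro a b b'
      obtain ⟨N₁, h₁⟩ := h.isCommutative.exists_bound a b
      obtain ⟨N₂, h₂⟩ := h.isCommutative.exists_bound a b'
      have := skewTransform_add (T := 𝒰.T) (N := max N₁ N₂)
        (fun n hn => h₁ n (by omega)) (fun n hn => h₂ n (by omega)) 1 1 l
      simpa using this
    refine h.parity_gr_induction (P := fun a => 𝒰.Y l b a =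
      sign (p * q) • skewTransform 𝒰.T (fun m : ℕ => 𝒰.Y m a b) l)
      (by simp [skewTransform]) (fun a b ha hb => by
        rw [map_add, ha, hb, hadd, smul_add]) (fun d hd a ha => ?_) a ha
    refine h.parity_gr_induction (P := fun b => 𝒰.Y l b a =
      sign (p * q) • skewTransform 𝒰.T (fun m : ℕ => 𝒰.Y m a b) l)
      (by simp [skewTransform]) (fun a b ha hb => by
        rw [map_add, LinearMap.add_apply, ha, hb, hadd', smul_add]) (fun e he b hb => ?_) b hb
    rw [h.skew_gr ha hb l, hd, he]

/-- For non-negative indices the commutator is a sum of `binom(m, n) C^n_{m+l-n}` over `n ≤ N`. -/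
theorem isLocalPair {d e : Deg} {a b : U} (ha : a ∈ 𝒰.gr d) (hb : b ∈ 𝒰.gr e) :
    IsLocalPair 𝒰 (par d) (par e) a b := by
  obtain ⟨N, C, -, hC⟩ := h.locality d e a ha b hb
  -- By Pascal's rule one application of `z - w` removes the term `n = 0` and shifts the remaining
  -- coefficients down by one.
  have key : ∀ (K : ℕ) (C : ℕ → ℤ → Module.End ℂ U), diagDiff^[K] (fun m l : ℕ =>
      ∑ n ∈ Finset.range K, (m.choose n : ℂ) • C n ((m : ℤ) + l - n)) = fun _ _ => 0 := by
    intro K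
    induction K with
    | zero => intro C; simp
    | succ K ih =>
      intro C
      rw [Function.iterate_succ_apply]
      refine Eq.trans (congrArg _ ?_) (ih (fun n k => C (n + 1) k))
      funext m l
      rw [diagDiff, ← Finset.sum_sub_distrib, Finset.sum_range_succ']
      have h0 : ∀ n, (((m + 1).choose n : ℕ) : ℂ) • C n (((m + 1 : ℕ) : ℤ) + l - n) -
          (m.choose n : ℂ) • C n ((m : ℤ) + ((l + 1 : ℕ) : ℤ) - n) =
          ((((m + 1).choose n : ℕ) : ℂ) - (m.choose n : ℂ)) • C n ((m : ℤ) + l + 1 - n) := by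
        intro n
        rw [sub_smul]
        congr 3
        all_goals push_cast; ring
      simp only [h0]
      simp only [Nat.choose_succ_succ, Nat.choose_zero_right, Nat.cast_add, Nat.cast_one,
        sub_self, zero_smul, add_zero, add_sub_cancel_right]
      refine Finset.sum_congr rfl fun n _ => ?_
      rw [show (m : ℤ) + l + 1 - (n + 1) = (m : ℤ) + l - n by ring]
  refine ⟨N + 1, ?_⟩
  have : modeComm 𝒰 (par d) (par e) a b = fun m l => LinearMap.lsmul ℂ (Module.End ℂ U)
      (sign (par d + 1)) ((fun m l : ℕ =>
        ∑ n ∈ Finset.range (N + 1), (m.choose n : ℂ) • C n ((m : ℤ) + (l : ℕ) - n)) m l) := by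
    funext m l
    have h1 := hC m l
    rw [if_neg (by omega), modePar_nat, modePar_nat, if_pos (by omega)] at h1
    change gradedComm (par d + 1) (par e + 1) (𝒰.Y m a) (𝒰.Y l b) = _
    rw [h1, LinearMap.lsmul_apply]
    congr 1
    refine Finset.sum_congr rfl fun n _ => ?_
    rw [if_pos (by omega), Ring.choose_natCast, natCast_zsmul, Nat.cast_smul_eq_nsmul]
  rw [this, diagDiff_iterate_map, key]
  simp

end IsRaviolo

end RavioloToPoisson


/-! ### From Poisson structures back to raviolo vertex algebras -/

section PoissonToRaviolo

variable {U : Type*} [AddCommGroup U] [Module ℂ U] {𝒰 : RavioloData U}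

namespace IsPoisson

variable (h : IsPoisson 𝒰)
include h

/-- Skew-symmetry moves `T` into the second argument, where covariance applies. -/
theorem mode_T_left (l : ℕ) (a v : U) :
    𝒰.Y l (𝒰.T a) v = -(l : ℂ) • 𝒰.Y ((l - 1 : ℕ) : ℤ) a v := by
  refine h.parity_induction (P := fun a => 𝒰.Y l (𝒰.T a) v =
    -(l : ℂ) • 𝒰.Y ((l - 1 : ℕ) : ℤ) a v) ?_ ?_ a
  · intro a b ha hb
    simp only [map_add, LinearMap.add_apply, ha, hb, smul_add]
  · intro p a ha
    refine h.parity_induction (P := fun v => 𝒰.Y l (𝒰.T a) v =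
      -(l : ℂ) • 𝒰.Y ((l - 1 : ℕ) : ℤ) a v) ?_ ?_ v
    · intro a b ha hb
      simp only [map_add, ha, hb, smul_add]
    · intro q v hv
      obtain ⟨N, hN⟩ := h.exists_bound v a
      rw [h.skew q p v _ hv (h.parity_T ha) l, h.skew q p v a hv ha]
      simp only [h.covariant v _ a]
      rw [skewTransform_T hN, smul_comm]

theorem mode_dpow_left (k l : ℕ) (a v : U) :
    𝒰.Y l (dpow 𝒰.T k a) v =
      ((-1 : ℂ) ^ k * (l.choose k : ℂ)) • 𝒰.Y ((l - k : ℕ) : ℤ) a v := by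
  induction k generalizing l with
  | zero => simp [dpow_zero]
  | succ k ih =>
    have hk : (k : ℂ) + 1 ≠ 0 := by exact_mod_cast k.succ_ne_zero
    rw [dpow_succ, map_smul, LinearMap.smul_apply, h.mode_T_left, ih, smul_smul, smul_smul,
      Nat.sub_sub, add_comm 1 k]
    congr 1
    cases l with
    | zero => simp
    | succ l =>
      have := Nat.add_one_mul_choose_eq l k
      have h2 : ((l : ℂ) + 1) * (l.choose k : ℂ) = ((l + 1).choose (k + 1) : ℂ) * (k + 1) := by
        exact_mod_cast this
      rw [Nat.add_sub_cancel, pow_succ]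
      field_simp
      push_cast
      linear_combination -h2

/-- The coefficient is `binom(-k-1, n)`, so this is the locality formula for a negative mode of `a`
against a non-negative mode of `b`, before passing to multiplication operators. -/
theorem mode_dpow_skew {p q : ZMod 2} {a b : U} (ha : HasParity 𝒰 p a) (hb : HasParity 𝒰 q b)
    (k l N : ℕ) (hN : ∀ n : ℕ, N ≤ n → 𝒰.Y n a b = 0) :
    𝒰.Y l b (dpow 𝒰.T k a) = sign (p * q) • ∑ n ∈ Finset.range N,
      if l ≤ n + k then ((-1 : ℂ) ^ n * ((n + k).choose k : ℂ)) • dpow 𝒰.T (n + k - l) (𝒰.Y n a b)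
      else 0 := by
  rw [h.skew p q _ b (h.parity_dpow ha k) hb]
  congr 1
  rw [skewTransform_eq (N := N + k) (fun n hn => by
    rw [h.mode_dpow_left, hN _ (by omega), smul_zero])]
  refine Finset.sum_bij_ne_zero (fun j _ _ => l + j - k) ?_ ?_ ?_ ?_
  · intro j hj h0
    by_contra hc
    rw [Finset.mem_range, not_lt] at hc
    exact h0 (by rw [h.mode_dpow_left, hN _ hc]; simp)
  · intro i hi h0 j hj h0' hij
    have h1 : k ≤ l + i := by
      by_contra hc
      exact h0 (by rw [h.mode_dpow_left, Nat.choose_eq_zero_of_lt (not_le.1 hc)]; simp)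
    have h2 : k ≤ l + j := by
      by_contra hc
      exact h0' (by rw [h.mode_dpow_left, Nat.choose_eq_zero_of_lt (not_le.1 hc)]; simp)
    omega
  · intro n hn h0
    rw [Finset.mem_range] at hn
    have h1 : l ≤ n + k := by by_contra hc; exact h0 (by simp [hc])
    refine ⟨n + k - l, by rw [Finset.mem_range]; omega, ?_, by omega⟩
    rw [if_pos h1] at h0
    rw [h.mode_dpow_left, show l + (n + k - l) = n + k by omega, Nat.add_sub_cancel]
    intro h0'
    apply h0
    rw [map_smul, smul_smul, smul_eq_zero] at h0'
    rcases h0' with h0' | h0'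
    · rw [mul_eq_zero, mul_eq_zero] at h0'
      rcases h0' with h0' | h0' | h0'
      · simp at h0'
      · simp at h0'
      · rw [h0']; simp
    · rw [h0', smul_zero]
  · intro j hj h0
    have h1 : k ≤ l + j := by
      by_contra hc
      exact h0 (by rw [h.mode_dpow_left, Nat.choose_eq_zero_of_lt (not_le.1 hc)]; simp)
    rw [if_pos (by omega), h.mode_dpow_left, map_smul, smul_smul, ← mul_assoc, ← pow_add,
      show l + j - k + k - l = j by omega, show l + j - k + k = l + j by omega]
    congr 2
    rw [show l + j + k = (l + j - k) + 2 * k by omega, pow_add, pow_mul]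
    simp

theorem diagDiff_modeComm_eventually {p q : ZMod 2} (a b v : U) (n m : ℕ) :
    ∃ K : ℕ, ∀ k, K ≤ k → (diagDiff^[n] (modeComm 𝒰 p q a b)) m k v = 0 := by
  induction n generalizing m with
  | zero =>
    obtain ⟨N₁, h₁⟩ := h.exists_bound b v
    obtain ⟨N₂, h₂⟩ := h.exists_bound b (𝒰.Y m a v)
    refine ⟨max N₁ N₂, fun k hk => ?_⟩
    simp only [Function.iterate_zero, id, modeComm, LinearMap.sub_apply, LinearMap.smul_apply,
      Module.End.mul_apply]
    rw [h₁ k (by omega), h₂ k (by omega)]; simp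
  | succ n ih =>
    obtain ⟨K₁, h₁⟩ := ih (m + 1)
    obtain ⟨K₂, h₂⟩ := ih m
    refine ⟨max K₁ K₂, fun k hk => ?_⟩
    rw [Function.iterate_succ_apply', diagDiff, LinearMap.sub_apply, h₁ k (by omega),
      h₂ (k + 1) (by omega), sub_zero]

/-- The cases are distinguished by the signs of the two indices. Two negative modes supercommute. In
the mixed cases the derivation property reduces the commutator to multiplication by a mode applied
to a divided derivative, computed by covariance or by skew-symmetry. For two non-negative modes the
Newton expansion of the commutator is finite. -/
theorem mutuallyLocal {p q : ZMod 2} {a b : U} (ha : HasParity 𝒰 p a) (hb : HasParity 𝒰 q b)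
    (hl : IsLocalPair 𝒰 p q a b) :
    MutuallyLocal p q (fun m => 𝒰.Y m a) (fun m => 𝒰.Y m b) := by
  obtain ⟨M, hM⟩ := hl
  obtain ⟨K, hK⟩ := h.exists_bound a b
  set N := max M K with hN
  -- The mixed cases force the negative modes of `C^n` to be those of `a_(n) b`. The non-negative
  -- modes enter only when both indices are non-negative, so they are free to be the Newton
  -- coefficients, with `sign (p + 1)` cancelling the prefactor of the locality formula.
  refine ⟨N, fun n k => if k < 0 then 𝒰.Y k (𝒰.Y n a b) else
    sign (p + 1) • (diagDiff^[n] (modeComm 𝒰 p q a b)) 0 k.toNat, ?_, ?_⟩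
  · intro n v
    obtain ⟨L, hL⟩ := h.diagDiff_modeComm_eventually (p := p) (q := q) a b v n 0
    refine ⟨L, fun m hm => ?_⟩
    beta_reduce
    rw [if_neg (by omega), LinearMap.smul_apply, hL _ (by omega), smul_zero]
  · intro m l
    beta_reduce
    by_cases hm : m < 0
    · obtain ⟨k, rfl⟩ : ∃ k : ℕ, m = -(k : ℤ) - 1 := ⟨(-m - 1).toNat, by omega⟩
      by_cases hl : l < 0
      · obtain ⟨j, rfl⟩ : ∃ k : ℕ, l = -(k : ℤ) - 1 := ⟨(-l - 1).toNat, by omega⟩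
        rw [if_pos ⟨hm, hl⟩, modePar_neg _ hm, modePar_neg _ hl, gradedComm, h.neg, h.neg]
        ext v
        rw [LinearMap.sub_apply, Module.End.mul_apply, LinearMap.smul_apply, Module.End.mul_apply,
          h.left_comm (h.parity_dpow ha k) (h.parity_dpow hb j), sub_self, LinearMap.zero_apply]
      · obtain ⟨j, rfl⟩ : ∃ k : ℕ, l = (k : ℤ) := ⟨l.toNat, by omega⟩
        rw [if_neg (by omega), if_pos (by omega), modePar_neg _ hm, modePar_nat, gradedComm, h.neg]
        have hcomm : 𝒰.Y (-1) (dpow 𝒰.T k a) * 𝒰.Y j b - sign (p * (q + 1)) •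
            (𝒰.Y j b * 𝒰.Y (-1) (dpow 𝒰.T k a)) =
            -sign (p * (q + 1)) • 𝒰.Y (-1) (𝒰.Y j b (dpow 𝒰.T k a)) := by
          ext v
          simp only [LinearMap.sub_apply, Module.End.mul_apply, LinearMap.smul_apply]
          rw [h.derivation q b hb p _ (h.parity_dpow ha k), smul_add, mul_comm (q + 1) p,
            sign_smul_smul]
          module
        rw [hcomm, h.mode_dpow_skew ha hb k j (N + 1) (fun n hn => hK n (by omega)), map_smul,
          map_sum, smul_smul]
        have hs : -sign (p * (q + 1)) * sign (p * q) = sign (p + 1) := by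
          rw [mul_add, mul_one, sign_add, sign_add_one]
          linear_combination -sign p * sign_mul_self (p * q)
        rw [hs]
        congr 1
        refine Finset.sum_congr rfl fun n _ => ?_
        by_cases hj : j ≤ n + k
        · rw [if_pos hj, if_pos (by omega), if_pos (by omega), ring_choose_neg,
            show -(k : ℤ) - 1 + j - n = -((n + k - j : ℕ) : ℤ) - 1 by omega, h.neg, map_smul,
            ← Int.cast_smul_eq_zsmul ℂ]
          push_cast
          rfl
        · rw [if_neg hj, if_neg (by omega), map_zero]
    · obtain ⟨k, rfl⟩ : ∃ k : ℕ, m = (k : ℤ) := ⟨m.toNat, by omega⟩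
      by_cases hl : l < 0
      · obtain ⟨j, rfl⟩ : ∃ k : ℕ, l = -(k : ℤ) - 1 := ⟨(-l - 1).toNat, by omega⟩
        rw [if_neg (by omega), if_neg (by omega), one_smul, modePar_neg _ hl, modePar_nat,
          gradedComm, h.neg]
        have hcomm : 𝒰.Y k a * 𝒰.Y (-1) (dpow 𝒰.T j b) - sign ((p + 1) * q) •
            (𝒰.Y (-1) (dpow 𝒰.T j b) * 𝒰.Y k a) = 𝒰.Y (-1) (𝒰.Y k a (dpow 𝒰.T j b)) := by
          ext v
          simp only [LinearMap.sub_apply, Module.End.mul_apply, LinearMap.smul_apply]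
          rw [h.derivation p a ha q _ (h.parity_dpow hb j), add_sub_cancel_right]
        rw [hcomm, mode_dpow_eq_sum_range (A := fun n : ℕ => 𝒰.Y n a) (h.covariant a) k j b (N + 1)
          (fun n hn => hK n (by omega)), map_sum]
        refine Finset.sum_congr rfl fun n _ => ?_
        by_cases hj : k ≤ n + j
        · rw [if_pos hj, if_pos (by omega), if_pos (by omega), Ring.choose_natCast, natCast_zsmul,
            ← Nat.cast_smul_eq_nsmul ℂ,
            show (k : ℤ) + (-j - 1) - n = -((n + j - k : ℕ) : ℤ) - 1 by omega, h.neg, map_smul]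
        · rw [if_neg hj, if_neg (by omega), map_zero]
      · obtain ⟨j, rfl⟩ : ∃ k : ℕ, l = (k : ℤ) := ⟨l.toNat, by omega⟩
        rw [if_neg (by omega), if_pos (by omega), modePar_nat, modePar_nat]
        change modeComm 𝒰 p q a b k j = _
        rw [newton_diagDiff (modeComm 𝒰 p q a b), Finset.smul_sum]
        -- The Newton sum stops at the index of the first mode and the locality sum at `N`. Outside
        -- the common range the terms vanish, by the order of the commutator or by the binomial
        -- coefficient.
        refine Finset.sum_congr_of_eq_on_inter ?_ ?_ ?_
        · intro n hn hn'
          rw [Finset.mem_range, not_lt] at hn'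
          rw [diagDiff_iterate_eq_zero_of_le (show M ≤ n by omega) hM, smul_zero]
        · intro n hn hn'
          rw [Finset.mem_range, not_lt] at hn'
          rw [if_pos (by omega), Ring.choose_natCast, Nat.choose_eq_zero_of_lt (by omega)]
          simp
        · intro n hn hn'
          rw [Finset.mem_range] at hn
          rw [if_pos (by omega), if_neg (by omega), Ring.choose_natCast, natCast_zsmul,
            ← Nat.cast_smul_eq_nsmul ℂ, smul_comm, sign_smul_smul,
            show ((k : ℤ) + j - n).toNat = k + j - n by omega]

theorem isRaviolo (grading : DirectSum.IsInternal 𝒰.gr)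
    (sgn_eq : ∀ d, ∀ a ∈ 𝒰.gr d, HasParity 𝒰 (par d) a) (vac_mem : 𝒰.vac ∈ 𝒰.gr (0, 0))
    (T_mem : ∀ d, ∀ a ∈ 𝒰.gr d, 𝒰.T a ∈ 𝒰.gr d)
    (mul_mem : ∀ d e, ∀ a ∈ 𝒰.gr d, ∀ b ∈ 𝒰.gr e, 𝒰.Y (-1) a b ∈ 𝒰.gr (d + e))
    (mode_mem : ∀ (m : ℕ) d e, ∀ a ∈ 𝒰.gr d, ∀ b ∈ 𝒰.gr e, 𝒰.Y m a b ∈ 𝒰.gr (d + e - (1, 0)))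
    (loc : ∀ d e, ∀ a ∈ 𝒰.gr d, ∀ b ∈ 𝒰.gr e, IsLocalPair 𝒰 (par d) (par e) a b) :
    IsRaviolo 𝒰 where
  grading := grading
  sgn_eq := sgn_eq
  vac_mem := vac_mem
  T_mem := T_mem
  Y_mem_neg m hm d e a ha b hb := by
    obtain ⟨k, rfl⟩ : ∃ k : ℕ, m = -(k : ℤ) - 1 := ⟨(-m - 1).toNat, by omega⟩
    rw [h.neg]
    refine mul_mem _ _ _ ?_ _ hb
    clear hm
    induction k with
    | zero => rwa [dpow_zero]
    | succ n ih => rw [dpow_succ]; exact Submodule.smul_mem _ _ (T_mem _ _ ih)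
  Y_mem_nonneg m hm := by
    obtain ⟨k, rfl⟩ : ∃ k : ℕ, m = (k : ℤ) := ⟨m.toNat, by omega⟩
    exact mode_mem k
  field := h.field
  translation m a b := by
    by_cases hm : m < 0
    · obtain ⟨k, rfl⟩ : ∃ k : ℕ, m = -(k : ℤ) - 1 := ⟨(-m - 1).toNat, by omega⟩
      rw [h.neg, h.T_mul, add_sub_cancel_right, T_dpow,
        show -(k : ℤ) - 1 - 1 = -((k + 1 : ℕ) : ℤ) - 1 by push_cast; ring, h.neg,
        ← Int.cast_smul_eq_zsmul ℂ, map_smul, LinearMap.smul_apply]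
      congr 1
      push_cast; ring
    · obtain ⟨k, rfl⟩ : ∃ k : ℕ, m = (k : ℤ) := ⟨m.toNat, by omega⟩
      rw [h.covariant, sub_add_cancel_left, ← Int.cast_smul_eq_zsmul ℂ]
      cases k with
      | zero => simp
      | succ k =>
        rw [Nat.add_sub_cancel, show ((k + 1 : ℕ) : ℤ) - 1 = k by push_cast; ring]
        push_cast
        rw [neg_smul]
  T_vac := h.T_vac
  Y_vac m a := by
    split_ifs with hm
    · rw [hm, h.vac_mul]
    · by_cases hm' : m < 0
      · obtain ⟨k, rfl⟩ : ∃ k : ℕ, m = -(k : ℤ) - 1 := ⟨(-m - 1).toNat, by omega⟩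
        rw [h.neg, dpow_of_T_eq_zero h.T_vac, if_neg (by omega)]; simp
      · obtain ⟨k, rfl⟩ : ∃ k : ℕ, m = (k : ℤ) := ⟨m.toNat, by omega⟩
        exact h.vac_mode k a
  Y_apply_vac m a hm := by
    obtain ⟨k, rfl⟩ : ∃ k : ℕ, m = (k : ℤ) := ⟨m.toNat, by omega⟩
    exact h.mode_vac k a
  Y_neg_one_vac := h.mul_vac
  locality d e a ha b hb := h.mutuallyLocal (sgn_eq d a ha) (sgn_eq e b hb) (loc d e a ha b hb)

end IsPoisson

end PoissonToRaviolo


/-! ### Locally finite sums and additivity of the Poisson properties -/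

theorem locSum_apply {α E F : Type*} [AddCommGroup E] [Module ℂ E] [AddCommGroup F] [Module ℂ F]
    {f : α → E →ₗ[ℂ] F} (h : ∀ x, (Function.support fun j => f j x).Finite) (x : E) :
    locSum f x = ∑ᶠ j, f j x := by
  rw [locSum, dif_pos h]; rfl

theorem locSum₂_apply {α E F G : Type*} [AddCommGroup E] [Module ℂ E] [AddCommGroup F] [Module ℂ F]
    [AddCommGroup G] [Module ℂ G] {f : α → E →ₗ[ℂ] F →ₗ[ℂ] G}
    (h : ∀ x y, (Function.support fun j => f j x y).Finite) (x : E) (y : F) :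
    locSum₂ f x y = ∑ᶠ j, f j x y := by
  rw [locSum₂, dif_pos h]; rfl

section ParityLemmas

variable {U : Type*} [AddCommGroup U] [Module ℂ U] {𝒰 : RavioloData U} {p q r : ZMod 2}
  {a b c : U}

theorem IsDerivation.add (ha : IsDerivation 𝒰 p a) (hb : IsDerivation 𝒰 p b) :
    IsDerivation 𝒰 p (a + b) := by
  intro q c hc m v
  simp only [map_add, LinearMap.add_apply, ha q c hc, hb q c hc, smul_add]
  abel

theorem IsCovariant.add (ha : IsCovariant 𝒰 a) (hb : IsCovariant 𝒰 b) : IsCovariant 𝒰 (a + b) := by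
  intro m v
  simp only [map_add, LinearMap.add_apply, ha m v, hb m v, smul_add]
  abel

theorem modeComm_add_left (m l : ℕ) :
    modeComm 𝒰 p q (a + b) c m l = modeComm 𝒰 p q a c m l + modeComm 𝒰 p q b c m l := by
  simp only [modeComm, map_add, add_mul, mul_add, smul_add]
  abel

theorem IsLocalPair.add_left (ha : IsLocalPair 𝒰 p q a c) (hb : IsLocalPair 𝒰 p q b c) :
    IsLocalPair 𝒰 p q (a + b) c := by
  obtain ⟨M, hM⟩ := ha
  obtain ⟨M', hM'⟩ := hb
  refine ⟨max M M', ?_⟩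
  have : modeComm 𝒰 p q (a + b) c =
      fun m l => modeComm 𝒰 p q a c m l + modeComm 𝒰 p q b c m l := by
    funext m l; exact modeComm_add_left m l
  rw [this, diagDiff_iterate_add, diagDiff_iterate_eq_zero_of_le (le_max_left _ _) hM,
    diagDiff_iterate_eq_zero_of_le (le_max_right _ _) hM']
  simp

theorem IsLocalPair.zero_left : IsLocalPair 𝒰 p q 0 c := by
  refine ⟨0, ?_⟩
  funext m l
  simp [modeComm]

theorem IsLocalPair.smul_left (ha : IsLocalPair 𝒰 p q a c) (t : ℂ) :
    IsLocalPair 𝒰 p q (t • a) c := by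
  obtain ⟨M, hM⟩ := ha
  refine ⟨M, ?_⟩
  have : modeComm 𝒰 p q (t • a) c =
      fun m l => LinearMap.lsmul ℂ (Module.End ℂ U) t (modeComm 𝒰 p q a c m l) := by
    funext m l
    simp only [modeComm, map_smul, smul_mul_assoc, mul_smul_comm, LinearMap.lsmul_apply, smul_sub]
    rw [smul_comm t]
  rw [this, diagDiff_iterate_map, hM]
  simp

namespace IsCommutative

variable (h : IsCommutative 𝒰)
include h

theorem isSkew_add_left (ha : IsSkew 𝒰 p q a c) (hb : IsSkew 𝒰 p q b c) :
    IsSkew 𝒰 p q (a + b) c := by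
  intro l
  obtain ⟨N₁, h₁⟩ := h.exists_bound a c
  obtain ⟨N₂, h₂⟩ := h.exists_bound b c
  have := skewTransform_add (T := 𝒰.T) (N := max N₁ N₂)
    (fun n hn => h₁ n (by omega)) (fun n hn => h₂ n (by omega)) 1 1 l
  simp only [one_smul] at this
  simp only [map_add, LinearMap.add_apply]
  rw [this, smul_add, ha l, hb l]

end IsCommutative

end ParityLemmas

/-! ### Tensor products: modes and the commutative product -/

section TensorPoisson

variable {V W : Type*} [AddCommGroup V] [Module ℂ V] [AddCommGroup W] [Module ℂ W]
  {𝒱 : RavioloData V} {𝒲 : RavioloData W}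

/-- The two summands of `koszul` project `x` onto its even and its odd part, and the odd part comes
with the parity operator on `b`. -/
theorem koszul_apply {p q : ZMod 2} {b : V} {x : W} (hx : HasParity 𝒲 p x) (hb : HasParity 𝒱 q b)
    (α : V →ₗ[ℂ] V →ₗ[ℂ] V) (β : W →ₗ[ℂ] W →ₗ[ℂ] W) (a : V) (y : W) :
    koszul 𝒱 𝒲 α β (a ⊗ₜ x) (b ⊗ₜ y) = sign (p * q) • (α a b ⊗ₜ[ℂ] β x y) := by
  simp only [koszul, LinearMap.add_apply, TensorProduct.map₂_apply_tmul, TensorProduct.map_tmul,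
    LinearMap.comp_apply, LinearMap.smul_apply, LinearMap.sub_apply, LinearMap.id_apply,
    LinearMap.compl₂_apply]
  rw [hx, hb]
  rcases zmod_two_cases p with rfl | rfl
  · simp only [sign_zero, one_smul, sub_self, smul_zero, map_zero, LinearMap.zero_apply,
      TensorProduct.tmul_zero, add_zero, zero_mul, ← two_smul ℂ x]
    rw [smul_smul]; norm_num
  · simp only [sign_one, neg_smul, one_smul, add_neg_cancel, sub_neg_eq_add, smul_zero, map_zero,
      LinearMap.zero_apply, TensorProduct.tmul_zero, zero_add, one_mul, ← two_smul ℂ x]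
    rw [smul_smul, map_smul, TensorProduct.smul_tmul']
    norm_num

variable (hV : IsPoisson 𝒱) (hW : IsPoisson 𝒲)
include hV hW

theorem tensor_induction {P : V ⊗[ℂ] W → Prop} (hadd : ∀ x y, P x → P y → P (x + y))
    (hP : ∀ p q a x, HasParity 𝒱 p a → HasParity 𝒲 q x → P (a ⊗ₜ x)) (X : V ⊗[ℂ] W) : P X := by
  induction X with
  | zero => simpa using hP 0 0 0 0 HasParity.zero HasParity.zero
  | tmul a x =>
    obtain ⟨a₀, a₁, rfl, h₀, h₁⟩ := hV.exists_parity_decomp a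
    obtain ⟨x₀, x₁, rfl, k₀, k₁⟩ := hW.exists_parity_decomp x
    simp only [TensorProduct.add_tmul, TensorProduct.tmul_add]
    exact hadd _ _ (hadd _ _ (hP _ _ _ _ h₀ k₀) (hP _ _ _ _ h₁ k₀))
      (hadd _ _ (hP _ _ _ _ h₀ k₁) (hP _ _ _ _ h₁ k₁))
  | add X Y hX hY => exact hadd X Y hX hY

omit hV hW in
theorem parity_tmul {p q : ZMod 2} {a : V} {x : W} (ha : HasParity 𝒱 p a) (hx : HasParity 𝒲 q x) :
    HasParity (tensor 𝒱 𝒲) (p + q) (a ⊗ₜ x) := by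
  change TensorProduct.map 𝒱.sgn 𝒲.sgn (a ⊗ₜ x) = _
  rw [TensorProduct.map_tmul, ha, hx, TensorProduct.smul_tmul_smul, sign_add]

theorem tensor_parity_induction {r : ZMod 2} {P : V ⊗[ℂ] W → Prop} (h0 : P 0)
    (hadd : ∀ x y, P x → P y → P (x + y))
    (hP : ∀ p q a x, p + q = r → HasParity 𝒱 p a → HasParity 𝒲 q x → P (a ⊗ₜ x))
    (X : V ⊗[ℂ] W) (hX : HasParity (tensor 𝒱 𝒲) r X) : P X := by
  have key : ∀ X, P ((1 / 2 : ℂ) • (X + sign r • (tensor 𝒱 𝒲).sgn X)) := by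
    refine tensor_induction hV hW ?_ ?_
    · intro a b ha hb
      convert hadd _ _ ha hb using 1
      simp only [map_add]; module
    · intro p q a x ha hx
      rw [parity_tmul ha hx]
      by_cases hd : p + q = r
      · rw [hd, sign_smul_smul]
        convert hP p q a x hd ha hx using 1
        module
      · have : sign r * sign (p + q) = -1 := by
          rcases zmod_two_cases r with rfl | rfl <;>
            rcases zmod_two_cases (p + q) with h' | h' <;> simp_all [sign_zero, sign_one]
        rw [smul_smul, this]
        simpa using h0
  have := key X
  rw [hX, sign_smul_smul] at this
  convert this using 1
  module

omit hV hW in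
theorem tensor_mul {p q : ZMod 2} {b : V} {x : W} (hx : HasParity 𝒲 p x) (hb : HasParity 𝒱 q b)
    (a : V) (y : W) : (tensor 𝒱 𝒲).Y (-1) (a ⊗ₜ x) (b ⊗ₜ y) =
      sign (p * q) • (𝒱.Y (-1) a b ⊗ₜ[ℂ] 𝒲.Y (-1) x y) := by
  have : (tensor 𝒱 𝒲).Y (-1) = koszul 𝒱 𝒲 (𝒱.Y (-1)) (𝒲.Y (-1)) := by
    simp [tensor]
  rw [this, koszul_apply hx hb]

theorem tensor_finite (m : ℕ) (X Y : V ⊗[ℂ] W) : (Function.support fun n : ℕ =>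
    (koszul 𝒱 𝒲 ((𝒱.Y (-n - 1) ∘ₗ 𝒱.sgn).compl₂ 𝒱.sgn) (𝒲.Y ((m : ℤ) + n)) +
      koszul 𝒱 𝒲 (𝒱.Y ((m : ℤ) + n)) (𝒲.Y (-n - 1))) X Y).Finite := by
  revert X Y
  refine tensor_induction hV hW (fun X X' hX hX' Y => ?_) (fun r p a x ha hx => ?_)
  · refine ((hX Y).union (hX' Y)).subset fun n hn => ?_
    by_contra hc
    simp only [Set.mem_union, Function.mem_support, not_or, not_not] at hc
    exact hn (by beta_reduce; rw [map_add, LinearMap.add_apply, hc.1, hc.2, add_zero])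
  refine tensor_induction hV hW (fun X X' hX hX' => ?_) (fun q s b y hb hy => ?_)
  · refine (hX.union hX').subset fun n hn => ?_
    by_contra hc
    simp only [Set.mem_union, Function.mem_support, not_or, not_not] at hc
    exact hn (by beta_reduce; rw [map_add, hc.1, hc.2, add_zero])
  · obtain ⟨N₁, h₁⟩ := hV.exists_bound a b
    obtain ⟨N₂, h₂⟩ := hW.exists_bound x y
    refine finite_support_of_eventually (max N₁ N₂) fun n hn => ?_
    rw [LinearMap.add_apply, LinearMap.add_apply, koszul_apply hx hb, koszul_apply hx hb,
      show (m : ℤ) + n = ((m + n : ℕ) : ℤ) by push_cast; ring, h₁ _ (by omega), h₂ _ (by omega)]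
    simp

/-- The extra `r + q` in the first sign comes from moving the odd coefficient Ω of the field of `x`
past the mode of `a` and past `b`. -/
theorem tensor_mode {r p q : ZMod 2} {a b : V} {x : W} (ha : HasParity 𝒱 r a)
    (hx : HasParity 𝒲 p x) (hb : HasParity 𝒱 q b) (y : W) (m : ℕ) :
    (tensor 𝒱 𝒲).Y m (a ⊗ₜ x) (b ⊗ₜ y) = ∑ᶠ n : ℕ,
      (sign (p * q + r + q) • (𝒱.Y (-1) (dpow 𝒱.T n a) b ⊗ₜ[ℂ] 𝒲.Y ((m + n : ℕ) : ℤ) x y) +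
        sign (p * q) • (𝒱.Y ((m + n : ℕ) : ℤ) a b ⊗ₜ[ℂ] 𝒲.Y (-1) (dpow 𝒲.T n x) y)) := by
  have : (tensor 𝒱 𝒲).Y m = locSum₂ fun n : ℕ =>
      koszul 𝒱 𝒲 ((𝒱.Y (-n - 1) ∘ₗ 𝒱.sgn).compl₂ 𝒱.sgn) (𝒲.Y ((m : ℤ) + n)) +
      koszul 𝒱 𝒲 (𝒱.Y ((m : ℤ) + n)) (𝒲.Y (-n - 1)) := by
    simp only [tensor, if_neg (show ¬ (m : ℤ) < 0 by omega)]
  rw [this, locSum₂_apply (tensor_finite hV hW m)]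
  refine finsum_congr fun n => ?_
  rw [LinearMap.add_apply, LinearMap.add_apply, koszul_apply hx hb, koszul_apply hx hb,
    LinearMap.compl₂_apply, LinearMap.comp_apply,
    hV.neg, hW.neg, show (m : ℤ) + n = ((m + n : ℕ) : ℤ) by push_cast; ring]
  congr 1
  rw [ha, hb]
  simp only [map_smul, LinearMap.smul_apply, TensorProduct.smul_tmul', smul_smul, sign_add]
  congr 1
  ring_nf

theorem tensor_inl_mode (a b : V) (y : W) (m : ℕ) :
    (tensor 𝒱 𝒲).Y m (a ⊗ₜ 𝒲.vac) (b ⊗ₜ y) = 𝒱.Y m a b ⊗ₜ[ℂ] y := by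
  revert a b
  refine hV.parity_induction (fun a a' h h' b => by
    rw [TensorProduct.add_tmul]
    simp only [map_add, LinearMap.add_apply, h, h', TensorProduct.add_tmul]) (fun r a ha => ?_)
  refine hV.parity_induction (fun b b' h h' => by
    simp only [map_add, TensorProduct.add_tmul, h, h']) (fun q b hb => ?_)
  rw [tensor_mode hV hW ha hW.parity_vac hb, finsum_eq_single _ 0]
  · simp [hW.vac_mode, dpow_zero, hW.vac_mul, sign_zero]
  · intro n hn
    rw [dpow_of_T_eq_zero hW.T_vac, if_neg hn, hW.vac_mode]
    simp

/-- The sign has `p + 1` because a non-negative mode of `x` has the opposite parity to `x`. -/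
theorem tensor_inr_mode {p q : ZMod 2} {b : V} {x : W} (hx : HasParity 𝒲 p x)
    (hb : HasParity 𝒱 q b) (y : W) (m : ℕ) :
    (tensor 𝒱 𝒲).Y m (𝒱.vac ⊗ₜ x) (b ⊗ₜ y) = sign ((p + 1) * q) • (b ⊗ₜ[ℂ] 𝒲.Y m x y) := by
  rw [tensor_mode hV hW hV.parity_vac hx hb, finsum_eq_single _ 0]
  · simp only [hV.vac_mode, dpow_zero, hV.vac_mul, add_zero, TensorProduct.zero_tmul, smul_zero]
    rw [add_mul, one_mul]
  · intro n hn
    rw [dpow_of_T_eq_zero hV.T_vac, if_neg hn, hV.vac_mode]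
    simp

omit hV hW in
theorem tensor_T_tmul (a : V) (x : W) :
    (tensor 𝒱 𝒲).T (a ⊗ₜ x) = 𝒱.T a ⊗ₜ x + a ⊗ₜ 𝒲.T x := by
  simp [tensor]

omit hV hW in
theorem tensor_dpow_tmul (n : ℕ) (a : V) (x : W) :
    dpow (tensor 𝒱 𝒲).T n (a ⊗ₜ x) =
      ∑ i ∈ antidiagonal n, dpow 𝒱.T i.1 a ⊗ₜ dpow 𝒲.T i.2 x :=
  dpow_bilin (TensorProduct.mk ℂ V W) (fun a x => tensor_T_tmul a x) n a x

omit hV in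
theorem tensor_dpow_inl (n : ℕ) (a : V) :
    dpow (tensor 𝒱 𝒲).T n (a ⊗ₜ 𝒲.vac) = dpow 𝒱.T n a ⊗ₜ 𝒲.vac := by
  have := dpow_map (T := 𝒱.T) (S := (tensor 𝒱 𝒲).T) ((TensorProduct.mk ℂ V W).flip 𝒲.vac)
    (fun x => by simp [tensor_T_tmul, hW.T_vac]) n a
  simpa using this.symm

omit hW in
theorem tensor_dpow_inr (n : ℕ) (x : W) :
    dpow (tensor 𝒱 𝒲).T n (𝒱.vac ⊗ₜ x) = 𝒱.vac ⊗ₜ dpow 𝒲.T n x := by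
  have := dpow_map (T := 𝒲.T) (S := (tensor 𝒱 𝒲).T) (TensorProduct.mk ℂ V W 𝒱.vac)
    (fun x => by simp [tensor_T_tmul, hV.T_vac]) n x
  simpa using this.symm

/-- This factorization reduces every property of the tensor product to vectors from one factor,
whose modes act on that factor alone. -/
theorem tensor_mul_inl_inr (a : V) (x : W) :
    (tensor 𝒱 𝒲).Y (-1) (a ⊗ₜ 𝒲.vac) (𝒱.vac ⊗ₜ x) = a ⊗ₜ x := by
  rw [tensor_mul hW.parity_vac hV.parity_vac, hV.mul_vac, hW.vac_mul, mul_zero, sign_zero, one_smul]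

theorem tensor_isCommutative : IsCommutative (tensor 𝒱 𝒲) where
  sgn_sgn := tensor_induction hV hW (fun X Y hX hY => by simp only [map_add, hX, hY])
    (fun p q a x ha hx => by
      rw [parity_tmul ha hx, map_smul, parity_tmul ha hx, sign_smul_smul])
  sgn_vac := by
    change TensorProduct.map 𝒱.sgn 𝒲.sgn (𝒱.vac ⊗ₜ 𝒲.vac) = 𝒱.vac ⊗ₜ 𝒲.vac
    rw [TensorProduct.map_tmul, hV.sgn_vac, hW.sgn_vac]
  sgn_T := tensor_induction hV hW (fun X Y hX hY => by simp only [map_add, hX, hY])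
    (fun p q a x ha hx => by
      rw [parity_tmul ha hx, map_smul, tensor_T_tmul, map_add, parity_tmul (hV.parity_T ha) hx,
        parity_tmul ha (hW.parity_T hx), smul_add])
  sgn_mul := tensor_induction hV hW
    (fun X X' hX hX' Y => by simp only [map_add, LinearMap.add_apply, hX, hX'])
    (fun r p a x ha hx => tensor_induction hV hW
      (fun X X' hX hX' => by simp only [map_add, hX, hX'])
      (fun q s b y hb hy => by
        rw [parity_tmul ha hx, parity_tmul hb hy, tensor_mul hx hb, map_smul,
          parity_tmul (hV.parity_mul ha hb) (hW.parity_mul hx hy), map_smul, map_smul,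
          LinearMap.smul_apply, tensor_mul hx hb]
        simp only [smul_smul, sign_add]
        congr 1; ring_nf))
  sgn_mode m := tensor_induction hV hW
    (fun X X' hX hX' Y => by simp only [map_add, LinearMap.add_apply, hX, hX', neg_add])
    (fun r p a x ha hx => tensor_induction hV hW
      (fun X X' hX hX' => by simp only [map_add, hX, hX', neg_add])
      (fun q s b y hb hy => by
        obtain ⟨N₁, h₁⟩ := hV.exists_bound a b
        obtain ⟨N₂, h₂⟩ := hW.exists_bound x y
        rw [parity_tmul ha hx, parity_tmul hb hy, map_smul, map_smul,
          LinearMap.smul_apply, tensor_mode hV hW ha hx hb,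
          finsum_eq_sum_range (max N₁ N₂) (fun n hn => by
            rw [h₁ _ (by omega), h₂ _ (by omega)]; simp), map_sum, Finset.smul_sum,
          Finset.smul_sum, ← Finset.sum_neg_distrib]
        refine Finset.sum_congr rfl fun n _ => ?_
        rw [map_add, map_smul, map_smul,
          parity_tmul (hV.parity_mul (hV.parity_dpow ha n) hb) (hW.parity_mode hx hy _),
          parity_tmul (hV.parity_mode ha hb _) (hW.parity_mul (hW.parity_dpow hx n) hy)]
        simp only [smul_add, smul_smul, sign_add, sign_one, neg_add, ← neg_smul]
        congr 2 <;> ring_nf))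
  field := by
    refine tensor_induction hV hW (fun X X' hX hX' Y => ?_) (fun r p a x ha hx => ?_)
    · obtain ⟨N, hN⟩ := hX Y
      obtain ⟨N', hN'⟩ := hX' Y
      refine ⟨max N N', fun m hm => ?_⟩
      have h1 := hN m (by omega)
      have h2 := hN' m (by omega)
      beta_reduce at h1 h2 ⊢
      rw [map_add, LinearMap.add_apply, h1, h2, add_zero]
    refine tensor_induction hV hW (fun X X' hX hX' => ?_) (fun q s b y hb hy => ?_)
    · obtain ⟨N, hN⟩ := hX
      obtain ⟨N', hN'⟩ := hX'
      refine ⟨max N N', fun m hm => ?_⟩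
      rw [map_add, hN m (by omega), hN' m (by omega), add_zero]
    · obtain ⟨N₁, h₁⟩ := hV.exists_bound a b
      obtain ⟨N₂, h₂⟩ := hW.exists_bound x y
      refine ⟨max N₁ N₂, fun m hm => ?_⟩
      obtain ⟨k, rfl⟩ : ∃ k : ℕ, m = (k : ℤ) := ⟨m.toNat, by omega⟩
      beta_reduce
      rw [tensor_mode hV hW ha hx hb]
      refine finsum_eq_zero_of_forall_eq_zero fun n => ?_
      rw [h₁ _ (by omega), h₂ _ (by omega)]; simp
  T_vac := by
    change (tensor 𝒱 𝒲).T (𝒱.vac ⊗ₜ 𝒲.vac) = 0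
    rw [tensor_T_tmul, hV.T_vac, hW.T_vac]; simp
  T_mul := tensor_induction hV hW
    (fun X X' hX hX' Y => by simp only [map_add, LinearMap.add_apply, hX, hX']; abel)
    (fun r p a x ha hx => tensor_induction hV hW
      (fun X X' hX hX' => by simp only [map_add, hX, hX']; abel)
      (fun q s b y hb hy => by
        simp only [tensor_T_tmul, map_add, LinearMap.add_apply]
        rw [tensor_mul hx hb, tensor_mul hx hb, tensor_mul (hW.parity_T hx) hb,
          tensor_mul hx (hV.parity_T hb), tensor_mul hx hb, map_smul, tensor_T_tmul, hV.T_mul,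
          hW.T_mul]
        simp only [TensorProduct.add_tmul, TensorProduct.tmul_add, smul_add]
        abel))
  neg n X := by
    -- The index `-n - 1` splits as `-i - 1` and `-j - 1` with `i + j = n`, which matches the
    -- Leibniz rule for divided powers of the total translation.
    have hn : (tensor 𝒱 𝒲).Y (-(n : ℤ) - 1) =
        ∑ i ∈ antidiagonal n, koszul 𝒱 𝒲 (𝒱.Y (-(i.1 : ℤ) - 1)) (𝒲.Y (-(i.2 : ℤ) - 1)) := by
      change (if (-(n : ℤ) - 1) < 0 then _ else _) = _
      rw [if_pos (by omega)]
      refine Finset.sum_nbij' (fun m => ((-m - 1).toNat, (n + m + 1).toNat))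
        (fun i => -(i.1 : ℤ) - 1) ?_ ?_ ?_ ?_ ?_
      · intro m hm
        simp only [Finset.mem_Icc, Finset.HasAntidiagonal.mem_antidiagonal] at hm ⊢
        omega
      · rintro ⟨i, j⟩ hi
        simp only [Finset.mem_Icc, Finset.HasAntidiagonal.mem_antidiagonal] at hi ⊢
        omega
      · intro m hm
        simp only [Finset.mem_Icc] at hm ⊢
        omega
      · rintro ⟨i, j⟩ hi
        simp only [Finset.HasAntidiagonal.mem_antidiagonal, Prod.mk.injEq] at hi ⊢
        omega
      · intro m hm
        simp only [Finset.mem_Icc] at hm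
        congr 2 <;> omega
    suffices h : ∀ X Y, (tensor 𝒱 𝒲).Y (-(n : ℤ) - 1) X Y =
        (tensor 𝒱 𝒲).Y (-1) (dpow (tensor 𝒱 𝒲).T n X) Y from LinearMap.ext (h X)
    refine tensor_induction hV hW
      (fun X X' hX hX' Y => by simp only [map_add, LinearMap.add_apply, hX, hX'])
      (fun r p a x ha hx => tensor_induction hV hW
        (fun X X' hX hX' => by simp only [map_add, hX, hX']) (fun q s b y hb hy => ?_))
    rw [hn, tensor_dpow_tmul, map_sum, LinearMap.sum_apply, LinearMap.sum_apply,
      LinearMap.sum_apply]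
    refine Finset.sum_congr rfl fun i _ => ?_
    rw [koszul_apply hx hb, hV.neg, hW.neg, tensor_mul (hW.parity_dpow hx _) hb]
  vac_mul := tensor_induction hV hW (fun X Y hX hY => by rw [map_add, hX, hY])
    (fun q s b y hb hy => by
      change (tensor 𝒱 𝒲).Y (-1) (𝒱.vac ⊗ₜ 𝒲.vac) (b ⊗ₜ y) = _
      rw [tensor_mul hW.parity_vac hb, hV.vac_mul, hW.vac_mul, zero_mul, sign_zero, one_smul])
  vac_mode m := tensor_induction hV hW (fun X Y hX hY => by rw [map_add, hX, hY, add_zero])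
    (fun q s b y hb hy => by
      change (tensor 𝒱 𝒲).Y m (𝒱.vac ⊗ₜ 𝒲.vac) (b ⊗ₜ y) = _
      rw [tensor_inl_mode hV hW, hV.vac_mode, TensorProduct.zero_tmul])
  mode_vac m := tensor_induction hV hW
    (fun X Y hX hY => by rw [map_add, LinearMap.add_apply, hX, hY, add_zero])
    (fun q s b y hb hy => by
      change (tensor 𝒱 𝒲).Y m (b ⊗ₜ y) (𝒱.vac ⊗ₜ 𝒲.vac) = _
      rw [tensor_mode hV hW hb hy hV.parity_vac]
      refine finsum_eq_zero_of_forall_eq_zero fun n => ?_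
      rw [hV.mode_vac, hW.mode_vac]; simp)
  comm P Q X Y hX hY := by
    refine tensor_parity_induction hV hW (P := fun X => (tensor 𝒱 𝒲).Y (-1) X Y =
      sign (P * Q) • (tensor 𝒱 𝒲).Y (-1) Y X) (by simp)
      (fun X X' h h' => by simp only [map_add, LinearMap.add_apply, h, h', smul_add])
      (fun r p a x hrp ha hx => ?_) X hX
    refine tensor_parity_induction hV hW (P := fun Y => (tensor 𝒱 𝒲).Y (-1) (a ⊗ₜ x) Y =
      sign (P * Q) • (tensor 𝒱 𝒲).Y (-1) Y (a ⊗ₜ x)) (by simp)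
      (fun X X' h h' => by simp only [map_add, LinearMap.add_apply, h, h', smul_add])
      (fun q s b y hqs hb hy => ?_) Y hY
    subst hrp hqs
    rw [tensor_mul hx hb, tensor_mul hy ha, hV.comm _ _ a b ha hb, hW.comm _ _ x y hx hy,
      TensorProduct.smul_tmul_smul, smul_smul, smul_smul]
    simp only [← sign_add]
    congr 2
    have h2 : (2 : ZMod 2) = 0 := rfl
    linear_combination -(s * r) * h2
  assoc := tensor_induction hV hW
    (fun X X' hX hX' Y Z => by simp only [map_add, LinearMap.add_apply, hX, hX'])
    (fun r p a x ha hx => tensor_induction hV hW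
      (fun X X' hX hX' Z => by simp only [map_add, LinearMap.add_apply, hX, hX'])
      (fun q s b y hb hy => tensor_induction hV hW
        (fun X X' hX hX' => by simp only [map_add, hX, hX'])
        (fun t u c z hc hz => by
          rw [tensor_mul hx hb, tensor_mul hy hc, map_smul, LinearMap.smul_apply, map_smul,
            tensor_mul (hW.parity_mul hx hy) hc, tensor_mul hx (hV.parity_mul hb hc), hV.assoc,
            hW.assoc, smul_smul, smul_smul]
          simp only [← sign_add]
          congr 2; ring_nf)))

end TensorPoisson


/-- The commutators of the non-negative modes of homogeneous vectors have finite order on the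
diagonal. -/
def IsLocal {U : Type*} [AddCommGroup U] [Module ℂ U] (𝒰 : RavioloData U) : Prop :=
  ∀ p q a b, HasParity 𝒰 p a → HasParity 𝒰 q b → IsLocalPair 𝒰 p q a b

theorem IsRaviolo.isLocal {U : Type*} [AddCommGroup U] [Module ℂ U] {𝒰 : RavioloData U}
    (h : IsRaviolo 𝒰) : IsLocal 𝒰 := by
  intro p q a b ha hb
  refine h.parity_gr_induction (P := fun a => IsLocalPair 𝒰 p q a b) IsLocalPair.zero_left
    (fun _ _ h h' => h.add_left h') (fun d hd a ha => ?_) a ha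
  apply h.isCommutative.isLocalPair_symm
  refine h.parity_gr_induction (P := fun b => IsLocalPair 𝒰 q p b a) IsLocalPair.zero_left
    (fun _ _ h h' => h.add_left h') (fun e he b hb => ?_) b hb
  rw [← hd, ← he]
  exact h.isLocalPair hb ha

theorem skewTransform_map {E F : Type*} [AddCommGroup E] [Module ℂ E] [AddCommGroup F] [Module ℂ F]
    {T : E →ₗ[ℂ] E} {S : F →ₗ[ℂ] F} (φ : E →ₗ[ℂ] F) (h : ∀ x, φ (T x) = S (φ x)) {f : ℕ → E} {N : ℕ}
    (hf : ∀ n, N ≤ n → f n = 0) (l : ℕ) :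
    skewTransform S (fun n => φ (f n)) l = φ (skewTransform T f l) := by
  rw [skewTransform_eq hf, skewTransform_eq (N := N) (fun n hn => by rw [hf n hn, map_zero]),
    map_sum]
  refine Finset.sum_congr rfl fun j _ => ?_
  rw [map_smul, dpow_map φ h]

theorem skewTransform_zero {E : Type*} [AddCommGroup E] [Module ℂ E] (T : E →ₗ[ℂ] E) (l : ℕ) :
    skewTransform T (fun _ => 0) l = 0 := by
  simp [skewTransform]

/-! ### Tensor products: derivations, skew-symmetry and locality -/

section TensorPoisson

variable {V W : Type*} [AddCommGroup V] [Module ℂ V] [AddCommGroup W] [Module ℂ W]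
  {𝒱 : RavioloData V} {𝒲 : RavioloData W}

variable (hV : IsPoisson 𝒱) (hW : IsPoisson 𝒲)
include hV hW

/-- The definition of the product field is already a Wick sum over the two factors, since a vacuum
factor is only multiplied by. It is proved directly, without skew-symmetry, so that the closure
lemmas for products are available to establish the other properties. -/
theorem tensor_isWick {r p : ZMod 2} {a : V} {x : W} (ha : HasParity 𝒱 r a)
    (hx : HasParity 𝒲 p x) :
    IsWick (tensor 𝒱 𝒲) r p (a ⊗ₜ 𝒲.vac) (𝒱.vac ⊗ₜ x) := by
  have hC := tensor_isCommutative hV hW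
  intro m
  rw [tensor_mul_inl_inr hV hW]
  have hbound : ∀ X v, ∃ N : ℕ, ∀ n, N ≤ n → (tensor 𝒱 𝒲).Y n X v = 0 := hC.exists_bound
  refine tensor_induction hV hW (fun v w hv hw => ?_) (fun q s b y hb hy => ?_)
  · have key : ∀ A X, wickSum (tensor 𝒱 𝒲).T ((tensor 𝒱 𝒲).Y (-1)) A
          (fun k : ℕ => (tensor 𝒱 𝒲).Y k X (v + w)) m =
        wickSum (tensor 𝒱 𝒲).T ((tensor 𝒱 𝒲).Y (-1)) A
          (fun k : ℕ => (tensor 𝒱 𝒲).Y k X v) m +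
        wickSum (tensor 𝒱 𝒲).T ((tensor 𝒱 𝒲).Y (-1)) A
          (fun k : ℕ => (tensor 𝒱 𝒲).Y k X w) m := by
      intro A X
      obtain ⟨N₁, h₁⟩ := hC.exists_bound X v
      obtain ⟨N₂, h₂⟩ := hC.exists_bound X w
      set N := max N₁ N₂
      rw [wickSum_eq (N := N) (fun n hn => h₁ n (by omega)),
        wickSum_eq (N := N) (fun n hn => h₂ n (by omega)),
        wickSum_eq (N := N) (fun n hn => by rw [map_add, h₁ n (by omega), h₂ n (by omega),
          add_zero]), ← Finset.sum_add_distrib]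
      simp only [map_add]
    rw [map_add, hv, hw, key, key]
    simp only [smul_add]; abel
  · obtain ⟨N₁, h₁⟩ := hV.exists_bound a b
    obtain ⟨N₂, h₂⟩ := hW.exists_bound x y
    set N := max N₁ N₂
    rw [tensor_mode hV hW ha hx hb, finsum_eq_sum_range N (fun n hn => by
        rw [h₁ _ (by omega), h₂ _ (by omega)]; simp)]
    simp only [tensor_inl_mode hV hW, tensor_inr_mode hV hW hx hb]
    rw [wickSum_eq (N := N) (fun n hn => by rw [h₂ n (by omega)]; simp),
      wickSum_eq (N := N) (fun n hn => by rw [h₁ n (by omega)]; simp), Finset.smul_sum,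
      Finset.smul_sum, ← Finset.sum_add_distrib]
    refine Finset.sum_congr rfl fun i _ => ?_
    rw [tensor_dpow_inl hW, tensor_dpow_inr hV, map_smul, tensor_mul hW.parity_vac hb,
      tensor_mul (hW.parity_dpow hx i) (hV.parity_mode ha hb _), hV.vac_mul, hW.vac_mul]
    simp only [smul_smul, ← sign_add]
    have h2 : (2 : ZMod 2) = 0 := rfl
    congr 3
    · ring
    · linear_combination -(p * r + p) * h2

theorem tensor_inl_isDerivation {r : ZMod 2} {a : V} (ha : HasParity 𝒱 r a) :
    IsDerivation (tensor 𝒱 𝒲) r (a ⊗ₜ 𝒲.vac) := by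
  intro Q X hX m
  refine tensor_parity_induction hV hW (P := fun X => ∀ Z, (tensor 𝒱 𝒲).Y m (a ⊗ₜ 𝒲.vac)
      ((tensor 𝒱 𝒲).Y (-1) X Z) = (tensor 𝒱 𝒲).Y (-1) ((tensor 𝒱 𝒲).Y m (a ⊗ₜ 𝒲.vac) X) Z +
      sign ((r + 1) * Q) • (tensor 𝒱 𝒲).Y (-1) X ((tensor 𝒱 𝒲).Y m (a ⊗ₜ 𝒲.vac) Z)) (by simp)
      (fun X X' h h' Z => by simp only [map_add, LinearMap.add_apply, h, h', smul_add]; abel)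
      (fun q s b y hqs hb hy => ?_) X hX
  refine tensor_induction hV hW
    (fun X X' h h' => by simp only [map_add, h, h', smul_add]; abel) (fun t u c z hc hz => ?_)
  subst hqs
  simp only [tensor_inl_mode hV hW]
  rw [tensor_mul hy hc, tensor_mul hy hc, tensor_mul hy (hV.parity_mode ha hc m), map_smul,
    tensor_inl_mode hV hW, hV.derivation r a ha q b hb, TensorProduct.add_tmul, smul_add]
  simp only [TensorProduct.smul_tmul', smul_smul, ← sign_add]
  congr 4
  have h2 : (2 : ZMod 2) = 0 := rfl
  linear_combination -(s * (r + 1)) * h2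

theorem tensor_inr_isDerivation {p : ZMod 2} {x : W} (hx : HasParity 𝒲 p x) :
    IsDerivation (tensor 𝒱 𝒲) p (𝒱.vac ⊗ₜ x) := by
  intro Q X hX m
  refine tensor_parity_induction hV hW (P := fun X => ∀ Z, (tensor 𝒱 𝒲).Y m (𝒱.vac ⊗ₜ x)
      ((tensor 𝒱 𝒲).Y (-1) X Z) = (tensor 𝒱 𝒲).Y (-1) ((tensor 𝒱 𝒲).Y m (𝒱.vac ⊗ₜ x) X) Z +
      sign ((p + 1) * Q) • (tensor 𝒱 𝒲).Y (-1) X ((tensor 𝒱 𝒲).Y m (𝒱.vac ⊗ₜ x) Z)) (by simp)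
      (fun X X' h h' Z => by simp only [map_add, LinearMap.add_apply, h, h', smul_add]; abel)
      (fun q s b y hqs hb hy => ?_) X hX
  refine tensor_induction hV hW
    (fun X X' h h' => by simp only [map_add, h, h', smul_add]; abel) (fun t u c z hc hz => ?_)
  subst hqs
  rw [tensor_inr_mode hV hW hx hb, tensor_inr_mode hV hW hx hc, tensor_mul hy hc, map_smul,
    map_smul, map_smul,
    tensor_inr_mode hV hW hx (hV.parity_mul hb hc), LinearMap.smul_apply,
    tensor_mul (hW.parity_mode hx hy m) hc, tensor_mul hy hc, hW.derivation p x hx s y hy,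
    TensorProduct.tmul_add, smul_add, smul_add, TensorProduct.tmul_smul]
  simp only [smul_smul, ← sign_add]
  congr 3 <;> ring

theorem tensor_inl_isCovariant (a : V) : IsCovariant (tensor 𝒱 𝒲) (a ⊗ₜ 𝒲.vac) := by
  intro m
  refine tensor_induction hV hW (fun X X' h h' => by simp only [map_add, h, h', smul_add]; abel)
    (fun q s b y hb hy => ?_)
  simp only [tensor_T_tmul, map_add, tensor_inl_mode hV hW, hV.covariant a m b,
    TensorProduct.add_tmul, TensorProduct.smul_tmul']
  abel

theorem tensor_inr_isCovariant {p : ZMod 2} {x : W} (hx : HasParity 𝒲 p x) :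
    IsCovariant (tensor 𝒱 𝒲) (𝒱.vac ⊗ₜ x) := by
  intro m
  refine tensor_induction hV hW (fun X X' h h' => by simp only [map_add, h, h', smul_add]; abel)
    (fun q s b y hb hy => ?_)
  simp only [tensor_T_tmul, map_add, tensor_inr_mode hV hW hx hb, hW.covariant x m y,
    tensor_inr_mode hV hW hx (hV.parity_T hb), map_smul, tensor_T_tmul,
    TensorProduct.tmul_add, TensorProduct.tmul_smul, smul_add]
  rw [smul_comm (m : ℂ)]
  abel

theorem tensor_isDerivation (p : ZMod 2) (X : V ⊗[ℂ] W) (hX : HasParity (tensor 𝒱 𝒲) p X) :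
    IsDerivation (tensor 𝒱 𝒲) p X := by
  refine tensor_parity_induction hV hW (P := fun X => IsDerivation (tensor 𝒱 𝒲) p X)
    (fun _ _ _ _ _ => by simp) (fun _ _ h h' => h.add h') (fun r s a x hrs ha hx => ?_) X hX
  have hC := tensor_isCommutative hV hW
  have ha' := parity_tmul ha hW.parity_vac
  have hx' := parity_tmul hV.parity_vac hx
  rw [add_zero] at ha'
  rw [zero_add] at hx'
  have := hC.isDerivation_mul ha' hx' (tensor_isWick hV hW ha hx)
    (tensor_inl_isDerivation hV hW ha) (tensor_inr_isDerivation hV hW hx)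
  rwa [tensor_mul_inl_inr hV hW, hrs] at this

theorem tensor_isCovariant (X : V ⊗[ℂ] W) : IsCovariant (tensor 𝒱 𝒲) X := by
  refine tensor_induction hV hW (fun _ _ h h' => h.add h') (fun r s a x ha hx => ?_) X
  have := (tensor_isCommutative hV hW).isCovariant_mul (tensor_isWick hV hW ha hx)
    (tensor_inl_isCovariant hV hW a) (tensor_inr_isCovariant hV hW hx)
  rwa [tensor_mul_inl_inr hV hW] at this

/-- Extends skew-symmetry in the first argument from the two factors to everything. As the relation
is symmetric, applying it twice treats both arguments. -/
theorem tensor_isSkew_of {q : ZMod 2} {Z : V ⊗[ℂ] W} (hZ : HasParity (tensor 𝒱 𝒲) q Z)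
    (hl : ∀ p a, HasParity 𝒱 p a → IsSkew (tensor 𝒱 𝒲) p q (a ⊗ₜ 𝒲.vac) Z)
    (hr : ∀ p x, HasParity 𝒲 p x → IsSkew (tensor 𝒱 𝒲) p q (𝒱.vac ⊗ₜ x) Z)
    (p : ZMod 2) (X : V ⊗[ℂ] W) (hX : HasParity (tensor 𝒱 𝒲) p X) :
    IsSkew (tensor 𝒱 𝒲) p q X Z := by
  have hC := tensor_isCommutative hV hW
  refine tensor_parity_induction hV hW (P := fun X => IsSkew (tensor 𝒱 𝒲) p q X Z)
    (fun l => by simp [skewTransform_zero]) (fun _ _ h h' => hC.isSkew_add_left h h')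
    (fun r s a x hrs ha hx => ?_) X hX
  have ha' := parity_tmul ha hW.parity_vac
  have hx' := parity_tmul hV.parity_vac hx
  rw [add_zero] at ha'
  rw [zero_add] at hx'
  have := hC.isSkew_mul ha' hx' hZ (tensor_isWick hV hW ha hx)
    (tensor_isDerivation hV hW q Z hZ) (hl r a ha) (hr s x hx)
  rwa [tensor_mul_inl_inr hV hW, hrs] at this

/-- For one vector from each factor all non-negative modes vanish on both sides, and for two vectors
from the same factor the relation is transported along the inclusion of that factor. -/
theorem tensor_isSkew (p q : ZMod 2) (X Z : V ⊗[ℂ] W) (hX : HasParity (tensor 𝒱 𝒲) p X)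
    (hZ : HasParity (tensor 𝒱 𝒲) q Z) : IsSkew (tensor 𝒱 𝒲) p q X Z := by
  have hC := tensor_isCommutative hV hW
  have hmixed : ∀ p q a x, HasParity 𝒱 p a → HasParity 𝒲 q x →
      IsSkew (tensor 𝒱 𝒲) p q (a ⊗ₜ 𝒲.vac) (𝒱.vac ⊗ₜ x) := by
    intro p q a x ha hx l
    simp only [tensor_inl_mode hV hW, tensor_inr_mode hV hW hx ha, hV.mode_vac, hW.mode_vac,
      TensorProduct.zero_tmul, TensorProduct.tmul_zero, skewTransform_zero, smul_zero]
  have hll : ∀ p q a b, HasParity 𝒱 p a → HasParity 𝒱 q b →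
      IsSkew (tensor 𝒱 𝒲) p q (a ⊗ₜ 𝒲.vac) (b ⊗ₜ 𝒲.vac) := by
    intro p q a b ha hb l
    obtain ⟨N, hN⟩ := hV.exists_bound a b
    simp only [tensor_inl_mode hV hW]
    have := skewTransform_map (S := (tensor 𝒱 𝒲).T) (T := 𝒱.T)
      ((TensorProduct.mk ℂ V W).flip 𝒲.vac)
      (fun x => by simp [tensor_T_tmul, hW.T_vac]) hN l
    simp only [LinearMap.flip_apply, TensorProduct.mk_apply] at this
    rw [this, hV.skew p q a b ha hb l, TensorProduct.smul_tmul']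
  have hrr : ∀ p q x y, HasParity 𝒲 p x → HasParity 𝒲 q y →
      IsSkew (tensor 𝒱 𝒲) p q (𝒱.vac ⊗ₜ x) (𝒱.vac ⊗ₜ y) := by
    intro p q x y hx hy l
    obtain ⟨N, hN⟩ := hW.exists_bound x y
    simp only [tensor_inr_mode hV hW hx hV.parity_vac, tensor_inr_mode hV hW hy hV.parity_vac,
      mul_zero, sign_zero, one_smul]
    have := skewTransform_map (S := (tensor 𝒱 𝒲).T) (T := 𝒲.T)
      (TensorProduct.mk ℂ V W 𝒱.vac)
      (fun x => by simp [tensor_T_tmul, hV.T_vac]) hN l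
    simp only [TensorProduct.mk_apply] at this
    rw [this, hW.skew p q x y hx hy l, TensorProduct.tmul_smul]
  refine tensor_isSkew_of hV hW hZ (fun p a ha => ?_) (fun p x hx => ?_) p X hX
  · have ha' := parity_tmul ha hW.parity_vac
    rw [add_zero] at ha'
    exact hC.isSkew_symm (tensor_isSkew_of hV hW ha' (fun q b hb => hll q p b a hb ha)
      (fun q x hx => hC.isSkew_symm (hmixed p q a x ha hx)) q Z hZ)
  · have hx' := parity_tmul hV.parity_vac hx
    rw [zero_add] at hx'
    exact hC.isSkew_symm (tensor_isSkew_of hV hW hx' (fun q b hb => hmixed q p b x hb hx)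
      (fun q y hy => hrr q p y x hy hx) q Z hZ)

theorem tensor_isPoisson : IsPoisson (tensor 𝒱 𝒲) where
  toIsCommutative := tensor_isCommutative hV hW
  derivation := tensor_isDerivation hV hW
  covariant := tensor_isCovariant hV hW
  skew := tensor_isSkew hV hW

theorem tensor_isLocalPair_of {q : ZMod 2} {Z : V ⊗[ℂ] W} (hZ : HasParity (tensor 𝒱 𝒲) q Z)
    (hl : ∀ p a, HasParity 𝒱 p a → IsLocalPair (tensor 𝒱 𝒲) p q (a ⊗ₜ 𝒲.vac) Z)
    (hr : ∀ p x, HasParity 𝒲 p x → IsLocalPair (tensor 𝒱 𝒲) p q (𝒱.vac ⊗ₜ x) Z)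
    (p : ZMod 2) (X : V ⊗[ℂ] W) (hX : HasParity (tensor 𝒱 𝒲) p X) :
    IsLocalPair (tensor 𝒱 𝒲) p q X Z := by
  have hC := tensor_isPoisson hV hW
  refine tensor_parity_induction hV hW (P := fun X => IsLocalPair (tensor 𝒱 𝒲) p q X Z)
    IsLocalPair.zero_left (fun _ _ h h' => h.add_left h')
    (fun r s a x hrs ha hx => ?_) X hX
  have ha' := parity_tmul ha hW.parity_vac
  have hx' := parity_tmul hV.parity_vac hx
  rw [add_zero] at ha'
  rw [zero_add] at hx'
  have := hC.isLocalPair_mul ha' hx' (tensor_isWick hV hW ha hx)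
    (hC.derivation q Z hZ) (hC.covariant Z) (hl r a ha) (hr s x hx)
  rwa [tensor_mul_inl_inr hV hW, hrs] at this

/-- Modes of vectors from different factors supercommute exactly, so their order is zero. Two
vectors from one factor keep their order. -/
theorem tensor_isLocal (hlV : IsLocal 𝒱) (hlW : IsLocal 𝒲) : IsLocal (tensor 𝒱 𝒲) := by
  have hC := tensor_isPoisson hV hW
  have hmixed : ∀ p q a x, HasParity 𝒱 p a → HasParity 𝒲 q x →
      IsLocalPair (tensor 𝒱 𝒲) p q (a ⊗ₜ 𝒲.vac) (𝒱.vac ⊗ₜ x) := by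
    intro p q a x ha hx
    refine ⟨0, ?_⟩
    funext m l
    refine LinearMap.ext (tensor_induction hV hW (fun X Y h h' => by rw [map_add, h, h']; simp)
      (fun r s b y hb hy => ?_))
    simp only [Function.iterate_zero, id_eq, modeComm, LinearMap.sub_apply, LinearMap.smul_apply,
      Module.End.mul_apply, tensor_inr_mode hV hW hx hb, tensor_inl_mode hV hW, map_smul,
      tensor_inr_mode hV hW hx (hV.parity_mode ha hb m), smul_smul, ← sign_add,
      LinearMap.zero_apply]
    rw [sub_eq_zero]
    congr 2
    have h2 : (2 : ZMod 2) = 0 := rfl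
    linear_combination -((p + 1) * (q + 1)) * h2
  have hll : ∀ p q a b, HasParity 𝒱 p a → HasParity 𝒱 q b →
      IsLocalPair (tensor 𝒱 𝒲) p q (a ⊗ₜ 𝒲.vac) (b ⊗ₜ 𝒲.vac) := by
    intro p q a b ha hb
    obtain ⟨M, hM⟩ := hlV p q a b ha hb
    refine ⟨M, ?_⟩
    have : modeComm (tensor 𝒱 𝒲) p q (a ⊗ₜ 𝒲.vac) (b ⊗ₜ 𝒲.vac) =
        fun m l => LinearMap.rTensorHom W (modeComm 𝒱 p q a b m l) := by
      funext m l
      refine TensorProduct.ext' fun v y => ?_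
      simp [modeComm, tensor_inl_mode hV hW, TensorProduct.smul_tmul']
    rw [this, diagDiff_iterate_map, hM]
    simp
  have hrr : ∀ p q x y, HasParity 𝒲 p x → HasParity 𝒲 q y →
      IsLocalPair (tensor 𝒱 𝒲) p q (𝒱.vac ⊗ₜ x) (𝒱.vac ⊗ₜ y) := by
    intro p q x y hx hy
    obtain ⟨M, hM⟩ := hlW p q x y hx hy
    refine ⟨M, ?_⟩
    -- The signs from moving the modes of `x` and `y` past `b` combine into one operator on the left
    -- factor, the identity or the parity operator according to the parity of the commutator. The
    -- commutator on the tensor product is then `σ` tensored with the one on `W`.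
    obtain ⟨σ, hσ⟩ : ∃ σ : Module.End ℂ V, ∀ r b, HasParity 𝒱 r b →
        σ b = sign ((p + 1) * r + (q + 1) * r) • b := by
      by_cases h : p + 1 + (q + 1) = 0
      · exact ⟨1, fun r b _ => by rw [← add_mul, h, zero_mul, sign_zero, one_smul]; rfl⟩
      · refine ⟨𝒱.sgn, fun r b hb => ?_⟩
        rw [← add_mul, (zmod_two_cases _).resolve_left h, one_mul, hb]
    have : modeComm (tensor 𝒱 𝒲) p q (𝒱.vac ⊗ₜ x) (𝒱.vac ⊗ₜ y) =
        fun m l => TensorProduct.mapBilinear (RingHom.id ℂ) V W V W σ (modeComm 𝒲 p q x y m l) := by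
      funext m l
      refine LinearMap.ext (tensor_induction hV hW (fun X Y h h' => by rw [map_add, map_add, h, h'])
        (fun r s b z hb hz => ?_))
      simp only [modeComm, LinearMap.sub_apply, LinearMap.smul_apply, Module.End.mul_apply,
        tensor_inr_mode hV hW hx hb, tensor_inr_mode hV hW hy hb, map_smul,
        TensorProduct.mapBilinear_apply, TensorProduct.map_tmul, hσ r b hb,
        TensorProduct.tmul_sub, TensorProduct.tmul_smul]
      simp only [TensorProduct.smul_tmul', smul_smul, ← sign_add]
      congr 4
      ring
    rw [this, diagDiff_iterate_map, hM]
    simp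
  intro p q X Z hX hZ
  refine tensor_isLocalPair_of hV hW hZ (fun p a ha => ?_) (fun p x hx => ?_) p X hX
  · have ha' := parity_tmul ha hW.parity_vac
    rw [add_zero] at ha'
    exact hC.isLocalPair_symm (tensor_isLocalPair_of hV hW ha' (fun q b hb => hll q p b a hb ha)
      (fun q x hx => hC.isLocalPair_symm (hmixed p q a x ha hx)) q Z hZ)
  · have hx' := parity_tmul hV.parity_vac hx
    rw [zero_add] at hx'
    exact hC.isLocalPair_symm (tensor_isLocalPair_of hV hW hx' (fun q b hb => hmixed q p b x hb hx)
      (fun q y hy => hrr q p y x hy hx) q Z hZ)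

end TensorPoisson


/-! ### Gradings as coactions -/

section Gradings

variable {G H U : Type*} [AddCommGroup U] [Module ℂ U]

/-- `Δ` sends each homogeneous vector to itself, placed in its degree. -/
def IsCoaction (A : G → Submodule ℂ U) (Δ : U →ₗ[ℂ] G →₀ U) : Prop :=
  ∀ g, ∀ u ∈ A g, Δ u = Finsupp.single g u

/-- The component of `Δ` in degree `g` is the identity on `A g` and zero on the other pieces, which
forces independence. Gradings can then be combined by composing linear maps. -/
theorem IsCoaction.isInternal [DecidableEq G] {A : G → Submodule ℂ U} {Δ : U →ₗ[ℂ] G →₀ U}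
    (h : IsCoaction A Δ) (hA : ⨆ g, A g = ⊤) : DirectSum.IsInternal A := by
  rw [DirectSum.isInternal_submodule_iff_iSupIndep_and_iSup_eq_top]
  refine ⟨fun g => ?_, hA⟩
  rw [Submodule.disjoint_def]
  intro u hu hu'
  have h2 : (⨆ (j) (_ : j ≠ g), A j) ≤ LinearMap.ker (Finsupp.lapply g ∘ₗ Δ) := by
    refine iSup₂_le fun j hj v hv => ?_
    rw [LinearMap.mem_ker, LinearMap.comp_apply, h j v hv, Finsupp.lapply_apply,
      Finsupp.single_eq_of_ne hj.symm]
  have := h2 hu'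
  rwa [LinearMap.mem_ker, LinearMap.comp_apply, h g u hu, Finsupp.lapply_apply,
    Finsupp.single_eq_same] at this

theorem exists_isCoaction [DecidableEq G] {A : G → Submodule ℂ U} (h : DirectSum.IsInternal A) :
    ∃ Δ, IsCoaction A Δ := by
  let e := LinearEquiv.ofBijective (DirectSum.coeLinearMap A) h
  refine ⟨DirectSum.toModule ℂ G (G →₀ U) (fun g => Finsupp.lsingle g ∘ₗ (A g).subtype) ∘ₗ
    e.symm.toLinearMap, fun g u hu => ?_⟩
  have : e.symm u = DirectSum.lof ℂ G (fun g => A g) g ⟨u, hu⟩ := by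
    rw [LinearEquiv.symm_apply_eq]
    exact (DirectSum.coeLinearMap_lof A g ⟨u, hu⟩).symm
  rw [LinearMap.comp_apply, LinearEquiv.coe_coe, this, DirectSum.toModule_lof]
  rfl

/-- Applying the second coaction to the components of the first gives a coaction for the double
grading; only spanning has to be supplied. -/
theorem isInternal_inf [DecidableEq G] [DecidableEq H] {A : G → Submodule ℂ U}
    {B : H → Submodule ℂ U} {Δ : U →ₗ[ℂ] G →₀ U} {Δ' : U →ₗ[ℂ] H →₀ U} (hA : IsCoaction A Δ)
    (hB : IsCoaction B Δ') (htop : ⨆ i : G × H, A i.1 ⊓ B i.2 = ⊤) :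
    DirectSum.IsInternal fun i : G × H => A i.1 ⊓ B i.2 := by
  refine IsCoaction.isInternal (Δ := (Finsupp.curryLinearEquiv ℂ).symm.toLinearMap ∘ₗ
    Finsupp.mapRange.linearMap Δ' ∘ₗ Δ) (fun i u hu => ?_) htop
  rw [LinearMap.comp_apply, LinearMap.comp_apply, hA i.1 u hu.1, Finsupp.mapRange.linearMap_apply,
    Finsupp.mapRange_single, hB i.2 u hu.2, LinearEquiv.coe_coe, LinearEquiv.symm_apply_eq]
  ext
  simp [Finsupp.curryLinearEquiv]

variable [AddCommGroup G] {V W : Type*} [AddCommGroup V] [Module ℂ V] [AddCommGroup W] [Module ℂ W]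

/-- The grading of a tensor product by the total degree. -/
def tensorGrading (A : G → Submodule ℂ V) (B : G → Submodule ℂ W) (d : G) :
    Submodule ℂ (V ⊗[ℂ] W) :=
  ⨆ e : G, Submodule.map₂ (TensorProduct.mk ℂ V W) (A e) (B (d - e))

variable {A : G → Submodule ℂ V} {B : G → Submodule ℂ W}

theorem tmul_mem_tensorGrading {e f d : G} {a : V} {x : W} (ha : a ∈ A e) (hx : x ∈ B f)
    (h : e + f = d) : a ⊗ₜ[ℂ] x ∈ tensorGrading A B d := by
  subst h
  refine Submodule.mem_iSup_of_mem e (Submodule.apply_mem_map₂ _ ha ?_)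
  rwa [add_sub_cancel_left]

theorem tensorGrading_induction {d : G} {P : V ⊗[ℂ] W → Prop} (h0 : P 0)
    (hadd : ∀ X Y, P X → P Y → P (X + Y))
    (hP : ∀ e f a x, e + f = d → a ∈ A e → x ∈ B f → P (a ⊗ₜ x))
    (X : V ⊗[ℂ] W) (hX : X ∈ tensorGrading A B d) : P X := by
  -- The motive is not assumed stable under scalars, so these are carried along and absorbed into
  -- the pure tensors.
  have key : ∀ t : ℂ, P (t • X) := by
    refine Submodule.iSup_induction (motive := fun X => ∀ t : ℂ, P (t • X)) _ hX
      (fun e Y hY => ?_) (fun t => by rwa [smul_zero])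
      (fun Y Z hY hZ t => by rw [smul_add]; exact hadd _ _ (hY t) (hZ t))
    rw [Submodule.map₂_eq_span_image2] at hY
    refine Submodule.span_induction (p := fun Y _ => ∀ t : ℂ, P (t • Y)) ?_ (fun t => by
      rwa [smul_zero]) (fun Y Z _ _ hY hZ t => by rw [smul_add]; exact hadd _ _ (hY t) (hZ t))
      (fun s Y _ hY t => by rw [smul_smul]; exact hY _) hY
    rintro _ ⟨a, ha, x, hx, rfl⟩ t
    exact hP e (d - e) (t • a) x (by abel) ((A e).smul_mem t ha) hx
  simpa using key 1

theorem iSup_tensorGrading (hA : ⨆ g, A g = ⊤) (hB : ⨆ g, B g = ⊤) :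
    ⨆ g, tensorGrading A B g = ⊤ := by
  rw [eq_top_iff]
  rintro X -
  induction X with
  | zero => exact zero_mem _
  | add X Y hX hY => exact add_mem hX hY
  | tmul a x =>
    refine Submodule.iSup_induction (motive := fun a => a ⊗ₜ[ℂ] x ∈ ⨆ g, tensorGrading A B g) A
      (hA ▸ Submodule.mem_top : a ∈ ⨆ g, A g) (fun e a ha => ?_) (by simp)
      (fun a b ha hb => by rw [TensorProduct.add_tmul]; exact add_mem ha hb)
    refine Submodule.iSup_induction (motive := fun x => a ⊗ₜ[ℂ] x ∈ ⨆ g, tensorGrading A B g) B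
      (hB ▸ Submodule.mem_top : x ∈ ⨆ g, B g) (fun f x hx => ?_) (by simp)
      (fun a b ha hb => by rw [TensorProduct.tmul_add]; exact add_mem ha hb)
    exact Submodule.mem_iSup_of_mem (e + f) (tmul_mem_tensorGrading ha hx rfl)

/-- Tensoring the two coactions records both degrees, and pushing forward along addition keeps the
total one. -/
theorem IsCoaction.tensor [DecidableEq G] {Δ : V →ₗ[ℂ] G →₀ V} {Δ' : W →ₗ[ℂ] G →₀ W}
    (hA : IsCoaction A Δ) (hB : IsCoaction B Δ') :
    IsCoaction (tensorGrading A B) (Finsupp.lmapDomain (V ⊗[ℂ] W) ℂ (fun i : G × G => i.1 + i.2) ∘ₗ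
      (finsuppTensorFinsupp ℂ ℂ V W G G).toLinearMap ∘ₗ TensorProduct.map Δ Δ') := by
  intro d
  refine tensorGrading_induction (by simp) (fun X Y hX hY => by rw [map_add, hX, hY,
    Finsupp.single_add]) (fun e f a x hef ha hx => ?_)
  rw [LinearMap.comp_apply, LinearMap.comp_apply, TensorProduct.map_tmul, hA e a ha, hB f x hx,
    LinearEquiv.coe_coe, finsuppTensorFinsupp_single, Finsupp.lmapDomain_apply,
    Finsupp.mapDomain_single, hef]

theorem iSup_eq_top_of_isInternal {K : Type*} [DecidableEq K] {A : K → Submodule ℂ U}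
    (h : DirectSum.IsInternal A) : ⨆ g, A g = ⊤ :=
  ((DirectSum.isInternal_submodule_iff_iSupIndep_and_iSup_eq_top A).1 h).2

theorem tensorGrading_isInternal [DecidableEq G] (hA : DirectSum.IsInternal A)
    (hB : DirectSum.IsInternal B) : DirectSum.IsInternal (tensorGrading A B) := by
  obtain ⟨Δ, hΔ⟩ := exists_isCoaction hA
  obtain ⟨Δ', hΔ'⟩ := exists_isCoaction hB
  exact (hΔ.tensor hΔ').isInternal
    (iSup_tensorGrading (iSup_eq_top_of_isInternal hA) (iSup_eq_top_of_isInternal hB))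

end Gradings

/-! ### Tensor products of raviolo vertex algebras -/

section TensorRaviolo

variable {V W : Type*} [AddCommGroup V] [Module ℂ V] [AddCommGroup W] [Module ℂ W]
  {𝒱 : RavioloData V} {𝒲 : RavioloData W}

theorem IsRaviolo.dpow_mem {U : Type*} [AddCommGroup U] [Module ℂ U] {𝒰 : RavioloData U}
    (h : IsRaviolo 𝒰) {d : Deg} {a : U} (ha : a ∈ 𝒰.gr d) (n : ℕ) : dpow 𝒰.T n a ∈ 𝒰.gr d := by
  induction n with
  | zero => rwa [dpow_zero]
  | succ n ih => rw [dpow_succ]; exact Submodule.smul_mem _ _ (h.T_mem d _ ih)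

theorem tensor_isRaviolo (hV : IsRaviolo 𝒱) (hW : IsRaviolo 𝒲) : IsRaviolo (tensor 𝒱 𝒲) := by
  have hsgn : ∀ d, ∀ X ∈ (tensor 𝒱 𝒲).gr d, HasParity (tensor 𝒱 𝒲) (par d) X := by
    intro d
    refine tensorGrading_induction HasParity.zero (fun _ _ h h' => h.add h')
      (fun e f a x hef ha hx => ?_)
    rw [← hef, par_add]
    exact parity_tmul (hV.hasParity ha) (hW.hasParity hx)
  have hPV := hV.isPoisson
  have hPW := hW.isPoisson
  refine (tensor_isPoisson hPV hPW).isRaviolo ?_ hsgn ?_ ?_ ?_ ?_ ?_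
  · exact tensorGrading_isInternal hV.grading hW.grading
  · exact tmul_mem_tensorGrading hV.vac_mem hW.vac_mem (by simp)
  · intro d
    refine tensorGrading_induction (by simp) (fun X Y h h' => by rw [map_add]; exact add_mem h h')
      (fun e f a x hef ha hx => ?_)
    rw [tensor_T_tmul]
    exact add_mem (tmul_mem_tensorGrading (hV.T_mem e a ha) hx hef)
      (tmul_mem_tensorGrading ha (hW.T_mem f x hx) hef)
  · intro d d'
    refine tensorGrading_induction (by simp) (fun X Y h h' b hb => by
      rw [map_add, LinearMap.add_apply]; exact add_mem (h b hb) (h' b hb))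
      (fun e f a x hef ha hx => ?_)
    refine tensorGrading_induction (by simp) (fun X Y h h' => by rw [map_add]; exact add_mem h h')
      (fun e' f' b y hef' hb hy => ?_)
    rw [tensor_mul (hW.hasParity hx) (hV.hasParity hb)]
    exact Submodule.smul_mem _ _ (tmul_mem_tensorGrading (hV.mul_mem ha hb) (hW.mul_mem hx hy)
      (by rw [← hef, ← hef']; abel))
  · intro m d d'
    refine tensorGrading_induction (by simp) (fun X Y h h' b hb => by
      rw [map_add, LinearMap.add_apply]; exact add_mem (h b hb) (h' b hb))
      (fun e f a x hef ha hx => ?_)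
    refine tensorGrading_induction (by simp) (fun X Y h h' => by rw [map_add]; exact add_mem h h')
      (fun e' f' b y hef' hb hy => ?_)
    rw [tensor_mode hPV hPW (hV.hasParity ha) (hW.hasParity hx) (hV.hasParity hb)]
    refine finsum_induction (fun X => X ∈ (tensor 𝒱 𝒲).gr (d + d' - (1, 0)))
      (zero_mem _) (fun _ _ h h' => add_mem h h') (fun n => ?_)
    exact add_mem
      (Submodule.smul_mem _ _ (tmul_mem_tensorGrading (hV.mul_mem (hV.dpow_mem ha n) hb)
        (hW.mode_mem hx hy _) (by rw [← hef, ← hef']; abel)))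
      (Submodule.smul_mem _ _ (tmul_mem_tensorGrading (hV.mode_mem ha hb _)
        (hW.mul_mem (hW.dpow_mem hx n) hy) (by rw [← hef, ← hef']; abel)))
  · intro d e a ha b hb
    exact tensor_isLocal hPV hPW hV.isLocal hW.isLocal _ _ _ _ (hsgn d a ha) (hsgn e b hb)

/-! ### Spin gradings -/

section Spin

variable {U : Type*} [AddCommGroup U] [Module ℂ U] {𝒰 : RavioloData U}
  {spin : ℚ → Submodule ℂ U}

theorem spin_dpow_mem (hT : ∀ s, ∀ a ∈ spin s, 𝒰.T a ∈ spin (s + 1)) {s : ℚ} {a : U}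
    (ha : a ∈ spin s) (n : ℕ) : dpow 𝒰.T n a ∈ spin (s + n) := by
  induction n with
  | zero => simpa [dpow_zero] using ha
  | succ n ih =>
    rw [dpow_succ, Nat.cast_succ, ← add_assoc]
    exact Submodule.smul_mem _ _ (hT _ _ ih)

theorem IsPoisson.spin_Y_mem (h : IsPoisson 𝒰) (hT : ∀ s, ∀ a ∈ spin s, 𝒰.T a ∈ spin (s + 1))
    (hmul : ∀ s t, ∀ a ∈ spin s, ∀ b ∈ spin t, 𝒰.Y (-1) a b ∈ spin (t + s))
    (hmode : ∀ (m : ℕ) s t, ∀ a ∈ spin s, ∀ b ∈ spin t, 𝒰.Y m a b ∈ spin (t + (s - m - 1)))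
    (m : ℤ) (s t : ℚ) (a : U) (ha : a ∈ spin s) (b : U) (hb : b ∈ spin t) :
    𝒰.Y m a b ∈ spin (t + (s - m - 1)) := by
  rcases le_or_gt 0 m with hm | hm
  · obtain ⟨k, rfl⟩ := Int.eq_ofNat_of_zero_le hm
    exact_mod_cast hmode k s t a ha b hb
  · obtain ⟨k, rfl⟩ : ∃ k : ℕ, m = -(k : ℤ) - 1 := ⟨(-m - 1).toNat, by omega⟩
    rw [h.neg]
    convert hmul (s + k) t _ (spin_dpow_mem hT ha k) b hb using 2
    push_cast; ring

/-- A vector of spin `s` is a sum of vectors homogeneous for both gradings: decompose it for the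
bigrading and take the spin `s` component. The signs of the tensor product are only explicit on such
vectors. -/
theorem IsSpinGrading.le_iSup (h : IsSpinGrading 𝒰 spin) (s : ℚ) :
    spin s ≤ ⨆ d, 𝒰.gr d ⊓ spin s := by
  obtain ⟨Δ, hΔ⟩ := exists_isCoaction h.grading
  have key : ∀ u, Δ u s ∈ ⨆ d, 𝒰.gr d ⊓ spin s := by
    intro u
    refine Submodule.iSup_induction (motive := fun u => Δ u s ∈ ⨆ d, 𝒰.gr d ⊓ spin s)
      (fun i : Deg × ℚ => 𝒰.gr i.1 ⊓ spin i.2)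
      ((iSup_eq_top_of_isInternal h.bigrading) ▸ Submodule.mem_top) (fun i a ha => ?_) (by simp)
      (fun a b ha hb => by rw [map_add, Finsupp.add_apply]; exact add_mem ha hb)
    rw [hΔ i.2 a ha.2]
    by_cases hs : i.2 = s
    · subst hs
      rw [Finsupp.single_eq_same]
      exact Submodule.mem_iSup_of_mem i.1 ha
    · rw [Finsupp.single_eq_of_ne (Ne.symm hs)]
      exact zero_mem _
  intro u hu
  have := key u
  rwa [hΔ s u hu, Finsupp.single_eq_same] at this

theorem IsSpinGrading.gr_induction (h : IsSpinGrading 𝒰 spin) {s : ℚ} {P : U → Prop} (h0 : P 0)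
    (hadd : ∀ a b, P a → P b → P (a + b)) (hP : ∀ d, ∀ a ∈ 𝒰.gr d, a ∈ spin s → P a) (a : U)
    (ha : a ∈ spin s) : P a :=
  Submodule.iSup_induction (motive := P) _ (h.le_iSup s ha) (fun d a ha => hP d a ha.1 ha.2) h0
    hadd

end Spin

theorem tensorSpin_induction {spin₁ : ℚ → Submodule ℂ V} {spin₂ : ℚ → Submodule ℂ W}
    (h₁ : IsSpinGrading 𝒱 spin₁) (h₂ : IsSpinGrading 𝒲 spin₂) {s : ℚ} {P : V ⊗[ℂ] W → Prop}
    (h0 : P 0) (hadd : ∀ X Y, P X → P Y → P (X + Y))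
    (hP : ∀ d d' e f, ∀ a ∈ 𝒱.gr d, ∀ x ∈ 𝒲.gr d', a ∈ spin₁ e → x ∈ spin₂ f → e + f = s →
      P (a ⊗ₜ x)) (X : V ⊗[ℂ] W) (hX : X ∈ tensorSpin spin₁ spin₂ s) : P X := by
  refine tensorGrading_induction h0 hadd (fun e f a x hef ha hx => ?_) X hX
  refine h₁.gr_induction (P := fun a => P (a ⊗ₜ x)) (by simpa using h0)
    (fun a b h h' => by rw [TensorProduct.add_tmul]; exact hadd _ _ h h') (fun d a ha ha' => ?_) a ha
  exact h₂.gr_induction (P := fun x => P (a ⊗ₜ x)) (by simpa using h0)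
    (fun a b h h' => by rw [TensorProduct.tmul_add]; exact hadd _ _ h h')
    (fun d' x hx hx' => hP d d' e f a ha x hx ha' hx' hef) x hx

theorem tensor_isSpinGrading (hV : IsRaviolo 𝒱) (hW : IsRaviolo 𝒲) {spin₁ : ℚ → Submodule ℂ V}
    {spin₂ : ℚ → Submodule ℂ W} (h₁ : IsSpinGrading 𝒱 spin₁) (h₂ : IsSpinGrading 𝒲 spin₂) :
    IsSpinGrading (tensor 𝒱 𝒲) (tensorSpin spin₁ spin₂) := by
  have hPV := hV.isPoisson
  have hPW := hW.isPoisson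
  have hT : ∀ s, ∀ a ∈ tensorSpin spin₁ spin₂ s,
      (tensor 𝒱 𝒲).T a ∈ tensorSpin spin₁ spin₂ (s + 1) := by
    intro d
    refine tensorGrading_induction (by simp) (fun X Y h h' => by rw [map_add]; exact add_mem h h')
      (fun e f a x hef ha hx => ?_)
    rw [tensor_T_tmul]
    exact add_mem (tmul_mem_tensorGrading (h₁.T_mem e a ha) hx (by rw [← hef]; ring))
      (tmul_mem_tensorGrading ha (h₂.T_mem f x hx) (by rw [← hef]; ring))
  have hmulV : ∀ {s t a b}, a ∈ spin₁ s → b ∈ spin₁ t → 𝒱.Y (-1) a b ∈ spin₁ (t + s) := by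
    intro s t a b ha hb
    convert h₁.Y_mem (-1) s t a ha b hb using 2
    push_cast; ring
  have hmulW : ∀ {s t a b}, a ∈ spin₂ s → b ∈ spin₂ t → 𝒲.Y (-1) a b ∈ spin₂ (t + s) := by
    intro s t a b ha hb
    convert h₂.Y_mem (-1) s t a ha b hb using 2
    push_cast; ring
  refine ⟨?_, tensorGrading_isInternal h₁.grading h₂.grading, ?_, ?_, hT, ?_⟩
  · obtain ⟨L, hL, h⟩ := h₁.denom
    obtain ⟨L', hL', h'⟩ := h₂.denom
    refine ⟨L * L', Nat.mul_pos hL hL', fun s hs => ?_⟩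
    obtain ⟨t, ht, ht'⟩ : ∃ t, spin₁ t ≠ ⊥ ∧ spin₂ (s - t) ≠ ⊥ := by
      by_contra hc
      push Not at hc
      refine hs ((Submodule.eq_bot_iff _).2 ?_)
      refine tensorGrading_induction rfl (fun X Y hX hY => by rw [hX, hY, add_zero])
        (fun e f a x hef ha hx => ?_)
      by_cases he : spin₁ e = ⊥
      · rw [he, Submodule.mem_bot] at ha
        rw [ha, TensorProduct.zero_tmul]
      · have := hc e he
        rw [← hef, add_sub_cancel_left] at this
        rw [this, Submodule.mem_bot] at hx
        rw [hx, TensorProduct.tmul_zero]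
    obtain ⟨k, hk⟩ := h t ht
    obtain ⟨k', hk'⟩ := h' _ ht'
    refine ⟨k * L' + k' * L, ?_⟩
    push_cast
    rw [← hk, ← hk']; ring
  · obtain ⟨Δ, hΔ⟩ := exists_isCoaction (tensorGrading_isInternal hV.grading hW.grading)
    obtain ⟨Δ', hΔ'⟩ := exists_isCoaction (tensorGrading_isInternal h₁.grading h₂.grading)
    refine isInternal_inf hΔ hΔ' ?_
    -- The tensor product is spanned by pure tensors of bihomogeneous vectors, that is, by the
    -- tensor grading over the group `Deg × ℚ`.
    rw [eq_top_iff, ← iSup_tensorGrading (iSup_eq_top_of_isInternal h₁.bigrading)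
      (iSup_eq_top_of_isInternal h₂.bigrading)]
    refine iSup_mono fun i => ?_
    intro X hX
    refine tensorGrading_induction (zero_mem _) (fun _ _ h h' => add_mem h h')
      (fun e f a x hef ha hx => ?_) X hX
    exact ⟨tmul_mem_tensorGrading ha.1 hx.1 (congrArg Prod.fst hef),
      tmul_mem_tensorGrading ha.2 hx.2 (congrArg Prod.snd hef)⟩
  · exact tmul_mem_tensorGrading h₁.vac_mem h₂.vac_mem (add_zero 0)
  · refine (tensor_isPoisson hPV hPW).spin_Y_mem hT ?_ ?_
    · intro s t
      refine tensorSpin_induction h₁ h₂ (by simp) (fun X Y h h' b hb => by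
        rw [map_add, LinearMap.add_apply]; exact add_mem (h b hb) (h' b hb))
        (fun d d' e f a ha x hx ha' hx' hef => ?_)
      refine tensorSpin_induction h₁ h₂ (by simp) (fun X Y h h' => by
        rw [map_add]; exact add_mem h h') (fun d₂ d₂' e₂ f₂ b hb y hy hb' hy' hef₂ => ?_)
      rw [tensor_mul (hW.hasParity hx) (hV.hasParity hb)]
      exact Submodule.smul_mem _ _ (tmul_mem_tensorGrading (hmulV ha' hb') (hmulW hx' hy')
        (by rw [← hef, ← hef₂]; ring))
    · intro m s t
      refine tensorSpin_induction h₁ h₂ (by simp) (fun X Y h h' b hb => by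
        rw [map_add, LinearMap.add_apply]; exact add_mem (h b hb) (h' b hb))
        (fun d d' e f a ha x hx ha' hx' hef => ?_)
      refine tensorSpin_induction h₁ h₂ (by simp) (fun X Y h h' => by
        rw [map_add]; exact add_mem h h') (fun d₂ d₂' e₂ f₂ b hb y hy hb' hy' hef₂ => ?_)
      rw [tensor_mode hPV hPW (hV.hasParity ha) (hW.hasParity hx) (hV.hasParity hb)]
      refine finsum_induction (fun X => X ∈ tensorSpin spin₁ spin₂ (t + (s - m - 1)))
        (zero_mem _) (fun _ _ h h' => add_mem h h') (fun n => ?_)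
      exact add_mem
        (Submodule.smul_mem _ _ (tmul_mem_tensorGrading
          (hmulV (spin_dpow_mem h₁.T_mem ha' n) hb') (h₂.Y_mem _ _ _ _ hx' _ hy')
          (by rw [← hef, ← hef₂]; push_cast; ring)))
        (Submodule.smul_mem _ _ (tmul_mem_tensorGrading (h₁.Y_mem _ _ _ _ ha' _ hb')
          (hmulW (spin_dpow_mem h₂.T_mem hx' n) hy') (by rw [← hef, ← hef₂]; push_cast; ring)))

end TensorRaviolo


/-! ### Modes of normally ordered polynomials -/

section WickModes

variable {F J : Type*} [Ring F] [Algebra ℂ F] {T : F →ₗ[ℂ] F} {D ann : J → ℕ → F →ₗ[ℂ] F}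

theorem wick_neg (k : ℕ) (a x : F) : wick T D ann (-(k : ℤ) - 1) a x = dpow T k a * x := by
  rw [wick, if_pos (by omega), show (-(-(k : ℤ) - 1) - 1).toNat = k by omega]
  rfl

theorem wick_neg_one (a x : F) : wick T D ann (-1) a x = a * x := by
  have := wick_neg (T := T) (D := D) (ann := ann) 0 a x
  rwa [dpow_zero] at this

theorem wick_finite (m : ℕ)
    (hD : ∀ x, {i : J × ℕ | D i.1 i.2 x ≠ 0}.Finite)
    (hann : ∀ x, {i : J × ℕ | ann i.1 i.2 x ≠ 0}.Finite) (a v : F) :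
    (Function.support fun i : J × ℕ × ℕ => if m ≤ i.2.1 + i.2.2 then
      ((-1 : ℂ) ^ i.2.1 * (i.2.1 + i.2.2).choose i.2.1) •
        (dpow T (i.2.1 + i.2.2 - m) (D i.1 i.2.1 a) * ann i.1 i.2.2 v) else 0).Finite := by
  refine (((hD a).prod (hann v)).preimage (f := fun i : J × ℕ × ℕ =>
    ((i.1, i.2.1), (i.1, i.2.2))) (fun i _ j _ h => ?_)).subset fun i hi => ?_
  · simp only [Prod.mk.injEq] at h
    exact Prod.ext h.1.1 (Prod.ext h.1.2 h.2.2)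
  · simp only [Set.mem_preimage, Set.mem_prod, Set.mem_ofPred_eq]
    refine ⟨fun h => hi ?_, fun h => hi ?_⟩ <;> simp [h]

theorem wick_nonneg (m : ℕ)
    (hD : ∀ x, {i : J × ℕ | D i.1 i.2 x ≠ 0}.Finite)
    (hann : ∀ x, {i : J × ℕ | ann i.1 i.2 x ≠ 0}.Finite) (a v : F) :
    wick T D ann m a v = ∑ᶠ i : J × ℕ × ℕ, if m ≤ i.2.1 + i.2.2 then
      ((-1 : ℂ) ^ i.2.1 * (i.2.1 + i.2.2).choose i.2.1) •
        (dpow T (i.2.1 + i.2.2 - m) (D i.1 i.2.1 a) * ann i.1 i.2.2 v) else 0 := by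
  have h : ∀ (i : J × ℕ × ℕ) (a v : F), (if (m : ℤ) ≤ i.2.1 + i.2.2 then
      ((-1 : ℂ) ^ i.2.1 * (i.2.1 + i.2.2).choose i.2.1) •
        (LinearMap.mul ℂ F ∘ₗ divPow T (i.2.1 + i.2.2 - m : ℤ).toNat ∘ₗ D i.1 i.2.1).compl₂
          (ann i.1 i.2.2) else 0 : F →ₗ[ℂ] F →ₗ[ℂ] F) a v =
      if m ≤ i.2.1 + i.2.2 then
      ((-1 : ℂ) ^ i.2.1 * (i.2.1 + i.2.2).choose i.2.1) •
        (dpow T (i.2.1 + i.2.2 - m) (D i.1 i.2.1 a) * ann i.1 i.2.2 v) else 0 := by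
    intro i a v
    by_cases hi : m ≤ i.2.1 + i.2.2
    · rw [if_pos (by omega), if_pos hi,
        show (i.2.1 + i.2.2 - m : ℤ).toNat = i.2.1 + i.2.2 - m by omega]
      rfl
    · rw [if_neg (by omega), if_neg hi]; rfl
  rw [wick, if_neg (by omega), locSum₂_apply (fun a v => by
    simp only [h]; exact wick_finite m hD hann a v)]
  exact finsum_congr fun i => h i a v

end WickModes

/-! ### The Fock space: letters, derivatives and translation -/

section FockAlgebra

variable {ι : Type*}

theorem oddLetter_anticomm (i j : ι × ℕ) :
    oddLetter i * oddLetter j = -(oddLetter j * oddLetter i) :=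
  eq_neg_of_add_eq_zero_left (ExteriorAlgebra.ι_add_mul_swap _ _)

@[elab_as_elim]
theorem ext_induction {P : ExtAlg ι → Prop} (hone : P 1) (hadd : ∀ x y, P x → P y → P (x + y))
    (hsmul : ∀ (t : ℂ) x, P x → P (t • x)) (hl : ∀ i x, P x → P (oddLetter i * x)) (x : ExtAlg ι) :
    P x := by
  induction x using CliffordAlgebra.left_induction with
  | algebraMap r => rw [Algebra.algebraMap_eq_smul_one]; exact hsmul r 1 hone
  | add x y hx hy => exact hadd x y hx hy
  | ι_mul x m hx =>
    induction m using Finsupp.induction_linear with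
    | zero => simpa using hsmul 0 1 hone
    | add f g hf hg => rw [map_add, add_mul]; exact hadd _ _ hf hg
    | single i t =>
      have : Finsupp.single i t = t • Finsupp.single i (1 : ℂ) := by simp
      rw [this, map_smul, smul_mul_assoc]
      exact hsmul _ _ (hl i x hx)

theorem extSgn_one : extSgn (1 : ExtAlg ι) = 1 := map_one CliffordAlgebra.involute

theorem extSgn_mul (x y : ExtAlg ι) : extSgn (x * y) = extSgn x * extSgn y :=
  map_mul CliffordAlgebra.involute x y

theorem extSgn_oddLetter (i : ι × ℕ) : extSgn (oddLetter i) = -oddLetter i :=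
  CliffordAlgebra.involute_ι _

theorem extSgn_extSgn (x : ExtAlg ι) : extSgn (extSgn x) = x :=
  CliffordAlgebra.involute_involute x

theorem oddDeriv_one (i : ι × ℕ) : oddDeriv i (1 : ExtAlg ι) = 0 :=
  CliffordAlgebra.contractLeft_one (Q := 0) _

theorem oddDeriv_oddLetter_mul [DecidableEq ι] (i j : ι × ℕ) (x : ExtAlg ι) :
    oddDeriv i (oddLetter j * x) = (if j = i then x else 0) - oddLetter j * oddDeriv i x := by
  refine (CliffordAlgebra.contractLeft_ι_mul _ _ _).trans ?_
  rw [Finsupp.lapply_apply, Finsupp.single_apply, ite_smul, one_smul, zero_smul]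
  rfl

theorem oddDeriv_mul (i : ι × ℕ) (x y : ExtAlg ι) :
    oddDeriv i (x * y) = oddDeriv i x * y + extSgn x * oddDeriv i y := by
  classical
  refine ext_induction ?_ ?_ ?_ ?_ x
  · rw [one_mul, oddDeriv_one, extSgn_one, zero_mul, zero_add, one_mul]
  · intro x x' h h'; rw [add_mul, map_add, h, h', map_add, map_add, add_mul, add_mul]; abel
  · intro t x h
    rw [smul_mul_assoc, map_smul, h, map_smul, map_smul, smul_mul_assoc, smul_mul_assoc, smul_add]
  · intro j x h
    rw [mul_assoc, oddDeriv_oddLetter_mul, h, oddDeriv_oddLetter_mul, extSgn_mul, extSgn_oddLetter,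
      sub_mul, ite_mul, zero_mul, mul_add, mul_assoc, neg_mul, neg_mul, mul_assoc]
    abel

theorem oddDeriv_oddDeriv (i j : ι × ℕ) (x : ExtAlg ι) :
    oddDeriv i (oddDeriv j x) = -oddDeriv j (oddDeriv i x) :=
  CliffordAlgebra.contractLeft_comm _ _ _

theorem extSgn_oddDeriv (i : ι × ℕ) (x : ExtAlg ι) :
    extSgn (oddDeriv i x) = -oddDeriv i (extSgn x) := by
  classical
  refine ext_induction ?_ ?_ ?_ ?_ x
  · rw [extSgn_one, oddDeriv_one, map_zero, neg_zero]
  · intro x x' h h'; simp only [map_add, h, h', neg_add]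
  · intro t x h; simp only [map_smul, h, smul_neg]
  · intro j x h
    rw [oddDeriv_oddLetter_mul, extSgn_mul, extSgn_oddLetter, neg_mul, map_neg,
      oddDeriv_oddLetter_mul, map_sub, extSgn_mul, extSgn_oddLetter, h]
    split_ifs <;> simp

theorem finite_oddDeriv (x : ExtAlg ι) : {i : ι × ℕ | oddDeriv i x ≠ 0}.Finite := by
  classical
  refine ext_induction ?_ ?_ ?_ ?_ x
  · simp [oddDeriv_one]
  · refine fun x y hx hy => (hx.union hy).subset fun i hi => ?_
    by_contra hc
    simp only [Set.mem_union, Set.mem_ofPred_eq, not_or, not_not] at hc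
    exact hi (by rw [map_add, hc.1, hc.2, add_zero])
  · refine fun t x hx => hx.subset fun i hi h => hi (by rw [map_smul, h, smul_zero])
  · refine fun j x hx => (hx.union (Set.finite_singleton j)).subset fun i hi => ?_
    by_contra hc
    simp only [Set.mem_union, Set.mem_ofPred_eq, not_or, not_not, Set.mem_singleton_iff] at hc
    exact hi (by rw [oddDeriv_oddLetter_mul, hc.1, if_neg (Ne.symm hc.2), mul_zero, sub_zero])

@[elab_as_elim]
theorem fock_induction {P : Fock ι → Prop} (hone : P 1) (hadd : ∀ x y, P x → P y → P (x + y))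
    (hsmul : ∀ (t : ℂ) x, P x → P (t • x)) (hb : ∀ a n x, P x → P (bLetter a n * x))
    (hc : ∀ a n x, P x → P (cLetter a n * x)) (x : Fock ι) : P x := by
  induction x using TensorProduct.induction_on with
  | zero => simpa using hsmul 0 1 hone
  | add x y hx hy => exact hadd x y hx hy
  | tmul p u =>
    induction p using MvPolynomial.induction_on with
    | C t =>
      rw [← mul_one (MvPolynomial.C t), ← MvPolynomial.smul_eq_C_mul, ← TensorProduct.smul_tmul']
      refine hsmul t _ ?_
      refine ext_induction (P := fun u => P (1 ⊗ₜ[ℂ] u)) hone ?_ ?_ ?_ u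
      · intro x y hx hy; rw [TensorProduct.tmul_add]; exact hadd _ _ hx hy
      · intro s x hx; rw [TensorProduct.tmul_smul]; exact hsmul _ _ hx
      · intro i x hx
        have := hc i.1 i.2 _ hx
        rwa [cLetter, Algebra.TensorProduct.tmul_mul_tmul, one_mul] at this
    | add p q hp hq => rw [TensorProduct.add_tmul]; exact hadd _ _ hp hq
    | mul_X p i hp =>
      have := hb i.1 i.2 _ hp
      rwa [bLetter, Algebra.TensorProduct.tmul_mul_tmul, one_mul, mul_comm] at this

@[elab_as_elim]
theorem tmul_induction {P : Fock ι → Prop} (hadd : ∀ x y, P x → P y → P (x + y))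
    (hP : ∀ p u, P (p ⊗ₜ u)) (x : Fock ι) : P x := by
  induction x using TensorProduct.induction_on with
  | zero => simpa using hP 0 0
  | add x y hx hy => exact hadd x y hx hy
  | tmul p u => exact hP p u

theorem fockSgn_tmul (p : MvPolynomial (ι × ℕ) ℂ) (u : ExtAlg ι) :
    fockSgn (p ⊗ₜ[ℂ] u) = p ⊗ₜ extSgn u := rfl

theorem bDeriv_tmul (a : ι) (n : ℕ) (p : MvPolynomial (ι × ℕ) ℂ) (u : ExtAlg ι) :
    bDeriv a n (p ⊗ₜ[ℂ] u) = MvPolynomial.pderiv (a, n) p ⊗ₜ u := rfl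

theorem cDeriv_tmul (a : ι) (n : ℕ) (p : MvPolynomial (ι × ℕ) ℂ) (u : ExtAlg ι) :
    cDeriv a n (p ⊗ₜ[ℂ] u) = p ⊗ₜ oddDeriv (a, n) u := rfl

theorem fockSgn_one : fockSgn (1 : Fock ι) = 1 := by
  rw [Algebra.TensorProduct.one_def, fockSgn_tmul, extSgn_one]

theorem fockSgn_mul (x y : Fock ι) : fockSgn (x * y) = fockSgn x * fockSgn y := by
  refine tmul_induction (fun x x' h h' => by simp only [add_mul, map_add, h, h']) (fun p u => ?_) x
  refine tmul_induction (fun x x' h h' => by simp only [mul_add, map_add, h, h']) (fun q v => ?_) y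
  simp only [Algebra.TensorProduct.tmul_mul_tmul, fockSgn_tmul, extSgn_mul]

theorem fockSgn_fockSgn (x : Fock ι) : fockSgn (fockSgn x) = x :=
  tmul_induction (fun x x' h h' => by simp only [map_add, h, h'])
    (fun p u => by rw [fockSgn_tmul, fockSgn_tmul, extSgn_extSgn]) x

theorem bDeriv_mul (a : ι) (n : ℕ) (x y : Fock ι) :
    bDeriv a n (x * y) = bDeriv a n x * y + x * bDeriv a n y := by
  refine tmul_induction (fun x x' h h' => by simp only [add_mul, map_add, h, h']; abel)
    (fun p u => ?_) x
  refine tmul_induction (fun x x' h h' => by simp only [mul_add, map_add, h, h']; abel)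
    (fun q v => ?_) y
  simp only [Algebra.TensorProduct.tmul_mul_tmul, bDeriv_tmul, Derivation.leibniz,
    TensorProduct.add_tmul, smul_eq_mul]
  rw [mul_comm q, add_comm]

theorem cDeriv_mul (a : ι) (n : ℕ) (x y : Fock ι) :
    cDeriv a n (x * y) = cDeriv a n x * y + fockSgn x * cDeriv a n y := by
  refine tmul_induction (fun x x' h h' => by simp only [add_mul, map_add, h, h']; abel)
    (fun p u => ?_) x
  refine tmul_induction (fun x x' h h' => by simp only [mul_add, map_add, h, h']; abel)
    (fun q v => ?_) y
  simp only [Algebra.TensorProduct.tmul_mul_tmul, cDeriv_tmul, fockSgn_tmul, oddDeriv_mul,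
    TensorProduct.tmul_add]

theorem bDeriv_one (a : ι) (n : ℕ) : bDeriv a n (1 : Fock ι) = 0 := by
  rw [Algebra.TensorProduct.one_def, bDeriv_tmul, Derivation.map_one_eq_zero,
    TensorProduct.zero_tmul]

theorem cDeriv_one (a : ι) (n : ℕ) : cDeriv a n (1 : Fock ι) = 0 := by
  rw [Algebra.TensorProduct.one_def, cDeriv_tmul, oddDeriv_one, TensorProduct.tmul_zero]

theorem bDeriv_bLetter [DecidableEq ι] (a a' : ι) (n n' : ℕ) :
    bDeriv a n (bLetter a' n') = if a' = a ∧ n' = n then 1 else 0 := by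
  rw [bLetter, bDeriv_tmul, MvPolynomial.pderiv_X, Pi.single_apply]
  simp only [Prod.mk.injEq]
  split_ifs
  · rfl
  · rw [TensorProduct.zero_tmul]

theorem bDeriv_cLetter (a a' : ι) (n n' : ℕ) : bDeriv a n (cLetter a' n') = 0 := by
  rw [cLetter, bDeriv_tmul, Derivation.map_one_eq_zero, TensorProduct.zero_tmul]

theorem cDeriv_bLetter (a a' : ι) (n n' : ℕ) : cDeriv a n (bLetter a' n') = 0 := by
  rw [bLetter, cDeriv_tmul, oddDeriv_one, TensorProduct.tmul_zero]

theorem cDeriv_cLetter [DecidableEq ι] (a a' : ι) (n n' : ℕ) :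
    cDeriv a n (cLetter a' n') = if a' = a ∧ n' = n then 1 else 0 := by
  have := oddDeriv_oddLetter_mul (a, n) (a', n') 1
  rw [mul_one, oddDeriv_one, mul_zero, sub_zero] at this
  rw [cLetter, cDeriv_tmul, this]
  simp only [Prod.mk.injEq]
  split_ifs
  · rfl
  · rw [TensorProduct.tmul_zero]

theorem fockSgn_bLetter (a : ι) (n : ℕ) : fockSgn (bLetter a n) = bLetter a n := by
  rw [bLetter, fockSgn_tmul, extSgn_one]

theorem fockSgn_cLetter (a : ι) (n : ℕ) : fockSgn (cLetter a n) = -cLetter a n := by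
  rw [cLetter, fockSgn_tmul, extSgn_oddLetter, TensorProduct.tmul_neg]

theorem fockSgn_bDeriv (a : ι) (n : ℕ) (x : Fock ι) :
    fockSgn (bDeriv a n x) = bDeriv a n (fockSgn x) :=
  tmul_induction (fun x x' h h' => by simp only [map_add, h, h']) (fun p u => rfl) x

theorem fockSgn_cDeriv (a : ι) (n : ℕ) (x : Fock ι) :
    fockSgn (cDeriv a n x) = -cDeriv a n (fockSgn x) :=
  tmul_induction (fun x x' h h' => by simp only [map_add, h, h', neg_add]) (fun p u => by
    rw [cDeriv_tmul, fockSgn_tmul, fockSgn_tmul, cDeriv_tmul, extSgn_oddDeriv,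
      TensorProduct.tmul_neg]) x

theorem bDeriv_bDeriv (a a' : ι) (n n' : ℕ) (x : Fock ι) :
    bDeriv a n (bDeriv a' n' x) = bDeriv a' n' (bDeriv a n x) := by
  classical
  refine fock_induction ?_ ?_ ?_ ?_ ?_ x
  · simp only [bDeriv_one, map_zero]
  · intro x y h h'; simp only [map_add, h, h']
  · intro t x h; simp only [map_smul, h]
  · intro c k x h
    simp only [bDeriv_mul, map_add, h, bDeriv_bLetter, ite_mul, one_mul, zero_mul, apply_ite,
      map_zero]
    rw [add_left_comm]
  · intro c k x h
    simp only [bDeriv_mul, h, bDeriv_cLetter, zero_mul, zero_add]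

theorem bDeriv_cDeriv (a a' : ι) (n n' : ℕ) (x : Fock ι) :
    bDeriv a n (cDeriv a' n' x) = cDeriv a' n' (bDeriv a n x) :=
  tmul_induction (fun x x' h h' => by simp only [map_add, h, h']) (fun p u => rfl) x

theorem cDeriv_cDeriv (a a' : ι) (n n' : ℕ) (x : Fock ι) :
    cDeriv a n (cDeriv a' n' x) = -cDeriv a' n' (cDeriv a n x) :=
  tmul_induction (fun x x' h h' => by simp only [map_add, h, h', neg_add]) (fun p u => by
    rw [cDeriv_tmul, cDeriv_tmul, cDeriv_tmul, cDeriv_tmul, oddDeriv_oddDeriv,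
      TensorProduct.tmul_neg]) x

theorem finite_bDeriv (x : Fock ι) : {i : ι × ℕ | bDeriv i.1 i.2 x ≠ 0}.Finite := by
  classical
  refine fock_induction ?_ ?_ ?_ ?_ ?_ x
  · simp [bDeriv_one]
  · refine fun x y hx hy => (hx.union hy).subset fun i hi => ?_
    by_contra hc
    simp only [Set.mem_union, Set.mem_ofPred_eq, not_or, not_not] at hc
    exact hi (by rw [map_add, hc.1, hc.2, add_zero])
  · refine fun t x hx => hx.subset fun i hi h => hi (by rw [map_smul, h, smul_zero])
  · refine fun a n x hx => (hx.union (Set.finite_singleton (a, n))).subset fun i hi => ?_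
    by_contra hc
    simp only [Set.mem_union, Set.mem_ofPred_eq, not_or, not_not, Set.mem_singleton_iff] at hc
    refine hi ?_
    rw [bDeriv_mul, hc.1, bDeriv_bLetter, if_neg (fun h => hc.2 (Prod.ext h.1.symm h.2.symm)),
      mul_zero, zero_mul, add_zero]
  · refine fun a n x hx => hx.subset fun i hi h => hi ?_
    rw [bDeriv_mul, h, bDeriv_cLetter, mul_zero, zero_mul, add_zero]

theorem finite_cDeriv (x : Fock ι) : {i : ι × ℕ | cDeriv i.1 i.2 x ≠ 0}.Finite := by
  classical
  refine fock_induction ?_ ?_ ?_ ?_ ?_ x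
  · simp [cDeriv_one]
  · refine fun x y hx hy => (hx.union hy).subset fun i hi => ?_
    by_contra hc
    simp only [Set.mem_union, Set.mem_ofPred_eq, not_or, not_not] at hc
    exact hi (by rw [map_add, hc.1, hc.2, add_zero])
  · refine fun t x hx => hx.subset fun i hi h => hi (by rw [map_smul, h, smul_zero])
  · refine fun a n x hx => hx.subset fun i hi h => hi ?_
    rw [cDeriv_mul, h, cDeriv_bLetter, mul_zero, zero_mul, add_zero]
  · refine fun a n x hx => (hx.union (Set.finite_singleton (a, n))).subset fun i hi => ?_
    by_contra hc
    simp only [Set.mem_union, Set.mem_ofPred_eq, not_or, not_not, Set.mem_singleton_iff] at hc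
    refine hi ?_
    rw [cDeriv_mul, hc.1, cDeriv_cLetter, if_neg (fun h => hc.2 (Prod.ext h.1.symm h.2.symm)),
      mul_zero, zero_mul, add_zero]

theorem bLetter_comm (a : ι) (n : ℕ) (x : Fock ι) : bLetter a n * x = x * bLetter a n :=
  tmul_induction (fun x x' h h' => by simp only [mul_add, add_mul, h, h']) (fun p u => by
    rw [bLetter, Algebra.TensorProduct.tmul_mul_tmul, Algebra.TensorProduct.tmul_mul_tmul, mul_comm,
      one_mul, mul_one]) x

theorem oddLetter_comm (i : ι × ℕ) (x : ExtAlg ι) : oddLetter i * x = extSgn x * oddLetter i := by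
  refine ext_induction ?_ ?_ ?_ ?_ x
  · rw [extSgn_one, one_mul, mul_one]
  · intro x x' h h'; simp only [mul_add, add_mul, map_add, h, h']
  · intro t x h; rw [mul_smul_comm, map_smul, h, smul_mul_assoc]
  · intro j x h
    rw [extSgn_mul, extSgn_oddLetter, mul_assoc, ← h, ← mul_assoc, oddLetter_anticomm, neg_mul,
      neg_mul, mul_assoc]

theorem cLetter_comm (a : ι) (n : ℕ) (x : Fock ι) : cLetter a n * x = fockSgn x * cLetter a n :=
  tmul_induction (fun x x' h h' => by simp only [mul_add, add_mul, map_add, h, h']) (fun p u => by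
    rw [cLetter, fockSgn_tmul, Algebra.TensorProduct.tmul_mul_tmul,
      Algebra.TensorProduct.tmul_mul_tmul, oddLetter_comm, one_mul, mul_one]) x

theorem fockT_apply (x : Fock ι) : fockT x = ∑ᶠ i : ι × ℕ, ((i.2 : ℂ) + 1) •
    (bLetter i.1 (i.2 + 1) * bDeriv i.1 i.2 x + cLetter i.1 (i.2 + 1) * cDeriv i.1 i.2 x) := by
  refine locSum_apply (fun x => ?_) x
  refine ((finite_bDeriv x).union (finite_cDeriv x)).subset fun i hi => ?_
  by_contra hc
  simp only [Set.mem_union, Set.mem_ofPred_eq, not_or, not_not] at hc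
  refine hi ?_
  change ((i.2 : ℂ) + 1) • (bLetter i.1 (i.2 + 1) * bDeriv i.1 i.2 x +
    cLetter i.1 (i.2 + 1) * cDeriv i.1 i.2 x) = 0
  rw [hc.1, hc.2, mul_zero, mul_zero, add_zero, smul_zero]

theorem finite_fockT (x : Fock ι) : (Function.support fun i : ι × ℕ => ((i.2 : ℂ) + 1) •
    (bLetter i.1 (i.2 + 1) * bDeriv i.1 i.2 x +
      cLetter i.1 (i.2 + 1) * cDeriv i.1 i.2 x)).Finite := by
  refine ((finite_bDeriv x).union (finite_cDeriv x)).subset fun i hi => ?_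
  by_contra hc
  simp only [Set.mem_union, Set.mem_ofPred_eq, not_or, not_not] at hc
  refine hi ?_
  beta_reduce
  rw [hc.1, hc.2, mul_zero, mul_zero, add_zero, smul_zero]

theorem fockT_one : fockT (1 : Fock ι) = 0 := by
  rw [fockT_apply]
  simp [bDeriv_one, cDeriv_one]

theorem fockT_mul (x y : Fock ι) : fockT (x * y) = fockT x * y + x * fockT y := by
  rw [fockT_apply, fockT_apply, fockT_apply, finsum_mul' _ _ (finite_fockT x),
    mul_finsum' _ _ (finite_fockT y)]
  rw [← finsum_add_distrib]
  · refine finsum_congr fun i => ?_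
    rw [bDeriv_mul, cDeriv_mul, smul_mul_assoc, mul_smul_comm, ← smul_add]
    congr 1
    -- The sign of the left derivative passing `x` cancels against that of the odd letter passing
    -- `x`, so each summand of the translation operator is an even derivation.
    rw [mul_add, mul_add, mul_add, add_mul, ← mul_assoc (cLetter i.1 (i.2 + 1)) (fockSgn x),
      cLetter_comm _ _ (fockSgn x), fockSgn_fockSgn, ← mul_assoc (bLetter i.1 (i.2 + 1)) x,
      bLetter_comm _ _ x]
    simp only [mul_assoc]
    abel
  · exact (finite_fockT x).subset fun i hi h => hi (by simp only [h, zero_mul])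
  · exact (finite_fockT y).subset fun i hi h => hi (by simp only [h, mul_zero])

theorem fockT_bLetter (a : ι) (n : ℕ) :
    fockT (bLetter a n) = ((n : ℂ) + 1) • bLetter a (n + 1) := by
  classical
  rw [fockT_apply, finsum_eq_single _ (a, n)]
  · simp [bDeriv_bLetter, cDeriv_bLetter]
  · intro i hi
    rw [bDeriv_bLetter, cDeriv_bLetter, if_neg (fun h => hi (Prod.ext h.1.symm h.2.symm))]
    simp

theorem fockT_cLetter (a : ι) (n : ℕ) :
    fockT (cLetter a n) = ((n : ℂ) + 1) • cLetter a (n + 1) := by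
  classical
  rw [fockT_apply, finsum_eq_single _ (a, n)]
  · simp [cDeriv_cLetter, bDeriv_cLetter]
  · intro i hi
    rw [cDeriv_cLetter, bDeriv_cLetter, if_neg (fun h => hi (Prod.ext h.1.symm h.2.symm))]
    simp

theorem fockSgn_fockT (x : Fock ι) : fockSgn (fockT x) = fockT (fockSgn x) := by
  refine fock_induction ?_ ?_ ?_ ?_ ?_ x
  · simp only [fockSgn_one, fockT_one, map_zero]
  · intro x y h h'; simp only [map_add, h, h']
  · intro t x h; simp only [map_smul, h]
  · intro a n x h
    simp only [fockT_mul, fockSgn_mul, map_add, h, fockT_bLetter, fockSgn_bLetter, map_smul]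
  · intro a n x h
    simp only [fockT_mul, fockSgn_mul, map_add, h, fockT_cLetter, fockSgn_cLetter, map_smul,
      map_neg, smul_neg]

end FockAlgebra


/-! ### The modes of the ghost system and their Wick formula -/

section BCSystem

variable {ι : Type*}

theorem fock_neg_one_smul (x : Fock ι) : (-1 : ℂ) • x = -x := neg_one_smul ℂ x

theorem fock_smul_neg (t : ℂ) (x : Fock ι) : t • -x = -(t • x) := smul_neg t x

/-- The parity of a generating field of the `bc` system. -/
def bcParity : ι ⊕ ι → ZMod 2 := Sum.elim (fun _ => 0) (fun _ => 1)

/-- The letters of the `bc` system. -/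
def bcLetter : ι ⊕ ι → ℕ → Fock ι := Sum.elim bLetter cLetter

/-- The signed derivatives with respect to the letters. -/
def bcDeriv : ι ⊕ ι → ℕ → Fock ι →ₗ[ℂ] Fock ι :=
  Sum.elim (fun a n => bDeriv a n ∘ₗ fockSgn) cDeriv

/-- The non-negative modes of the generating fields. -/
def bcAnn : ι ⊕ ι → ℕ → Fock ι →ₗ[ℂ] Fock ι := Sum.elim cDeriv bDeriv

theorem bcLetter_parity (φ : ι ⊕ ι) (n : ℕ) :
    HasParity (bcSystem ι) (bcParity φ) (bcLetter φ n) := by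
  rcases φ with a | a
  · exact (fockSgn_bLetter a n).trans (by rw [bcParity, Sum.elim_inl, sign_zero, one_smul]; rfl)
  · exact (fockSgn_cLetter a n).trans (by
      rw [bcParity, Sum.elim_inr, sign_one, neg_smul, one_smul]; rfl)

theorem fockSgn_apply_of_parity {p : ZMod 2} {x : Fock ι} (hx : HasParity (bcSystem ι) p x) :
    fockSgn x = sign p • x := hx

theorem bcDeriv_one (φ : ι ⊕ ι) (n : ℕ) : bcDeriv φ n (1 : Fock ι) = 0 := by
  rcases φ with a | a
  · change bDeriv a n (fockSgn 1) = 0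
    rw [fockSgn_one, bDeriv_one]
  · exact cDeriv_one a n

theorem bcAnn_one (φ : ι ⊕ ι) (n : ℕ) : bcAnn φ n (1 : Fock ι) = 0 := by
  rcases φ with a | a
  · exact cDeriv_one a n
  · exact bDeriv_one a n

/-- `bcDeriv` includes the sign of moving the annihilator to the far right, which explains the sign
in `r` on the first term. -/
theorem bcDeriv_mul {p r : ZMod 2} {a x : Fock ι} (ha : HasParity (bcSystem ι) p a)
    (hx : HasParity (bcSystem ι) r x) (φ : ι ⊕ ι) (n : ℕ) :
    bcDeriv φ n (a * x) = sign ((bcParity φ + 1) * r) • (bcDeriv φ n a * x) +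
      sign p • (a * bcDeriv φ n x) := by
  rcases φ with i | i
  · change bDeriv i n (fockSgn (a * x)) = sign ((0 + 1) * r) • (bDeriv i n (fockSgn a) * x) +
      sign p • (a * bDeriv i n (fockSgn x))
    rw [fockSgn_mul, fockSgn_apply_of_parity ha, fockSgn_apply_of_parity hx, bDeriv_mul, zero_add,
      one_mul, mul_smul_comm, map_smul, map_smul, smul_mul_assoc, smul_mul_assoc, mul_smul_comm]
  · change cDeriv i n (a * x) = sign ((1 + 1) * r) • (cDeriv i n a * x) +
      sign p • (a * cDeriv i n x)
    rw [cDeriv_mul, fockSgn_apply_of_parity ha, show (1 + 1 : ZMod 2) = 0 from rfl, zero_mul,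
      sign_zero, one_smul, smul_mul_assoc]

theorem bcAnn_mul {q : ZMod 2} {x : Fock ι} (hx : HasParity (bcSystem ι) q x) (φ : ι ⊕ ι) (n : ℕ)
    (y : Fock ι) : bcAnn φ n (x * y) = bcAnn φ n x * y +
      sign ((bcParity φ + 1) * q) • (x * bcAnn φ n y) := by
  rcases φ with i | i
  · change cDeriv i n (x * y) = cDeriv i n x * y + sign ((0 + 1) * q) • (x * cDeriv i n y)
    rw [cDeriv_mul, fockSgn_apply_of_parity hx, zero_add, one_mul, smul_mul_assoc]
  · change bDeriv i n (x * y) = bDeriv i n x * y + sign ((1 + 1) * q) • (x * bDeriv i n y)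
    rw [bDeriv_mul, show (1 + 1 : ZMod 2) = 0 from rfl, zero_mul, sign_zero, one_smul]

theorem fockSgn_bcDeriv (φ : ι ⊕ ι) (n : ℕ) (x : Fock ι) :
    fockSgn (bcDeriv φ n x) = sign (bcParity φ) • bcDeriv φ n (fockSgn x) := by
  rcases φ with i | i
  · change fockSgn (bDeriv i n (fockSgn x)) = sign 0 • bDeriv i n (fockSgn (fockSgn x))
    rw [fockSgn_bDeriv, sign_zero, one_smul]
  · change fockSgn (cDeriv i n x) = sign 1 • cDeriv i n (fockSgn x)
    rw [fockSgn_cDeriv, sign_one, fock_neg_one_smul]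

theorem fockSgn_bcAnn (φ : ι ⊕ ι) (n : ℕ) (x : Fock ι) :
    fockSgn (bcAnn φ n x) = sign (bcParity φ + 1) • bcAnn φ n (fockSgn x) := by
  rcases φ with i | i
  · change fockSgn (cDeriv i n x) = sign (0 + 1) • cDeriv i n (fockSgn x)
    rw [fockSgn_cDeriv, zero_add, sign_one, fock_neg_one_smul]
  · change fockSgn (bDeriv i n x) = sign (1 + 1) • bDeriv i n (fockSgn x)
    rw [fockSgn_bDeriv, show (1 + 1 : ZMod 2) = 0 from rfl, sign_zero, one_smul]

theorem bcDeriv_parity {p : ZMod 2} {x : Fock ι} (hx : HasParity (bcSystem ι) p x) (φ : ι ⊕ ι)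
    (n : ℕ) : HasParity (bcSystem ι) (bcParity φ + p) (bcDeriv φ n x) := by
  refine (fockSgn_bcDeriv φ n x).trans ?_
  rw [fockSgn_apply_of_parity hx, map_smul, smul_smul, sign_add]

theorem finite_sum_elim {f g : ι → ℕ → Fock ι →ₗ[ℂ] Fock ι} (x : Fock ι)
    (hf : {i : ι × ℕ | f i.1 i.2 x ≠ 0}.Finite) (hg : {i : ι × ℕ | g i.1 i.2 x ≠ 0}.Finite) :
    {i : (ι ⊕ ι) × ℕ | (Sum.elim f g : ι ⊕ ι → ℕ → Fock ι →ₗ[ℂ] Fock ι) i.1 i.2 x ≠ 0}.Finite := by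
  refine ((hf.image fun i => (Sum.inl i.1, i.2)).union
    (hg.image fun i => (Sum.inr i.1, i.2))).subset ?_
  rintro ⟨i | i, n⟩ hi
  · exact Or.inl ⟨(i, n), hi, rfl⟩
  · exact Or.inr ⟨(i, n), hi, rfl⟩

theorem finite_bcDeriv (x : Fock ι) : {i : (ι ⊕ ι) × ℕ | bcDeriv i.1 i.2 x ≠ 0}.Finite :=
  finite_sum_elim x (finite_bDeriv (fockSgn x)) (finite_cDeriv x)

theorem finite_bcAnn (x : Fock ι) : {i : (ι ⊕ ι) × ℕ | bcAnn i.1 i.2 x ≠ 0}.Finite :=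
  finite_sum_elim x (finite_cDeriv x) (finite_bDeriv x)

theorem bc_mul (x y : Fock ι) : (bcSystem ι).Y (-1) x y = x * y := wick_neg_one (D := bcDeriv) (ann := bcAnn) x y

theorem bc_mode (m : ℕ) (a v : Fock ι) : (bcSystem ι).Y m a v =
    ∑ᶠ i : (ι ⊕ ι) × ℕ × ℕ, if m ≤ i.2.1 + i.2.2 then
      ((-1 : ℂ) ^ i.2.1 * (i.2.1 + i.2.2).choose i.2.1) •
        (dpow fockT (i.2.1 + i.2.2 - m) (bcDeriv i.1 i.2.1 a) * bcAnn i.1 i.2.2 v) else 0 :=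
  wick_nonneg m finite_bcDeriv finite_bcAnn a v

/-- Finitely many indices are enough for the modes of `a` on `v`. -/
theorem exists_bc_mode_eq_sum (a v : Fock ι) : ∃ S : Finset ((ι ⊕ ι) × ℕ × ℕ),
    ∀ S', S ⊆ S' → ∀ m : ℕ, (bcSystem ι).Y m a v = ∑ i ∈ S', if m ≤ i.2.1 + i.2.2 then
      ((-1 : ℂ) ^ i.2.1 * (i.2.1 + i.2.2).choose i.2.1) •
        (dpow fockT (i.2.1 + i.2.2 - m) (bcDeriv i.1 i.2.1 a) * bcAnn i.1 i.2.2 v) else 0 := by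
  have hfin : {i : (ι ⊕ ι) × ℕ × ℕ | bcDeriv i.1 i.2.1 a ≠ 0 ∧ bcAnn i.1 i.2.2 v ≠ 0}.Finite := by
    refine (((finite_bcDeriv a).prod (finite_bcAnn v)).preimage
      (f := fun i : (ι ⊕ ι) × ℕ × ℕ => ((i.1, i.2.1), (i.1, i.2.2))) (fun i _ j _ h => ?_)).subset
      fun i hi => hi
    simp only [Prod.mk.injEq] at h
    exact Prod.ext h.1.1 (Prod.ext h.1.2 h.2.2)
  refine ⟨hfin.toFinset, fun S' hS m => ?_⟩
  rw [bc_mode]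
  refine finsum_eq_sum_of_support_subset _ fun i hi => hS ?_
  rw [Set.Finite.mem_toFinset]
  refine ⟨fun h => hi ?_, fun h => hi ?_⟩ <;> simp [h]

theorem bc_parity_mul {p q : ZMod 2} {x y : Fock ι} (hx : HasParity (bcSystem ι) p x)
    (hy : HasParity (bcSystem ι) q y) : HasParity (bcSystem ι) (p + q) (x * y) := by
  refine (fockSgn_mul x y).trans ?_
  rw [fockSgn_apply_of_parity hx, fockSgn_apply_of_parity hy, smul_mul_assoc, mul_smul_comm,
    smul_smul, sign_add]

/-- Induction on letters does not see homogeneity, so every vector is split into an even and an odd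
part that both satisfy the claim; multiplication by an odd letter exchanges them. For a homogeneous
vector the part of the wrong parity vanishes because `2` is invertible. Scalars are built into the
claim, as `P` need not be stable under them. -/
theorem fock_parity_induction {P : ZMod 2 → Fock ι → Prop} (h0 : ∀ r, P r 0)
    (hone : ∀ t : ℂ, P 0 (t • 1)) (hadd : ∀ r x y, P r x → P r y → P r (x + y))
    (hl : ∀ φ n r x, HasParity (bcSystem ι) r x → P r x → P (bcParity φ + r) (bcLetter φ n * x))
    (r : ZMod 2) (x : Fock ι) (hx : HasParity (bcSystem ι) r x) : P r x := by
  have key : ∀ x : Fock ι, ∃ y : ZMod 2 → Fock ι, x = y 0 + y 1 ∧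
      ∀ r, HasParity (bcSystem ι) r (y r) ∧ ∀ t : ℂ, P r (t • y r) := by
    intro x
    have hstep : ∀ φ n x, (∃ y : ZMod 2 → Fock ι, x = y 0 + y 1 ∧
        ∀ r, HasParity (bcSystem ι) r (y r) ∧ ∀ t : ℂ, P r (t • y r)) →
        ∃ y : ZMod 2 → Fock ι, bcLetter φ n * x = y 0 + y 1 ∧
        ∀ r, HasParity (bcSystem ι) r (y r) ∧ ∀ t : ℂ, P r (t • y r) := by
      rintro φ n x ⟨y, rfl, hy⟩
      refine ⟨fun r => bcLetter φ n * y (bcParity φ + r), ?_, fun r => ⟨?_, fun t => ?_⟩⟩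
      · rcases zmod_two_cases (bcParity φ) with h | h
        · beta_reduce; rw [h, zero_add, zero_add, mul_add]
        · beta_reduce; rw [h, show (1 + 1 : ZMod 2) = 0 from rfl, add_zero, mul_add, add_comm]
      all_goals
        have hr : r = bcParity φ + (bcParity φ + r) := by
          rw [← add_assoc, CharTwo.add_self_eq_zero, zero_add]
      · have := bc_parity_mul (bcLetter_parity φ n) (hy (bcParity φ + r)).1
        rwa [← hr] at this
      · have := hl φ n _ _ ((hy (bcParity φ + r)).1.smul t) ((hy (bcParity φ + r)).2 t)
        rwa [← hr, mul_smul_comm] at this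
    refine fock_induction ?_ ?_ ?_ ?_ ?_ x
    · refine ⟨fun r => if r = 0 then 1 else 0, by simp, fun r => ?_⟩
      rcases zmod_two_cases r with rfl | rfl
      · refine ⟨?_, fun t => ?_⟩
        · beta_reduce; rw [if_pos rfl]
          exact fockSgn_one.trans (by rw [sign_zero, one_smul])
        · beta_reduce; rw [if_pos rfl]; exact hone t
      · refine ⟨?_, fun t => ?_⟩
        · beta_reduce; rw [if_neg one_ne_zero]; exact HasParity.zero
        · beta_reduce; rw [if_neg one_ne_zero, smul_zero]; exact h0 1
    · rintro x x' ⟨y, rfl, hy⟩ ⟨y', rfl, hy'⟩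
      refine ⟨fun r => y r + y' r, add_add_add_comm _ _ _ _, fun r => ⟨(hy r).1.add (hy' r).1, fun t => ?_⟩⟩
      rw [smul_add]
      exact hadd _ _ _ ((hy r).2 t) ((hy' r).2 t)
    · rintro s x ⟨y, rfl, hy⟩
      refine ⟨fun r => s • y r, smul_add _ _ _, fun r => ⟨(hy r).1.smul s, fun t => ?_⟩⟩
      rw [smul_smul]
      exact (hy r).2 _
    · exact fun a n x h => hstep (Sum.inl a) n x h
    · exact fun a n x h => hstep (Sum.inr a) n x h
  obtain ⟨y, rfl, hy⟩ := key x
  have h1 := fockSgn_apply_of_parity (hy 0).1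
  have h2 := fockSgn_apply_of_parity (hy 1).1
  have h3 := fockSgn_apply_of_parity hx
  rw [map_add, h1, h2, sign_zero, sign_one] at h3
  rcases zmod_two_cases r with rfl | rfl
  · have : y 1 = 0 := by
      rw [sign_zero, one_smul, one_smul, fock_neg_one_smul, add_right_inj] at h3
      have h4 : (2 : ℂ) • y 1 = 0 := by
        rw [two_smul]; nth_rewrite 1 [← h3]; exact neg_add_cancel _
      exact (smul_eq_zero.1 h4).resolve_left two_ne_zero
    rw [this, add_zero]
    simpa using (hy 0).2 1
  · have : y 0 = 0 := by
      rw [sign_one, one_smul, fock_neg_one_smul, fock_neg_one_smul, neg_add, add_left_inj] at h3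
      have h4 : (2 : ℂ) • y 0 = 0 := by
        rw [two_smul]; nth_rewrite 1 [h3]; exact neg_add_cancel _
      exact (smul_eq_zero.1 h4).resolve_left two_ne_zero
    rw [this, zero_add]
    simpa using (hy 1).2 1

theorem bcLetter_comm (φ : ι ⊕ ι) (n : ℕ) {q : ZMod 2} {x : Fock ι}
    (hx : HasParity (bcSystem ι) q x) :
    bcLetter φ n * x = sign (bcParity φ * q) • (x * bcLetter φ n) := by
  rcases φ with a | a
  · change bLetter a n * x = sign (0 * q) • (x * bLetter a n)
    rw [bLetter_comm, zero_mul, sign_zero, one_smul]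
  · change cLetter a n * x = sign (1 * q) • (x * cLetter a n)
    rw [cLetter_comm, fockSgn_apply_of_parity hx, one_mul, smul_mul_assoc]

theorem bc_comm {p q : ZMod 2} {x y : Fock ι} (hx : HasParity (bcSystem ι) p x)
    (hy : HasParity (bcSystem ι) q y) : x * y = sign (p * q) • (y * x) := by
  refine fock_parity_induction (P := fun p x => x * y = sign (p * q) • (y * x)) ?_ ?_ ?_ ?_ p x hx
  · simp
  · intro t; rw [zero_mul, sign_zero, one_smul, smul_mul_assoc, mul_smul_comm, one_mul, mul_one]
  · intro r x x' h h'; rw [add_mul, h, h', mul_add, smul_add]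
  · intro φ n r x _ h
    rw [mul_assoc, h, mul_smul_comm, ← mul_assoc, bcLetter_comm φ n hy, smul_mul_assoc, smul_smul,
      mul_assoc, ← sign_add]
    congr 2; ring

theorem bc_isCommutative : IsCommutative (bcSystem ι) where
  sgn_sgn := fockSgn_fockSgn
  sgn_vac := fockSgn_one
  sgn_T := fockSgn_fockT
  sgn_mul a b := by rw [bc_mul, bc_mul]; exact fockSgn_mul a b
  sgn_mode m a b := by
    change fockSgn _ = -(bcSystem ι).Y m (fockSgn a) (fockSgn b)
    classical
    obtain ⟨S, hS⟩ := exists_bc_mode_eq_sum a b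
    obtain ⟨S', hS'⟩ := exists_bc_mode_eq_sum (fockSgn a) (fockSgn b)
    rw [hS (S ∪ S') Finset.subset_union_left, hS' (S ∪ S') Finset.subset_union_right, map_sum,
      ← Finset.sum_neg_distrib]
    refine Finset.sum_congr rfl fun i _ => ?_
    split_ifs
    · rw [map_smul, fockSgn_mul, dpow_map (S := fockT) fockSgn fockSgn_fockT, fockSgn_bcDeriv,
        fockSgn_bcAnn, map_smul, smul_mul_assoc, mul_smul_comm, smul_smul (sign (bcParity i.1)),
        sign_add_one, mul_neg, sign_mul_self, fock_neg_one_smul, fock_smul_neg]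
    · rw [map_zero, neg_zero]
  field a v := by
    obtain ⟨S, hS⟩ := exists_bc_mode_eq_sum a v
    refine ⟨(S.sup fun i => i.2.1 + i.2.2) + 1, fun m hm => ?_⟩
    obtain ⟨k, rfl⟩ : ∃ k : ℕ, m = (k : ℤ) := ⟨m.toNat, by omega⟩
    beta_reduce
    rw [hS S subset_rfl]
    refine Finset.sum_eq_zero fun i hi => if_neg ?_
    have := Finset.le_sup (f := fun i : (ι ⊕ ι) × ℕ × ℕ => i.2.1 + i.2.2) hi
    beta_reduce at this
    omega
  T_vac := fockT_one
  T_mul a b := by rw [bc_mul, bc_mul, bc_mul]; exact fockT_mul a b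
  neg n a := LinearMap.ext fun b => by rw [bc_mul]; exact wick_neg (D := bcDeriv) (ann := bcAnn) n a b
  vac_mul a := by rw [bc_mul]; exact one_mul a
  vac_mode m a := by
    rw [bc_mode]
    refine finsum_eq_zero_of_forall_eq_zero fun i => ?_
    change (if _ then _ • (dpow fockT _ (bcDeriv i.1 i.2.1 1) * _) else 0) = (0 : Fock ι)
    rw [bcDeriv_one, map_zero, zero_mul, smul_zero, ite_self]
  mode_vac m a := by
    rw [bc_mode]
    refine finsum_eq_zero_of_forall_eq_zero fun i => ?_
    change (if _ then _ • (_ * bcAnn i.1 i.2.2 1) else 0) = (0 : Fock ι)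
    rw [bcAnn_one, mul_zero, smul_zero, ite_self]
  comm p q a b ha hb := by rw [bc_mul, bc_mul]; exact bc_comm ha hb
  assoc a b c := by rw [bc_mul, bc_mul, bc_mul, bc_mul, mul_assoc]

/-- The Leibniz rule over a range that does not depend on `L`. In the Wick formula one bound then
serves all contractions and the sums can be exchanged. -/
theorem dpow_mul_eq_sum (m L N : ℕ) (hN : L < N) (a y : Fock ι) :
    (if m ≤ L then dpow fockT (L - m) (a * y) else 0) =
      ∑ j ∈ Finset.range N, dpow fockT j a *
        if m + j ≤ L then dpow fockT (L - (m + j)) y else 0 := by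
  by_cases h : m ≤ L
  · have h1 := dpow_bilin (T := fockT) (S := fockT) (R := fockT) (LinearMap.mul ℂ (Fock ι))
      (fun x y => fockT_mul x y) (L - m) a y
    simp only [LinearMap.mul_apply'] at h1
    rw [if_pos h, h1, Finset.Nat.sum_antidiagonal_eq_sum_range_succ_mk]
    refine (Finset.sum_congr rfl fun j hj => ?_).trans
      (Finset.sum_subset (s₁ := Finset.range (L - m).succ)
        (by intro j; simp only [Finset.mem_range]; omega) fun j _ hj => ?_)
    · rw [Finset.mem_range] at hj
      rw [if_pos (by omega), Nat.sub_sub]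
    · rw [Finset.mem_range] at hj
      rw [if_neg (by omega), mul_zero]
  · rw [if_neg h]
    symm
    exact Finset.sum_eq_zero fun j _ => by rw [if_neg (by omega), mul_zero]

/-- Each term of a mode contains one derivative of the polynomial and one annihilator. The product
rule lets the derivative hit `a` or `x`, and the other factor becomes the coefficient. The identity
holds contraction by contraction. -/
theorem bc_isWick {p r : ZMod 2} {a x : Fock ι} (ha : HasParity (bcSystem ι) p a)
    (hx : HasParity (bcSystem ι) r x) : IsWick (bcSystem ι) p r a x := by
  classical
  intro m v
  obtain ⟨S₁, h₁⟩ := exists_bc_mode_eq_sum a v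
  obtain ⟨S₂, h₂⟩ := exists_bc_mode_eq_sum x v
  obtain ⟨S₃, h₃⟩ := exists_bc_mode_eq_sum (a * x) v
  set S := S₁ ∪ (S₂ ∪ S₃) with hS
  have e₁ := h₁ S Finset.subset_union_left
  have e₂ := h₂ S (Finset.subset_union_left.trans Finset.subset_union_right)
  have e₃ := h₃ S (Finset.subset_union_right.trans Finset.subset_union_right)
  set N := (S.sup fun i => i.2.1 + i.2.2) + 1 with hN
  have hle : ∀ i ∈ S, i.2.1 + i.2.2 < N := fun i hi => by
    have := Finset.le_sup (f := fun i : (ι ⊕ ι) × ℕ × ℕ => i.2.1 + i.2.2) hi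
    exact Nat.lt_succ_of_le this
  have z₁ : ∀ n, N ≤ n → (bcSystem ι).Y n a v = 0 := fun n hn => by
    rw [e₁]; exact Finset.sum_eq_zero fun i hi => if_neg (by have := hle i hi; omega)
  have z₂ : ∀ n, N ≤ n → (bcSystem ι).Y n x v = 0 := fun n hn => by
    rw [e₂]; exact Finset.sum_eq_zero fun i hi => if_neg (by have := hle i hi; omega)
  -- the sum for one factor
  have key : ∀ (a x : Fock ι), (∀ m : ℕ, (bcSystem ι).Y m x v = ∑ i ∈ S, if m ≤ i.2.1 + i.2.2 then
      ((-1 : ℂ) ^ i.2.1 * (i.2.1 + i.2.2).choose i.2.1) •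
        (dpow fockT (i.2.1 + i.2.2 - m) (bcDeriv i.1 i.2.1 x) * bcAnn i.1 i.2.2 v) else 0) →
      (∀ n, N ≤ n → (bcSystem ι).Y n x v = 0) →
      wickSum (bcSystem ι).T ((bcSystem ι).Y (-1)) a (fun k : ℕ => (bcSystem ι).Y k x v) m =
      ∑ i ∈ S, ((-1 : ℂ) ^ i.2.1 * (i.2.1 + i.2.2).choose i.2.1) •
        ((if m ≤ i.2.1 + i.2.2 then dpow fockT (i.2.1 + i.2.2 - m) (a * bcDeriv i.1 i.2.1 x)
          else 0) * bcAnn i.1 i.2.2 v) := by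
    intro a x e z
    rw [wickSum_eq z]
    simp only [e, bc_mul, Finset.mul_sum]
    rw [Finset.sum_comm]
    refine Finset.sum_congr rfl fun i hi => ?_
    rw [dpow_mul_eq_sum m _ N (hle i hi), Finset.sum_mul, Finset.smul_sum]
    refine Finset.sum_congr rfl fun j _ => ?_
    change dpow fockT j a * _ = _
    split_ifs
    · rw [mul_smul_comm, mul_assoc]
    · rw [mul_zero, zero_mul, smul_zero]
  rw [key a x e₂ z₂, key x a e₁ z₁, bc_mul, e₃, Finset.smul_sum, Finset.smul_sum,
    ← Finset.sum_add_distrib]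
  refine Finset.sum_congr rfl fun i hi => ?_
  split_ifs
  · rw [bcDeriv_mul ha hx, bc_comm (bcDeriv_parity ha i.1 i.2.1) hx, smul_smul, ← sign_add,
      map_add, map_smul, map_smul, add_mul, smul_add, smul_mul_assoc, smul_mul_assoc, add_comm,
      smul_comm (sign p)]
    rw [show (bcParity i.1 + 1) * r + (bcParity i.1 + p) * r =
      p * r + r + (bcParity i.1 + bcParity i.1) * r by ring, CharTwo.add_self_eq_zero, zero_mul,
      add_zero, smul_comm (sign (p * r + r))]
  · simp

end BCSystem


/-! ### The Poisson structure of the ghost system -/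

section BCPoisson

variable {ι : Type*}

theorem bcDeriv_bcLetter [DecidableEq ι] (φ ψ : ι ⊕ ι) (j n : ℕ) :
    bcDeriv ψ j (bcLetter φ n) = if φ = ψ ∧ n = j then 1 else 0 := by
  rcases φ with a | a <;> rcases ψ with b | b
  · change bDeriv b j (fockSgn (bLetter a n)) = _
    rw [fockSgn_bLetter, bDeriv_bLetter]
    simp only [Sum.inl.injEq]
  · exact (cDeriv_bLetter b a j n).trans (by simp)
  · change bDeriv b j (fockSgn (cLetter a n)) = _
    rw [fockSgn_cLetter, map_neg, bDeriv_cLetter]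
    simp
  · change cDeriv b j (cLetter a n) = _
    rw [cDeriv_cLetter]
    simp only [Sum.inr.injEq]

theorem bcAnn_bcLetter [DecidableEq ι] (φ ψ : ι ⊕ ι) (k n : ℕ) :
    bcAnn φ k (bcLetter ψ n) = if ψ = φ.swap ∧ n = k then 1 else 0 := by
  rcases φ with a | a <;> rcases ψ with b | b
  · exact (cDeriv_bLetter a b k n).trans (by simp)
  · change cDeriv a k (cLetter b n) = _
    rw [cDeriv_cLetter]
    simp only [Sum.swap_inl, Sum.inr.injEq]
  · change bDeriv a k (bLetter b n) = _
    rw [bDeriv_bLetter]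
    simp only [Sum.swap_inr, Sum.inl.injEq]
  · exact (bDeriv_cLetter a b k n).trans (by simp)

theorem bcAnn_bcAnn (φ ψ : ι ⊕ ι) (k l : ℕ) (x : Fock ι) : bcAnn φ k (bcAnn ψ l x) =
    sign ((bcParity φ + 1) * (bcParity ψ + 1)) • bcAnn ψ l (bcAnn φ k x) := by
  have h : (1 + 1 : ZMod 2) = 0 := rfl
  rcases φ with a | a <;> rcases ψ with b | b
  · change cDeriv a k (cDeriv b l x) = sign ((0 + 1) * (0 + 1)) • cDeriv b l (cDeriv a k x)
    rw [cDeriv_cDeriv, zero_add, one_mul, sign_one, fock_neg_one_smul]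
  · change cDeriv a k (bDeriv b l x) = sign ((0 + 1) * (1 + 1)) • bDeriv b l (cDeriv a k x)
    rw [bDeriv_cDeriv, h, mul_zero, sign_zero, one_smul]
  · change bDeriv a k (cDeriv b l x) = sign ((1 + 1) * (0 + 1)) • cDeriv b l (bDeriv a k x)
    rw [bDeriv_cDeriv, h, zero_mul, sign_zero, one_smul]
  · change bDeriv a k (bDeriv b l x) = sign ((1 + 1) * (1 + 1)) • bDeriv b l (bDeriv a k x)
    rw [bDeriv_bDeriv, h, zero_mul, sign_zero, one_smul]

theorem fockT_bcLetter (φ : ι ⊕ ι) (n : ℕ) :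
    fockT (bcLetter φ n) = ((n : ℂ) + 1) • bcLetter φ (n + 1) := by
  rcases φ with a | a
  · exact fockT_bLetter a n
  · exact fockT_cLetter a n

theorem bcAnn_bcLetter_mul [DecidableEq ι] (φ ψ : ι ⊕ ι) (k n : ℕ) (x : Fock ι) :
    bcAnn φ k (bcLetter ψ n * x) = (if ψ = φ.swap ∧ n = k then x else 0) +
      sign ((bcParity φ + 1) * bcParity ψ) • (bcLetter ψ n * bcAnn φ k x) := by
  rw [bcAnn_mul (bcLetter_parity ψ n), bcAnn_bcLetter, ite_mul, one_mul, zero_mul]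

theorem bcAnn_fockT (φ : ι ⊕ ι) (k : ℕ) (x : Fock ι) :
    bcAnn φ k (fockT x) = fockT (bcAnn φ k x) + (k : ℂ) • bcAnn φ (k - 1) x := by
  classical
  have step : ∀ ψ n x, bcAnn φ k (fockT x) = fockT (bcAnn φ k x) + (k : ℂ) • bcAnn φ (k - 1) x →
      bcAnn φ k (fockT (bcLetter ψ n * x)) = fockT (bcAnn φ k (bcLetter ψ n * x)) +
        (k : ℂ) • bcAnn φ (k - 1) (bcLetter ψ n * x) := by
    intro ψ n x h
    -- Translation raises the letter `n` to `n + 1` with factor `n + 1`, which equals `k` when the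
    -- annihilator detects it. For `k = 0` the truncated index `k - 1` is harmless, as its
    -- coefficient is zero.
    have e1 : (k : ℂ) • (if ψ = φ.swap ∧ n = k - 1 then x else 0) =
        ((n : ℂ) + 1) • (if ψ = φ.swap ∧ n + 1 = k then x else 0) := by
      by_cases hψ : ψ = φ.swap
      · rcases k with _ | k
        · simp
        · by_cases hn : n = k
          · subst hn; simp
          · rw [if_neg (by omega), if_neg (by omega), smul_zero, smul_zero]
      · simp [hψ]
    rw [fockT_mul, fockT_bcLetter, smul_mul_assoc, map_add, map_smul, bcAnn_bcLetter_mul,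
      bcAnn_bcLetter_mul, bcAnn_bcLetter_mul, bcAnn_bcLetter_mul, h, map_add, map_smul, fockT_mul,
      fockT_bcLetter, smul_mul_assoc, mul_add, smul_add (k : ℂ), e1, mul_smul_comm]
    have e2 : fockT (if ψ = φ.swap ∧ n = k then x else 0) =
        if ψ = φ.swap ∧ n = k then fockT x else 0 := by split_ifs <;> simp
    rw [e2]
    module
  refine fock_induction ?_ ?_ ?_ ?_ ?_ x
  · rw [fockT_one, bcAnn_one, bcAnn_one, map_zero, map_zero, smul_zero, add_zero]
  · intro x y h h'; simp only [map_add, h, h', smul_add]; exact add_add_add_comm _ _ _ _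
  · intro t x h; rw [map_smul, map_smul, h, map_smul, map_smul, map_smul, smul_add, smul_comm t]
  · exact fun a n x h => step (Sum.inl a) n x h
  · exact fun a n x h => step (Sum.inr a) n x h

/-- The derivative of a letter is a constant, which is killed by every positive power of the
translation operator. So only the contraction with `n + k = m` contributes. -/
theorem bc_mode_bcLetter (φ : ι ⊕ ι) (n m : ℕ) (v : Fock ι) :
    (bcSystem ι).Y m (bcLetter φ n) v =
      if n ≤ m then ((-1 : ℂ) ^ n * m.choose n) • bcAnn φ (m - n) v else 0 := by
  classical
  rw [bc_mode, finsum_eq_single _ (φ, n, m - n)]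
  · dsimp only
    rw [bcDeriv_bcLetter, if_pos (show φ = φ ∧ n = n from ⟨rfl, rfl⟩)]
    by_cases h : n ≤ m
    · rw [if_pos h, if_pos (by omega), Nat.add_sub_cancel' h, Nat.sub_self, dpow_zero, one_mul]
    · rw [if_neg h, if_pos (by omega), dpow_of_T_eq_zero fockT_one, if_neg (by omega), zero_mul,
        smul_zero]
  · rintro ⟨ψ, j, k⟩ hne
    split_ifs with h
    · rw [bcDeriv_bcLetter]
      split_ifs with h'
      · obtain ⟨rfl, rfl⟩ := h'
        rw [dpow_of_T_eq_zero fockT_one, if_neg, zero_mul, smul_zero]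
        intro h0
        dsimp only at h0 h
        exact hne (by rw [show k = m - n by omega])
      · rw [map_zero, zero_mul, smul_zero]
    · rfl

theorem bcLetter_isDerivation (φ : ι ⊕ ι) (n : ℕ) :
    IsDerivation (bcSystem ι) (bcParity φ) (bcLetter φ n) := by
  intro q b hb m c
  simp only [bc_mode_bcLetter, bc_mul]
  split_ifs
  · rw [bcAnn_mul hb, smul_add, smul_mul_assoc, mul_smul_comm, smul_comm (sign _)]
  · simp

theorem bcLetter_isCovariant (φ : ι ⊕ ι) (n : ℕ) : IsCovariant (bcSystem ι) (bcLetter φ n) := by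
  intro m b
  change _ = fockT _ + _
  simp only [bc_mode_bcLetter]
  change (if n ≤ m then _ • bcAnn φ (m - n) (fockT b) else 0) = _
  rcases lt_trichotomy n m with h | rfl | h
  · rw [if_pos h.le, if_pos h.le, if_pos (by omega), bcAnn_fockT, smul_add, map_smul, smul_smul,
      smul_smul, show m - n - 1 = m - 1 - n by omega]
    congr 2
    obtain ⟨k, rfl⟩ : ∃ k, m = k + 1 := ⟨m - 1, by omega⟩
    have := Nat.choose_mul_succ_eq k n
    have h2 : ((k.choose n : ℕ) : ℂ) * (k + 1) = ((k + 1).choose n : ℕ) * ((k + 1 - n : ℕ) : ℂ) := by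
      exact_mod_cast this
    rw [Nat.add_sub_cancel]
    push_cast
    linear_combination -(-1 : ℂ) ^ n * h2
  · rw [if_pos le_rfl, if_pos le_rfl, bcAnn_fockT, Nat.sub_self, Nat.cast_zero, zero_smul,
      add_zero, map_smul]
    rcases n with _ | n
    · simp
    · rw [if_neg (by omega), smul_zero, add_zero]
  · rw [if_neg (by omega), if_neg (by omega), if_neg (by omega), map_zero, smul_zero, add_zero]

theorem bcParity_swap (φ : ι ⊕ ι) : bcParity φ * bcParity φ.swap = 0 := by
  rcases φ with a | a
  · exact zero_mul _
  · exact mul_zero _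

/-- Contractions of two letters are multiples of the vacuum, so the transform reduces to its term
without derivatives. The Koszul sign is trivial because a `b` is only paired with a `c`, and the
rest is the symmetry of `binom(n + j, n)`. -/
theorem bcLetter_isSkew (φ ψ : ι ⊕ ι) (n j : ℕ) :
    IsSkew (bcSystem ι) (bcParity φ) (bcParity ψ) (bcLetter φ n) (bcLetter ψ j) := by
  classical
  intro l
  have h : ∀ (φ ψ : ι ⊕ ι) (n j m : ℕ), (bcSystem ι).Y m (bcLetter φ n) (bcLetter ψ j) =
      (if ψ = φ.swap ∧ m = n + j then (-1 : ℂ) ^ n * m.choose n else 0) • 1 := by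
    intro φ ψ n j m
    rw [bc_mode_bcLetter, bcAnn_bcLetter]
    by_cases hm : n ≤ m
    · rw [if_pos hm]
      by_cases h : ψ = φ.swap ∧ j = m - n
      · rw [if_pos h, if_pos ⟨h.1, by omega⟩]
      · rw [if_neg h, if_neg (fun h' => h ⟨h'.1, by omega⟩), smul_zero, zero_smul]
    · rw [if_neg hm, if_neg (fun h' => hm (by omega)), zero_smul]
  simp only [h]
  change _ = sign _ • skewTransform fockT _ l
  rw [skewTransform, finsum_eq_single _ 0]
  · rw [dpow_zero, add_zero, smul_smul, smul_smul]
    congr 1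
    by_cases hs : ψ = φ.swap ∧ l = n + j
    · obtain ⟨rfl, rfl⟩ := hs
      rw [if_pos ⟨φ.swap_swap.symm, add_comm n j⟩, if_pos ⟨rfl, rfl⟩, bcParity_swap, sign_zero,
        one_mul, Nat.choose_symm_add, pow_add]
      linear_combination (-(-1 : ℂ) ^ j * ((n + j).choose j : ℂ)) *
        (Even.neg_one_pow (α := ℂ) ⟨n, rfl⟩ : (-1 : ℂ) ^ (n + n) = 1) +
        (-1 : ℂ) ^ j * ((n + j).choose j : ℂ) * pow_add (-1 : ℂ) n n
    · rw [if_neg hs, if_neg, mul_zero]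
      rintro ⟨h1, h2⟩
      exact hs ⟨by rw [h1, Sum.swap_swap], by omega⟩
  · intro i hi
    rw [map_smul, dpow_of_T_eq_zero fockT_one, if_neg hi, smul_zero, smul_zero]

/-- The annihilators supercommute, so the order on the diagonal is zero. -/
theorem bcLetter_isLocalPair (φ ψ : ι ⊕ ι) (n j : ℕ) :
    IsLocalPair (bcSystem ι) (bcParity φ) (bcParity ψ) (bcLetter φ n) (bcLetter ψ j) := by
  refine ⟨0, ?_⟩
  funext m l
  refine LinearMap.ext fun v => ?_
  simp only [Function.iterate_zero, id_eq, modeComm, LinearMap.sub_apply, LinearMap.smul_apply,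
    Module.End.mul_apply, bc_mode_bcLetter]
  rw [LinearMap.zero_apply, sub_eq_zero]
  split_ifs
  · rw [map_smul, map_smul, bcAnn_bcAnn, smul_smul, smul_smul, smul_smul, smul_smul]
    congr 1; ring
  all_goals simp

theorem bc_isDerivation (p : ZMod 2) (x : Fock ι) (hx : HasParity (bcSystem ι) p x) :
    IsDerivation (bcSystem ι) p x := by
  refine fock_parity_induction (P := fun p x => IsDerivation (bcSystem ι) p x) ?_ ?_ ?_ ?_ p x hx
  · exact fun r _ _ _ _ _ => by simp
  · intro t q b _ m c
    have := fun y => bc_isCommutative (ι := ι).vac_mode m y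
    change ∀ y, (bcSystem ι).Y m 1 y = 0 at this
    simp [this]
  · exact fun _ _ _ h h' => h.add h'
  · intro φ n r x hx h
    have := bc_isCommutative.isDerivation_mul (bcLetter_parity φ n) hx
      (bc_isWick (bcLetter_parity φ n) hx) (bcLetter_isDerivation φ n) h
    rwa [bc_mul] at this

theorem bc_isCovariant (x : Fock ι) : IsCovariant (bcSystem ι) x := by
  refine bc_isCommutative.parity_induction (P := IsCovariant (bcSystem ι))
    (fun _ _ h h' => h.add h') (fun p x hx => ?_) x
  refine fock_parity_induction (P := fun _ x => IsCovariant (bcSystem ι) x) ?_ ?_ ?_ ?_ p x hx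
  · exact fun r _ _ => by simp
  · intro t m c
    have := fun m y => bc_isCommutative (ι := ι).vac_mode m y
    change ∀ (m : ℕ) y, (bcSystem ι).Y m 1 y = 0 at this
    simp [this]
  · exact fun _ _ _ h h' => h.add h'
  · intro φ n r x hx h
    have := bc_isCommutative.isCovariant_mul (bc_isWick (bcLetter_parity φ n) hx)
      (bcLetter_isCovariant φ n) h
    rwa [bc_mul] at this

theorem bc_isSkew_of {q : ZMod 2} {z : Fock ι} (hz : HasParity (bcSystem ι) q z)
    (hl : ∀ φ n, IsSkew (bcSystem ι) (bcParity φ) q (bcLetter φ n) z)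
    (p : ZMod 2) (x : Fock ι) (hx : HasParity (bcSystem ι) p x) :
    IsSkew (bcSystem ι) p q x z := by
  refine fock_parity_induction (P := fun p x => IsSkew (bcSystem ι) p q x z) ?_ ?_ ?_ ?_ p x hx
  · exact fun r l => by simp [skewTransform_zero]
  · intro t l
    have h1 := fun m y => bc_isCommutative (ι := ι).vac_mode m y
    change ∀ (m : ℕ) y, (bcSystem ι).Y m 1 y = 0 at h1
    have h2 := fun m y => bc_isCommutative (ι := ι).mode_vac m y
    change ∀ (m : ℕ) y, (bcSystem ι).Y m y 1 = 0 at h2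
    simp [h1, h2, skewTransform_zero]
  · exact fun _ _ _ h h' => bc_isCommutative.isSkew_add_left h h'
  · intro φ n r x hx h
    have := bc_isCommutative.isSkew_mul (bcLetter_parity φ n) hx hz
      (bc_isWick (bcLetter_parity φ n) hx) (bc_isDerivation q z hz) (hl φ n) h
    rwa [bc_mul] at this

theorem bc_isPoisson : IsPoisson (bcSystem ι) where
  toIsCommutative := bc_isCommutative
  derivation := bc_isDerivation
  covariant := bc_isCovariant
  skew p q a b ha hb := bc_isSkew_of hb (fun φ n => bc_isCommutative.isSkew_symm
    (bc_isSkew_of (bcLetter_parity φ n) (fun ψ j => bcLetter_isSkew ψ φ j n) q b hb)) p a ha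

theorem bc_isLocalPair_of {q : ZMod 2} {z : Fock ι} (hz : HasParity (bcSystem ι) q z)
    (hl : ∀ φ n, IsLocalPair (bcSystem ι) (bcParity φ) q (bcLetter φ n) z)
    (p : ZMod 2) (x : Fock ι) (hx : HasParity (bcSystem ι) p x) :
    IsLocalPair (bcSystem ι) p q x z := by
  refine fock_parity_induction (P := fun p x => IsLocalPair (bcSystem ι) p q x z) ?_ ?_ ?_ ?_ p x hx
  · exact fun r => IsLocalPair.zero_left
  · refine fun t => IsLocalPair.smul_left ⟨0, ?_⟩ t
    have h1 := fun m y => bc_isCommutative (ι := ι).vac_mode m y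
    change ∀ (m : ℕ) y, (bcSystem ι).Y m 1 y = 0 at h1
    funext m l
    refine LinearMap.ext fun v => ?_
    simp [modeComm, h1]
  · exact fun _ _ _ h h' => h.add_left h'
  · intro φ n r x hx h
    have := bc_isCommutative.isLocalPair_mul (bcLetter_parity φ n) hx
      (bc_isWick (bcLetter_parity φ n) hx) (bc_isDerivation q z hz) (bc_isCovariant z) (hl φ n) h
    rwa [bc_mul] at this

theorem bc_isLocal : IsLocal (bcSystem ι) := fun p q a b ha hb =>
  bc_isLocalPair_of hb (fun φ n => bc_isCommutative.isLocalPair_symm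
    (bc_isLocalPair_of (bcLetter_parity φ n) (fun ψ j => bcLetter_isLocalPair ψ φ j n) q b hb)) p a ha

end BCPoisson

/-! ### Weight gradings of the Fock space -/

section Weights

variable {ι G : Type*} [AddCommGroup G]

/-- The span of the monomials of weight `g`, where `b_{a,n}` has weight `β + n t` and `c^a_n`
has weight `κ + n t`. -/
def fockWeight (ι : Type*) (β κ t : G) (g : G) : Submodule ℂ (Fock ι) :=
  Submodule.span ℂ {x | ∃ (p : ι × ℕ →₀ ℕ) (l : List (ι × ℕ)),
    (p.sum fun i k => k • (β + i.2 • t)) + (l.map fun i => κ + i.2 • t).sum = g ∧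
      x = fockMonomial p l}

variable {β κ t : G}

theorem fock_neg_mul (x y : Fock ι) : -x * y = -(x * y) := neg_mul x y

theorem fockMonomial_single_add (i : ι × ℕ) (p : ι × ℕ →₀ ℕ) (l : List (ι × ℕ)) :
    fockMonomial (Finsupp.single i 1 + p) l = bLetter i.1 i.2 * fockMonomial p l := by
  rw [fockMonomial, fockMonomial, bLetter, Algebra.TensorProduct.tmul_mul_tmul, one_mul,
    MvPolynomial.X, MvPolynomial.monomial_mul, one_mul]

theorem fockMonomial_cons (i : ι × ℕ) (p : ι × ℕ →₀ ℕ) (l : List (ι × ℕ)) :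
    fockMonomial p (i :: l) = cLetter i.1 i.2 * fockMonomial p l := by
  rw [fockMonomial, fockMonomial, cLetter, Algebra.TensorProduct.tmul_mul_tmul, one_mul,
    List.map_cons, List.prod_cons]

theorem fockMonomial_zero_nil : fockMonomial (0 : ι × ℕ →₀ ℕ) [] = (1 : Fock ι) := rfl

theorem weight_single_add (w : ι × ℕ → G) (i : ι × ℕ) (p : ι × ℕ →₀ ℕ) :
    ((Finsupp.single i 1 + p).sum fun i k => k • w i) = w i + p.sum fun i k => k • w i := by
  classical
  rw [Finsupp.sum_add_index' (by simp) (fun _ _ _ => add_smul _ _ _),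
    Finsupp.sum_single_index (by simp), one_smul]

theorem one_mem_fockWeight : (1 : Fock ι) ∈ fockWeight ι β κ t 0 :=
  Submodule.subset_span ⟨0, [], by simp, rfl⟩

theorem bLetter_mul_mem_fockWeight {g : G} {x : Fock ι} (hx : x ∈ fockWeight ι β κ t g) (a : ι)
    (n : ℕ) : bLetter a n * x ∈ fockWeight ι β κ t (β + n • t + g) := by
  have : fockWeight ι β κ t g ≤
      (fockWeight ι β κ t (β + n • t + g)).comap (LinearMap.mulLeft ℂ (bLetter a n)) := by
    refine Submodule.span_le.2 ?_
    rintro _ ⟨p, l, h, rfl⟩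
    refine Submodule.subset_span ⟨Finsupp.single (a, n) 1 + p, l, ?_, ?_⟩
    · rw [weight_single_add (fun i : ι × ℕ => β + i.2 • t), ← h, add_assoc]
    · exact (fockMonomial_single_add (a, n) p l).symm
  exact this hx

theorem cLetter_mul_mem_fockWeight {g : G} {x : Fock ι} (hx : x ∈ fockWeight ι β κ t g) (a : ι)
    (n : ℕ) : cLetter a n * x ∈ fockWeight ι β κ t (κ + n • t + g) := by
  have : fockWeight ι β κ t g ≤
      (fockWeight ι β κ t (κ + n • t + g)).comap (LinearMap.mulLeft ℂ (cLetter a n)) := by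
    refine Submodule.span_le.2 ?_
    rintro _ ⟨p, l, h, rfl⟩
    refine Submodule.subset_span ⟨p, (a, n) :: l, ?_, ?_⟩
    · rw [List.map_cons, List.sum_cons, ← h]; abel
    · exact (fockMonomial_cons (a, n) p l).symm
  exact this hx

theorem fockMonomial_induction {P : G → Fock ι → Prop} (hone : P 0 1)
    (hb : ∀ a n g x, P g x → P (β + n • t + g) (bLetter a n * x))
    (hc : ∀ a n g x, P g x → P (κ + n • t + g) (cLetter a n * x))
    (p : ι × ℕ →₀ ℕ) (l : List (ι × ℕ)) :
    P ((p.sum fun i k => k • (β + i.2 • t)) + (l.map fun i => κ + i.2 • t).sum)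
      (fockMonomial p l) := by
  classical
  induction p using Finsupp.induction with
  | zero =>
    induction l with
    | nil => rw [fockMonomial_zero_nil]; simpa using hone
    | cons i l ih =>
      rw [fockMonomial_cons, List.map_cons, List.sum_cons, add_left_comm]
      exact hc _ _ _ _ ih
  | single_add i k f hi hk ih =>
    clear hk
    induction k with
    | zero => rwa [Finsupp.single_zero, zero_add]
    | succ k ihk =>
      rw [add_comm k 1, Finsupp.single_add, add_assoc, fockMonomial_single_add,
        weight_single_add (fun i : ι × ℕ => β + i.2 • t), add_assoc]
      exact hb _ _ _ _ ihk

theorem fockWeight_induction {P : G → Fock ι → Prop} (h0 : ∀ g, P g 0)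
    (hone : ∀ s : ℂ, P 0 (s • 1)) (hadd : ∀ g x y, P g x → P g y → P g (x + y))
    (hb : ∀ a n g x, x ∈ fockWeight ι β κ t g → P g x → P (β + n • t + g) (bLetter a n * x))
    (hc : ∀ a n g x, x ∈ fockWeight ι β κ t g → P g x → P (κ + n • t + g) (cLetter a n * x))
    (g : G) (x : Fock ι) (hx : x ∈ fockWeight ι β κ t g) : P g x := by
  have key : ∀ (p : ι × ℕ →₀ ℕ) (l : List (ι × ℕ)), (fun g x => x ∈ fockWeight ι β κ t g ∧
      ∀ s : ℂ, P g (s • x)) ((p.sum fun i k => k • (β + i.2 • t)) +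
        (l.map fun i => κ + i.2 • t).sum) (fockMonomial p l) := by
    refine fockMonomial_induction (β := β) (κ := κ) (t := t)
      (P := fun g x => x ∈ fockWeight ι β κ t g ∧ ∀ s : ℂ, P g (s • x))
      ⟨one_mem_fockWeight, hone⟩ ?_ ?_
    · rintro a n g x ⟨hx, h⟩
      refine ⟨bLetter_mul_mem_fockWeight hx a n, fun s => ?_⟩
      rw [← mul_smul_comm]
      exact hb _ _ _ _ (Submodule.smul_mem _ s hx) (h s)
    · rintro a n g x ⟨hx, h⟩
      refine ⟨cLetter_mul_mem_fockWeight hx a n, fun s => ?_⟩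
      rw [← mul_smul_comm]
      exact hc _ _ _ _ (Submodule.smul_mem _ s hx) (h s)
  have h2 : ∀ s : ℂ, P g (s • x) := by
    refine Submodule.span_induction (p := fun x _ => ∀ s : ℂ, P g (s • x)) ?_ ?_ ?_ ?_ hx
    · rintro _ ⟨p, l, rfl, rfl⟩
      exact (key p l).2
    · intro s; rw [smul_zero]; exact h0 g
    · intro x y _ _ h h' s; rw [smul_add]; exact hadd _ _ _ (h s) (h' s)
    · intro r x _ h s; rw [smul_smul]; exact h _
  have := h2 1
  rwa [one_smul] at this

theorem mul_mem_fockWeight {g h : G} {x y : Fock ι} (hx : x ∈ fockWeight ι β κ t g)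
    (hy : y ∈ fockWeight ι β κ t h) : x * y ∈ fockWeight ι β κ t (g + h) := by
  refine fockWeight_induction (P := fun g x => x * y ∈ fockWeight ι β κ t (g + h))
    ?_ ?_ ?_ ?_ ?_ g x hx
  · intro g; rw [zero_mul]; exact zero_mem _
  · intro s; rw [smul_mul_assoc, one_mul, zero_add]; exact Submodule.smul_mem _ _ hy
  · intro g x x' h h'; rw [add_mul]; exact add_mem h h'
  · intro a n g x _ h; rw [mul_assoc, add_assoc]; exact bLetter_mul_mem_fockWeight h a n
  · intro a n g x _ h; rw [mul_assoc, add_assoc]; exact cLetter_mul_mem_fockWeight h a n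

theorem fockT_mem_fockWeight {g : G} {x : Fock ι} (hx : x ∈ fockWeight ι β κ t g) :
    fockT x ∈ fockWeight ι β κ t (g + t) := by
  refine fockWeight_induction (P := fun g x => fockT x ∈ fockWeight ι β κ t (g + t))
    ?_ ?_ ?_ ?_ ?_ g x hx
  · intro g; rw [map_zero]; exact zero_mem _
  · intro s; rw [map_smul, fockT_one, smul_zero]; exact zero_mem _
  · intro g x x' h h'; rw [map_add]; exact add_mem h h'
  · intro a n g x hx h
    rw [fockT_mul, fockT_bLetter, smul_mul_assoc]
    refine add_mem (Submodule.smul_mem _ _ ?_) ?_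
    · convert bLetter_mul_mem_fockWeight hx a (n + 1) using 2
      rw [add_smul, one_smul]; abel
    · rw [add_assoc]; exact bLetter_mul_mem_fockWeight h a n
  · intro a n g x hx h
    rw [fockT_mul, fockT_cLetter, smul_mul_assoc]
    refine add_mem (Submodule.smul_mem _ _ ?_) ?_
    · convert cLetter_mul_mem_fockWeight hx a (n + 1) using 2
      rw [add_smul, one_smul]; abel
    · rw [add_assoc]; exact cLetter_mul_mem_fockWeight h a n

theorem dpow_fockT_mem_fockWeight {g : G} {x : Fock ι} (hx : x ∈ fockWeight ι β κ t g) (n : ℕ) :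
    dpow fockT n x ∈ fockWeight ι β κ t (g + n • t) := by
  induction n with
  | zero => rwa [dpow_zero, zero_smul, add_zero]
  | succ n ih =>
    rw [dpow_succ, add_smul, one_smul, ← add_assoc]
    exact Submodule.smul_mem _ _ (fockT_mem_fockWeight ih)

theorem fockSgn_mem_fockWeight {g : G} {x : Fock ι} (hx : x ∈ fockWeight ι β κ t g) :
    fockSgn x ∈ fockWeight ι β κ t g := by
  refine fockWeight_induction (P := fun g x => fockSgn x ∈ fockWeight ι β κ t g)
    ?_ ?_ ?_ ?_ ?_ g x hx
  · intro g; rw [map_zero]; exact zero_mem _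
  · intro s; rw [map_smul, fockSgn_one]; exact Submodule.smul_mem _ _ one_mem_fockWeight
  · intro g x x' h h'; rw [map_add]; exact add_mem h h'
  · intro a n g x hx h
    rw [fockSgn_mul, fockSgn_bLetter]
    exact bLetter_mul_mem_fockWeight h a n
  · intro a n g x hx h
    rw [fockSgn_mul, fockSgn_cLetter, fock_neg_mul]
    exact neg_mem (cLetter_mul_mem_fockWeight h a n)

theorem bDeriv_mem_fockWeight {g : G} {x : Fock ι} (hx : x ∈ fockWeight ι β κ t g) (a : ι) (n : ℕ) :
    bDeriv a n x ∈ fockWeight ι β κ t (g - (β + n • t)) := by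
  classical
  refine fockWeight_induction (P := fun g x => bDeriv a n x ∈ fockWeight ι β κ t (g - (β + n • t)))
    ?_ ?_ ?_ ?_ ?_ g x hx
  · intro g; rw [map_zero]; exact zero_mem _
  · intro s; rw [map_smul, bDeriv_one, smul_zero]; exact zero_mem _
  · intro g x x' h h'; rw [map_add]; exact add_mem h h'
  · intro a' n' g x hx h
    rw [bDeriv_mul, bDeriv_bLetter]
    refine add_mem ?_ ?_
    · split_ifs with hi
      · rw [one_mul, hi.2, add_sub_cancel_left]; exact hx
      · rw [zero_mul]; exact zero_mem _
    · rw [add_sub_assoc]; exact bLetter_mul_mem_fockWeight h a' n'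
  · intro a' n' g x hx h
    rw [bDeriv_mul, bDeriv_cLetter, zero_mul, zero_add, add_sub_assoc]
    exact cLetter_mul_mem_fockWeight h a' n'

theorem cDeriv_mem_fockWeight {g : G} {x : Fock ι} (hx : x ∈ fockWeight ι β κ t g) (a : ι) (n : ℕ) :
    cDeriv a n x ∈ fockWeight ι β κ t (g - (κ + n • t)) := by
  classical
  refine fockWeight_induction (P := fun g x => cDeriv a n x ∈ fockWeight ι β κ t (g - (κ + n • t)))
    ?_ ?_ ?_ ?_ ?_ g x hx
  · intro g; rw [map_zero]; exact zero_mem _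
  · intro s; rw [map_smul, cDeriv_one, smul_zero]; exact zero_mem _
  · intro g x x' h h'; rw [map_add]; exact add_mem h h'
  · intro a' n' g x hx h
    rw [cDeriv_mul, cDeriv_bLetter, zero_mul, zero_add, add_sub_assoc, fockSgn_bLetter]
    exact bLetter_mul_mem_fockWeight h a' n'
  · intro a' n' g x hx h
    rw [cDeriv_mul, cDeriv_cLetter]
    refine add_mem ?_ ?_
    · split_ifs with hi
      · rw [one_mul, hi.2, add_sub_cancel_left]; exact hx
      · rw [zero_mul]; exact zero_mem _
    · rw [add_sub_assoc, fockSgn_cLetter, fock_neg_mul]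
      exact neg_mem (cLetter_mul_mem_fockWeight h a' n')

/-- Each contraction removes one `b` and one `c`, with translation indices `n` and `k`, and applies
`n + k - m` translations. The net loss is therefore `β + κ + m t`, the same for all terms. -/
theorem bc_mode_mem_fockWeight (m : ℕ) {g h : G} {x y : Fock ι} (hx : x ∈ fockWeight ι β κ t g)
    (hy : y ∈ fockWeight ι β κ t h) :
    (bcSystem ι).Y m x y ∈ fockWeight ι β κ t (g + h - (β + κ) - m • t) := by
  rw [bc_mode]
  refine finsum_induction (fun X => X ∈ fockWeight ι β κ t (g + h - (β + κ) - m • t))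
    (zero_mem _) (fun _ _ h h' => add_mem h h') ?_
  rintro ⟨φ, n, k⟩
  dsimp only
  split_ifs with hm
  · refine Submodule.smul_mem _ _ ?_
    obtain ⟨j, hj⟩ : ∃ j, n + k = m + j := ⟨n + k - m, by omega⟩
    have hj' : n • t + k • t = m • t + j • t := by rw [← add_smul, hj, add_smul]
    rw [show n + k - m = j by omega]
    have hn := eq_sub_of_add_eq hj'
    rcases φ with a | a
    · rw [show g + h - (β + κ) - m • t = g - (β + n • t) + j • t + (h - (κ + k • t)) by
        rw [hn]; abel]
      exact mul_mem_fockWeight (dpow_fockT_mem_fockWeight (bDeriv_mem_fockWeight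
        (fockSgn_mem_fockWeight hx) a n) j) (cDeriv_mem_fockWeight hy a k)
    · rw [show g + h - (β + κ) - m • t = g - (κ + n • t) + j • t + (h - (β + k • t)) by
        rw [hn]; abel]
      exact mul_mem_fockWeight (dpow_fockT_mem_fockWeight (cDeriv_mem_fockWeight hx a n) j)
        (bDeriv_mem_fockWeight hy a k)
  · exact zero_mem _

theorem iSup_fockWeight : ⨆ g, fockWeight ι β κ t g = ⊤ := by
  rw [eq_top_iff]
  rintro x -
  refine fock_induction ?_ ?_ ?_ ?_ ?_ x
  · exact Submodule.mem_iSup_of_mem 0 one_mem_fockWeight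
  · exact fun x y h h' => add_mem h h'
  · exact fun s x h => Submodule.smul_mem _ _ h
  · intro a n x h
    refine Submodule.iSup_induction (motive := fun x => bLetter a n * x ∈ ⨆ g, fockWeight ι β κ t g)
      _ h (fun g x hx => ?_) ?_ ?_
    · exact Submodule.mem_iSup_of_mem _ (bLetter_mul_mem_fockWeight hx a n)
    · rw [mul_zero]; exact zero_mem _
    · intro x y h h'; rw [mul_add]; exact add_mem h h'
  · intro a n x h
    refine Submodule.iSup_induction (motive := fun x => cLetter a n * x ∈ ⨆ g, fockWeight ι β κ t g)
      _ h (fun g x hx => ?_) ?_ ?_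
    · exact Submodule.mem_iSup_of_mem _ (cLetter_mul_mem_fockWeight hx a n)
    · rw [mul_zero]; exact zero_mem _
    · intro x y h h'; rw [mul_add]; exact add_mem h h'

/-- The action of a letter on the exterior algebra with its grading made explicit. -/
def gradedOddLetter (w : ι × ℕ → G) (i : ι × ℕ) : Module.End ℂ (G →₀ ExtAlg ι) :=
  Finsupp.lsum ℂ fun g => Finsupp.lsingle (w i + g) ∘ₗ LinearMap.mulLeft ℂ (oddLetter i)

theorem gradedOddLetter_single (w : ι × ℕ → G) (i : ι × ℕ) (g : G) (u : ExtAlg ι) :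
    gradedOddLetter w i (Finsupp.single g u) = Finsupp.single (w i + g) (oddLetter i * u) := by
  rw [gradedOddLetter, Finsupp.lsum_single]; rfl

theorem gradedOddLetter_anticomm (w : ι × ℕ → G) (i j : ι × ℕ) :
    gradedOddLetter w i * gradedOddLetter w j + gradedOddLetter w j * gradedOddLetter w i = 0 := by
  refine Finsupp.lhom_ext fun g u => ?_
  rw [LinearMap.add_apply, Module.End.mul_apply, Module.End.mul_apply, gradedOddLetter_single,
    gradedOddLetter_single, gradedOddLetter_single, gradedOddLetter_single, ← mul_assoc,
    oddLetter_anticomm, neg_mul, mul_assoc, add_left_comm, Finsupp.single_neg]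
  exact neg_add_cancel _

/-- Anticommutation of the operators attached to the letters extends bilinearly, and the diagonal
case gives the square because `2` is invertible. -/
theorem gradedOddLetter_linearCombination_sq (w : ι × ℕ → G) (m : ι × ℕ →₀ ℂ) :
    Finsupp.linearCombination ℂ (gradedOddLetter w) m *
      Finsupp.linearCombination ℂ (gradedOddLetter w) m = 0 := by
  have h : ∀ m m' : ι × ℕ →₀ ℂ, Finsupp.linearCombination ℂ (gradedOddLetter w) m *
      Finsupp.linearCombination ℂ (gradedOddLetter w) m' +
      Finsupp.linearCombination ℂ (gradedOddLetter w) m' *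
      Finsupp.linearCombination ℂ (gradedOddLetter w) m = 0 := by
    intro m m'
    induction m using Finsupp.induction_linear with
    | zero => rw [map_zero, zero_mul, mul_zero, add_zero]
    | add f g hf hg => rw [map_add, add_mul, mul_add, add_add_add_comm, hf, hg, add_zero]
    | single i s =>
      induction m' using Finsupp.induction_linear with
      | zero => rw [map_zero, zero_mul, mul_zero, add_zero]
      | add f g hf hg => rw [map_add, mul_add, add_mul, add_add_add_comm, hf, hg, add_zero]
      | single j s' =>
        simp only [Finsupp.linearCombination_single, smul_mul_assoc, mul_smul_comm]
        rw [smul_comm s' s, ← smul_add, ← smul_add, gradedOddLetter_anticomm,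
          smul_zero, smul_zero]
  have h2 := h m m
  have h3 : (2 : ℂ) • (Finsupp.linearCombination ℂ (gradedOddLetter w) m *
      Finsupp.linearCombination ℂ (gradedOddLetter w) m) = 0 := by
    rw [two_smul]; exact h2
  exact (smul_eq_zero.1 h3).resolve_left two_ne_zero

/-- The universal property of the exterior algebra is applied to operators that multiply by a letter
and shift the degree at once. Acting on `1` in degree zero, a product of letters ends in its own
weight. No ordered basis of monomials is needed. -/
theorem exists_extAlg_coaction (w : ι × ℕ → G) : ∃ Δ : ExtAlg ι →ₗ[ℂ] G →₀ ExtAlg ι,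
    ∀ l : List (ι × ℕ), Δ (l.map oddLetter).prod =
      Finsupp.single (l.map w).sum (l.map oddLetter).prod := by
  let f : ExtAlg ι →ₐ[ℂ] Module.End ℂ (G →₀ ExtAlg ι) := ExteriorAlgebra.lift ℂ
    ⟨Finsupp.linearCombination ℂ (gradedOddLetter w), gradedOddLetter_linearCombination_sq w⟩
  have hf : ∀ i, f (oddLetter i) = gradedOddLetter w i := by
    intro i
    refine (ExteriorAlgebra.lift_ι_apply _ _ _ _).trans ?_
    rw [Finsupp.linearCombination_single, one_smul]
  refine ⟨(LinearMap.applyₗ (Finsupp.single 0 1)) ∘ₗ f.toLinearMap, fun l => ?_⟩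
  change f (l.map oddLetter).prod (Finsupp.single 0 1) = _
  induction l with
  | nil => simp
  | cons i l ih =>
    rw [List.map_cons, List.prod_cons, map_mul, Module.End.mul_apply, ih, hf,
      gradedOddLetter_single, List.map_cons, List.sum_cons]

theorem exists_fockWeight_coaction [DecidableEq G] (β κ t : G) :
    ∃ Δ, IsCoaction (fockWeight ι β κ t) Δ := by
  obtain ⟨Δ₂, h₂⟩ := exists_extAlg_coaction (ι := ι) (fun i => κ + i.2 • t)
  let Δ₁ : MvPolynomial (ι × ℕ) ℂ →ₗ[ℂ] G →₀ MvPolynomial (ι × ℕ) ℂ :=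
    (MvPolynomial.basisMonomials (ι × ℕ) ℂ).constr ℂ fun p =>
      Finsupp.single (p.sum fun i k => k • (β + i.2 • t)) (MvPolynomial.monomial p 1)
  have h₁ : ∀ p : ι × ℕ →₀ ℕ, Δ₁ (MvPolynomial.monomial p 1) =
      Finsupp.single (p.sum fun i k => k • (β + i.2 • t)) (MvPolynomial.monomial p 1) := by
    intro p
    have := (MvPolynomial.basisMonomials (ι × ℕ) ℂ).constr_basis ℂ (fun p =>
      Finsupp.single (p.sum fun i k => k • (β + i.2 • t)) (MvPolynomial.monomial p (1 : ℂ))) p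
    rwa [MvPolynomial.coe_basisMonomials] at this
  let Δ : Fock ι →ₗ[ℂ] G →₀ Fock ι := Finsupp.lmapDomain (Fock ι) ℂ (fun i : G × G => i.1 + i.2) ∘ₗ
      (finsuppTensorFinsupp ℂ ℂ (MvPolynomial (ι × ℕ) ℂ) (ExtAlg ι) G G).toLinearMap ∘ₗ
      TensorProduct.map Δ₁ Δ₂
  refine ⟨Δ, fun g u hu => ?_⟩
  refine Submodule.span_induction (p := fun u _ => Δ u = Finsupp.single g u) ?_ ?_ ?_ ?_ hu
  · rintro _ ⟨p, l, rfl, rfl⟩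
    rw [LinearMap.comp_apply, LinearMap.comp_apply, fockMonomial, TensorProduct.map_tmul, h₁, h₂,
      LinearEquiv.coe_coe, finsuppTensorFinsupp_single, Finsupp.lmapDomain_apply,
      Finsupp.mapDomain_single]
  · rw [map_zero, Finsupp.single_zero]
  · intro x y _ _ h h'; rw [map_add, h, h', Finsupp.single_add]
  · intro s x _ h; rw [map_smul, h, Finsupp.smul_single]

/-- The weights cover the cohomological degree (`t = 0`), the spin (`t = 1`), and also the two
together with values in `Deg × ℚ`, so each closure property is proved once. -/
theorem bc_gr_eq : (bcSystem ι).gr = fockWeight ι (0 : Deg) (1, 0) 0 := by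
  funext d
  refine congrArg (Submodule.span ℂ) (Set.ext fun x => exists_congr fun p => exists_congr fun l => ?_)
  have h1 : (p.sum fun i k => k • ((0 : Deg) + i.2 • 0)) = 0 := by simp
  have h2 : (l.map fun i => ((1, 0) : Deg) + i.2 • 0).sum = ((l.length : ℤ), 0) := by
    induction l with
    | nil => rfl
    | cons i l ih =>
      rw [List.map_cons, List.sum_cons, ih]
      simp [add_comm]
  rw [h1, h2, zero_add, ← and_assoc]
  refine and_congr_left fun _ => ?_
  rw [Prod.ext_iff, eq_comm (a := (0 : ZMod 2))]

theorem bcSpin_eq : bcSpin ι = fockWeight ι (1 : ℚ) 0 1 := by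
  funext s
  refine congrArg (Submodule.span ℂ) (Set.ext fun x => exists_congr fun p => exists_congr fun l => ?_)
  refine and_congr_left fun hx => ?_
  clear hx
  have h1 : ((p.sum fun i k => k * (i.2 + 1) : ℕ) : ℚ) =
      p.sum fun i k => k • ((1 : ℚ) + i.2 • 1) := by
    rw [Finsupp.sum, Finsupp.sum, Nat.cast_sum]
    refine Finset.sum_congr rfl fun i _ => ?_
    simp [add_comm, mul_add]
  have h2 : (((l.map Prod.snd).sum : ℕ) : ℚ) = (l.map fun i => (0 : ℚ) + i.2 • 1).sum := by
    induction l with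
    | nil => simp
    | cons i l ih =>
      rw [List.map_cons, List.sum_cons, Nat.cast_add, ih, List.map_cons, List.sum_cons]
      simp
  rw [h1, h2]

theorem bc_isRaviolo : IsRaviolo (bcSystem ι) := by
  have hpar : ∀ d, ∀ a ∈ (bcSystem ι).gr d, HasParity (bcSystem ι) (par d) a := by
    rw [bc_gr_eq]
    refine fockWeight_induction (P := fun d a => HasParity (bcSystem ι) (par d) a) ?_ ?_ ?_ ?_ ?_
    · exact fun _ => HasParity.zero
    · exact fun s => bc_isCommutative.parity_vac.smul s
    · exact fun _ _ _ h h' => h.add h'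
    · intro a n g x _ h
      have := bc_parity_mul (bcLetter_parity (Sum.inl a) n) h
      rwa [smul_zero, add_zero, zero_add, ← zero_add (par g)]
    · intro a n g x _ h
      have := bc_parity_mul (bcLetter_parity (Sum.inr a) n) h
      rw [smul_zero, add_zero, par_add, show par ((1, 0) : Deg) = 1 from rfl]
      exact this
  refine bc_isPoisson.isRaviolo ?_ hpar ?_ ?_ ?_ ?_ ?_
  · rw [bc_gr_eq]
    obtain ⟨Δ, hΔ⟩ := exists_fockWeight_coaction (ι := ι) (0 : Deg) (1, 0) 0
    exact hΔ.isInternal iSup_fockWeight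
  · rw [bc_gr_eq]; exact one_mem_fockWeight
  · rw [bc_gr_eq]; intro d a ha
    have := fockT_mem_fockWeight ha
    rwa [add_zero] at this
  · rw [bc_gr_eq]; intro d e a ha b hb; rw [bc_mul]; exact mul_mem_fockWeight ha hb
  · rw [bc_gr_eq]; intro m d e a ha b hb
    have := bc_mode_mem_fockWeight m ha hb
    rwa [zero_add, smul_zero, sub_zero] at this
  · exact fun d e a ha b hb => bc_isLocal _ _ _ _ (hpar d a ha) (hpar e b hb)

theorem bc_isSpinGrading : IsSpinGrading (bcSystem ι) (bcSpin ι) := by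
  obtain ⟨Δ, hΔ⟩ := exists_fockWeight_coaction (ι := ι) (0 : Deg) (1, 0) 0
  obtain ⟨Δ', hΔ'⟩ := exists_fockWeight_coaction (ι := ι) (1 : ℚ) 0 1
  have hT : ∀ s, ∀ a ∈ bcSpin ι s, (bcSystem ι).T a ∈ bcSpin ι (s + 1) := by
    rw [bcSpin_eq]; exact fun s a ha => fockT_mem_fockWeight ha
  refine ⟨⟨1, one_pos, fun s hs => ?_⟩, ?_, ?_, ?_, hT, ?_⟩
  · by_contra hc
    refine hs ((Submodule.eq_bot_iff _).2 fun x hx => ?_)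
    have key : ∀ s, ∀ x ∈ bcSpin ι s, x = 0 ∨ ∃ k : ℤ, s = k := by
      rw [bcSpin_eq]
      refine fockWeight_induction ?_ ?_ ?_ ?_ ?_
      · exact fun _ => Or.inl rfl
      · exact fun _ => Or.inr ⟨0, by simp⟩
      · rintro g x y (rfl | h) (rfl | h')
        · exact Or.inl (add_zero 0)
        · exact Or.inr h'
        · exact Or.inr h
        · exact Or.inr h
      · rintro a n g x _ (rfl | ⟨k, rfl⟩)
        · exact Or.inl (mul_zero _)
        · exact Or.inr ⟨1 + n + k, by simp⟩
      · rintro a n g x _ (rfl | ⟨k, rfl⟩)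
        · exact Or.inl (mul_zero _)
        · exact Or.inr ⟨n + k, by simp⟩
    refine (key s x hx).resolve_right ?_
    rintro ⟨k, rfl⟩
    exact hc ⟨k, by simp⟩
  · rw [bcSpin_eq]; exact hΔ'.isInternal iSup_fockWeight
  · rw [bc_gr_eq, bcSpin_eq]
    refine isInternal_inf hΔ hΔ' ?_
    rw [eq_top_iff, ← iSup_fockWeight (ι := ι) (β := ((0, 1) : Deg × ℚ)) (κ := ((1, 0), 0))
      (t := (0, 1))]
    refine iSup_mono fun i x hx => ?_
    refine fockWeight_induction (P := fun (i : Deg × ℚ) x =>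
      x ∈ fockWeight ι (0 : Deg) (1, 0) 0 i.1 ⊓ fockWeight ι (1 : ℚ) 0 1 i.2) ?_ ?_ ?_ ?_ ?_ i x hx
    · exact fun _ => zero_mem _
    · exact fun s => Submodule.smul_mem _ _ ⟨one_mem_fockWeight, one_mem_fockWeight⟩
    · exact fun _ _ _ h h' => add_mem h h'
    · exact fun a n g x _ h => ⟨bLetter_mul_mem_fockWeight h.1 a n,
        bLetter_mul_mem_fockWeight h.2 a n⟩
    · exact fun a n g x _ h => ⟨cLetter_mul_mem_fockWeight h.1 a n,
        cLetter_mul_mem_fockWeight h.2 a n⟩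
  · rw [bcSpin_eq]; exact one_mem_fockWeight
  · refine bc_isPoisson.spin_Y_mem hT ?_ ?_
    · rw [bcSpin_eq]; intro s t a ha b hb
      rw [bc_mul, add_comm]; exact mul_mem_fockWeight ha hb
    · rw [bcSpin_eq]; intro m s t a ha b hb
      convert bc_mode_mem_fockWeight m ha hb using 2
      simp only [nsmul_eq_mul]; ring

end Weights

/-! ### The operator products of the moment maps -/

section CurrentAlgebra

variable {ι 𝔤 : Type*} [Fintype ι] [LieRing 𝔤] [LieAlgebra ℂ 𝔤] (T : Module.Basis ι ℂ 𝔤)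

theorem oddDeriv_oddLetter [DecidableEq ι] (i j : ι × ℕ) :
    oddDeriv i (oddLetter j : ExtAlg ι) = if j = i then 1 else 0 := by
  have := oddDeriv_oddLetter_mul i j (1 : ExtAlg ι)
  rwa [mul_one, oddDeriv_one, mul_zero, sub_zero] at this

theorem currentT_one : currentT (1 : ExtAlg ι) = 0 := by
  rw [currentT, locSum_apply]
  · simp [oddDeriv_one]
  · intro x
    refine (finite_oddDeriv x).subset fun i hi h => hi ?_
    simp [h]

theorem dpow_currentT_one (n : ℕ) : dpow currentT n (1 : ExtAlg ι) = if n = 0 then 1 else 0 := by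
  cases n with
  | zero => rw [dpow_zero, if_pos rfl]
  | succ n =>
    rw [if_neg n.succ_ne_zero]
    induction n with
    | zero => rw [dpow_succ, dpow_zero, currentT_one, smul_zero]
    | succ n ih => rw [dpow_succ, ih, map_zero, smul_zero]

theorem currentJ_apply (a : ι) (m : ℕ) (x : ExtAlg ι) :
    currentJ T a m x = ∑ᶠ i : ι × ℕ, if m ≤ i.2 then
      ∑ c, structConst T a i.1 c • (oddLetter (c, i.2 - m) * oddDeriv i x) else 0 := by
  have h : ∀ (i : ι × ℕ) (x : ExtAlg ι), (if m ≤ i.2 then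
      ∑ c, structConst T a i.1 c • (LinearMap.mulLeft ℂ (oddLetter (c, i.2 - m)) ∘ₗ oddDeriv i)
      else 0 : ExtAlg ι →ₗ[ℂ] ExtAlg ι) x = if m ≤ i.2 then
      ∑ c, structConst T a i.1 c • (oddLetter (c, i.2 - m) * oddDeriv i x) else 0 := by
    intro i x
    split_ifs
    · simp [LinearMap.sum_apply]
    · rfl
  rw [currentJ, locSum_apply]
  · exact finsum_congr fun i => h i x
  · intro y
    refine (finite_oddDeriv y).subset fun i hi h0 => hi ?_
    beta_reduce
    rw [h, h0]; simp

theorem finite_currentJ (x : ExtAlg ι) : {i : ι × ℕ | currentJ T i.1 i.2 x ≠ 0}.Finite := by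
  refine ((finite_oddDeriv x).biUnion (t := fun j => (Set.univ : Set ι) ×ˢ Set.Iic j.2)
    (fun j _ => Set.finite_univ.prod (Set.finite_Iic _))).subset fun i hi => ?_
  by_contra hc
  refine hi ?_
  rw [currentJ_apply]
  refine finsum_eq_zero_of_forall_eq_zero fun j => ?_
  split_ifs with hj
  · refine Finset.sum_eq_zero fun c _ => ?_
    by_cases h0 : oddDeriv j x = 0
    · rw [h0, mul_zero, smul_zero]
    · refine absurd (Set.mem_iUnion₂.2 ⟨j, h0, ?_⟩) hc
      exact ⟨trivial, hj⟩
  · rfl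

theorem currentJ_oddLetter (a b : ι) (m : ℕ) :
    currentJ T a m (oddLetter (b, 0)) =
      if m = 0 then ∑ c, structConst T a b c • oddLetter (c, 0) else 0 := by
  classical
  rw [currentJ_apply, finsum_eq_single _ (b, 0)]
  · rw [oddDeriv_oddLetter, if_pos rfl]
    simp
  · intro i hi
    rw [oddDeriv_oddLetter, if_neg (Ne.symm hi)]
    simp

/-- As for the ghosts, the derivative of a single letter is constant and only one contraction
survives. -/
theorem currentAlgebra_mode (a : ι) (m : ℕ) (v : ExtAlg ι) :
    (currentAlgebra T).Y m (oddLetter (a, 0)) v = currentJ T a m v := by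
  classical
  change wick currentT (fun a n => oddDeriv (a, n)) (currentJ T) m _ _ = _
  rw [wick_nonneg m (fun x => finite_oddDeriv x) (finite_currentJ T),
    finsum_eq_single _ (a, 0, m)]
  · simp [oddDeriv_oddLetter, dpow_zero]
  · rintro ⟨b, n, k⟩ hi
    split_ifs with hm
    · rw [oddDeriv_oddLetter]
      split_ifs with h
      · simp only [Prod.mk.injEq] at h
        obtain ⟨rfl, rfl⟩ := h
        have : k ≠ m := fun h => hi (by rw [h])
        rw [dpow_currentT_one, if_neg (by simp only at hm ⊢; omega), zero_mul, smul_zero]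
      · rw [map_zero, zero_mul, smul_zero]
    · rfl

variable {T} {V : Type*} [AddCommGroup V] [Module ℂ V] {𝒱 : RavioloData V} {ρ : ExtAlg ι →ₗ[ℂ] V}

theorem IsHamiltonianSymmetry.moment_mem (hρ : IsHamiltonianSymmetry T 𝒱 ρ) (a : ι) :
    moment ρ a ∈ 𝒱.gr (1, 0) :=
  hρ.degree _ _ (Submodule.subset_span ⟨[(a, 0)], rfl, rfl, by simp⟩)

/-- Apart from the degree of the moment maps, this is all that is used of the morphism from the
current algebra. -/
theorem IsHamiltonianSymmetry.mode_moment (hρ : IsHamiltonianSymmetry T 𝒱 ρ) (a b : ι) (m : ℕ) :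
    𝒱.Y m (moment ρ a) (moment ρ b) =
      if m = 0 then ∑ c, structConst T a b c • moment ρ c else 0 := by
  rw [moment, moment, ← hρ.Y, currentAlgebra_mode, currentJ_oddLetter]
  split_ifs
  · rw [map_sum]
    exact Finset.sum_congr rfl fun c _ => map_smul _ _ _
  · exact map_zero _

end CurrentAlgebra

/-! ### The zero mode of the gauged superpotential -/

section Superpotential

variable {U : Type*} [AddCommGroup U] [Module ℂ U] {𝒰 : RavioloData U}

/-! ### Modes of products of fields with simple poles -/

/-- With simple poles each Wick sum collapses to its term without derivatives, and the product has a
simple pole again, so the lemma can be iterated. -/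
theorem IsPoisson.mode_mul_of_simple (h : IsPoisson 𝒰) {p r : ZMod 2} {a x v α β : U}
    (ha : HasParity 𝒰 p a) (hx : HasParity 𝒰 r x)
    (hα : ∀ m : ℕ, 𝒰.Y m a v = if m = 0 then α else 0)
    (hβ : ∀ m : ℕ, 𝒰.Y m x v = if m = 0 then β else 0) (m : ℕ) :
    𝒰.Y m (𝒰.Y (-1) a x) v =
      if m = 0 then sign p • 𝒰.Y (-1) a β + sign (p * r + r) • 𝒰.Y (-1) x α else 0 := by
  have h1 : ∀ {f : ℕ → U} {γ : U}, (∀ n, f n = if n = 0 then γ else 0) → ∀ n, 1 ≤ n → f n = 0 :=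
    fun hf n hn => by rw [hf, if_neg (by omega)]
  rw [h.wick ha hx, wickSum_eq (h1 hβ), wickSum_eq (h1 hα), Finset.sum_range_one,
    Finset.sum_range_one, dpow_zero, dpow_zero, add_zero, hα, hβ]
  split_ifs
  · rfl
  · rw [map_zero, map_zero, smul_zero, smul_zero, add_zero]

/-- `T x` has no zero mode on `v`, but its first mode is `-β`. It pairs with the first derivative of
`a` in the Wick sum and gives the second term. -/
theorem IsPoisson.mode_mul_T_of_simple (h : IsPoisson 𝒰) {p r : ZMod 2} {a x v α β : U}
    (ha : HasParity 𝒰 p a) (hx : HasParity 𝒰 r x)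
    (hα : ∀ m : ℕ, 𝒰.Y m a v = if m = 0 then α else 0)
    (hβ : ∀ m : ℕ, 𝒰.Y m x v = if m = 0 then β else 0) :
    𝒰.Y (0 : ℕ) (𝒰.Y (-1) a (𝒰.T x)) v =
      sign (p * r + r) • 𝒰.Y (-1) (𝒰.T x) α - sign p • 𝒰.Y (-1) (𝒰.T a) β := by
  rw [h.wick ha (h.parity_T hx), wickSum_eq (N := 2) (fun n hn => by
    rw [h.mode_T_left, hβ, if_neg (by omega), smul_zero]),
    wickSum_eq (N := 1) (fun n hn => by rw [hα, if_neg (by omega)]), Finset.sum_range_succ,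
    Finset.sum_range_one, Finset.sum_range_one, h.mode_T_left, h.mode_T_left, dpow_one, dpow_zero,
    dpow_zero, hα, hβ]
  simp only [add_zero, zero_add, Nat.cast_zero, Nat.cast_one, neg_zero, zero_smul, map_zero,
    if_true, neg_smul, one_smul, map_neg, smul_neg]
  abel

/-! ### The gauging of a Hamiltonian symmetry -/

/-- States `b`, `c`, `μ`, `w` with the operator products of the ghosts, the moment maps and an
invariant superpotential. -/
structure IsGauging {ι : Type*} [Fintype ι] [DecidableEq ι] (𝒰 : RavioloData U) (f : ι → ι → ι → ℂ)
    (b c μ : ι → U) (w : U) : Prop where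
  parity_b : ∀ i, HasParity 𝒰 0 (b i)
  parity_c : ∀ i, HasParity 𝒰 1 (c i)
  parity_μ : ∀ i, HasParity 𝒰 1 (μ i)
  parity_w : HasParity 𝒰 0 w
  bb : ∀ i j (m : ℕ), 𝒰.Y m (b i) (b j) = 0
  bc : ∀ i j (m : ℕ), 𝒰.Y m (b i) (c j) = if m = 0 then if i = j then 𝒰.vac else 0 else 0
  cb : ∀ i j (m : ℕ), 𝒰.Y m (c i) (b j) = if m = 0 then if i = j then 𝒰.vac else 0 else 0
  cc : ∀ i j (m : ℕ), 𝒰.Y m (c i) (c j) = 0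
  bμ : ∀ i j (m : ℕ), 𝒰.Y m (b i) (μ j) = 0
  cμ : ∀ i j (m : ℕ), 𝒰.Y m (c i) (μ j) = 0
  μb : ∀ i j (m : ℕ), 𝒰.Y m (μ i) (b j) = 0
  μc : ∀ i j (m : ℕ), 𝒰.Y m (μ i) (c j) = 0
  bw : ∀ i (m : ℕ), 𝒰.Y m (b i) w = 0
  cw : ∀ i (m : ℕ), 𝒰.Y m (c i) w = 0
  wb : ∀ i (m : ℕ), 𝒰.Y m w (b i) = 0
  wc : ∀ i (m : ℕ), 𝒰.Y m w (c i) = 0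
  μμ : ∀ i j (m : ℕ), 𝒰.Y m (μ i) (μ j) = if m = 0 then ∑ k, f i j k • μ k else 0
  μw : ∀ i (m : ℕ), 𝒰.Y m (μ i) w = 0
  wμ : ∀ i (m : ℕ), 𝒰.Y m w (μ i) = 0

variable {ι : Type*} [Fintype ι]

/-- The superpotential of the gauging. -/
def gaugePotential (𝒰 : RavioloData U) (f : ι → ι → ι → ℂ) (k : ι → ι → ℂ) (b c μ : ι → U)
    (w : U) : U :=
  (1 / 2 : ℂ) • ∑ i, ∑ j, ∑ l, f j l i • 𝒰.Y (-1) (b i) (𝒰.Y (-1) (c j) (c l)) +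
    (1 / 2 : ℂ) • ∑ i, ∑ j, k i j • 𝒰.Y (-1) (c i) (𝒰.T (c j)) +
    ∑ i, 𝒰.Y (-1) (c i) (μ i) + w

variable [DecidableEq ι] {f : ι → ι → ι → ℂ} {k : ι → ι → ℂ} {b c μ : ι → U} {w : U}

namespace IsGauging

variable (h : IsPoisson 𝒰) (hg : IsGauging 𝒰 f b c μ w)
include h hg

theorem mode_gaugePotential (v : U) : 𝒰.Y 0 (gaugePotential 𝒰 f k b c μ w) v =
    (1 / 2 : ℂ) • ∑ i, ∑ j, ∑ l,
      f j l i • 𝒰.Y (0 : ℕ) (𝒰.Y (-1) (b i) (𝒰.Y (-1) (c j) (c l))) v +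
    (1 / 2 : ℂ) • ∑ i, ∑ j, k i j • 𝒰.Y (0 : ℕ) (𝒰.Y (-1) (c i) (𝒰.T (c j))) v +
    ∑ i, 𝒰.Y (0 : ℕ) (𝒰.Y (-1) (c i) (μ i)) v + 𝒰.Y (0 : ℕ) w v := by
  simp only [gaugePotential, map_add, map_smul, map_sum, LinearMap.add_apply, LinearMap.smul_apply,
    LinearMap.sum_apply, Nat.cast_zero]

/-- Only a `b` contracts with `c^d`, so this is the Chevalley-Eilenberg differential. -/
theorem gaugePotential_mode_c (d : ι) : 𝒰.Y 0 (gaugePotential 𝒰 f k b c μ w) (c d) =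
    (1 / 2 : ℂ) • ∑ i, ∑ j, f i j d • 𝒰.Y (-1) (c i) (c j) := by
  have hcc : ∀ i j (m : ℕ), 𝒰.Y m (c i) (c j) = if m = 0 then 0 else 0 := fun i j m => by
    rw [hg.cc, ite_self]
  have hμc : ∀ i j (m : ℕ), 𝒰.Y m (μ i) (c j) = if m = 0 then 0 else 0 := fun i j m => by
    rw [hg.μc, ite_self]
  have h1 : ∀ i j l, 𝒰.Y (0 : ℕ) (𝒰.Y (-1) (b i) (𝒰.Y (-1) (c j) (c l))) (c d) =
      if i = d then 𝒰.Y (-1) (c j) (c l) else 0 := by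
    intro i j l
    rw [h.mode_mul_of_simple (hg.parity_b i) (h.parity_mul (hg.parity_c j) (hg.parity_c l))
      (hg.bc i d) (h.mode_mul_of_simple (hg.parity_c j) (hg.parity_c l) (hcc j d) (hcc l d)),
      if_pos rfl, show sign (0 * (1 + 1) + (1 + 1)) = 1 from sign_zero, one_smul]
    simp only [map_zero, smul_zero, add_zero, zero_add]
    split_ifs
    · exact h.mul_vac _
    · exact map_zero _
  have h2 : ∀ i j, 𝒰.Y (0 : ℕ) (𝒰.Y (-1) (c i) (𝒰.T (c j))) (c d) = 0 := by
    intro i j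
    rw [h.mode_mul_T_of_simple (hg.parity_c i) (hg.parity_c j) (hcc i d) (hcc j d)]
    simp
  have h3 : ∀ i, 𝒰.Y (0 : ℕ) (𝒰.Y (-1) (c i) (μ i)) (c d) = 0 := by
    intro i
    rw [h.mode_mul_of_simple (hg.parity_c i) (hg.parity_μ i) (hcc i d) (hμc i d)]
    simp
  rw [mode_gaugePotential h hg]
  simp only [h1, h2, h3, hg.wc, smul_zero, Finset.sum_const_zero, add_zero]
  rw [Finset.sum_eq_single d]
  · simp only [if_true]
  · intro i _ hi
    simp only [if_neg hi, smul_zero, Finset.sum_const_zero]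
  · exact fun hd => absurd (Finset.mem_univ _) hd

/-- Each `c` in the superpotential may contract with `b_d`. The two contractions with `cc` agree by
antisymmetry of `f`, and the two with `c ∂c` by symmetry of `k`, which removes the factors one half.
-/
theorem gaugePotential_mode_b (hf : ∀ i j l, f j i l = -f i j l) (hk : ∀ i j, k i j = k j i)
    (d : ι) : 𝒰.Y 0 (gaugePotential 𝒰 f k b c μ w) (b d) =
    ∑ i, ∑ j, f d j i • 𝒰.Y (-1) (b i) (c j) + ∑ j, k d j • 𝒰.T (c j) + μ d := by
  have hbb : ∀ i j (m : ℕ), 𝒰.Y m (b i) (b j) = if m = 0 then 0 else 0 := fun i j m => by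
    rw [hg.bb, ite_self]
  have hμb : ∀ i j (m : ℕ), 𝒰.Y m (μ i) (b j) = if m = 0 then 0 else 0 := fun i j m => by
    rw [hg.μb, ite_self]
  have hvac : ∀ x (i : ι), 𝒰.Y (-1) x (if i = d then 𝒰.vac else 0) = if i = d then x else 0 := by
    intro x i
    split_ifs
    · exact h.mul_vac _
    · exact map_zero _
  have h1 : ∀ i j l, 𝒰.Y (0 : ℕ) (𝒰.Y (-1) (b i) (𝒰.Y (-1) (c j) (c l))) (b d) =
      (if j = d then 𝒰.Y (-1) (b i) (c l) else 0) - if l = d then 𝒰.Y (-1) (b i) (c j) else 0 := by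
    intro i j l
    rw [h.mode_mul_of_simple (hg.parity_b i) (h.parity_mul (hg.parity_c j) (hg.parity_c l))
      (hbb i d) (h.mode_mul_of_simple (hg.parity_c j) (hg.parity_c l) (hg.cb j d) (hg.cb l d)),
      if_pos rfl, show sign (1 * 1 + 1) = 1 from sign_zero, sign_zero, sign_one, one_smul,
      map_zero, smul_zero, add_zero, hvac, hvac, one_smul, neg_one_smul, neg_add_eq_sub, map_sub]
    congr 1 <;> split_ifs <;> simp
  have h2 : ∀ i j, 𝒰.Y (0 : ℕ) (𝒰.Y (-1) (c i) (𝒰.T (c j))) (b d) =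
      (if i = d then 𝒰.T (c j) else 0) + if j = d then 𝒰.T (c i) else 0 := by
    intro i j
    rw [h.mode_mul_T_of_simple (hg.parity_c i) (hg.parity_c j) (hg.cb i d) (hg.cb j d), hvac, hvac,
      show sign (1 * 1 + 1) = 1 from sign_zero, sign_one, one_smul, neg_one_smul, sub_neg_eq_add]
  have h3 : ∀ i, 𝒰.Y (0 : ℕ) (𝒰.Y (-1) (c i) (μ i)) (b d) = if i = d then μ i else 0 := by
    intro i
    rw [h.mode_mul_of_simple (hg.parity_c i) (hg.parity_μ i) (hg.cb i d) (hμb i d), if_pos rfl,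
      show sign (1 * 1 + 1) = 1 from sign_zero, hvac, map_zero, smul_zero, zero_add, one_smul]
  rw [mode_gaugePotential h hg]
  simp only [h1, h2, h3, hg.wb, add_zero, smul_sub, smul_add, Finset.sum_sub_distrib,
    Finset.sum_add_distrib, smul_ite, smul_zero, Finset.sum_ite_eq', Finset.mem_univ, if_true]
  congr 2
  · have e1 : ∀ i, ∑ j, ∑ l, (if j = d then f j l i • 𝒰.Y (-1) (b i) (c l) else 0) =
        ∑ l, f d l i • 𝒰.Y (-1) (b i) (c l) := by
      intro i
      rw [Finset.sum_comm]
      exact Finset.sum_congr rfl fun l _ => by rw [Finset.sum_ite_eq', if_pos (Finset.mem_univ _)]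
    have e2 : ∀ i, ∑ j, f j d i • 𝒰.Y (-1) (b i) (c j) =
        -∑ l, f d l i • 𝒰.Y (-1) (b i) (c l) := by
      intro i
      rw [← Finset.sum_neg_distrib]
      exact Finset.sum_congr rfl fun l _ => by rw [hf, neg_smul]
    simp only [e1, e2, Finset.sum_neg_distrib]
    module
  · have e1 : ∑ i, ∑ j, (if i = d then k i j • 𝒰.T (c j) else 0) = ∑ j, k d j • 𝒰.T (c j) := by
      rw [Finset.sum_comm]
      exact Finset.sum_congr rfl fun l _ => by rw [Finset.sum_ite_eq', if_pos (Finset.mem_univ _)]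
    have e2 : ∑ i, k i d • 𝒰.T (c i) = ∑ j, k d j • 𝒰.T (c j) :=
      Finset.sum_congr rfl fun l _ => by rw [hk]
    rw [e1, e2]
    module

theorem gaugePotential_mode_μ (d : ι) : 𝒰.Y 0 (gaugePotential 𝒰 f k b c μ w) (μ d) =
    -∑ i, ∑ j, f i d j • 𝒰.Y (-1) (c i) (μ j) := by
  have hbμ : ∀ i j (m : ℕ), 𝒰.Y m (b i) (μ j) = if m = 0 then 0 else 0 := fun i j m => by
    rw [hg.bμ, ite_self]
  have hcμ : ∀ i j (m : ℕ), 𝒰.Y m (c i) (μ j) = if m = 0 then 0 else 0 := fun i j m => by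
    rw [hg.cμ, ite_self]
  have h1 : ∀ i j l, 𝒰.Y (0 : ℕ) (𝒰.Y (-1) (b i) (𝒰.Y (-1) (c j) (c l))) (μ d) = 0 := by
    intro i j l
    rw [h.mode_mul_of_simple (hg.parity_b i) (h.parity_mul (hg.parity_c j) (hg.parity_c l))
      (hbμ i d) (h.mode_mul_of_simple (hg.parity_c j) (hg.parity_c l) (hcμ j d) (hcμ l d))]
    simp
  have h2 : ∀ i j, 𝒰.Y (0 : ℕ) (𝒰.Y (-1) (c i) (𝒰.T (c j))) (μ d) = 0 := by
    intro i j
    rw [h.mode_mul_T_of_simple (hg.parity_c i) (hg.parity_c j) (hcμ i d) (hcμ j d)]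
    simp
  have h3 : ∀ i, 𝒰.Y (0 : ℕ) (𝒰.Y (-1) (c i) (μ i)) (μ d) =
      -∑ j, f i d j • 𝒰.Y (-1) (c i) (μ j) := by
    intro i
    rw [h.mode_mul_of_simple (hg.parity_c i) (hg.parity_μ i) (hcμ i d) (hg.μμ i d), if_pos rfl,
      map_zero, smul_zero, add_zero, sign_one, neg_one_smul, map_sum]
    simp only [map_smul]
  rw [mode_gaugePotential h hg]
  simp only [h1, h2, h3, hg.wμ, smul_zero, Finset.sum_const_zero, add_zero, zero_add,
    Finset.sum_neg_distrib]

theorem gaugePotential_mode_w : 𝒰.Y 0 (gaugePotential 𝒰 f k b c μ w) w = 𝒰.Y 0 w w := by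
  have hb : ∀ i (m : ℕ), 𝒰.Y m (b i) w = if m = 0 then 0 else 0 := fun i m => by
    rw [hg.bw, ite_self]
  have hc : ∀ i (m : ℕ), 𝒰.Y m (c i) w = if m = 0 then 0 else 0 := fun i m => by
    rw [hg.cw, ite_self]
  have hμ : ∀ i (m : ℕ), 𝒰.Y m (μ i) w = if m = 0 then 0 else 0 := fun i m => by
    rw [hg.μw, ite_self]
  rw [mode_gaugePotential h hg]
  have h1 : ∀ i j l, 𝒰.Y (0 : ℕ) (𝒰.Y (-1) (b i) (𝒰.Y (-1) (c j) (c l))) w = 0 := by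
    intro i j l
    rw [h.mode_mul_of_simple (hg.parity_b i) (h.parity_mul (hg.parity_c j) (hg.parity_c l))
      (hb i) (h.mode_mul_of_simple (hg.parity_c j) (hg.parity_c l) (hc j) (hc l))]
    simp
  have h2 : ∀ i j, 𝒰.Y (0 : ℕ) (𝒰.Y (-1) (c i) (𝒰.T (c j))) w = 0 := by
    intro i j
    rw [h.mode_mul_T_of_simple (hg.parity_c i) (hg.parity_c j) (hc i) (hc j)]
    simp
  have h3 : ∀ i, 𝒰.Y (0 : ℕ) (𝒰.Y (-1) (c i) (μ i)) w = 0 := by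
    intro i
    rw [h.mode_mul_of_simple (hg.parity_c i) (hg.parity_μ i) (hc i) (hμ i)]
    simp
  simp only [h1, h2, h3, smul_zero, Finset.sum_const_zero, add_zero, zero_add]
  rfl

variable {h} in
omit h hg in
theorem sum_cyclic {E : Type*} [AddCommGroup E] (g : ι → ι → ι → E) :
    ∑ i, ∑ j, ∑ l, g j l i = ∑ i, ∑ j, ∑ l, g i j l := by
  rw [Finset.sum_comm]
  exact Finset.sum_congr rfl fun j _ => Finset.sum_comm

omit h hg in
/-- A sum against a cyclically invariant family vanishes if the cyclic sums of the coefficients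
vanish. -/
theorem sum_smul_cyclic_eq_zero {X : ι → ι → ι → ℂ} {M : ι → ι → ι → U}
    (hX : ∀ i j l, X i j l + X j l i + X l i j = 0) (hM : ∀ i j l, M j l i = M i j l) :
    ∑ i, ∑ j, ∑ l, X i j l • M i j l = 0 := by
  have h1 : ∑ i, ∑ j, ∑ l, X j l i • M i j l = ∑ i, ∑ j, ∑ l, X i j l • M i j l := by
    rw [← sum_cyclic fun i j l => X i j l • M i j l]
    exact Finset.sum_congr rfl fun i _ => Finset.sum_congr rfl fun j _ =>
      Finset.sum_congr rfl fun l _ => by rw [hM i j l]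
  have h2 : ∑ i, ∑ j, ∑ l, X l i j • M i j l = ∑ i, ∑ j, ∑ l, X i j l • M i j l := by
    rw [← h1, ← sum_cyclic fun i j l => X j l i • M i j l]
    exact Finset.sum_congr rfl fun i _ => Finset.sum_congr rfl fun j _ =>
      Finset.sum_congr rfl fun l _ => by rw [hM i j l]
  have h3 : ∑ i, ∑ j, ∑ l, (X i j l + X j l i + X l i j) • M i j l = 0 := by
    simp only [hX, zero_smul, Finset.sum_const_zero]
  simp only [add_smul, Finset.sum_add_distrib] at h3
  rw [h1, h2] at h3
  have h4 : (3 : ℂ) • ∑ i, ∑ j, ∑ l, X i j l • M i j l = 0 := by rw [← h3]; module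
  exact (smul_eq_zero.1 h4).resolve_left three_ne_zero

theorem c_anticomm (i j : ι) : 𝒰.Y (-1) (c i) (c j) = -𝒰.Y (-1) (c j) (c i) := by
  rw [h.comm 1 1 _ _ (hg.parity_c i) (hg.parity_c j), mul_one, sign_one, neg_one_smul]

theorem c_left_anticomm (i j : ι) (x : U) :
    𝒰.Y (-1) (c i) (𝒰.Y (-1) (c j) x) = -𝒰.Y (-1) (c j) (𝒰.Y (-1) (c i) x) := by
  rw [h.left_comm (hg.parity_c i) (hg.parity_c j), mul_one, sign_one, neg_one_smul]

theorem ccc_cyclic (i j l : ι) : 𝒰.Y (-1) (c j) (𝒰.Y (-1) (c l) (c i)) =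
    𝒰.Y (-1) (c i) (𝒰.Y (-1) (c j) (c l)) := by
  rw [c_anticomm h hg l i, map_neg, c_left_anticomm h hg j i, neg_neg]

/-- The product of three odd vectors is invariant under cyclic rotation, so only the cyclic sum of
the coefficients matters, and that is a multiple of the Jacobi expression. -/
theorem gaugePotential_cubic (hf : ∀ i j l, f j i l = -f i j l)
    (hJ : ∀ i j l e, ∑ a, (f i j a * f a l e + f j l a * f a i e + f l i a * f a j e) = 0) :
    ∑ i, ∑ j, ∑ l, f j l i • (𝒰.Y (-1) (∑ a, ∑ d, f i d a • 𝒰.Y (-1) (b a) (c d))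
          (𝒰.Y (-1) (c j) (c l)) +
        𝒰.Y (-1) (b i) (𝒰.Y (-1) ((1 / 2 : ℂ) • ∑ a, ∑ d, f a d j • 𝒰.Y (-1) (c a) (c d)) (c l)) -
        𝒰.Y (-1) (b i) (𝒰.Y (-1) (c j) ((1 / 2 : ℂ) • ∑ a, ∑ d, f a d l • 𝒰.Y (-1) (c a) (c d))))
      = 0 := by
  set M : ι → ι → ι → ι → U := fun e i j l =>
    𝒰.Y (-1) (b e) (𝒰.Y (-1) (c i) (𝒰.Y (-1) (c j) (c l))) with hM
  have sum5 : ∀ g : ι → ι → ι → ι → ι → U, ∑ a, ∑ b, ∑ c, ∑ d, ∑ e, g a b c d e =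
      ∑ x : ι × ι × ι × ι × ι, g x.1 x.2.1 x.2.2.1 x.2.2.2.1 x.2.2.2.2 := by
    intro g; simp only [Fintype.sum_prod_type]
  -- The three reindexings bring all terms to the common monomial `b_e c^i c^j c^l`; the third uses
  -- the antisymmetry of `f` to match the coefficient of the first up to sign.
  have e1 : ∑ i, ∑ j, ∑ l, ∑ a, ∑ d, (f j l i * f i d a) • M a d j l =
      ∑ e, ∑ i, ∑ j, ∑ l, ∑ a, (f j l a * f a i e) • M e i j l := by
    rw [sum5, sum5]
    exact Fintype.sum_equiv ⟨fun x => (x.2.2.2.1, x.2.2.2.2, x.2.1, x.2.2.1, x.1),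
      fun x => (x.2.2.2.2, x.2.2.1, x.2.2.2.1, x.1, x.2.1), fun _ => rfl, fun _ => rfl⟩ _ _
      fun _ => rfl
  have e2 : ∑ i, ∑ j, ∑ l, ∑ a, ∑ d, (f j l i * f a d j) • M i a d l =
      ∑ e, ∑ i, ∑ j, ∑ l, ∑ a, (f i j a * f a l e) • M e i j l := by
    rw [sum5, sum5]
    exact Fintype.sum_equiv ⟨fun x => (x.1, x.2.2.2.1, x.2.2.2.2, x.2.2.1, x.2.1),
      fun x => (x.1, x.2.2.2.2, x.2.2.2.1, x.2.1, x.2.2.1), fun _ => rfl, fun _ => rfl⟩ _ _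
      fun _ => by rw [mul_comm]; rfl
  have e3 : ∑ i, ∑ j, ∑ l, ∑ a, ∑ d, (f j l i * f a d l) • M i j a d =
      ∑ e, ∑ i, ∑ j, ∑ l, ∑ a, (-(f j l a * f a i e)) • M e i j l := by
    rw [sum5, sum5]
    exact Fintype.sum_equiv ⟨fun x => (x.1, x.2.1, x.2.2.2.1, x.2.2.2.2, x.2.2.1),
      fun x => (x.1, x.2.1, x.2.2.2.2, x.2.2.1, x.2.2.2.1), fun _ => rfl, fun _ => rfl⟩ _ _
      fun x => by
        rw [mul_comm, hf x.2.2.1 x.2.1, mul_neg]; rfl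
  -- The first sum comes from `Q b` and the other two from `Q c` in either position. Summed
  -- cyclically, each of the three Jacobi terms appears with coefficient `1 + 1/2 + 1/2 = 2`.
  have hsum : ∀ e, ∑ i, ∑ j, ∑ l, (∑ a, f j l a * f a i e + (1 / 2 : ℂ) * ∑ a, f i j a * f a l e +
      (1 / 2 : ℂ) * ∑ a, f j l a * f a i e) • M e i j l = 0 := by
    intro e
    refine sum_smul_cyclic_eq_zero ?_ ?_
    · intro i j l
      have := hJ i j l e
      simp only [Finset.sum_add_distrib] at this ⊢
      linear_combination 2 * this
    · intro i j l; simp only [hM, ccc_cyclic h hg i j l]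
  have e4 : ∀ i j l, f j l i • (𝒰.Y (-1) (∑ a, ∑ d, f i d a • 𝒰.Y (-1) (b a) (c d))
        (𝒰.Y (-1) (c j) (c l)) +
      𝒰.Y (-1) (b i) (𝒰.Y (-1) ((1 / 2 : ℂ) • ∑ a, ∑ d, f a d j • 𝒰.Y (-1) (c a) (c d)) (c l)) -
      𝒰.Y (-1) (b i) (𝒰.Y (-1) (c j) ((1 / 2 : ℂ) • ∑ a, ∑ d, f a d l • 𝒰.Y (-1) (c a) (c d)))) =
      ∑ a, ∑ d, (f j l i * f i d a) • M a d j l +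
      (1 / 2 : ℂ) • ∑ a, ∑ d, (f j l i * f a d j) • M i a d l -
      (1 / 2 : ℂ) • ∑ a, ∑ d, (f j l i * f a d l) • M i j a d := by
    intro i j l
    simp only [map_sum, map_smul, LinearMap.sum_apply, LinearMap.smul_apply, h.assoc, smul_add,
      smul_sub, Finset.smul_sum, smul_smul, hM]
    simp only [mul_left_comm]
  simp only [e4, Finset.sum_add_distrib, Finset.sum_sub_distrib, ← Finset.smul_sum, e1, e2, e3]
  have hsum' := Finset.sum_eq_zero (s := Finset.univ) fun e _ => hsum e
  simp only [add_smul, mul_smul (1 / 2 : ℂ), Finset.sum_add_distrib, ← Finset.smul_sum,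
    Finset.sum_smul] at hsum'
  simp only [neg_smul, Finset.sum_neg_distrib]
  rw [← hsum']
  module

/-- All three contributions are multiples of one sum of monomials `c c μ`, with coefficients `1/2`
from `Q b`, `1/2` from `Q c` and `-1` from `Q μ`. -/
theorem gaugePotential_linear (hf : ∀ i j l, f j i l = -f i j l) :
    (1 / 2 : ℂ) • ∑ i, ∑ j, ∑ l, f j l i • 𝒰.Y (-1) (μ i) (𝒰.Y (-1) (c j) (c l)) +
      ∑ i, (𝒰.Y (-1) ((1 / 2 : ℂ) • ∑ j, ∑ l, f j l i • 𝒰.Y (-1) (c j) (c l)) (μ i) -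
        𝒰.Y (-1) (c i) (-∑ j, ∑ l, f j i l • 𝒰.Y (-1) (c j) (μ l))) = 0 := by
  have h1 : ∀ i j l, 𝒰.Y (-1) (μ i) (𝒰.Y (-1) (c j) (c l)) =
      𝒰.Y (-1) (c j) (𝒰.Y (-1) (c l) (μ i)) := by
    intro i j l
    rw [h.comm 1 (1 + 1) _ _ (hg.parity_μ i) (h.parity_mul (hg.parity_c j) (hg.parity_c l)),
      h.assoc, show sign (1 * (1 + 1)) = 1 from sign_zero, one_smul]
  have h2 : ∑ i, ∑ j, ∑ l, f j i l • 𝒰.Y (-1) (c i) (𝒰.Y (-1) (c j) (μ l)) =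
      -∑ i, ∑ j, ∑ l, f j l i • 𝒰.Y (-1) (c j) (𝒰.Y (-1) (c l) (μ i)) := by
    rw [sum_cyclic (fun i j l => f i j l • 𝒰.Y (-1) (c i) (𝒰.Y (-1) (c j) (μ l))),
      ← Finset.sum_neg_distrib]
    refine Finset.sum_congr rfl fun i _ => ?_
    rw [← Finset.sum_neg_distrib]
    refine Finset.sum_congr rfl fun j _ => ?_
    rw [← Finset.sum_neg_distrib]
    exact Finset.sum_congr rfl fun l _ => by rw [hf, neg_smul]
  simp only [h1, map_sum, map_smul, map_neg, LinearMap.sum_apply, LinearMap.smul_apply, h.assoc,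
    sub_neg_eq_add, Finset.sum_add_distrib, h2, ← Finset.smul_sum]
  module

/-- The cubic Chern-Simons form. -/
theorem gaugePotential_quadratic (hf : ∀ i j l, f j i l = -f i j l) (hk : ∀ i j, k i j = k j i)
    (hG : ∀ i j l, ∑ a, f j l a * k a i = ∑ a, f l i a * k a j) :
    (1 / 2 : ℂ) • ∑ i, ∑ j, ∑ l, f j l i • 𝒰.Y (-1) (∑ d, k i d • 𝒰.T (c d))
        (𝒰.Y (-1) (c j) (c l)) +
      (1 / 2 : ℂ) • ∑ i, ∑ j, k i j •
        (𝒰.Y (-1) ((1 / 2 : ℂ) • ∑ a, ∑ d, f a d i • 𝒰.Y (-1) (c a) (c d)) (𝒰.T (c j)) -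
        𝒰.Y (-1) (c i) (𝒰.T ((1 / 2 : ℂ) • ∑ a, ∑ d, f a d j • 𝒰.Y (-1) (c a) (c d)))) =
      𝒰.T ((1 / 12 : ℂ) • ∑ i, ∑ j, ∑ l, (∑ a, f j l a * k a i) •
        𝒰.Y (-1) (c i) (𝒰.Y (-1) (c j) (c l))) := by
  -- `G` is the totally antisymmetric form `K([T_j, T_l], T_i)`, cyclic by invariance of the
  -- bilinear form. Hence each position of the derivative in `ccc` gives the same sum against `M`.
  set G : ι → ι → ι → ℂ := fun i j l => ∑ a, f j l a * k a i with hGdef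
  set M : ι → ι → ι → U := fun i j l => 𝒰.Y (-1) (𝒰.T (c i)) (𝒰.Y (-1) (c j) (c l)) with hM
  have hG1 : ∀ i j l, G j l i = G i j l := fun i j l => (hG i j l).symm
  have hG2 : ∀ i j l, G i l j = -G i j l := by
    intro i j l
    simp only [hGdef, hf j l, neg_mul, Finset.sum_neg_distrib]
  have hpar : ∀ i, HasParity 𝒰 1 (𝒰.T (c i)) := fun i => h.parity_T (hg.parity_c i)
  have s1 : ∑ i, ∑ j, ∑ l, G i j l • 𝒰.Y (-1) (c i) (𝒰.Y (-1) (𝒰.T (c j)) (c l)) =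
      ∑ i, ∑ j, ∑ l, G i j l • M i j l := by
    rw [Finset.sum_comm]
    refine Finset.sum_congr rfl fun i _ => Finset.sum_congr rfl fun j _ =>
      Finset.sum_congr rfl fun l _ => ?_
    rw [h.left_comm (hg.parity_c j) (hpar i), mul_one, sign_one, ← hG1, hG2, smul_smul,
      mul_neg_one, neg_neg, hG1]
  have s2 : ∑ i, ∑ j, ∑ l, G i j l • 𝒰.Y (-1) (c i) (𝒰.Y (-1) (c j) (𝒰.T (c l))) =
      ∑ i, ∑ j, ∑ l, G i j l • M i j l := by
    rw [← sum_cyclic]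
    refine Finset.sum_congr rfl fun i _ => Finset.sum_congr rfl fun j _ =>
      Finset.sum_congr rfl fun l _ => ?_
    rw [hG1, ← h.assoc, h.comm (1 + 1) 1 _ _ (h.parity_mul (hg.parity_c j) (hg.parity_c l))
      (hpar i), show sign ((1 + 1) * 1) = 1 from sign_zero, one_smul]
  have sum4 : ∀ g : ι → ι → ι → ι → U, ∑ a, ∑ b, ∑ c, ∑ d, g a b c d =
      ∑ x : ι × ι × ι × ι, g x.1 x.2.1 x.2.2.1 x.2.2.2 := by
    intro g; simp only [Fintype.sum_prod_type]
  have t1 : ∑ i, ∑ j, ∑ l, f j l i • 𝒰.Y (-1) (∑ d, k i d • 𝒰.T (c d)) (𝒰.Y (-1) (c j) (c l)) =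
      ∑ i, ∑ j, ∑ l, G i j l • M i j l := by
    simp only [map_sum, map_smul, LinearMap.sum_apply, LinearMap.smul_apply, Finset.smul_sum,
      smul_smul, hGdef, Finset.sum_smul]
    rw [sum4, sum4]
    exact Fintype.sum_equiv ⟨fun x => (x.2.2.2, x.2.1, x.2.2.1, x.1),
      fun x => (x.2.2.2, x.2.1, x.2.2.1, x.1), fun _ => rfl, fun _ => rfl⟩ _ _ fun _ => rfl
  have t2 : ∑ i, ∑ j, k i j •
        𝒰.Y (-1) (∑ a, ∑ d, f a d i • 𝒰.Y (-1) (c a) (c d)) (𝒰.T (c j)) =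
      ∑ i, ∑ j, ∑ l, G i j l • M i j l := by
    have : ∀ i j l, 𝒰.Y (-1) (𝒰.Y (-1) (c i) (c j)) (𝒰.T (c l)) = M l i j := fun i j l => by
      rw [h.comm (1 + 1) 1 _ _ (h.parity_mul (hg.parity_c i) (hg.parity_c j))
        (hpar l), show sign ((1 + 1) * 1) = 1 from sign_zero, one_smul]
    simp only [map_sum, map_smul, LinearMap.sum_apply, LinearMap.smul_apply, Finset.smul_sum,
      smul_smul, hGdef, Finset.sum_smul, this]
    rw [sum4, sum4]
    exact Fintype.sum_equiv ⟨fun x => (x.2.1, x.2.2.1, x.2.2.2, x.1),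
      fun x => (x.2.2.2, x.1, x.2.1, x.2.2.1), fun _ => rfl, fun _ => rfl⟩ _ _
      fun _ => by rw [mul_comm]; rfl
  have t3 : ∑ i, ∑ j, k i j •
        𝒰.Y (-1) (c i) (𝒰.T (∑ a, ∑ d, f a d j • 𝒰.Y (-1) (c a) (c d))) =
      (2 : ℂ) • ∑ i, ∑ j, ∑ l, G i j l • M i j l := by
    rw [two_smul, ← s1]
    nth_rewrite 2 [s1]
    rw [← s2]
    simp only [← Finset.sum_add_distrib, ← smul_add]
    simp only [map_sum, map_smul, h.T_mul, ← map_add, Finset.smul_sum, smul_smul, hGdef,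
      Finset.sum_smul]
    rw [sum4, sum4]
    exact Fintype.sum_equiv ⟨fun x => (x.1, x.2.2.1, x.2.2.2, x.2.1),
      fun x => (x.1, x.2.2.2, x.2.1, x.2.2.1), fun _ => rfl, fun _ => rfl⟩ _ _
      fun x => by rw [mul_comm, hk]; rfl
  have s3 : 𝒰.T (∑ i, ∑ j, ∑ l, G i j l • 𝒰.Y (-1) (c i) (𝒰.Y (-1) (c j) (c l))) =
      (3 : ℂ) • ∑ i, ∑ j, ∑ l, G i j l • M i j l := by
    simp only [map_sum, map_smul, h.T_mul, map_add, smul_add, Finset.sum_add_distrib]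
    rw [s1, s2, hM]
    module
  -- In units of that sum the left side is `1/2 + 1/2 (1/2 - 1) = 1/4`, and the derivative of the
  -- cubic form is `3`, whence the constant `1/12`.
  simp only [map_smul, LinearMap.smul_apply, smul_sub, Finset.sum_sub_distrib]
  have e : ∀ i j (x : U), k i j • (1 / 2 : ℂ) • x = (1 / 2 : ℂ) • k i j • x :=
    fun _ _ _ => smul_comm _ _ _
  simp only [e, ← Finset.smul_sum]
  rw [t1, t2, t3, s3]
  module

theorem mode_gaugePotential_gaugePotential (hf : ∀ i j l, f j i l = -f i j l)
    (hJ : ∀ i j l e, ∑ a, (f i j a * f a l e + f j l a * f a i e + f l i a * f a j e) = 0)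
    (hk : ∀ i j, k i j = k j i)
    (hG : ∀ i j l, ∑ a, f j l a * k a i = ∑ a, f l i a * k a j)
    (hw : 𝒰.Y 0 w w ∈ LinearMap.range 𝒰.T) :
    𝒰.Y 0 (gaugePotential 𝒰 f k b c μ w) (gaugePotential 𝒰 f k b c μ w) ∈
      LinearMap.range 𝒰.T := by
  -- The superpotential is kept opaque, so that it is expanded as the argument of its zero mode and
  -- not inside the mode itself.
  obtain ⟨P, hP⟩ : ∃ P, P = gaugePotential 𝒰 f k b c μ w := ⟨_, rfl⟩
  rw [← hP]
  have hPpar : HasParity 𝒰 0 P := by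
    rw [hP]
    refine (((HasParity.smul ?_ _).add (HasParity.smul ?_ _)).add ?_).add hg.parity_w
    · exact HasParity.sum fun i _ => HasParity.sum fun j _ => HasParity.sum fun l _ =>
        (h.parity_mul (hg.parity_b i) (h.parity_mul (hg.parity_c j) (hg.parity_c l))).smul _
    · exact HasParity.sum fun i _ => HasParity.sum fun j _ =>
        (h.parity_mul (hg.parity_c i) (h.parity_T (hg.parity_c j))).smul _
    · exact HasParity.sum fun i _ => h.parity_mul (hg.parity_c i) (hg.parity_μ i)
  have hd0 : ∀ x y, HasParity 𝒰 0 x → 𝒰.Y 0 P (𝒰.Y (-1) x y) =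
      𝒰.Y (-1) (𝒰.Y 0 P x) y + 𝒰.Y (-1) x (𝒰.Y 0 P y) := fun x y hx => by
    have := h.derivation 0 P hPpar 0 x hx 0 y
    rwa [mul_zero, sign_zero, one_smul] at this
  have hd1 : ∀ x y, HasParity 𝒰 1 x → 𝒰.Y 0 P (𝒰.Y (-1) x y) =
      𝒰.Y (-1) (𝒰.Y 0 P x) y - 𝒰.Y (-1) x (𝒰.Y 0 P y) := fun x y hx => by
    have := h.derivation 0 P hPpar 1 x hx 0 y
    rwa [mul_one, zero_add, sign_one, neg_one_smul, ← sub_eq_add_neg] at this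
  have hT : ∀ x, 𝒰.Y 0 P (𝒰.T x) = 𝒰.T (𝒰.Y 0 P x) := fun x => by
    have := h.covariant P 0 x
    simpa only [Nat.cast_zero, zero_smul, add_zero] using this
  obtain ⟨B, hB⟩ : ∃ B : ι → U, ∀ i, B i = ∑ a, ∑ d, f i d a • 𝒰.Y (-1) (b a) (c d) :=
    ⟨_, fun _ => rfl⟩
  obtain ⟨D, hD⟩ : ∃ D : ι → U, ∀ i, D i = ∑ d, k i d • 𝒰.T (c d) := ⟨_, fun _ => rfl⟩
  obtain ⟨C, hC⟩ : ∃ C : ι → U, ∀ i, C i =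
    (1 / 2 : ℂ) • ∑ a, ∑ d, f a d i • 𝒰.Y (-1) (c a) (c d) := ⟨_, fun _ => rfl⟩
  have hcub : ∑ i, ∑ j, ∑ l, f j l i • (𝒰.Y (-1) (B i) (𝒰.Y (-1) (c j) (c l)) +
        𝒰.Y (-1) (b i) (𝒰.Y (-1) (C j) (c l)) - 𝒰.Y (-1) (b i) (𝒰.Y (-1) (c j) (C l))) = 0 := by
    simp only [hB, hC]; exact gaugePotential_cubic h hg hf hJ
  have hlin : (1 / 2 : ℂ) • ∑ i, ∑ j, ∑ l, f j l i • 𝒰.Y (-1) (μ i) (𝒰.Y (-1) (c j) (c l)) +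
      ∑ i, (𝒰.Y (-1) (C i) (μ i) - 𝒰.Y (-1) (c i) (𝒰.Y 0 P (μ i))) = 0 := by
    simp only [hC, hP, gaugePotential_mode_μ h hg]; exact gaugePotential_linear h hg hf
  have hquad : (1 / 2 : ℂ) • ∑ i, ∑ j, ∑ l, f j l i • 𝒰.Y (-1) (D i) (𝒰.Y (-1) (c j) (c l)) +
      (1 / 2 : ℂ) • ∑ i, ∑ j, k i j •
        (𝒰.Y (-1) (C i) (𝒰.T (c j)) - 𝒰.Y (-1) (c i) (𝒰.T (C j))) =
      𝒰.T ((1 / 12 : ℂ) • ∑ i, ∑ j, ∑ l, (∑ a, f j l a * k a i) •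
        𝒰.Y (-1) (c i) (𝒰.Y (-1) (c j) (c l))) := by
    simp only [hC, hD]; exact gaugePotential_quadratic h hg hf hk hG
  have hQb : ∀ i, 𝒰.Y 0 P (b i) = B i + D i + μ i := fun i => by
    rw [hP, gaugePotential_mode_b h hg hf hk, hB, hD]
  have hQc : ∀ i, 𝒰.Y 0 P (c i) = C i := fun i => by rw [hP, gaugePotential_mode_c h hg, hC]
  -- The zero mode is an odd derivation commuting with translation, so its value on each monomial
  -- follows from the values on generators.
  have expand : ∀ Q : U →ₗ[ℂ] U, Q P =
      (1 / 2 : ℂ) • ∑ i, ∑ j, ∑ l, f j l i • Q (𝒰.Y (-1) (b i) (𝒰.Y (-1) (c j) (c l))) +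
      (1 / 2 : ℂ) • ∑ i, ∑ j, k i j • Q (𝒰.Y (-1) (c i) (𝒰.T (c j))) +
      ∑ i, Q (𝒰.Y (-1) (c i) (μ i)) + Q w := fun Q => by
    simp only [hP, gaugePotential, map_add, map_smul, map_sum]
  have t1 : ∀ i j l, 𝒰.Y 0 P (𝒰.Y (-1) (b i) (𝒰.Y (-1) (c j) (c l))) =
      (𝒰.Y (-1) (B i) (𝒰.Y (-1) (c j) (c l)) + 𝒰.Y (-1) (b i) (𝒰.Y (-1) (C j) (c l)) -
        𝒰.Y (-1) (b i) (𝒰.Y (-1) (c j) (C l))) +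
      𝒰.Y (-1) (D i) (𝒰.Y (-1) (c j) (c l)) + 𝒰.Y (-1) (μ i) (𝒰.Y (-1) (c j) (c l)) := by
    intro i j l
    rw [hd0 _ _ (hg.parity_b i), hd1 _ _ (hg.parity_c j), hQb, hQc, hQc]
    simp only [map_add, map_sub, LinearMap.add_apply]
    abel
  have t2 : ∀ i j, 𝒰.Y 0 P (𝒰.Y (-1) (c i) (𝒰.T (c j))) =
      𝒰.Y (-1) (C i) (𝒰.T (c j)) - 𝒰.Y (-1) (c i) (𝒰.T (C j)) := by
    intro i j
    rw [hd1 _ _ (hg.parity_c i), hT, hQc, hQc]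
  have t3 : ∀ i, 𝒰.Y 0 P (𝒰.Y (-1) (c i) (μ i)) =
      𝒰.Y (-1) (C i) (μ i) - 𝒰.Y (-1) (c i) (𝒰.Y 0 P (μ i)) := by
    intro i
    rw [hd1 _ _ (hg.parity_c i), hQc]
  have main : 𝒰.Y 0 P P = 𝒰.T ((1 / 12 : ℂ) • ∑ i, ∑ j, ∑ l, (∑ a, f j l a * k a i) •
      𝒰.Y (-1) (c i) (𝒰.Y (-1) (c j) (c l))) + 𝒰.Y 0 w w := by
    rw [expand]
    simp only [t1, t2, t3, smul_add (f _ _ _), Finset.sum_add_distrib]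
    rw [hcub, show 𝒰.Y 0 P w = 𝒰.Y 0 w w by rw [hP, gaugePotential_mode_w h hg], zero_add,
      smul_add, add_right_comm ((1 / 2 : ℂ) • _), hquad, add_assoc _ ((1 / 2 : ℂ) • _), hlin,
      add_zero]
  rw [main]
  exact add_mem ⟨_, rfl⟩ hw

end IsGauging

end Superpotential

/-! ### The gauged vertex algebra and its superpotential -/

section GaugedModes

variable {ι V : Type*} [AddCommGroup V] [Module ℂ V] {𝒱 : RavioloData V}

theorem gauged_isPoisson (ι : Type*) (hV : IsPoisson 𝒱) : IsPoisson (gauged ι 𝒱) :=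
  tensor_isPoisson hV bc_isPoisson

/-- The states `b_a` and `c^a` of the tensor product. -/
def ghost (𝒱 : RavioloData V) (φ : ι ⊕ ι) : V ⊗[ℂ] Fock ι := 𝒱.vac ⊗ₜ[ℂ] bcLetter φ 0

theorem ghost_parity (hV : IsPoisson 𝒱) (φ : ι ⊕ ι) :
    HasParity (gauged ι 𝒱) (bcParity φ) (ghost 𝒱 φ) := by
  rw [← zero_add (bcParity φ)]
  exact parity_tmul hV.parity_vac (bcLetter_parity φ 0)

theorem matter_parity {p : ZMod 2} {v : V} (hv : HasParity 𝒱 p v) :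
    HasParity (gauged ι 𝒱) p (matter ι v) := by
  rw [← add_zero p]
  exact parity_tmul hv bc_isPoisson.parity_vac

theorem ghost_mode (hV : IsPoisson 𝒱) (φ : ι ⊕ ι) {q : ZMod 2} {v : V} (hv : HasParity 𝒱 q v)
    (y : Fock ι) (m : ℕ) : (gauged ι 𝒱).Y m (ghost 𝒱 φ) (v ⊗ₜ y) =
      sign ((bcParity φ + 1) * q) • (v ⊗ₜ[ℂ] bcAnn φ m y) := by
  have := tensor_inr_mode hV bc_isPoisson (bcLetter_parity φ 0) hv y m
  rw [bc_mode_bcLetter, if_pos m.zero_le, pow_zero, Nat.choose_zero_right, Nat.cast_one, mul_one,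
    one_smul, Nat.sub_zero] at this
  exact this

theorem ghost_mode_ghost [DecidableEq ι] (hV : IsPoisson 𝒱) (φ ψ : ι ⊕ ι) (m : ℕ) :
    (gauged ι 𝒱).Y m (ghost 𝒱 φ) (ghost 𝒱 ψ) =
      if m = 0 then if ψ = φ.swap then (gauged ι 𝒱).vac else 0 else 0 := by
  refine (ghost_mode hV φ hV.parity_vac (bcLetter ψ 0) m).trans ?_
  rw [mul_zero, sign_zero, one_smul, bcAnn_bcLetter]
  by_cases hm : m = 0
  · rw [if_pos hm]
    by_cases hφ : ψ = φ.swap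
    · rw [if_pos hφ, if_pos ⟨hφ, hm.symm⟩]; rfl
    · rw [if_neg hφ, if_neg fun h => hφ h.1, TensorProduct.tmul_zero]
  · rw [if_neg hm, if_neg fun h => hm h.2.symm, TensorProduct.tmul_zero]

theorem ghost_mode_matter (hV : IsPoisson 𝒱) (φ : ι ⊕ ι) (v : V) (m : ℕ) :
    (gauged ι 𝒱).Y m (ghost 𝒱 φ) (matter ι v) = 0 := by
  refine hV.parity_induction (P := fun v => (gauged ι 𝒱).Y m (ghost 𝒱 φ) (matter ι v) = 0)
    (fun a b h h' => ?_) (fun q v hv => ?_) v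
  · rw [matter, TensorProduct.add_tmul, map_add]
    exact (congrArg₂ (· + ·) h h').trans (add_zero 0)
  · rw [matter, ghost_mode hV φ hv, bcAnn_one, TensorProduct.tmul_zero, smul_zero]

theorem matter_mode (hV : IsPoisson 𝒱) (a v : V) (y : Fock ι) (m : ℕ) :
    (gauged ι 𝒱).Y m (matter ι a) (v ⊗ₜ y) = 𝒱.Y m a v ⊗ₜ[ℂ] y :=
  tensor_inl_mode hV bc_isPoisson a v y m

theorem matter_mode_matter (hV : IsPoisson 𝒱) (a v : V) (m : ℕ) :
    (gauged ι 𝒱).Y m (matter ι a) (matter ι v) = matter ι (𝒱.Y m a v) :=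
  matter_mode hV a v 1 m

theorem matter_zero : matter ι (0 : V) = 0 := TensorProduct.zero_tmul _ _

theorem matter_mode_ghost (hV : IsPoisson 𝒱) (φ : ι ⊕ ι) (v : V) (m : ℕ) :
    (gauged ι 𝒱).Y m (matter ι v) (ghost 𝒱 φ) = 0 := by
  rw [ghost, matter_mode hV, hV.mode_vac, TensorProduct.zero_tmul]

variable [Fintype ι] {𝔤 : Type*} [LieRing 𝔤] [LieAlgebra ℂ 𝔤] (T : Module.Basis ι ℂ 𝔤)
  {ρ : ExtAlg ι →ₗ[ℂ] V} {K : LinearMap.BilinForm ℂ 𝔤} {W : V}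

theorem gauged_isGauging [DecidableEq ι] (hV : IsRaviolo 𝒱) (hρ : IsHamiltonianSymmetry T 𝒱 ρ)
    (hW : W ∈ 𝒱.gr (2, 0)) (hW' : IsInvariantPrimary 𝒱 ρ W) :
    IsGauging (gauged ι 𝒱) (structConst T) (bState 𝒱) (cState 𝒱)
      (fun a => matter ι (moment ρ a)) (matter ι W) := by
  have hP := hV.isPoisson
  have hμ : ∀ i, HasParity 𝒱 1 (moment ρ i) := fun i => hV.hasParity (hρ.moment_mem i)
  have hw : HasParity 𝒱 0 W := hV.hasParity hW
  have hμw : ∀ i (m : ℕ), 𝒱.Y m (moment ρ i) W = 0 := fun i m => hW' i m (Int.natCast_nonneg m)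
  refine
    { parity_b := fun i => ghost_parity hP (Sum.inl i)
      parity_c := fun i => ghost_parity hP (Sum.inr i)
      parity_μ := fun i => matter_parity (hμ i)
      parity_w := matter_parity hw
      bb := fun i j m => (ghost_mode_ghost hP (Sum.inl i) (Sum.inl j) m).trans (by simp)
      bc := fun i j m => (ghost_mode_ghost hP (Sum.inl i) (Sum.inr j) m).trans (by
        simp [eq_comm])
      cb := fun i j m => (ghost_mode_ghost hP (Sum.inr i) (Sum.inl j) m).trans (by
        simp [eq_comm])
      cc := fun i j m => (ghost_mode_ghost hP (Sum.inr i) (Sum.inr j) m).trans (by simp)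
      bμ := fun i j m => ghost_mode_matter hP (Sum.inl i) _ m
      cμ := fun i j m => ghost_mode_matter hP (Sum.inr i) _ m
      μb := fun i j m => matter_mode_ghost hP (Sum.inl j) _ m
      μc := fun i j m => matter_mode_ghost hP (Sum.inr j) _ m
      bw := fun i m => ghost_mode_matter hP (Sum.inl i) _ m
      cw := fun i m => ghost_mode_matter hP (Sum.inr i) _ m
      wb := fun i m => matter_mode_ghost hP (Sum.inl i) _ m
      wc := fun i m => matter_mode_ghost hP (Sum.inr i) _ m
      μμ := fun i j m => ?_
      μw := fun i m => ?_
      wμ := fun i m => ?_ }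
  · rw [matter_mode_matter hP, hρ.mode_moment]
    split_ifs
    · simp only [TensorProduct.sum_tmul, matter, TensorProduct.smul_tmul']
    · exact matter_zero
  · rw [matter_mode_matter hP, hμw, matter_zero]
  -- Invariance is stated for the moment maps acting on `W`; skew-symmetry gives the opposite order.
  · rw [matter_mode_matter hP, hP.skew _ _ _ _ (hμ i) hw m]
    simp only [hμw, skewTransform_zero, smul_zero, matter_zero]

theorem totalSuperpotential_eq : totalSuperpotential T K 𝒱 ρ W =
    gaugePotential (gauged ι 𝒱) (structConst T) (fun i j => K (T i) (T j)) (bState 𝒱) (cState 𝒱)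
      (fun a => matter ι (moment ρ a)) (matter ι W) := rfl

theorem structConst_antisymm (i j l : ι) : structConst T j i l = -structConst T i j l := by
  rw [structConst, structConst, ← lie_skew, map_neg, Finsupp.neg_apply]

theorem sum_structConst_smul {E : Type*} [AddCommGroup E] [Module ℂ E] (i j : ι) (φ : 𝔤 →ₗ[ℂ] E) :
    ∑ a, structConst T i j a • φ (T a) = φ ⁅T i, T j⁆ := by
  conv_rhs => rw [← T.sum_repr ⁅T i, T j⁆, map_sum]
  simp only [map_smul, structConst]

theorem sum_structConst_mul (i j l e : ι) :
    ∑ a, structConst T i j a * structConst T a l e = T.repr ⁅⁅T i, T j⁆, T l⁆ e := by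
  have := sum_structConst_smul T i j
    ((Finsupp.lapply e ∘ₗ T.repr.toLinearMap) ∘ₗ (-(LieModule.toEnd ℂ 𝔤 𝔤 (T l) : 𝔤 →ₗ[ℂ] 𝔤)))
  simp only [LinearMap.comp_apply, LinearMap.neg_apply, LieModule.toEnd_apply_apply, lie_skew] at this
  exact this

theorem structConst_jacobi (i j l e : ι) :
    ∑ a, (structConst T i j a * structConst T a l e + structConst T j l a * structConst T a i e +
      structConst T l i a * structConst T a j e) = 0 := by
  simp only [Finset.sum_add_distrib, sum_structConst_mul]
  rw [← Finsupp.add_apply, ← Finsupp.add_apply, ← map_add, ← map_add]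
  have : ⁅⁅T i, T j⁆, T l⁆ + ⁅⁅T j, T l⁆, T i⁆ + ⁅⁅T l, T i⁆, T j⁆ = 0 := by
    rw [← lie_skew ⁅T i, T j⁆, ← lie_skew ⁅T j, T l⁆, ← lie_skew ⁅T l, T i⁆, ← neg_add, ← neg_add,
      neg_eq_zero, ← lie_jacobi (T l) (T i) (T j)]
  rw [this, map_zero, Finsupp.zero_apply]

/-- Both sides are values of the trilinear form `K([x, y], z)`, which is cyclic for a symmetric
invariant form. -/
theorem sum_structConst_mul_form (hK : K.IsSymm) (hK' : K.lieInvariant 𝔤) (i j l : ι) :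
    ∑ a, structConst T j l a * K (T a) (T i) = ∑ a, structConst T l i a * K (T a) (T j) := by
  have h : ∀ i j l, ∑ a, structConst T j l a * K (T a) (T i) = K ⁅T j, T l⁆ (T i) := fun i j l =>
    sum_structConst_smul T j l (K.flip (T i))
  rw [h, h, hK' (T l), hK.eq, ← map_neg, lie_skew]

omit [Fintype ι] in
theorem bLetter_mem_gr (a : ι) : bLetter a 0 ∈ (bcSystem ι).gr (0, 0) :=
  Submodule.subset_span ⟨Finsupp.single (a, 0) 1, [], rfl, rfl, rfl⟩

omit [Fintype ι] in
theorem cLetter_mem_gr (a : ι) : cLetter a 0 ∈ (bcSystem ι).gr (1, 0) :=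
  Submodule.subset_span ⟨0, [(a, 0)], rfl, rfl, by simp [cLetter, fockMonomial]⟩

omit [Fintype ι] in
theorem bLetter_mem_bcSpin (a : ι) : bLetter a 0 ∈ bcSpin ι 1 :=
  Submodule.subset_span ⟨Finsupp.single (a, 0) 1, [], by simp, rfl⟩

omit [Fintype ι] in
theorem cLetter_mem_bcSpin (a : ι) : cLetter a 0 ∈ bcSpin ι 0 :=
  Submodule.subset_span ⟨0, [(a, 0)], by simp, by simp [cLetter, fockMonomial]⟩

theorem totalSuperpotential_mem (hV : IsRaviolo 𝒱) (hρ : IsHamiltonianSymmetry T 𝒱 ρ)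
    (hW : W ∈ 𝒱.gr (2, 0)) : totalSuperpotential T K 𝒱 ρ W ∈ (gauged ι 𝒱).gr (2, 0) := by
  have hR : IsRaviolo (gauged ι 𝒱) := tensor_isRaviolo hV bc_isRaviolo
  have hb : ∀ i, bState 𝒱 i ∈ (gauged ι 𝒱).gr (0, 0) := fun i =>
    tmul_mem_tensorGrading hV.vac_mem (bLetter_mem_gr i) rfl
  have hc : ∀ i, cState 𝒱 i ∈ (gauged ι 𝒱).gr (1, 0) := fun i =>
    tmul_mem_tensorGrading hV.vac_mem (cLetter_mem_gr i) rfl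
  have hm : ∀ (d : Deg) (v : V), v ∈ 𝒱.gr d → matter ι v ∈ (gauged ι 𝒱).gr d := fun d v hv =>
    tmul_mem_tensorGrading hv bc_isRaviolo.vac_mem (add_zero _)
  have hmul : ∀ (d e f : Deg) (x y), x ∈ (gauged ι 𝒱).gr d → y ∈ (gauged ι 𝒱).gr e → d + e = f →
      (gauged ι 𝒱).Y (-1) x y ∈ (gauged ι 𝒱).gr f := fun d e f x y hx hy h =>
    h ▸ hR.Y_mem_neg (-1) (by norm_num) d e x hx y hy
  have hcc : ∀ i j, (gauged ι 𝒱).Y (-1) (cState 𝒱 i) (cState 𝒱 j) ∈ (gauged ι 𝒱).gr (2, 0) :=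
    fun i j => hmul (1, 0) (1, 0) (2, 0) _ _ (hc i) (hc j) rfl
  rw [totalSuperpotential_eq]
  refine add_mem (add_mem (add_mem (Submodule.smul_mem _ _ ?_) (Submodule.smul_mem _ _ ?_)) ?_)
    (hm (2, 0) W hW)
  · exact sum_mem fun i _ => sum_mem fun j _ => sum_mem fun l _ => Submodule.smul_mem _ _
      (hmul (0, 0) (2, 0) (2, 0) _ _ (hb i) (hcc j l) rfl)
  · exact sum_mem fun i _ => sum_mem fun j _ => Submodule.smul_mem _ _
      (hmul (1, 0) (1, 0) (2, 0) _ _ (hc i) (hR.T_mem _ _ (hc j)) rfl)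
  · exact sum_mem fun i _ =>
      hmul (1, 0) (1, 0) (2, 0) _ _ (hc i) (hm (1, 0) _ (hρ.moment_mem i)) rfl

theorem totalSuperpotential_mem_spin (hV : IsRaviolo 𝒱) {spin : ℚ → Submodule ℂ V}
    (hs : IsSpinGrading 𝒱 spin) (hμ : ∀ a, moment ρ a ∈ spin 1) (hW : W ∈ spin 1) :
    totalSuperpotential T K 𝒱 ρ W ∈ tensorSpin spin (bcSpin ι) 1 := by
  have hS : IsSpinGrading (gauged ι 𝒱) (tensorSpin spin (bcSpin ι)) :=
    tensor_isSpinGrading hV bc_isRaviolo hs bc_isSpinGrading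
  have hb : ∀ i, bState 𝒱 i ∈ tensorSpin spin (bcSpin ι) 1 := fun i =>
    tmul_mem_tensorGrading hs.vac_mem (bLetter_mem_bcSpin i) (zero_add 1)
  have hc : ∀ i, cState 𝒱 i ∈ tensorSpin spin (bcSpin ι) 0 := fun i =>
    tmul_mem_tensorGrading hs.vac_mem (cLetter_mem_bcSpin i) (zero_add 0)
  have hm : ∀ (v : V), v ∈ spin 1 → matter ι v ∈ tensorSpin spin (bcSpin ι) 1 := fun v hv =>
    tmul_mem_tensorGrading hv bc_isSpinGrading.vac_mem (add_zero 1)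
  have hmul : ∀ (d e f : ℚ) (x y), x ∈ tensorSpin spin (bcSpin ι) d →
      y ∈ tensorSpin spin (bcSpin ι) e → d + e = f →
      (gauged ι 𝒱).Y (-1) x y ∈ tensorSpin spin (bcSpin ι) f := fun d e f x y hx hy h => by
    have := hS.Y_mem (-1) d e x hx y hy
    rwa [show e + (d - ((-1 : ℤ) : ℚ) - 1) = f by rw [← h]; push_cast; ring] at this
  rw [totalSuperpotential_eq]
  refine add_mem (add_mem (add_mem (Submodule.smul_mem _ _ ?_) (Submodule.smul_mem _ _ ?_)) ?_)
    (hm W hW)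
  · exact sum_mem fun i _ => sum_mem fun j _ => sum_mem fun l _ => Submodule.smul_mem _ _
      (hmul 1 0 1 _ _ (hb i) (hmul 0 0 0 _ _ (hc j) (hc l) (zero_add 0)) (add_zero 1))
  · exact sum_mem fun i _ => sum_mem fun j _ => Submodule.smul_mem _ _
      (hmul 0 1 1 _ _ (hc i) (by simpa using hS.T_mem _ _ (hc j)) (zero_add 1))
  · exact sum_mem fun i _ => hmul 0 1 1 _ _ (hc i) (hm _ (hμ i)) (zero_add 1)

theorem totalSuperpotential_isSuperpotential (hV : IsRaviolo 𝒱) (hρ : IsHamiltonianSymmetry T 𝒱 ρ)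
    (hK : K.IsSymm) (hK' : K.lieInvariant 𝔤) (hW : IsSuperpotential 𝒱 W)
    (hW' : IsInvariantPrimary 𝒱 ρ W) :
    IsSuperpotential (gauged ι 𝒱) (totalSuperpotential T K 𝒱 ρ W) := by
  classical
  have hP := gauged_isPoisson ι hV.isPoisson
  refine ⟨totalSuperpotential_mem T hV hρ hW.mem, ?_⟩
  rw [hP.mul_vac, totalSuperpotential_eq]
  refine (gauged_isGauging T hV hρ hW.mem hW').mode_gaugePotential_gaugePotential hP
    (structConst_antisymm T) (structConst_jacobi T) (fun i j => hK.eq _ _)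
    (sum_structConst_mul_form T hK hK') ?_
  obtain ⟨x, hx⟩ := hW.bracket
  rw [hV.isPoisson.mul_vac] at hx
  refine ⟨matter ι x, ?_⟩
  have h1 := matter_mode (ι := ι) hV.isPoisson W W 1 0
  rw [Nat.cast_zero] at h1
  rw [matter, matter]
  refine Eq.trans ?_ h1.symm
  rw [← hx]
  refine (tensor_T_tmul (𝒲 := bcSystem ι) x 1).trans ?_
  rw [show (bcSystem ι).T 1 = 0 from bc_isPoisson.T_vac, TensorProduct.tmul_zero, add_zero]

end GaugedModes

/-! ### Primary vectors and the Witt relations -/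

section Conformal

variable {U : Type*} [AddCommGroup U] [Module ℂ U] {𝒰 : RavioloData U}

/-! ### Primary vectors -/

/-- Divided powers, extended by zero to negative exponents. -/
def dpowZ (T : U →ₗ[ℂ] U) (j : ℤ) : U →ₗ[ℂ] U := if j < 0 then 0 else dpow T j.toNat

theorem dpowZ_neg (T : U →ₗ[ℂ] U) {j : ℤ} (hj : j < 0) (x : U) : dpowZ T j x = 0 := by
  rw [dpowZ, if_pos hj]; rfl

theorem dpowZ_nat (T : U →ₗ[ℂ] U) (j : ℕ) (x : U) : dpowZ T j x = dpow T j x := by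
  rw [dpowZ, if_neg (by omega), Int.toNat_natCast]

theorem T_dpowZ (T : U →ₗ[ℂ] U) (j : ℤ) (x : U) :
    T (dpowZ T j x) = ((j : ℂ) + 1) • dpowZ T (j + 1) x := by
  rcases lt_or_ge j 0 with hj | hj
  · rw [dpowZ_neg T hj, map_zero]
    rcases eq_or_ne j (-1) with rfl | h
    · simp
    · rw [dpowZ_neg T (by omega), smul_zero]
  · obtain ⟨k, rfl⟩ := Int.eq_ofNat_of_zero_le hj
    have := dpowZ_nat T (k + 1) x
    rw [Nat.cast_succ] at this
    rw [dpowZ_nat, T_dpow, this, Int.cast_natCast]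

/-- `x` is a primary vector of weight `s` for the field of `g`. -/
structure IsPrimary (𝒰 : RavioloData U) (g : U) (s : ℂ) (x : U) : Prop where
  zero : 𝒰.Y (0 : ℕ) g x = 𝒰.T x
  one : 𝒰.Y (1 : ℕ) g x = s • x
  two : ∀ m : ℕ, 2 ≤ m → 𝒰.Y m g x = 0

/-- The commutators of the modes with `T` determine the action on all derivatives of a primary, as
that of the vector fields `z^m ∂` on densities of weight `s`. The extension of divided powers by
zero covers the cases in which too many derivatives would be removed. -/
theorem IsPoisson.mode_dpow_primary (h : IsPoisson 𝒰) {g x : U} {s : ℂ} (hx : IsPrimary 𝒰 g s x)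
    (m k : ℕ) : 𝒰.Y m g (dpow 𝒰.T k x) =
      ((k : ℂ) + 1 - m + m * s) • dpowZ 𝒰.T ((k : ℤ) + 1 - m) x := by
  induction k generalizing m with
  | zero =>
    rw [dpow_zero]
    match m with
    | 0 =>
      rw [hx.zero]
      have := dpowZ_nat 𝒰.T 1 x
      rw [dpow_one] at this
      simpa using this.symm
    | 1 =>
      rw [hx.one]
      have := dpowZ_nat 𝒰.T 0 x
      rw [dpow_zero, Nat.cast_zero] at this
      simp [this]
    | m + 2 =>
      rw [hx.two _ (by omega), dpowZ_neg 𝒰.T (by push_cast; omega), smul_zero]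
  | succ k ih =>
    have hk : (k : ℂ) + 1 ≠ 0 := by exact_mod_cast k.succ_ne_zero
    rw [dpow_succ, map_smul, h.covariant, ih, map_smul, T_dpowZ, inv_smul_eq_iff₀ hk, smul_smul,
      smul_smul]
    cases m with
    | zero =>
      rw [show ((k + 1 : ℕ) : ℤ) + 1 - (0 : ℕ) = (k : ℤ) + 1 - (0 : ℕ) + 1 by push_cast; ring]
      simp only [Nat.cast_zero, zero_smul, add_zero]
      congr 1
      push_cast
      ring
    | succ m =>
      rw [ih, smul_smul, show m + 1 - 1 = m by omega,
        show (k : ℤ) + 1 - (m + 1 : ℕ) + 1 = (k : ℤ) + 1 - m by push_cast; ring,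
        show ((k + 1 : ℕ) : ℤ) + 1 - (m + 1 : ℕ) = (k : ℤ) + 1 - m by push_cast; ring, ← add_smul]
      congr 1
      push_cast
      ring

theorem IsPoisson.mode_dpowZ_primary (h : IsPoisson 𝒰) {g x : U} {s : ℂ} (hx : IsPrimary 𝒰 g s x)
    (m : ℕ) (j : ℤ) : 𝒰.Y m g (dpowZ 𝒰.T j x) =
      ((j : ℂ) + 1 - m + m * s) • dpowZ 𝒰.T (j + 1 - m) x := by
  rcases lt_or_ge j 0 with hj | hj
  · rw [dpowZ_neg _ hj, map_zero]
    by_cases h0 : j + 1 - m < 0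
    · rw [dpowZ_neg _ h0, smul_zero]
    · obtain rfl : m = 0 := by omega
      obtain rfl : j = -1 := by omega
      simp
  · obtain ⟨k, rfl⟩ := Int.eq_ofNat_of_zero_le hj
    rw [dpowZ_nat, h.mode_dpow_primary hx, Int.cast_natCast]

theorem IsPoisson.mode_zero_dpow (h : IsPoisson 𝒰) {g x : U} (hx : 𝒰.Y (0 : ℕ) g x = 𝒰.T x)
    (k : ℕ) : 𝒰.Y (0 : ℕ) g (dpow 𝒰.T k x) = 𝒰.T (dpow 𝒰.T k x) := by
  induction k with
  | zero => rwa [dpow_zero]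
  | succ k ih =>
    rw [dpow_succ, map_smul, map_smul, h.covariant, ih, Nat.cast_zero, zero_smul, add_zero]

/-- The modes `g_(m)` and `g_(n)`, `m, n ≥ 0`, satisfy the Witt relation on `a`. -/
def WittRelation (𝒰 : RavioloData U) (g : U) (m n : ℕ) (a : U) : Prop :=
  𝒰.Y m g (𝒰.Y n g a) - 𝒰.Y n g (𝒰.Y m g a) = ((m : ℂ) - n) • 𝒰.Y ((m : ℤ) + n - 1) g a

theorem wittRelation_iff {g a : U} {m n : ℕ} (hmn : m + n ≠ 0) : WittRelation 𝒰 g m n a ↔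
    𝒰.Y m g (𝒰.Y n g a) - 𝒰.Y n g (𝒰.Y m g a) =
      ((m : ℂ) - n) • 𝒰.Y ((m + n - 1 : ℕ) : ℤ) g a := by
  rw [WittRelation, show ((m + n - 1 : ℕ) : ℤ) = (m : ℤ) + n - 1 by omega]

/-- Treated apart because the mode on the right would have index `-1`; its coefficient vanishes. -/
theorem wittRelation_zero_zero {g a : U} : WittRelation 𝒰 g 0 0 a := by
  simp [WittRelation]

/-- On derivatives of one primary, both sides are multiples of the same vector, and the coefficients
agree as polynomials. -/
theorem IsPoisson.wittRelation_dpow (h : IsPoisson 𝒰) {g x : U} {s : ℂ} (hx : IsPrimary 𝒰 g s x)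
    (m n k : ℕ) : WittRelation 𝒰 g m n (dpow 𝒰.T k x) := by
  by_cases hmn : m + n = 0
  · obtain ⟨rfl, rfl⟩ : m = 0 ∧ n = 0 := by omega
    exact wittRelation_zero_zero
  rw [wittRelation_iff hmn, ← dpowZ_nat]
  simp only [h.mode_dpowZ_primary hx, map_smul, smul_smul]
  rw [show (k : ℤ) + 1 - m + 1 - n = k + 2 - m - n by ring,
    show (k : ℤ) + 1 - n + 1 - m = k + 2 - m - n by ring,
    show (k : ℤ) + 1 - (m + n - 1 : ℕ) = k + 2 - m - n by omega, ← sub_smul]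
  congr 1
  rw [Nat.cast_sub (by omega)]
  push_cast
  ring

theorem IsPoisson.mode_mul_of_odd (h : IsPoisson 𝒰) {g : U} (hg : HasParity 𝒰 1 g) (m : ℕ)
    (a x : U) : 𝒰.Y m g (𝒰.Y (-1) a x) = 𝒰.Y (-1) (𝒰.Y m g a) x + 𝒰.Y (-1) a (𝒰.Y m g x) := by
  refine h.parity_induction (P := fun a => 𝒰.Y m g (𝒰.Y (-1) a x) =
    𝒰.Y (-1) (𝒰.Y m g a) x + 𝒰.Y (-1) a (𝒰.Y m g x)) (fun a b ha hb => ?_) (fun q a ha => ?_) a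
  · simp only [map_add, LinearMap.add_apply, ha, hb]; abel
  · rw [h.derivation 1 g hg q a ha, show (1 + 1 : ZMod 2) = 0 from rfl, zero_mul, sign_zero,
      one_smul]

/-- For odd `g` the non-negative modes are even derivations, and a commutator of derivations is a
derivation. So the relation extends from factors to products. -/
theorem IsPoisson.wittRelation_mul (h : IsPoisson 𝒰) {g : U} (hg : HasParity 𝒰 1 g) {m n : ℕ}
    {a x : U} (ha : WittRelation 𝒰 g m n a) (hx : WittRelation 𝒰 g m n x) :
    WittRelation 𝒰 g m n (𝒰.Y (-1) a x) := by
  by_cases hmn : m + n = 0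
  · obtain ⟨rfl, rfl⟩ : m = 0 ∧ n = 0 := by omega
    exact wittRelation_zero_zero
  rw [wittRelation_iff hmn] at *
  simp only [h.mode_mul_of_odd hg, map_add]
  rw [smul_add, ← map_smul (𝒰.Y (-1) a), ← hx, ← LinearMap.smul_apply, ← map_smul (𝒰.Y (-1)), ← ha]
  simp only [map_sub, LinearMap.sub_apply]
  abel

theorem IsPoisson.mode_mul_T_of_simple' (h : IsPoisson 𝒰) {p r : ZMod 2} {a x v α β : U}
    (ha : HasParity 𝒰 p a) (hx : HasParity 𝒰 r x)
    (hα : ∀ m : ℕ, 𝒰.Y m a v = if m = 0 then α else 0)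
    (hβ : ∀ m : ℕ, 𝒰.Y m x v = if m = 0 then β else 0) (m : ℕ) :
    𝒰.Y m (𝒰.Y (-1) a (𝒰.T x)) v =
      if m = 0 then sign (p * r + r) • 𝒰.Y (-1) (𝒰.T x) α - sign p • 𝒰.Y (-1) (𝒰.T a) β
      else if m = 1 then -(sign p • 𝒰.Y (-1) a β) else 0 := by
  by_cases hm : m = 0
  · subst hm
    rw [if_pos rfl, h.mode_mul_T_of_simple ha hx hα hβ]
  · have h1 : ∀ n : ℕ, 2 ≤ n → 𝒰.Y n (𝒰.T x) v = 0 := fun n hn => by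
      rw [h.mode_T_left, hβ, if_neg (by omega), smul_zero]
    rw [if_neg hm, h.wick ha (h.parity_T hx), wickSum_eq (N := 2) (fun n hn => h1 n hn),
      wickSum_eq (N := 1) (fun n hn => by rw [hα, if_neg (by omega)]), Finset.sum_range_succ,
      Finset.sum_range_one, Finset.sum_range_one, h1 (m + 1) (by omega), dpow_zero,
      dpow_zero, hα, if_neg (by omega), map_zero, map_zero, smul_zero, add_zero, add_zero,
      add_zero]
    split_ifs with hm1
    · subst hm1
      rw [h.mode_T_left, hβ]
      simp
    · rw [h1 _ (by omega), map_zero, smul_zero]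

/-- The predicates `P` and `Q` record which `b_i` and which `c^i` contract with `v`, so that both
kinds of ghosts are treated at once. -/
theorem IsPoisson.mode_stress (h : IsPoisson 𝒰) {ι : Type*} [Fintype ι] {b c : ι → U} {v : U}
    {P Q : ι → Prop} [DecidablePred P] [DecidablePred Q]
    (hb : ∀ i, HasParity 𝒰 0 (b i)) (hc : ∀ i, HasParity 𝒰 1 (c i))
    (hP : ∀ i (m : ℕ), 𝒰.Y m (b i) v = if m = 0 then if P i then 𝒰.vac else 0 else 0)
    (hQ : ∀ i (m : ℕ), 𝒰.Y m (c i) v = if m = 0 then if Q i then 𝒰.vac else 0 else 0) (m : ℕ) :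
    𝒰.Y m (-∑ i, 𝒰.Y (-1) (b i) (𝒰.T (c i))) v =
      if m = 0 then (∑ i, if P i then 𝒰.T (c i) else 0) + ∑ i, if Q i then 𝒰.T (b i) else 0
      else if m = 1 then ∑ i, if Q i then b i else 0 else 0 := by
  have hvac : ∀ x (R : Prop) [Decidable R],
      𝒰.Y (-1) x (if R then 𝒰.vac else 0) = if R then x else 0 := by
    intro x R _
    split_ifs
    · exact h.mul_vac _
    · exact map_zero _
  have key := fun i => h.mode_mul_T_of_simple' (hb i) (hc i) (hP i) (hQ i) m
  simp only [map_neg, map_sum, LinearMap.neg_apply, LinearMap.sum_apply, key, hvac]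
  rw [show sign (0 * 1 + 1) = -1 from sign_one, sign_zero]
  split_ifs
  · rw [← Finset.sum_add_distrib, ← Finset.sum_neg_distrib]
    exact Finset.sum_congr rfl fun i _ => by module
  · simp only [one_smul, Finset.sum_neg_distrib, neg_neg]
  · rw [Finset.sum_const_zero, neg_zero]

end Conformal

/-! ### The stress tensor of the ghosts -/

section BCStress

variable {ι : Type*}

theorem bcLetter_eq_dpow (φ : ι ⊕ ι) (n : ℕ) :
    bcLetter φ n = dpow (bcSystem ι).T n (bcLetter φ 0) := by
  induction n with
  | zero => rw [dpow_zero]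
  | succ n ih =>
    have hn : (n : ℂ) + 1 ≠ 0 := by exact_mod_cast n.succ_ne_zero
    rw [dpow_succ, ← ih]
    refine ((inv_smul_eq_iff₀ hn).2 ?_).symm
    rcases φ with a | a
    · exact fockT_bLetter a n
    · exact fockT_cLetter a n

@[elab_as_elim]
theorem bc_induction {P : Fock ι → Prop} (hone : P (bcSystem ι).vac)
    (hadd : ∀ x y, P x → P y → P (x + y)) (hsmul : ∀ (t : ℂ) x, P x → P (t • x))
    (hφ : ∀ φ n x, P x → P ((bcSystem ι).Y (-1) (bcLetter φ n) x)) (x : Fock ι) : P x := by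
  refine fock_induction hone hadd hsmul (fun a n x hx => ?_) (fun a n x hx => ?_) x
  · have := hφ (Sum.inl a) n x hx
    rwa [bc_mul] at this
  · have := hφ (Sum.inr a) n x hx
    rwa [bc_mul] at this

theorem bcLetter_mode_bcLetter [DecidableEq ι] (φ ψ : ι ⊕ ι) (m : ℕ) :
    (bcSystem ι).Y m (bcLetter φ 0) (bcLetter ψ 0) =
      if m = 0 then if ψ = φ.swap then (bcSystem ι).vac else 0 else 0 := by
  rw [bc_mode_bcLetter, if_pos m.zero_le, pow_zero, Nat.choose_zero_right, Nat.cast_one, mul_one,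
    one_smul, Nat.sub_zero, bcAnn_bcLetter]
  by_cases hm : m = 0
  · rw [if_pos hm]
    by_cases hφ : ψ = φ.swap
    · rw [if_pos hφ, if_pos ⟨hφ, hm.symm⟩]; rfl
    · rw [if_neg hφ, if_neg fun h => hφ h.1]
  · rw [if_neg hm, if_neg fun h => hm h.2.symm]

variable [Fintype ι]

/-- The conformal vector `-∑ :b_a ∂c^a:` of the `bc` system. -/
def bcStress (ι : Type*) [Fintype ι] : Fock ι :=
  -∑ a : ι, (bcSystem ι).Y (-1) (bcLetter (Sum.inl a) 0)
    ((bcSystem ι).T (bcLetter (Sum.inr a) 0))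

/-- The weight of a generating field of the `bc` system. -/
def bcWeight : ι ⊕ ι → ℂ := Sum.elim (fun _ => 1) (fun _ => 0)

theorem bcStress_parity : HasParity (bcSystem ι) 1 (bcStress ι) :=
  HasParity.neg (HasParity.sum fun a _ => by
    rw [← zero_add (1 : ZMod 2)]
    exact bc_isPoisson.parity_mul (bcLetter_parity (Sum.inl a) 0)
      (bc_isPoisson.parity_T (bcLetter_parity (Sum.inr a) 0)))

/-- The vector `-b ∂c` is even in neither weight by accident: the derivative sits on `c`, so only a
contraction through `c`, which detects `b`, has a first mode. This gives weights `1` for `b` and `0`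
for `c`. -/
theorem bcLetter_isPrimary (φ : ι ⊕ ι) :
    IsPrimary (bcSystem ι) (bcStress ι) (bcWeight φ) (bcLetter φ 0) := by
  classical
  have key := bc_isPoisson.mode_stress (v := bcLetter φ 0)
    (fun a => bcLetter_parity (Sum.inl a) 0) (fun a => bcLetter_parity (Sum.inr a) 0)
    (fun a => bcLetter_mode_bcLetter (Sum.inl a) φ) (fun a => bcLetter_mode_bcLetter (Sum.inr a) φ)
  refine ⟨(key 0).trans ?_, (key 1).trans ?_, fun m hm => (key m).trans ?_⟩
  · rcases φ with d | d <;> simp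
  · rcases φ with d | d <;> simp [bcWeight]
  · rw [if_neg (by omega), if_neg (by omega)]

theorem bcStress_wittRelation (m n : ℕ) (x : Fock ι) :
    WittRelation (bcSystem ι) (bcStress ι) m n x := by
  refine bc_induction ?_ ?_ ?_ ?_ x
  · simp only [WittRelation, bc_isPoisson.mode_vac, map_zero, sub_self]
    by_cases hmn : m + n = 0
    · obtain ⟨rfl, rfl⟩ : m = 0 ∧ n = 0 := by omega
      simp
    · rw [show (m : ℤ) + n - 1 = (m + n - 1 : ℕ) by omega, bc_isPoisson.mode_vac, smul_zero]
  · intro x y hx hy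
    simp only [WittRelation, map_add, smul_add] at *
    rw [← hx, ← hy]
    exact add_sub_add_comm _ _ _ _
  · intro t x hx
    simp only [WittRelation, map_smul] at *
    rw [smul_comm _ t, ← hx]
    exact (smul_sub t _ _).symm
  · intro φ k x hx
    refine bc_isPoisson.wittRelation_mul bcStress_parity ?_ hx
    rw [bcLetter_eq_dpow]
    exact bc_isPoisson.wittRelation_dpow (bcLetter_isPrimary φ) m n k

theorem bcStress_zero (x : Fock ι) : (bcSystem ι).Y (0 : ℕ) (bcStress ι) x = (bcSystem ι).T x := by
  refine bc_induction ?_ ?_ ?_ ?_ x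
  · rw [bc_isPoisson.mode_vac, bc_isPoisson.T_vac]
  · intro x y hx hy; rw [map_add, map_add, hx, hy]
  · intro t x hx; rw [map_smul, map_smul, hx]
  · intro φ k x hx
    rw [bc_isPoisson.mode_mul_of_odd bcStress_parity, hx, bc_isPoisson.T_mul]
    congr 2
    rw [bcLetter_eq_dpow, bc_isPoisson.mode_zero_dpow (bcLetter_isPrimary φ).zero]

theorem bcStress_one_bcLetter (φ : ι ⊕ ι) (n : ℕ) :
    (bcSystem ι).Y (1 : ℕ) (bcStress ι) (bcLetter φ n) = (bcWeight φ + n) • bcLetter φ n := by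
  have := bc_isPoisson.mode_dpow_primary (bcLetter_isPrimary φ) 1 n
  rw [← bcLetter_eq_dpow, show (n : ℤ) + 1 - (1 : ℕ) = n by simp, dpowZ_nat,
    ← bcLetter_eq_dpow] at this
  rw [this, show (n : ℂ) + 1 - (1 : ℕ) + (1 : ℕ) * bcWeight φ = bcWeight φ + n by
    push_cast; ring]

theorem bcStress_one_bcLetter_mul (φ : ι ⊕ ι) (n : ℕ) (s : ℂ) (x : Fock ι)
    (h : (bcSystem ι).Y (1 : ℕ) (bcStress ι) x = s • x) :
    (bcSystem ι).Y (1 : ℕ) (bcStress ι) (bcLetter φ n * x) =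
      (bcWeight φ + n + s) • (bcLetter φ n * x) := by
  rw [← bc_mul, bc_isPoisson.mode_mul_of_odd bcStress_parity, bcStress_one_bcLetter, h, map_smul,
    map_smul, LinearMap.smul_apply]
  exact (add_smul _ _ _).symm

theorem bcStress_one : ∀ s : ℚ, ∀ x ∈ bcSpin ι s,
    (bcSystem ι).Y (1 : ℕ) (bcStress ι) x = (s : ℂ) • x := by
  rw [bcSpin_eq]
  refine fockWeight_induction (P := fun (s : ℚ) x => (bcSystem ι).Y (1 : ℕ) (bcStress ι) x =
    (s : ℂ) • x) ?_ ?_ ?_ ?_ ?_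
  · intro g; rw [map_zero, smul_zero]
  · intro t
    have h1 : (bcSystem ι).Y (1 : ℕ) (bcStress ι) 1 = 0 := bc_isPoisson.mode_vac 1 _
    rw [map_smul, h1, smul_zero, Rat.cast_zero, zero_smul]
  · intro g x y hx hy; rw [map_add, hx, hy]; exact (smul_add _ _ _).symm
  · intro a n g x _ h
    have hw : (((1 : ℚ) + n • (1 : ℚ) + g : ℚ) : ℂ) = bcWeight (Sum.inl (β := ι) a) + n + g := by
      simp [bcWeight]
    rw [hw]
    exact bcStress_one_bcLetter_mul (Sum.inl a) n g x h
  · intro a n g x _ h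
    have hw : (((0 : ℚ) + n • (1 : ℚ) + g : ℚ) : ℂ) = bcWeight (Sum.inr (α := ι) a) + n + g := by
      simp [bcWeight]
    rw [hw]
    exact bcStress_one_bcLetter_mul (Sum.inr a) n g x h

theorem bcStress_mem_gr : bcStress ι ∈ (bcSystem ι).gr (1, 0) :=
  neg_mem (sum_mem fun a _ => bc_isRaviolo.Y_mem_neg (-1) (by norm_num) (0, 0) (1, 0) _
    (bLetter_mem_gr a) _ (bc_isRaviolo.T_mem (1, 0) _ (cLetter_mem_gr a)))

theorem bcStress_mem_bcSpin : bcStress ι ∈ bcSpin ι 2 := by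
  refine neg_mem (sum_mem fun a _ => ?_)
  have := bc_isSpinGrading.Y_mem (-1) 1 (0 + 1) _ (bLetter_mem_bcSpin a) _
    (bc_isSpinGrading.T_mem 0 _ (cLetter_mem_bcSpin a))
  norm_num at this
  exact this

/-- Since there are no double contractions, a mode of the stress tensor acts on `b ∂c` one factor at
a time, and no central term can appear. -/
theorem bcStress_isPrimary : IsPrimary (bcSystem ι) (bcStress ι) 2 (bcStress ι) := by
  refine ⟨bcStress_zero _, ?_, fun m hm => ?_⟩
  · simpa using bcStress_one 2 _ bcStress_mem_bcSpin
  · conv_lhs => arg 2; rw [bcStress]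
    rw [map_neg, map_sum, Finset.sum_eq_zero, neg_zero]
    intro a _
    have hT := bc_isPoisson.mode_dpow_primary (bcLetter_isPrimary (Sum.inr a)) m 1
    rw [bc_isPoisson.mode_mul_of_odd bcStress_parity, (bcLetter_isPrimary _).two m hm, map_zero,
      ← dpow_one (bcSystem ι).T, hT]
    -- The derivative of a primary of weight `s` is in general not primary: its second mode is
    -- proportional to `s`. It vanishes here because `c` has weight `0`.
    rcases eq_or_ne m 2 with rfl | h2
    · simp [bcWeight]; norm_num
    · rw [dpowZ_neg _ (by omega), smul_zero, map_zero]; exact add_zero 0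

end BCStress

/-! ### Central charges as multiplication operators -/

section CentralCharge

variable {U : Type*} [AddCommGroup U] [Module ℂ U] {𝒰 : RavioloData U}
  {spin : ℚ → Submodule ℂ U}

theorem dpow_mul_of_T_eq_zero (h : IsPoisson 𝒰) {z : U} (hzT : 𝒰.T z = 0) (n : ℕ) (a : U) :
    dpow 𝒰.T n (𝒰.Y (-1) z a) = 𝒰.Y (-1) z (dpow 𝒰.T n a) :=
  (dpow_map (𝒰.Y (-1) z) (fun x => by
    rw [h.T_mul, hzT, map_zero, LinearMap.zero_apply, zero_add]) n a).symm

/-- Multiplication by a translation invariant odd vector with regular field is a central charge. -/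
theorem isOver_mul (hR : IsRaviolo 𝒰) (hS : IsSpinGrading 𝒰 spin) {z : U} (hz : z ∈ 𝒰.gr (1, 0))
    (hz' : z ∈ spin 0) (hzT : 𝒰.T z = 0) (hzm : ∀ (m : ℕ) v, 𝒰.Y m z v = 0) :
    IsOver 𝒰 spin (𝒰.Y (-1) z) := by
  have h := hR.isPoisson
  have hz1 : HasParity 𝒰 1 z := hR.hasParity hz
  refine ⟨fun d a ha => ?_, fun s a ha => ?_, fun a => ?_, fun a => ?_, fun m d a ha b => ?_,
    fun m a b => ?_⟩
  · rw [add_comm]; exact hR.Y_mem_neg (-1) (by norm_num) _ _ _ hz _ ha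
  · have := hS.Y_mem (-1) 0 s z hz' a ha
    rwa [show s + (0 - ((-1 : ℤ) : ℚ) - 1) = s by push_cast; ring] at this
  · have := h.left_comm hz1 hz1 a
    rw [mul_one, sign_one, neg_one_smul, eq_neg_iff_add_eq_zero, ← two_smul ℂ] at this
    exact (smul_eq_zero.1 this).resolve_left two_ne_zero
  · rw [h.T_mul, hzT, map_zero, LinearMap.zero_apply, zero_add]
  · have ha' : HasParity 𝒰 (par d) a := hR.hasParity ha
    rcases lt_or_ge m 0 with hm | hm
    · obtain ⟨n, rfl⟩ : ∃ n : ℕ, m = -(n : ℤ) - 1 := ⟨(-m - 1).toNat, by omega⟩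
      rw [h.neg, modePar_neg _ hm, h.left_comm (h.parity_dpow ha' n) hz1, mul_one]
    · obtain ⟨n, rfl⟩ := Int.eq_ofNat_of_zero_le hm
      -- The field of `z` is regular, so by skew-symmetry all non-negative modes kill `z`, and the
      -- derivation property leaves only the sign of passing it.
      have hskew : 𝒰.Y n a z = 0 := by
        rw [h.skew _ _ _ _ hz1 ha' n]
        simp only [hzm, skewTransform_zero, smul_zero]
      rw [h.derivation _ _ ha' 1 z hz1, hskew, map_zero, LinearMap.zero_apply, zero_add, mul_one,
        modePar_nat]
  · rcases lt_or_ge m 0 with hm | hm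
    · obtain ⟨n, rfl⟩ : ∃ n : ℕ, m = -(n : ℤ) - 1 := ⟨(-m - 1).toNat, by omega⟩
      rw [h.neg, modePar_neg _ hm, dpow_mul_of_T_eq_zero h hzT, h.assoc, sign_zero, one_smul,
        h.neg n a]
    · obtain ⟨n, rfl⟩ := Int.eq_ofNat_of_zero_le hm
      refine h.parity_induction (P := fun a => 𝒰.Y n (𝒰.Y (-1) z a) b =
        sign (modePar 0 n) • 𝒰.Y (-1) z (𝒰.Y n a b)) (fun a a' ha ha' => ?_) (fun p a ha => ?_) a
      · simp only [map_add, LinearMap.add_apply, ha, ha', smul_add]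
      · rw [h.wick hz1 ha, modePar_nat, zero_add, wickSum, wickSum, finsum_eq_single _ 0]
        · rw [dpow_zero, add_zero, finsum_eq_zero_of_forall_eq_zero, smul_zero, add_zero]
          intro i; rw [hzm, map_zero]
        · intro i hi
          rw [dpow_of_T_eq_zero hzT, if_neg hi, map_zero, LinearMap.zero_apply]

theorem mode_neg_mode_neg (h : IsPoisson 𝒰) {g : U} (hg : HasParity 𝒰 1 g) (m n : ℕ) (a : U) :
    𝒰.Y (-m - 1) g (𝒰.Y (-n - 1) g a) + 𝒰.Y (-n - 1) g (𝒰.Y (-m - 1) g a) = 0 := by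
  rw [h.neg, h.neg, h.left_comm (h.parity_dpow hg m) (h.parity_dpow hg n), mul_one,
    sign_one, neg_one_smul, neg_add_cancel]

/-- A negative mode is multiplication by a divided derivative of `g` and a non-negative one is a
derivation, so their commutator is multiplication by the image of that derivative. The operator
relation thus follows from a relation between vectors. -/
theorem mode_mode_neg (h : IsPoisson 𝒰) {g z : U} (hg : HasParity 𝒰 1 g)
    (hmode : ∀ m n : ℕ, 𝒰.Y m g (dpow 𝒰.T n g) =
      ((m : ℂ) + n + 1) • dpowZ 𝒰.T ((n : ℤ) + 1 - m) g +
        if m = n + 3 then ((m : ℂ) * (m - 1) * (m - 2) / 12) • z else 0) (m n : ℕ) (a : U) :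
    𝒰.Y m g (𝒰.Y (-n - 1) g a) - 𝒰.Y (-n - 1) g (𝒰.Y m g a) =
      if m ≤ n + 1 then ((m : ℂ) + n + 1) • 𝒰.Y (-((n : ℤ) + 1 - m) - 1) g a
      else if m = n + 3 then ((m : ℂ) * (m - 1) * (m - 2) / 12) • 𝒰.Y (-1) z a
      else 0 := by
  rw [h.neg, h.mode_mul_of_odd hg, add_sub_cancel_right, hmode, map_add,
    LinearMap.add_apply, map_smul, LinearMap.smul_apply]
  by_cases hm : m ≤ n + 1
  · obtain ⟨k, hk⟩ : ∃ k, n + 1 = m + k := ⟨n + 1 - m, by omega⟩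
    rw [if_pos hm, if_neg (by omega), map_zero, LinearMap.zero_apply, add_zero,
      show (n : ℤ) + 1 - m = k by omega, h.neg, dpowZ_nat]
  · rw [if_neg hm, dpowZ_neg _ (by omega), map_zero, LinearMap.zero_apply, smul_zero, zero_add]
    split_ifs
    · rw [map_smul, LinearMap.smul_apply]
    · rw [map_zero, LinearMap.zero_apply]

/-- The modes with `m ≥ 2` are derivations killing each generator that occurs. They also kill `∂c`,
because `c` has weight `0`. -/
theorem mode_gaugePotential_eq_zero (h : IsPoisson 𝒰) {g : U} (hg : HasParity 𝒰 1 g)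
    {ι : Type*} [Fintype ι] (f : ι → ι → ι → ℂ) (k : ι → ι → ℂ) {b c μ : ι → U} {w : U}
    (hb : ∀ i, IsPrimary 𝒰 g 1 (b i)) (hc : ∀ i, IsPrimary 𝒰 g 0 (c i)) {m : ℕ} (hm : 2 ≤ m)
    (hμ : ∀ i, 𝒰.Y m g (μ i) = 0) (hw : 𝒰.Y m g w = 0) :
    𝒰.Y m g (gaugePotential 𝒰 f k b c μ w) = 0 := by
  have hmul : ∀ x y, 𝒰.Y m g x = 0 → 𝒰.Y m g y = 0 → 𝒰.Y m g (𝒰.Y (-1) x y) = 0 :=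
    fun x y hx hy => by
    rw [h.mode_mul_of_odd hg, hx, hy, map_zero, map_zero, LinearMap.zero_apply, add_zero]
  have hTc : ∀ i, 𝒰.Y m g (𝒰.T (c i)) = 0 := fun i => by
    have := h.mode_dpow_primary (hc i) m 1
    rw [dpow_one] at this
    rw [this]
    rcases eq_or_ne m 2 with rfl | h2
    · rw [show ((1 : ℕ) : ℂ) + 1 - (2 : ℕ) + (2 : ℕ) * 0 = 0 by norm_num, zero_smul]
    · rw [dpowZ_neg _ (by omega), smul_zero]
  have e1 : ∀ i j l, 𝒰.Y m g (𝒰.Y (-1) (b i) (𝒰.Y (-1) (c j) (c l))) = 0 := fun i j l =>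
    hmul _ _ ((hb i).two m hm) (hmul _ _ ((hc j).two m hm) ((hc l).two m hm))
  have e2 : ∀ i j, 𝒰.Y m g (𝒰.Y (-1) (c i) (𝒰.T (c j))) = 0 := fun i j =>
    hmul _ _ ((hc i).two m hm) (hTc j)
  have e3 : ∀ i, 𝒰.Y m g (𝒰.Y (-1) (c i) (μ i)) = 0 := fun i =>
    hmul _ _ ((hc i).two m hm) (hμ i)
  simp only [gaugePotential, map_add, map_smul, map_sum, e1, e2, e3, hw, smul_zero,
    Finset.sum_const_zero, add_zero]

end CentralCharge

/-! ### The conformal structure of the gauged vertex algebra -/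

section GaugedStress

variable {ι V : Type*} [Fintype ι] [AddCommGroup V] [Module ℂ V] {𝒱 : RavioloData V} {γ : V}
  {spin : ℚ → Submodule ℂ V} {ξ : V →ₗ[ℂ] V}

theorem gauged_T_tmul (v : V) (y : Fock ι) :
    (gauged ι 𝒱).T (v ⊗ₜ y) = 𝒱.T v ⊗ₜ y + v ⊗ₜ (bcSystem ι).T y :=
  tensor_T_tmul v y

theorem vac_tmul_mul (hV : IsPoisson 𝒱) {p q : ZMod 2} {x : Fock ι} (hx : HasParity (bcSystem ι) p x)
    {v : V} (hv : HasParity 𝒱 q v) (y : Fock ι) :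
    (gauged ι 𝒱).Y (-1) (𝒱.vac ⊗ₜ x) (v ⊗ₜ y) =
      sign (p * q) • (v ⊗ₜ[ℂ] (bcSystem ι).Y (-1) x y) := by
  refine (tensor_mul hx hv 𝒱.vac y).trans ?_
  rw [hV.vac_mul]

theorem matter_mul (hV : IsPoisson 𝒱) (a v : V) (y : Fock ι) :
    (gauged ι 𝒱).Y (-1) (matter ι a) (v ⊗ₜ y) = 𝒱.Y (-1) a v ⊗ₜ[ℂ] y := by
  refine hV.parity_induction (P := fun v => (gauged ι 𝒱).Y (-1) (matter ι a) (v ⊗ₜ y) =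
    𝒱.Y (-1) a v ⊗ₜ[ℂ] y) (fun v v' h h' => ?_) (fun q v hv => ?_) v
  · rw [TensorProduct.add_tmul, map_add, h, h', map_add, TensorProduct.add_tmul]
  · refine (tensor_mul (𝒲 := bcSystem ι) bc_isPoisson.parity_vac hv a y).trans ?_
    rw [zero_mul, sign_zero, one_smul, bc_isPoisson.vac_mul]

theorem totalStress_eq (hV : IsPoisson 𝒱) (γ : V) :
    totalStress ι 𝒱 γ = matter ι γ + 𝒱.vac ⊗ₜ bcStress ι := by
  have h : ∀ a : ι, nop (gauged ι 𝒱) (bState 𝒱 a) ((gauged ι 𝒱).T (cState 𝒱 a)) =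
      𝒱.vac ⊗ₜ (bcSystem ι).Y (-1) (bcLetter (Sum.inl a) 0)
        ((bcSystem ι).T (bcLetter (Sum.inr a) 0)) := by
    intro a
    rw [nop, cState, gauged_T_tmul, hV.T_vac, TensorProduct.zero_tmul, zero_add]
    refine (vac_tmul_mul hV (bcLetter_parity (Sum.inl a) 0) hV.parity_vac _).trans ?_
    rw [mul_zero, sign_zero, one_smul]
    rfl
  rw [totalStress, bcStress, Finset.sum_congr rfl fun a _ => h a, ← TensorProduct.tmul_sum,
    sub_eq_add_neg, ← TensorProduct.tmul_neg]

/-- No signs appear, because the non-negative modes of the odd ghost stress tensor are even. -/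
theorem totalStress_mode (hV : IsPoisson 𝒱) (γ v : V) (y : Fock ι) (m : ℕ) :
    (gauged ι 𝒱).Y m (totalStress ι 𝒱 γ) (v ⊗ₜ y) =
      𝒱.Y m γ v ⊗ₜ y + v ⊗ₜ (bcSystem ι).Y m (bcStress ι) y := by
  rw [totalStress_eq hV, map_add, LinearMap.add_apply, matter_mode hV]
  congr 1
  refine hV.parity_induction (P := fun v => (gauged ι 𝒱).Y m (𝒱.vac ⊗ₜ bcStress ι) (v ⊗ₜ y) =
    v ⊗ₜ (bcSystem ι).Y m (bcStress ι) y) (fun v v' h h' => ?_) (fun q v hv => ?_) v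
  · rw [TensorProduct.add_tmul, map_add, h, h', TensorProduct.add_tmul]
  · refine (tensor_inr_mode hV bc_isPoisson bcStress_parity hv y m).trans ?_
    rw [show (1 + 1 : ZMod 2) = 0 from rfl, zero_mul, sign_zero, one_smul]

theorem totalStress_mem_gr (hV : IsRaviolo 𝒱) (hγ : γ ∈ 𝒱.gr (1, 0)) :
    totalStress ι 𝒱 γ ∈ (gauged ι 𝒱).gr (1, 0) := by
  rw [totalStress_eq hV.isPoisson]
  exact add_mem (tmul_mem_tensorGrading hγ bc_isRaviolo.vac_mem (add_zero _))
    (tmul_mem_tensorGrading hV.vac_mem bcStress_mem_gr (zero_add ((1, 0) : Deg)))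

theorem totalStress_mem_spin (hV : IsPoisson 𝒱) (hs : IsSpinGrading 𝒱 spin) (hγ : γ ∈ spin 2) :
    totalStress ι 𝒱 γ ∈ tensorSpin spin (bcSpin ι) 2 := by
  rw [totalStress_eq hV]
  exact add_mem (tmul_mem_tensorGrading hγ bc_isSpinGrading.vac_mem (add_zero 2))
    (tmul_mem_tensorGrading hs.vac_mem bcStress_mem_bcSpin (zero_add 2))

/-- The coefficient of the vacuum. -/
def augmentation (ι : Type*) : Fock ι →ₗ[ℂ] ℂ :=
  (TensorProduct.lid ℂ ℂ).toLinearMap ∘ₗ TensorProduct.map (MvPolynomial.aeval (R := ℂ)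
    (fun _ : ι × ℕ => (0 : ℂ))).toLinearMap (ExteriorAlgebra.algebraMapInv (R := ℂ)).toLinearMap

theorem augmentation_one : augmentation ι 1 = 1 := by
  rw [Algebra.TensorProduct.one_def, augmentation]
  simp

theorem augmentation_bcStress : augmentation ι (bcStress ι) = 0 := by
  rw [bcStress, map_neg, map_sum, Finset.sum_eq_zero, neg_zero]
  intro a _
  rw [bc_mul]
  have h1 : (bcSystem ι).T (bcLetter (Sum.inr a) 0) = cLetter a 1 := by
    refine (fockT_cLetter a 0).trans ?_
    rw [Nat.cast_zero, zero_add, one_smul]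
  have h2 : bcLetter (Sum.inl a) 0 * cLetter a 1 =
      MvPolynomial.X (a, 0) ⊗ₜ[ℂ] (oddLetter (a, 1) : ExtAlg ι) := by
    change bLetter a 0 * cLetter a 1 = _
    rw [bLetter, cLetter, Algebra.TensorProduct.tmul_mul_tmul, one_mul, mul_one]
  rw [h1, h2, augmentation]
  simp

/-- Taking the vacuum coefficient in the Fock space kills the ghost part and recovers the conformal
vector of `𝒱`. -/
theorem totalStress_ne_zero (hV : IsPoisson 𝒱) (hγ : γ ≠ 0) : totalStress ι 𝒱 γ ≠ 0 := by
  intro h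
  refine hγ ?_
  have := congrArg ((TensorProduct.rid ℂ V).toLinearMap ∘ₗ (augmentation ι).lTensor V) h
  rw [totalStress_eq hV, map_add, map_zero, matter] at this
  simpa [augmentation_one, augmentation_bcStress] using this

theorem totalStress_wittRelation (hV : IsPoisson 𝒱) (hγ : ∀ (m n : ℕ) a, WittRelation 𝒱 γ m n a)
    (m n : ℕ) (a : V ⊗[ℂ] Fock ι) : WittRelation (gauged ι 𝒱) (totalStress ι 𝒱 γ) m n a := by
  by_cases hmn : m + n = 0
  · obtain ⟨rfl, rfl⟩ : m = 0 ∧ n = 0 := by omega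
    exact wittRelation_zero_zero
  induction a with
  | zero => simp [WittRelation]
  | add a b ha hb =>
    simp only [WittRelation, map_add, smul_add] at *
    rw [← ha, ← hb]
    abel
  | tmul v y =>
    have h1 := (wittRelation_iff hmn).1 (hγ m n v)
    have h2 := (wittRelation_iff hmn).1 (bcStress_wittRelation m n y)
    rw [wittRelation_iff hmn]
    simp only [totalStress_mode hV, map_add, smul_add]
    rw [TensorProduct.smul_tmul', ← h1, ← TensorProduct.tmul_smul, ← h2, TensorProduct.sub_tmul,
      TensorProduct.tmul_sub]
    abel

/-- By linearity of the state-field correspondence over `ℂ[ξ]`, the central charge of `𝒱` is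
multiplication by `ξ|0⟩`. -/
theorem centralCharge_eq_mul (h : IsConformal 𝒱 spin ξ γ) :
    TensorProduct.map ξ (LinearMap.id : Fock ι →ₗ[ℂ] Fock ι) =
      (gauged ι 𝒱).Y (-1) (matter ι (ξ 𝒱.vac)) := by
  refine TensorProduct.ext' fun v y => ?_
  rw [matter_mul h.raviolo.isPoisson, h.isOver.state, modePar_neg _ (by norm_num), sign_zero,
    one_smul, h.raviolo.isPoisson.vac_mul, TensorProduct.map_tmul, LinearMap.id_apply]

theorem gauged_isOver (h : IsConformal 𝒱 spin ξ γ) :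
    IsOver (gauged ι 𝒱) (tensorSpin spin (bcSpin ι)) (TensorProduct.map ξ LinearMap.id) := by
  have hP := h.raviolo.isPoisson
  rw [centralCharge_eq_mul h]
  have hξ : ξ 𝒱.vac ∈ 𝒱.gr (1, 0) := by
    simpa using h.isOver.degree _ _ h.raviolo.vac_mem
  refine isOver_mul (tensor_isRaviolo h.raviolo bc_isRaviolo)
    (tensor_isSpinGrading h.raviolo bc_isRaviolo h.spinGrading bc_isSpinGrading)
    (tmul_mem_tensorGrading hξ bc_isRaviolo.vac_mem (add_zero _))
    (tmul_mem_tensorGrading (h.isOver.spin _ _ h.spinGrading.vac_mem) bc_isSpinGrading.vac_mem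
      (add_zero 0)) ?_ ?_
  · refine (gauged_T_tmul _ _).trans ?_
    rw [h.isOver.T, hP.T_vac, map_zero, TensorProduct.zero_tmul, zero_add]
    exact (congrArg _ bc_isPoisson.T_vac).trans (TensorProduct.tmul_zero _ _)
  · intro m a
    induction a with
    | zero => rw [map_zero]
    | add a b ha hb => rw [map_add, ha, hb, add_zero]
    | tmul v y =>
      refine (matter_mode hP _ v y m).trans ?_
      rw [h.isOver.state, hP.vac_mode, map_zero, smul_zero, TensorProduct.zero_tmul]

/-- The mixed Virasoro relation evaluated on the vacuum, where the non-negative mode vanishes and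
the negative mode creates the derivative of `γ`. -/
theorem IsConformal.mode_dpow (h : IsConformal 𝒱 spin ξ γ) (m n : ℕ) :
    𝒱.Y m γ (dpow 𝒱.T n γ) =
      ((m : ℂ) + n + 1) • dpowZ 𝒱.T ((n : ℤ) + 1 - m) γ +
        if m = n + 3 then ((m : ℂ) * (m - 1) * (m - 2) / 12) • ξ 𝒱.vac else 0 := by
  have hP := h.raviolo.isPoisson
  have := h.comm_GΓ m n 𝒱.vac
  rw [hP.neg, hP.mul_vac, hP.mode_vac, map_zero, sub_zero] at this
  rw [this]
  by_cases hm : m ≤ n + 1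
  · obtain ⟨k, hk⟩ : ∃ k, n + 1 = m + k := ⟨n + 1 - m, by omega⟩
    rw [if_pos hm, if_neg (by omega), add_zero, show (n : ℤ) + 1 - m = k by omega, hP.neg,
      hP.mul_vac, dpowZ_nat]
  · rw [if_neg hm, dpowZ_neg _ (by omega), smul_zero, zero_add]

/-- The two stress tensors do not interact, and the ghost one is primary of weight `2`. The central
term is therefore that of `𝒱` alone. -/
theorem totalStress_mode_dpow (h : IsConformal 𝒱 spin ξ γ) (m n : ℕ) :
    (gauged ι 𝒱).Y m (totalStress ι 𝒱 γ) (dpow (gauged ι 𝒱).T n (totalStress ι 𝒱 γ)) =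
      ((m : ℂ) + n + 1) • dpowZ (gauged ι 𝒱).T ((n : ℤ) + 1 - m) (totalStress ι 𝒱 γ) +
        if m = n + 3 then ((m : ℂ) * (m - 1) * (m - 2) / 12) • matter ι (ξ 𝒱.vac) else 0 := by
  have hP := h.raviolo.isPoisson
  have hd : ∀ k : ℕ, dpow (gauged ι 𝒱).T k (totalStress ι 𝒱 γ) =
      matter ι (dpow 𝒱.T k γ) + 𝒱.vac ⊗ₜ dpow (bcSystem ι).T k (bcStress ι) := fun k => by
    rw [totalStress_eq hP, map_add]
    exact congrArg₂ (· + ·) (tensor_dpow_inl bc_isPoisson k γ) (tensor_dpow_inr hP k _)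
  have hdZ : ∀ j : ℤ, dpowZ (gauged ι 𝒱).T j (totalStress ι 𝒱 γ) =
      matter ι (dpowZ 𝒱.T j γ) + 𝒱.vac ⊗ₜ dpowZ (bcSystem ι).T j (bcStress ι) := fun j => by
    rcases lt_or_ge j 0 with hj | hj
    · rw [dpowZ_neg _ hj, dpowZ_neg _ hj, dpowZ_neg _ hj, matter_zero, TensorProduct.tmul_zero,
        add_zero]
    · obtain ⟨k, rfl⟩ := Int.eq_ofNat_of_zero_le hj
      rw [dpowZ_nat, dpowZ_nat, dpowZ_nat, hd]
  have hb := bc_isPoisson.mode_dpow_primary (bcStress_isPrimary (ι := ι)) m n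
  rw [show (n : ℂ) + 1 - m + m * 2 = m + n + 1 by ring] at hb
  rw [hd, hdZ, map_add, matter, totalStress_mode hP, totalStress_mode hP, h.mode_dpow, hb,
    hP.mode_vac, TensorProduct.zero_tmul, zero_add]
  have h1 : (bcSystem ι).Y m (bcStress ι) 1 = 0 := bc_isPoisson.mode_vac m _
  rw [h1, TensorProduct.tmul_zero, add_zero, TensorProduct.add_tmul, smul_add,
    TensorProduct.tmul_smul, ← TensorProduct.smul_tmul', add_right_comm]
  congr 1
  split_ifs
  · rw [← TensorProduct.smul_tmul']; rfl
  · rw [TensorProduct.zero_tmul]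

theorem totalStress_parity (h : IsConformal 𝒱 spin ξ γ) :
    HasParity (gauged ι 𝒱) 1 (totalStress ι 𝒱 γ) :=
  IsRaviolo.hasParity (d := (1, 0)) (tensor_isRaviolo h.raviolo bc_isRaviolo)
    (totalStress_mem_gr h.raviolo h.mem_gr)

theorem totalStress_zero (h : IsConformal 𝒱 spin ξ γ) (a : V ⊗[ℂ] Fock ι) :
    (gauged ι 𝒱).Y (0 : ℕ) (totalStress ι 𝒱 γ) a = (gauged ι 𝒱).T a := by
  induction a with
  | zero => rw [map_zero, map_zero]
  | add a b ha hb => rw [map_add, map_add, ha, hb]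
  | tmul v y =>
    refine (totalStress_mode h.raviolo.isPoisson γ v y 0).trans ?_
    rw [bcStress_zero, Nat.cast_zero, h.G_zero, gauged_T_tmul]

theorem totalStress_one (h : IsConformal 𝒱 spin ξ γ) (s : ℚ) :
    ∀ a ∈ tensorGrading spin (bcSpin ι) s,
      (gauged ι 𝒱).Y (1 : ℕ) (totalStress ι 𝒱 γ) a = (s : ℂ) • a := by
  refine tensorGrading_induction ?_ ?_ ?_
  · rw [map_zero, smul_zero]
  · intro a b ha hb
    rw [map_add, ha, hb, smul_add]
  · intro e f v y hef hv hy
    refine (totalStress_mode h.raviolo.isPoisson γ v y 1).trans ?_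
    rw [bcStress_one f y hy, Nat.cast_one, h.G_one e v hv, ← TensorProduct.smul_tmul',
      TensorProduct.tmul_smul, ← add_smul, ← hef, Rat.cast_add]

theorem gauged_isConformal (h : IsConformal 𝒱 spin ξ γ) :
    IsConformal (gauged ι 𝒱) (tensorSpin spin (bcSpin ι)) (TensorProduct.map ξ LinearMap.id)
      (totalStress ι 𝒱 γ) where
  raviolo := tensor_isRaviolo h.raviolo bc_isRaviolo
  spinGrading := tensor_isSpinGrading h.raviolo bc_isRaviolo h.spinGrading bc_isSpinGrading
  isOver := gauged_isOver h
  ne_zero := totalStress_ne_zero h.raviolo.isPoisson h.ne_zero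
  mem_gr := totalStress_mem_gr h.raviolo h.mem_gr
  mem_spin := totalStress_mem_spin h.raviolo.isPoisson h.spinGrading h.mem_spin
  comm_GG := totalStress_wittRelation h.raviolo.isPoisson h.comm_GG
  comm_ΓΓ := mode_neg_mode_neg (gauged_isPoisson ι h.raviolo.isPoisson) (totalStress_parity h)
  comm_GΓ := by
    rw [centralCharge_eq_mul h]
    exact mode_mode_neg (gauged_isPoisson ι h.raviolo.isPoisson) (totalStress_parity h)
      (totalStress_mode_dpow h)
  G_zero := totalStress_zero h
  G_one := totalStress_one h

theorem ghost_isPrimary (h : IsConformal 𝒱 spin ξ γ) (φ : ι ⊕ ι) :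
    IsPrimary (gauged ι 𝒱) (totalStress ι 𝒱 γ) (bcWeight φ) (ghost 𝒱 φ) := by
  have hP := h.raviolo.isPoisson
  have hm : ∀ m : ℕ, (gauged ι 𝒱).Y m (totalStress ι 𝒱 γ) (ghost 𝒱 φ) =
      𝒱.vac ⊗ₜ (bcSystem ι).Y m (bcStress ι) (bcLetter φ 0) := fun m => by
    rw [ghost, totalStress_mode hP, hP.mode_vac, TensorProduct.zero_tmul, zero_add]
  refine ⟨totalStress_zero h _, ?_, fun m h2 => ?_⟩
  · rw [hm, (bcLetter_isPrimary φ).one, TensorProduct.tmul_smul]; rfl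
  · rw [hm, (bcLetter_isPrimary φ).two m h2, TensorProduct.tmul_zero]

theorem totalStress_mode_matter (hP : IsPoisson 𝒱) {v : V} {m : ℕ} (hv : 𝒱.Y m γ v = 0) :
    (gauged ι 𝒱).Y m (totalStress ι 𝒱 γ) (matter ι v) = 0 := by
  have h1 : (bcSystem ι).Y m (bcStress ι) 1 = 0 := bc_isPoisson.mode_vac m _
  rw [matter, totalStress_mode hP, hv, h1, TensorProduct.zero_tmul, TensorProduct.tmul_zero,
    add_zero]

variable {𝔤 : Type*} [LieRing 𝔤] [LieAlgebra ℂ 𝔤] (T : Module.Basis ι ℂ 𝔤)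
  {ρ : ExtAlg ι →ₗ[ℂ] V} {K : LinearMap.BilinForm ℂ 𝔤} {W : V}

theorem totalSuperpotential_isConformalPrimary (h : IsConformal 𝒱 spin ξ γ)
    (hμ : ∀ a, IsConformalPrimary 𝒱 spin γ 1 (moment ρ a))
    (hW : IsConformalPrimary 𝒱 spin γ 1 W) :
    IsConformalPrimary (gauged ι 𝒱) (tensorSpin spin (bcSpin ι)) (totalStress ι 𝒱 γ) 1
      (totalSuperpotential T K 𝒱 ρ W) := by
  refine ⟨totalSuperpotential_mem_spin T h.raviolo h.spinGrading (fun a => (hμ a).1) hW.1,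
    fun k hk => ?_⟩
  obtain ⟨m, rfl⟩ := Int.eq_ofNat_of_zero_le (show 0 ≤ k by omega)
  have hP := h.raviolo.isPoisson
  exact mode_gaugePotential_eq_zero (gauged_isPoisson ι hP) (totalStress_parity h) _ _
    (fun i => ghost_isPrimary h (Sum.inl i)) (fun i => ghost_isPrimary h (Sum.inr i))
    (by exact_mod_cast hk) (fun i => totalStress_mode_matter hP ((hμ i).2 m hk))
    (totalStress_mode_matter hP (hW.2 m hk))

end GaugedStress

end Raviolo

end

theorem mainTheorem11 {V 𝔤 ι : Type*} [AddCommGroup V] [Module ℂ V]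
    [LieRing 𝔤] [LieAlgebra ℂ 𝔤] [Fintype ι] (T : Module.Basis ι ℂ 𝔤)
    (𝒱 : RavioloData V) (h𝒱 : IsRaviolo 𝒱)
    (ρ : ExtAlg ι →ₗ[ℂ] V) (hρ : IsHamiltonianSymmetry T 𝒱 ρ)
    (K : LinearMap.BilinForm ℂ 𝔤) (hK : K.IsSymm) (hK' : K.lieInvariant 𝔤)
    (W : V) (hW : IsSuperpotential 𝒱 W) (hW' : IsInvariantPrimary 𝒱 ρ W) :
    -- the superpotential on the tensor product
    (IsRaviolo (gauged ι 𝒱) ∧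
      IsSuperpotential (gauged ι 𝒱) (totalSuperpotential T K 𝒱 ρ W)) ∧
    -- compatibility with a spin grading
    (∀ spin : ℚ → Submodule ℂ V, IsSpinGrading 𝒱 spin →
      (∀ a, moment ρ a ∈ spin 1) → W ∈ spin 1 →
      IsSpinGrading (gauged ι 𝒱) (tensorSpin spin (bcSpin ι)) ∧
      totalSuperpotential T K 𝒱 ρ W ∈ tensorSpin spin (bcSpin ι) 1) ∧
    -- the conformal case
    (∀ (spin : ℚ → Submodule ℂ V) (ξ : V →ₗ[ℂ] V) (γ : V), IsConformal 𝒱 spin ξ γ →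
      (∀ a, IsConformalPrimary 𝒱 spin γ 1 (moment ρ a)) →
      IsConformalPrimary 𝒱 spin γ 1 W →
      IsConformal (gauged ι 𝒱) (tensorSpin spin (bcSpin ι))
        (TensorProduct.map ξ LinearMap.id) (totalStress ι 𝒱 γ) ∧
      IsConformalPrimary (gauged ι 𝒱) (tensorSpin spin (bcSpin ι)) (totalStress ι 𝒱 γ) 1
        (totalSuperpotential T K 𝒱 ρ W)) :=
  ⟨⟨tensor_isRaviolo h𝒱 bc_isRaviolo,
      totalSuperpotential_isSuperpotential T h𝒱 hρ hK hK' hW hW'⟩,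
    fun _ hs hμ hWs => ⟨tensor_isSpinGrading h𝒱 bc_isRaviolo hs bc_isSpinGrading,
      totalSuperpotential_mem_spin T h𝒱 hs hμ hWs⟩,
    fun _ _ _ hc hμ hWc => ⟨gauged_isConformal hc,
      totalSuperpotential_isConformalPrimary T hc hμ hWc⟩⟩
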